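/- **Theorem 2.7 (Transformation Formula).** Let $\mathbb K$ be a totally real number field of degree $d$ with ring of integers $\mathcal O$, different $\partial$ and real embeddings $\psi_1,\dots,\psi_d$; write $M^{(i)}=\psi_i(M)$. Let $k,n\ge 1$, $m=2k$, and let $L=\mathcal A_1x_1\oplus\cdots\oplus\mathcal A_mx_m$ (with $\mathcal A_i$ nonzero fractional ideals and $x_1,\dots,x_m$ linearly independent over $\mathbb K$) carry a totally positive quadratic form $\mathfrak q$ (that is, $\psi_i(\mathfrak q(x))>0$ for all $i$ and all $0\ne x\in L$) with symmetric bilinear form $B$, $\mathfrak q(x)=B(x,x)$, and Gram matrix $Q=(B(x_i,x_j))\in\mathbb K^{m,m}$. For a lattice $M$ let $\mathrm{norm}\,M$ be the fractional ideal generated by $\{\mathfrak q(x):x\in M\}$, let $L^\#=\{v\in \mathbb KL: B(v,L)\subseteq\mathcal O\}$, and set $\mathfrak N=\tfrac12\mathrm{norm}\,L$ and $\mathcal N=4(\mathrm{norm}\,L\cdot\mathrm{norm}\,L^\#)^{-1}$ (an integral ideal). Let $\mathcal I_1,\dots,\mathcal I_n$ be nonzero fractional ideals, and let $$\mathcal L'=\mathcal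 L\langle\mathcal I_1,\dots,\mathcal I_n\rangle=\{U\in\mathbb K^{m,n}: U_{ij}\in\mathcal A_i\mathcal I_j\}.$$ Let $\mathfrak H$ be the set of $\tau=(\tau_1,\dots,\tau_d)$ with each $\tau_i\in\mathbb C^{n,n}$ symmetric with positive definite imaginary part, and put $$\theta(\mathcal L';\tau)=\sum_{U\in\mathcal L'}\exp\Big(\pi i\,\mathrm{tr}\sum_{i=1}^d({}^tUQU)^{(i)}\tau_i\Big).$$ Let $\Gamma=\Gamma_0(\mathcal N;\mathcal I_1,\dots,\mathcal I_n;\mathfrak N)$ be the set of $\gamma=\begin{pmatrix}A&B\\C&D\end{pmatrix}\in Sp_n(\mathbb K)$ with $A_{ij}\in\mathcal I_i^{-1}\mathcal I_j$, $B_{ij}\in(\mathfrak N\partial\mathcal I_i\mathcal I_j)^{-1}$, $C_{ij}\in\mathcal N\mathfrak N\partial\mathcal I_i\mathcal I_j$, $D_{ij}\in\mathcal I_i\mathcal I_j^{-1}$, and for such $\gamma$ let $$(f|\gamma)(\tau)=\prod_{i=1}^d\det(C^{(i)}\tau_i+D^{(i)})^{-k}\; f\big((A\tau+B)(C\tau+D)^{-1}\big).$$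 The function $\chi_L$ is defined as follows. For a prime $\mathfrak P\nmid 2$ and a unit $u$ of the completion $\mathcal O_{\mathfrak P}$, let $\left(\frac u{\mathfrak P}\right)$ be $1$ if $u$ is a square modulo $\mathfrak P$ and $-1$ otherwise. For $\mathfrak P\mid2$ let $\left(\frac{\cdot}{\mathfrak P}\right):\mathcal O_{\mathfrak P}^\times\to\{\pm1\}$ be any homomorphism that is $-1$ on the units of quadratic defect $4\mathcal O_{\mathfrak P}$, where the quadratic defect of $u$ is $\bigcap_{\eta\in\mathcal O_{\mathfrak P}}(u-\eta^2)\mathcal O_{\mathfrak P}$. For $\mathfrak P\nmid\mathcal N$ choose $\eta'\in\mathfrak N^{-1}$ and $\alpha_i\in\mathcal A_i$ with $\eta'\mathcal O_{\mathfrak P}=\mathfrak N^{-1}\mathcal O_{\mathfrak P}$ and $\alpha_i\mathcal O_{\mathfrak P}=\mathcal A_i\mathcal O_{\mathfrak P}$, and set $$\chi^*(\mathfrak P)=\left(\frac{(-1)^k(\eta')^m(\alpha_1\cdots\alpha_m)^2\det Q}{\mathfrak P}\right).$$ Extend $\chi^*$ completely multiplicatively to the nonzero fractional ideals relatively prime to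 $\mathcal N$. For $0\ne y\in\mathcal O$ relatively prime to $\mathcal N$ set $\chi_L(y)=\Big(\prod_{i=1}^d\mathrm{sgn}\,\psi_i(y)\Big)^k\chi^*(y\mathcal O)$; set $\chi_L(y)=0$ if $y$ is not relatively prime to $\mathcal N$, and $\chi_L(0)=1$ if $\mathcal N=\mathcal O$. Then the series $\theta(\mathcal L';\tau)$ converges absolutely for every $\tau\in\mathfrak H$ and is holomorphic on $\mathfrak H$; $\chi_L$ is a character modulo $\mathcal N$ with values $\pm1$ on the elements relatively prime to $\mathcal N$; and for every $\gamma=\begin{pmatrix}A&B\\C&D\end{pmatrix}\in\Gamma$, $$\theta(\mathcal L';\cdot)\,|\,\gamma=\chi_L(\det D)\,\theta(\mathcal L';\cdot)\quad\text{on }\mathfrak H .$$ That is, $\theta(\mathcal L';\cdot)$ is a Hilbert–Siegel modular form of weight $k$ for $\Gamma$ with the quadratic character $\chi_L$. -/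

import Mathlib

open NumberField IsDedekindDomain Matrix
open scoped nonZeroDivisors

noncomputable section

namespace HilbertSiegel

/-- Fractional ideals of the number field `K`. -/
abbrev FracIdeal (K : Type*) [Field K] [NumberField K] : Type _ := FractionalIdeal (𝓞 K)⁰ K

/-- A lattice `L = 𝒜₁x₁ ⊕ ⋯ ⊕ 𝒜ₘxₘ` of rank `m` with a totally positive quadratic form `q`.
The vectors of `K L = K x₁ ⊕ ⋯ ⊕ K xₘ` are given by their coordinates, `gram` is the matrix
`Q = (B(xᵢ, xⱼ))` of the bilinear form with `q x = B(x, x)`, and total positivity says that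
every real conjugate of `q x` is positive for all nonzero `x` in `L`. -/
structure QuadLattice (K : Type*) [Field K] [NumberField K] (m : ℕ) where
  /-- the coefficient ideals `𝒜ᵢ` -/
  coeffIdeal : Fin m → FracIdeal K
  coeffIdeal_ne_zero : ∀ i, coeffIdeal i ≠ 0
  /-- the matrix `Q` -/
  gram : Matrix (Fin m) (Fin m) K
  gram_symm : gram.IsSymm
  totallyPositive : ∀ x : Fin m → K, (∀ i, x i ∈ coeffIdeal i) → x ≠ 0 →
    ∀ σ : K →+* ℝ, 0 < σ (x ⬝ᵥ gram *ᵥ x)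

section Lattice

variable {K : Type*} [Field K] [NumberField K] {m : ℕ}

/-- The bilinear form `B`. -/
def QuadLattice.bilin (L : QuadLattice K m) (x y : Fin m → K) : K := x ⬝ᵥ L.gram *ᵥ y

/-- `L` as a set of (coordinate) vectors. -/
def QuadLattice.vectors (L : QuadLattice K m) : Set (Fin m → K) :=
  {x | ∀ i, x i ∈ L.coeffIdeal i}

/-- The dual lattice `L^# = {v ∈ K L : B(v, L) ⊆ 𝓞}`. -/
def QuadLattice.dualVectors (L : QuadLattice K m) : Set (Fin m → K) :=
  {v | ∀ w ∈ L.vectors, ∃ a : 𝓞 K, (a : K) = L.bilin v w}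

/-- The `𝓞`-module generated by the values `q x`, for `x` in `S`. -/
def QuadLattice.normSpan (L : QuadLattice K m) (S : Set (Fin m → K)) : Submodule (𝓞 K) K :=
  Submodule.span (𝓞 K) {a | ∃ x ∈ S, a = L.bilin x x}

theorem form_mem (J : Fin m → FracIdeal K) (M : Matrix (Fin m) (Fin m) K) (x : Fin m → K)
    (hx : ∀ i, x i ∈ J i) :
    x ⬝ᵥ M *ᵥ x ∈ ∑ i, ∑ j, J i * (FractionalIdeal.spanSingleton (𝓞 K)⁰ (M i j) * J j) := by
  have hsum : ∀ (s : Finset (Fin m)) (I : Fin m → FracIdeal K) (f : Fin m → K),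
      (∀ i, f i ∈ I i) → ∑ i ∈ s, f i ∈ ∑ i ∈ s, I i := by
    intro s I f hf
    induction s using Finset.induction_on with
    | empty => simp
    | insert a s ha ih =>
      rw [Finset.sum_insert ha, Finset.sum_insert ha, ← FractionalIdeal.mem_coe,
        FractionalIdeal.coe_add]
      exact Submodule.add_mem_sup (hf a) ih
  simp only [dotProduct, mulVec, Finset.mul_sum]
  refine hsum _ _ _ fun i => hsum _ _ _ fun j => ?_
  exact FractionalIdeal.mul_mem_mul (hx i)
    (FractionalIdeal.mul_mem_mul (FractionalIdeal.mem_spanSingleton_self _ _) (hx j))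

theorem QuadLattice.isFractional_normSpan (L : QuadLattice K m) :
    IsFractional (𝓞 K)⁰ (L.normSpan L.vectors) := by
  refine FractionalIdeal.isFractional_of_le (J := ∑ i, ∑ j, L.coeffIdeal i *
    (FractionalIdeal.spanSingleton (𝓞 K)⁰ (L.gram i j) * L.coeffIdeal j)) ?_
  refine Submodule.span_le.2 ?_
  rintro _ ⟨x, hx, rfl⟩
  exact form_mem _ _ _ hx

theorem QuadLattice.det_gram_ne_zero [IsTotallyReal K] (L : QuadLattice K m) :
    L.gram.det ≠ 0 := by
  intro h
  obtain ⟨v, hv0, hv⟩ := Matrix.exists_mulVec_eq_zero_iff.2 h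
  choose a ha0 ha using fun i => FractionalIdeal.exists_ne_zero_mem_isInteger
    (L.coeffIdeal_ne_zero i)
  classical
  obtain ⟨b, hb⟩ := IsLocalization.exist_integer_multiples_of_finset (𝓞 K)⁰
    (Finset.univ.image v)
  have hb' : ∀ i, ∃ c : 𝓞 K, algebraMap (𝓞 K) K c = algebraMap (𝓞 K) K b * v i := fun i => by
    obtain ⟨c, hc⟩ := hb (v i) (Finset.mem_image_of_mem _ (Finset.mem_univ i))
    exact ⟨c, by rw [hc, Algebra.smul_def]⟩
  choose c hc using hb'
  set d : 𝓞 K := b * ∏ i, a i with hd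
  have hd0 : algebraMap (𝓞 K) K d ≠ 0 := by
    rw [Ne, FaithfulSMul.algebraMap_eq_zero_iff, hd]
    exact mul_ne_zero (nonZeroDivisors.coe_ne_zero b) (Finset.prod_ne_zero_iff.2 fun i _ => ha0 i)
  obtain ⟨w⟩ : Nonempty (InfinitePlace K) := inferInstance
  have hpos := L.totallyPositive (algebraMap (𝓞 K) K d • v) (fun i => ?_)
    (smul_ne_zero hd0 hv0) (InfinitePlace.embedding_of_isReal (IsTotallyReal.isReal w))
  · rw [Matrix.mulVec_smul, hv] at hpos
    simp at hpos
  · have : (algebraMap (𝓞 K) K d • v) i =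
        (c i * ∏ j ∈ Finset.univ.erase i, a j) • algebraMap (𝓞 K) K (a i) := by
      rw [Pi.smul_apply, smul_eq_mul, Algebra.smul_def, map_mul _ (c i), hc, hd,
        ← Finset.mul_prod_erase Finset.univ a (Finset.mem_univ i)]
      simp only [map_mul]
      ring
    rw [this]
    exact Submodule.smul_mem _ _ (ha i)

theorem QuadLattice.isFractional_normSpan_dual [IsTotallyReal K] (L : QuadLattice K m) :
    IsFractional (𝓞 K)⁰ (L.normSpan L.dualVectors) := by
  refine FractionalIdeal.isFractional_of_le (J := ∑ i, ∑ j, (L.coeffIdeal i)⁻¹ *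
    (FractionalIdeal.spanSingleton (𝓞 K)⁰ (L.gram⁻¹ i j) * (L.coeffIdeal j)⁻¹)) ?_
  refine Submodule.span_le.2 ?_
  rintro _ ⟨v, hv, rfl⟩
  have hsymm : ∀ x y : Fin m → K, L.bilin x y = x ⬝ᵥ L.gram *ᵥ y := fun _ _ => rfl
  have hmem : ∀ i, (L.gram *ᵥ v) i ∈ (L.coeffIdeal i)⁻¹ := by
    intro i
    rw [FractionalIdeal.mem_inv_iff (L.coeffIdeal_ne_zero i)]
    intro y hy
    obtain ⟨a, ha⟩ := hv (Pi.single i y) (fun j => by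
      by_cases hj : j = i
      · subst hj; simpa using hy
      · simp [hj, FractionalIdeal.zero_mem])
    rw [FractionalIdeal.mem_one_iff]
    refine ⟨a, ha.trans ?_⟩
    rw [hsymm, dotProduct_mulVec, ← mulVec_transpose, L.gram_symm.eq, dotProduct_single]
  have hval : L.bilin v v = (L.gram *ᵥ v) ⬝ᵥ L.gram⁻¹ *ᵥ (L.gram *ᵥ v) := by
    rw [mulVec_mulVec, Matrix.nonsing_inv_mul _ (isUnit_iff_ne_zero.2 L.det_gram_ne_zero),
      one_mulVec, dotProduct_comm, hsymm]
  rw [hval]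
  exact form_mem _ _ _ hmem

/-- `norm L`, the fractional ideal generated by the values `q x` for `x` in `L`. -/
def QuadLattice.norm (L : QuadLattice K m) : FracIdeal K :=
  ⟨L.normSpan L.vectors, L.isFractional_normSpan⟩

/-- `norm L^#`. -/
def QuadLattice.dualNorm [IsTotallyReal K] (L : QuadLattice K m) : FracIdeal K :=
  ⟨L.normSpan L.dualVectors, L.isFractional_normSpan_dual⟩

/-- The ideal `𝔑 = ½ norm L`. -/
def QuadLattice.halfNorm (L : QuadLattice K m) : FracIdeal K :=
  FractionalIdeal.spanSingleton (𝓞 K)⁰ (1 / 2 : K) * L.norm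

/-- The level `𝒩 = 4 (norm L · norm L^#)⁻¹`, as a fractional ideal. -/
def QuadLattice.level [IsTotallyReal K] (L : QuadLattice K m) : FracIdeal K :=
  FractionalIdeal.spanSingleton (𝓞 K)⁰ (4 : K) * (L.norm * L.dualNorm)⁻¹

/-- The level as an ideal of `𝓞 K` (it is always integral). -/
def QuadLattice.levelIdeal [IsTotallyReal K] (L : QuadLattice K m) : Ideal (𝓞 K) :=
  Submodule.comap (Algebra.linearMap (𝓞 K) K) (L.level : Submodule (𝓞 K) K)

/-- `𝔓 ∣ 𝒩`. -/
def QuadLattice.DvdLevel [IsTotallyReal K] (L : QuadLattice K m)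
    (P : HeightOneSpectrum (𝓞 K)) : Prop :=
  L.level ≤ (P.asIdeal : FracIdeal K)

end Lattice

section Symbols

variable {K : Type*} [Field K] [NumberField K]

theorem exists_localGenerator (P : HeightOneSpectrum (𝓞 K)) (J : FracIdeal K) :
    ∃ x ∈ J, ∀ y ∈ J, P.valuation K y ≤ P.valuation K x := by
  by_cases hJ : ∃ y ∈ J, y ≠ 0
  · obtain ⟨y₀, hy₀, hy₀0⟩ := hJ
    obtain ⟨a, ha, haJ⟩ := J.isFractional
    have hva : P.valuation K (algebraMap (𝓞 K) K a) ≠ 0 := by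
      rw [Valuation.ne_zero_iff, Ne, FaithfulSMul.algebraMap_eq_zero_iff]
      exact nonZeroDivisors.ne_zero ha
    obtain ⟨n, ⟨x, hx, hx0, hxn⟩, hmax⟩ := Int.exists_greatest_of_bdd
      (P := fun n => ∃ y ∈ J, y ≠ 0 ∧ WithZero.log (P.valuation K y) = n)
      ⟨- WithZero.log (P.valuation K (algebraMap (𝓞 K) K a)), by
        rintro _ ⟨y, hy, hy0, rfl⟩
        obtain ⟨c, hc⟩ := haJ y hy
        have h1 : P.valuation K (algebraMap (𝓞 K) K a * y) ≤ 1 := by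
          rw [← Algebra.smul_def, ← hc]
          exact P.valuation_le_one c
        have h2 : P.valuation K y ≠ 0 := (Valuation.ne_zero_iff _).2 hy0
        rw [map_mul] at h1
        have h3 := WithZero.log_le_log (mul_ne_zero hva h2) one_ne_zero |>.2 h1
        rw [WithZero.log_mul hva h2, WithZero.log_one] at h3
        linarith⟩
      ⟨_, y₀, hy₀, hy₀0, rfl⟩
    refine ⟨x, hx, fun y hy => ?_⟩
    by_cases hy0 : y = 0
    · simp [hy0]
    · have := hmax _ ⟨y, hy, hy0, rfl⟩
      rw [← hxn] at this
      exact (WithZero.log_le_log ((Valuation.ne_zero_iff _).2 hy0)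
        ((Valuation.ne_zero_iff _).2 hx0)).1 this
  · push Not at hJ
    exact ⟨0, FractionalIdeal.zero_mem _, fun y hy => by simp [hJ y hy]⟩

/-- An element `x` of `J` with `x 𝓞_𝔓 = J 𝓞_𝔓`. -/
def localGenerator (P : HeightOneSpectrum (𝓞 K)) (J : FracIdeal K) : K :=
  (exists_localGenerator P J).choose

open Classical in
/-- The Legendre-type symbol at `𝔓`, on the units of the completed local ring `𝓞_𝔓`:
it is `1` on the squares modulo `𝔓`, and `-1` otherwise. -/
def legendreSymbol (P : HeightOneSpectrum (𝓞 K)) (u : (P.adicCompletionIntegers K)ˣ) : ℤˣ :=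
  if ∃ z : P.adicCompletionIntegers K,
      (u : P.adicCompletionIntegers K) - z ^ 2 ∈
        IsLocalRing.maximalIdeal (P.adicCompletionIntegers K) then 1 else -1

/-- The quadratic defect of a unit `u` of `𝓞_𝔓`: the intersection of all the ideals
`α 𝓞_𝔓` with `u = η² + α`. (For a unit it does no harm to take `η` in `𝓞_𝔓`.) -/
def quadraticDefect (P : HeightOneSpectrum (𝓞 K)) (u : (P.adicCompletionIntegers K)ˣ) :
    Ideal (P.adicCompletionIntegers K) :=
  ⨅ η : P.adicCompletionIntegers K,
    Ideal.span {(u : P.adicCompletionIntegers K) - η ^ 2}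

/-- A Kronecker-type symbol at a dyadic prime `𝔓`: a homomorphism `𝓞_𝔓ˣ → {±1}`
(it is trivial on squares, as its values are `±1`) which is `-1` on the units of quadratic
defect `4 𝓞_𝔓`; these units form one nontrivial class `(1 - 4ε) 𝓞_𝔓ˣ²` modulo squares. -/
def IsKroneckerSymbol (P : HeightOneSpectrum (𝓞 K))
    (φ : (P.adicCompletionIntegers K)ˣ →* ℤˣ) : Prop :=
  ∀ u : (P.adicCompletionIntegers K)ˣ, quadraticDefect P u = Ideal.span {4} → φ u = -1

/-- A fixed choice of a homomorphism `𝓞_𝔓ˣ → {±1}` for every prime `𝔓`; only the values at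
the dyadic primes are used. -/
abbrev SymbolChoice (K : Type*) [Field K] [NumberField K] : Type _ :=
  ∀ P : HeightOneSpectrum (𝓞 K), (P.adicCompletionIntegers K)ˣ →* ℤˣ

open Classical in
/-- The symbol `(· / 𝔓)` on the units of `𝓞_𝔓`. -/
def localSymbol (φ : SymbolChoice K) (P : HeightOneSpectrum (𝓞 K))
    (u : (P.adicCompletionIntegers K)ˣ) : ℤˣ :=
  if (2 : 𝓞 K) ∈ P.asIdeal then φ P u else legendreSymbol P u

end Symbols

section Character

variable {K : Type*} [Field K] [NumberField K] {k : ℕ}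

/-- The local discriminant `(-1)ᵏ (η')ᵐ (α₁ ⋯ αₘ)² det Q` at `𝔓`, where `m = 2k`,
`η' 𝓞_𝔓 = 𝔑⁻¹ 𝓞_𝔓` and `αᵢ 𝓞_𝔓 = 𝒜ᵢ 𝓞_𝔓`. -/
def QuadLattice.localDisc (L : QuadLattice K (2 * k)) (P : HeightOneSpectrum (𝓞 K)) : K :=
  (-1) ^ k * localGenerator P (L.halfNorm)⁻¹ ^ (2 * k) *
    (∏ i, localGenerator P (L.coeffIdeal i)) ^ 2 * L.gram.det

open Classical in
/-- `χ*(𝔓)`, the symbol of the local discriminant. For `𝔓 ∤ 𝒩` the local discriminant is a unit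
of `𝓞_𝔓`; the value at the other primes is irrelevant. -/
def QuadLattice.chiStarPrime (L : QuadLattice K (2 * k)) (φ : SymbolChoice K)
    (P : HeightOneSpectrum (𝓞 K)) : ℤˣ :=
  if h : ∃ u : (P.adicCompletionIntegers K)ˣ,
      ((u : P.adicCompletionIntegers K) : P.adicCompletion K) =
        algebraMap K (P.adicCompletion K) (L.localDisc P)
  then localSymbol φ P h.choose else 1

/-- The completely multiplicative extension of `χ*` to the (nonzero) fractional ideals
relatively prime to `𝒩`. -/
def QuadLattice.chiStar (L : QuadLattice K (2 * k)) (φ : SymbolChoice K) (J : FracIdeal K) :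
    ℤˣ :=
  ∏ᶠ P : HeightOneSpectrum (𝓞 K), L.chiStarPrime φ P ^ FractionalIdeal.count K P J

/-- The sign of the norm, `N(sgn y) = ∏ sgn (ψᵢ y)`. -/
def normSign (y : K) : ℤ := ∏ σ : K →+* ℝ, (SignType.sign (σ y) : ℤ)

open Classical in
/-- The function `χ_L`. It is `N(sgn y)ᵏ χ*(y 𝓞)` when `y ≠ 0` is relatively prime to `𝒩`,
and, as for any character modulo `𝒩`, it is `0` when `y` is not relatively prime to `𝒩`.
If `𝒩 = 𝓞`, then `y = 0` is relatively prime to `𝒩`, and `χ_L 0 = 1`. -/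
def QuadLattice.chi [IsTotallyReal K] (L : QuadLattice K (2 * k)) (φ : SymbolChoice K)
    (y : K) : ℤ :=
  if ∀ P : HeightOneSpectrum (𝓞 K), L.DvdLevel P → P.valuation K y = 1 then
    if y = 0 then 1
    else normSign y ^ k * (L.chiStar φ (FractionalIdeal.spanSingleton (𝓞 K)⁰ y) : ℤ)
  else 0

/-- `χ_L` is a quadratic character modulo `𝒩`: its restriction to `𝓞` is induced by a
multiplicative character of `𝓞 / 𝒩` with values in `{0, 1, -1}`. -/
def QuadLattice.IsQuadraticCharacter [IsTotallyReal K] (L : QuadLattice K (2 * k))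
    (φ : SymbolChoice K) : Prop :=
  ∃ ψ : MulChar (𝓞 K ⧸ L.levelIdeal) ℤ, ψ.IsQuadratic ∧
    ∀ y : 𝓞 K, L.chi φ (y : K) = ψ (Ideal.Quotient.mk L.levelIdeal y)

end Character

section Modular

variable {K : Type*} [Field K] [NumberField K] {m n : ℕ}

/-- Tuples of complex matrices, one for each embedding of `K` into `ℝ`. -/
abbrev MatTuple (K : Type*) [Field K] [NumberField K] (n : ℕ) : Type _ :=
  (K →+* ℝ) → Matrix (Fin n) (Fin n) ℂ

/-- The Hilbert-Siegel upper half space: tuples of symmetric matrices `X + iY` with `Y`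
positive definite. -/
def upperHalfSpace (K : Type*) [Field K] [NumberField K] (n : ℕ) : Set (MatTuple K n) :=
  {τ | ∀ σ, (τ σ).IsSymm ∧ ((τ σ).map Complex.im).PosDef}

/-- The conjugate `M^(σ)` of a matrix `M`, as a complex matrix. -/
def conj {a b : Type*} (σ : K →+* ℝ) (M : Matrix a b K) : Matrix a b ℂ :=
  M.map fun x => ((σ x : ℝ) : ℂ)

/-- `e{Mτ} = exp(π i tr(∑ M^(σ) τ_σ))`. -/
def expo (M : Matrix (Fin n) (Fin n) K) (τ : MatTuple K n) : ℂ :=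
  Complex.exp (Real.pi * Complex.I * (∑ σ : K →+* ℝ, conj σ M * τ σ).trace)

/-- `ℒ' = ⟨𝒜₁, …, 𝒜ₘ⟩ 𝓞^{m,n} ⟨ℐ₁, …, ℐₙ⟩`. -/
def QuadLattice.matLattice (L : QuadLattice K m) (I : Fin n → FracIdeal K) :
    Set (Matrix (Fin m) (Fin n) K) :=
  {U | ∀ i j, U i j ∈ L.coeffIdeal i * I j}

/-- The general term `e{Q[U]τ}` of the theta series, where `Q[U] = ᵗU Q U`. -/
def QuadLattice.thetaTerm (L : QuadLattice K m) (τ : MatTuple K n)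
    (U : Matrix (Fin m) (Fin n) K) : ℂ :=
  expo (Uᵀ * L.gram * U) τ

/-- The theta series `θ(ℒ'; τ)`. -/
def QuadLattice.theta (L : QuadLattice K m) (I : Fin n → FracIdeal K) (τ : MatTuple K n) : ℂ :=
  ∑' U : L.matLattice I, L.thetaTerm τ (U : Matrix (Fin m) (Fin n) K)

/-- The different of `K`, as a fractional ideal. -/
def different (K : Type*) [Field K] [NumberField K] : FracIdeal K :=
  (differentIdeal ℤ (𝓞 K) : FracIdeal K)

/-- The group `Γ₀(𝒩; ℐ₁, …, ℐₙ; 𝔑)`, the intersection of `Sp_n(K)` with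
`diag((𝔑∂X)⁻¹, X) (𝓞, 𝓞; 𝒩𝓞, 𝓞) diag(𝔑∂X, X⁻¹)`, where `X = ⟨ℐ₁, …, ℐₙ⟩`. -/
def gammaZero (N 𝔑 : FracIdeal K) (I : Fin n → FracIdeal K) :
    Set (Matrix (Fin n ⊕ Fin n) (Fin n ⊕ Fin n) K) :=
  {γ | γ ∈ Matrix.symplecticGroup (Fin n) K ∧ ∀ i j,
    γ.toBlocks₁₁ i j ∈ (𝔑 * different K * I i)⁻¹ * (𝔑 * different K * I j) ∧
    γ.toBlocks₁₂ i j ∈ (𝔑 * different K * I i)⁻¹ * (I j)⁻¹ ∧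
    γ.toBlocks₂₁ i j ∈ I i * N * (𝔑 * different K * I j) ∧
    γ.toBlocks₂₂ i j ∈ I i * (I j)⁻¹}

/-- `Cτ + D`. -/
def denom (γ : Matrix (Fin n ⊕ Fin n) (Fin n ⊕ Fin n) K) (τ : MatTuple K n) : MatTuple K n :=
  fun σ => conj σ γ.toBlocks₂₁ * τ σ + conj σ γ.toBlocks₂₂

/-- `(Aτ + B)(Cτ + D)⁻¹`. -/
def moebius (γ : Matrix (Fin n ⊕ Fin n) (Fin n ⊕ Fin n) K) (τ : MatTuple K n) : MatTuple K n :=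
  fun σ => (conj σ γ.toBlocks₁₁ * τ σ + conj σ γ.toBlocks₁₂) * (denom γ τ σ)⁻¹

/-- The slash operator `f|γ (τ) = det(N(Cτ + D))⁻ᵏ f((Aτ + B)(Cτ + D)⁻¹)`. -/
def slash (k : ℕ) (f : MatTuple K n → ℂ) (γ : Matrix (Fin n ⊕ Fin n) (Fin n ⊕ Fin n) K)
    (τ : MatTuple K n) : ℂ :=
  ((∏ σ : K →+* ℝ, (denom γ τ σ).det) ^ k)⁻¹ * f (moebius γ τ)

/-- `f` is a Hilbert-Siegel modular form of weight `k` for `Γ` with character `χ`: it is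
holomorphic on the upper half space, and `f|γ = χ(det D) f` for all `γ` in `Γ`. The upper half
space is an open subset of the complex vector space of tuples of symmetric matrices, and `f` is
complex differentiable along this set. -/
structure IsModularForm (k : ℕ) (Γ : Set (Matrix (Fin n ⊕ Fin n) (Fin n ⊕ Fin n) K))
    (χ : K → ℤ) (f : MatTuple K n → ℂ) : Prop where
  holomorphic : DifferentiableOn ℂ f (upperHalfSpace K n)
  slash_eq : ∀ γ ∈ Γ, ∀ τ ∈ upperHalfSpace K n, slash k f γ τ = χ γ.toBlocks₂₂.det * f τ

end Modular

end HilbertSiegel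

end

/-!
The theta series is a sum of Gaussians over a lattice of matrices, so the proof is Poisson
summation followed by the evaluation of the Gauss sums that appear.

*Inversion.* Poisson summation for a real positive definite form and real characteristics
(`tsum_gaussTerm`) gives the inversion formula for theta series with a shift at the purely imaginary
points, and the identity theorem extends it to the upper half space
(`IsIntegralBasis.exists_inversion`). Holomorphy is that of a locally uniformly convergent Gaussian
series (`differentiableAt_gaussSeries`).

*Invertible `D`.* Put `Λ = ℐ₁ ⊕ ⋯ ⊕ ℐₙ`. If `det D ≠ 0`, then `γ` is, up to the change of variables
`U = V ᵗD`, an inversion, a translation by `D⁻¹C`, a second inversion and a translation by `ᵗDB`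
(`denom_moebius_of_isUnit`). The last translation is periodic on `L ⊗ Λ` only, so the theta series
is split along `L ⊗ D⁻¹Λ / L ⊗ Λ`. After the first inversion, completing the square
(`QuadLattice.sum_quadExp_twist`) shows that the resulting Gauss sums cancel the translation by
`D⁻¹C`, up to the Gauss sum with trivial twist, and the second inversion restores the original
series. Hence `θ | γ` is `θ` times `N(det D)⁻ᵏ ∑ e(tr(ᵗU Q U ᵗDB))`
(`QuadLattice.slash_theta_of_isUnit`).

*The Gauss sum.* By the symplectic relations `Λ` is the radical of the form `ᵗDB` on `D⁻¹Λ`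
modulo `(𝔑∂)⁻¹` (`QuadLattice.BlockIntegral.isRadical`), and the index is prime to the level. For
such a pair the Gauss sum is computed by induction on the index, splitting off a vector `v` with
`𝔓v ⊆ Λ`. If the form does not vanish at `v` modulo `(𝔑∂)⁻¹`, a line is split off, which contributes
the Gauss sum of `L / 𝔓L` over the residue field, namely `N(𝔓)ᵏ χ*(𝔓)`
(`exists_gaussSum_of_notMem`, `QuadLattice.sum_expTrace_bilin`). In odd residue characteristic this
is the classical Gauss sum; in residue characteristic two the reduction of `L` is an orthogonal sum
of planes, and a plane has sign `-1` exactly if it is anisotropic, that is, if its discriminant has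
quadratic defect `4𝓞`. If the form vanishes at `v`, a hyperbolic plane is split off, which
contributes `N(𝔓)²ᵏ` (`exists_gaussSum_of_mem`). The ideal generated by the determinants of the
`n`-tuples of vectors of a lattice (`detSpan`) keeps track of the index, so that the whole sum is
`|N(det D)|ᵏ χ*(det D)` (`IsRadical.exists_gaussSum`). Together with the factor `N(det D)⁻ᵏ` this
is `χ_L(det D)` (`QuadLattice.slash_theta`).

*The character.* That `χ_L` depends on the class modulo `𝒩` only is read off from the transformation
formula for `n = 1`: the translates of `τ` by symmetric matrices with entries in `(𝔑∂ℐᵢℐⱼ)⁻¹` fix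
`θ ≠ 0`, so that `χ_L(cβ + d) = χ_L(d)` (`QuadLattice.chi_det_translate`), and two congruent elements
`d`, `d'` prime to the level are joined by completing them to matrices of the group
(`QuadLattice.chi_congr`, `QuadLattice.isQuadraticCharacter`).

*Singular `D`.* If `det D = 0` the level is `𝓞` and `χ_L` is trivial, and a translation leads back to
invertible `D` (`QuadLattice.slash_theta_eq`).
-/

noncomputable section

namespace HilbertSiegel


/-! ### Gaussian sums over `ℤ^ι` and Poisson summation -/

section Poisson

open Complex

/-- The quadratic form of a real matrix. -/
abbrev qform {ι : Type*} [Fintype ι] (M : Matrix ι ι ℝ) (x : ι → ℝ) : ℝ := x ⬝ᵥ M *ᵥ x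

/-- A positive form which is homogeneous of degree two is bounded below by a multiple of the sum of
squares, by compactness of the unit sphere. -/
theorem exists_pos_le_qform {ι : Type*} [Fintype ι] (q : (ι → ℝ) → ℝ) (hq : Continuous q)
    (hom : ∀ (t : ℝ) x, q (t • x) = t ^ 2 * q x) (hpos : ∀ x, x ≠ 0 → 0 < q x) :
    ∃ c > 0, ∀ x, c * ∑ i, x i ^ 2 ≤ q x := by
  have q0 : q 0 = 0 := by simpa using hom 0 0
  rcases isEmpty_or_nonempty ι with h | h
  · exact ⟨1, one_pos, fun x => by simp [Subsingleton.elim x 0, q0]⟩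
  have hne : (Metric.sphere (0 : ι → ℝ) 1).Nonempty :=
    NormedSpace.sphere_nonempty.2 zero_le_one
  obtain ⟨y, hy, hmin⟩ := (isCompact_sphere (0 : ι → ℝ) 1).exists_isMinOn hne hq.continuousOn
  have hy0 : y ≠ 0 := by
    rintro rfl
    simp at hy
  have hc : 0 < q y / Fintype.card ι := div_pos (hpos y hy0) (by positivity)
  refine ⟨_, hc, fun x => ?_⟩
  by_cases hx : x = 0
  · simp [hx, q0]
  have hxn : 0 < ‖x‖ := norm_pos_iff.2 hx
  have h1 : q y ≤ q (‖x‖⁻¹ • x) := hmin (by simp [norm_smul, hxn.ne'])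
  rw [hom, inv_pow, inv_mul_eq_div, le_div_iff₀ (by positivity)] at h1
  refine le_trans ?_ h1
  have h2 : ∑ i, x i ^ 2 ≤ Fintype.card ι * ‖x‖ ^ 2 := by
    rw [← nsmul_eq_mul, ← Finset.card_univ]
    refine Finset.sum_le_card_nsmul _ _ _ fun i _ => ?_
    rw [← sq_abs]
    have := norm_le_pi_norm x i
    rw [Real.norm_eq_abs] at this
    gcongr
  calc _ ≤ q y / Fintype.card ι * (Fintype.card ι * ‖x‖ ^ 2) := by gcongr
    _ = _ := by field_simp

theorem PosDef.exists_pos_le {ι : Type*} [Fintype ι] {M : Matrix ι ι ℝ} (hM : M.PosDef) :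
    ∃ c > 0, ∀ x, c * ∑ i, x i ^ 2 ≤ qform M x := by
  refine exists_pos_le_qform _ ?_ ?_ ?_
  · change Continuous fun x : ι → ℝ => x ⬝ᵥ M *ᵥ x
    simp only [dotProduct, mulVec]
    fun_prop
  · intro t x
    simp [qform, mulVec_smul, sq, mul_assoc]
  · intro x hx
    simpa using hM.dotProduct_mulVec_pos hx

theorem summable_exp_neg_sq_int {c : ℝ} (hc : 0 < c) (a : ℝ) :
    Summable fun n : ℤ => Real.exp (-c * (n + a) ^ 2) := by
  have h : 0 < (((c / Real.pi : ℝ) : ℂ) * I).im := by simp; positivity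
  have := ((summable_jacobiTheta₂_term_iff (((c * a / Real.pi : ℝ) : ℂ) * I) _).2 h).norm.mul_left
    (Real.exp (-c * a ^ 2))
  refine this.congr fun n => ?_
  rw [norm_jacobiTheta₂_term, ← Real.exp_add]
  congr 1
  simp
  field_simp
  ring

theorem summable_exp_neg_sum_sq {ι : Type*} [Fintype ι] {c : ℝ} (hc : 0 < c) (a : ι → ℝ) :
    Summable fun v : ι → ℤ => Real.exp (-c * ∑ i, ((v i : ℝ) + a i) ^ 2) := by
  revert a
  refine Fintype.induction_empty_option
    (P := fun ι _ => ∀ a : ι → ℝ,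
      Summable fun v : ι → ℤ => Real.exp (-c * ∑ i, ((v i : ℝ) + a i) ^ 2)) ?_ ?_ ?_ ι
  · intro α β _ e h a
    let := Fintype.ofEquiv β e.symm
    refine ((Equiv.arrowCongr e (Equiv.refl ℤ)).summable_iff).1 ((h (a ∘ e)).congr fun v => ?_)
    simp only [Function.comp_def]
    congr 2
    rw [← e.sum_comp]
    simp [Equiv.arrowCongr]
  · intro a
    exact Summable.of_finite
  · intro α _ h a
    refine (Equiv.piOptionEquivProd (α := α) (β := fun _ => ℤ)).symm.summable_iff.1 ?_
    refine ((summable_exp_neg_sq_int hc (a none)).mul_of_nonneg (h fun i => a (some i))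
      (fun _ => (Real.exp_pos _).le) (fun _ => (Real.exp_pos _).le)).congr fun v => ?_
    simp [Function.comp, Equiv.piOptionEquivProd, Fintype.sum_option, ← Real.exp_add, mul_add]

theorem PosDef.summable_exp {ι : Type*} [Fintype ι] {M : Matrix ι ι ℝ} (hM : M.PosDef)
    (a : ι → ℝ) :
    Summable fun v : ι → ℤ => Real.exp (-Real.pi * qform M fun i => (v i : ℝ) + a i) := by
  obtain ⟨c, hc, h⟩ := PosDef.exists_pos_le hM
  refine Summable.of_nonneg_of_le (fun _ => (Real.exp_pos _).le) (fun v => ?_)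
    (summable_exp_neg_sum_sq (mul_pos Real.pi_pos hc) a)
  rw [Real.exp_le_exp]
  have := mul_le_mul_of_nonneg_left (h fun i => (v i : ℝ) + a i) Real.pi_pos.le
  linarith

/-- One-dimensional Poisson summation for a Gaussian with real characteristics `a` and `b`. -/
theorem tsum_gauss_int {p : ℝ} (hp : 0 < p) (a b : ℝ) :
    ∑' n : ℤ, cexp (-Real.pi * (p * (n + a) ^ 2) + 2 * Real.pi * I * (b * (n + a))) =
      ((Real.sqrt p)⁻¹ : ℝ) *
        ∑' w : ℤ, cexp (-Real.pi * ((w - b) ^ 2 / p) + 2 * Real.pi * I * (w * a)) := by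
  have hp' : (p : ℂ) ≠ 0 := by exact_mod_cast hp.ne'
  have h := Complex.tsum_exp_neg_quadratic (a := (p : ℂ)) (by simpa using hp) (I * b - p * a)
  have hs : (1 / (p : ℂ) ^ (1 / 2 : ℂ)) = ((Real.sqrt p)⁻¹ : ℝ) := by
    rw [Real.sqrt_eq_rpow]
    push_cast
    rw [Complex.ofReal_cpow hp.le]
    simp
  rw [hs] at h
  have h2 := congrArg (fun z => cexp (-Real.pi * p * a ^ 2 + 2 * Real.pi * I * b * a) * z) h
  simp only [mul_left_comm (cexp _) (((Real.sqrt p)⁻¹ : ℝ) : ℂ)] at h2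
  rw [← tsum_mul_left, ← tsum_mul_left] at h2
  simp only [← Complex.exp_add] at h2
  refine (Eq.trans ?_ h2).trans ?_
  · refine tsum_congr fun n => congrArg cexp ?_
    ring
  · refine congrArg _ (tsum_congr fun w => congrArg cexp ?_)
    have : (w + I * (I * b - p * a) : ℂ) = w - b - I * (p * a) := by
      linear_combination (b : ℂ) * I_sq
    rw [this]
    field_simp
    linear_combination (-(p ^ 2 * a ^ 2) : ℂ) * I_sq

/-- The term of the theta series of the real quadratic form `M` with characteristics `a`, `b`. -/
def gaussTerm {ι : Type*} [Fintype ι] (M : Matrix ι ι ℝ) (a b : ι → ℝ) (v : ι → ℤ) : ℂ :=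
  cexp (-Real.pi * (qform M fun i => (v i : ℝ) + a i : ℝ) +
    2 * Real.pi * I * (b ⬝ᵥ fun i => (v i : ℝ) + a i : ℝ))

/-- The term of the transformed series. -/
def dualGaussTerm {ι : Type*} [Fintype ι] (N : Matrix ι ι ℝ) (a b : ι → ℝ) (w : ι → ℤ) : ℂ :=
  cexp (-Real.pi * (qform N fun i => (w i : ℝ) - b i : ℝ) +
    2 * Real.pi * I * ((fun i => (w i : ℝ)) ⬝ᵥ a : ℝ))

theorem norm_gaussTerm {ι : Type*} [Fintype ι] (M : Matrix ι ι ℝ) (a b : ι → ℝ) (v : ι → ℤ) :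
    ‖gaussTerm M a b v‖ = Real.exp (-Real.pi * qform M fun i => (v i : ℝ) + a i) := by
  rw [gaussTerm, Complex.norm_exp]
  simp [-ofReal_sub, -ofReal_add]

theorem norm_dualGaussTerm {ι : Type*} [Fintype ι] (M : Matrix ι ι ℝ) (a b : ι → ℝ) (v : ι → ℤ) :
    ‖dualGaussTerm M a b v‖ = Real.exp (-Real.pi * qform M fun i => (v i : ℝ) + -b i) := by
  rw [dualGaussTerm, Complex.norm_exp]
  simp [-ofReal_sub, -ofReal_add, sub_eq_add_neg]

theorem summable_gaussTerm {ι : Type*} [Fintype ι] {M : Matrix ι ι ℝ} (hM : M.PosDef)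
    (a b : ι → ℝ) : Summable (gaussTerm M a b) := by
  refine Summable.of_norm ((PosDef.summable_exp hM a).congr fun v => ?_)
  rw [norm_gaussTerm]

theorem summable_dualGaussTerm {ι : Type*} [Fintype ι] {M : Matrix ι ι ℝ} (hM : M.PosDef)
    (a b : ι → ℝ) : Summable (dualGaussTerm M a b) := by
  refine Summable.of_norm ((PosDef.summable_exp hM (fun i => - b i)).congr fun v => ?_)
  rw [norm_dualGaussTerm]

/-- The Schur complement of the entry at `none`. -/
def schurNone {α : Type*} (M : Matrix (Option α) (Option α) ℝ) : Matrix α α ℝ :=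
  fun i j => M (some i) (some j) - M none (some i) * M none (some j) / M none none

/-- Completing the square in the coordinate `none`. -/
theorem qform_option {α : Type*} [Fintype α] {M : Matrix (Option α) (Option α) ℝ}
    (hM : M.PosDef) (x : Option α → ℝ) :
    qform M x = M none none * (x none + (∑ i, M none (some i) * x (some i)) / M none none) ^ 2 +
      qform (schurNone M) (fun i => x (some i)) := by
  have hp : 0 < M none none := hM.diag_pos
  have hsymm : ∀ i j, M i j = M j i := fun i j => by
    have := hM.isHermitian.apply i j
    simpa using this.symm
  have e1 : qform (schurNone M) (fun i => x (some i)) =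
      ∑ i, ∑ j, x (some i) * (M (some i) (some j) * x (some j)) -
        (∑ i, M none (some i) * x (some i)) ^ 2 / M none none := by
    rw [sq, Finset.sum_mul_sum, Finset.sum_div]
    simp only [qform, dotProduct, mulVec, schurNone, Finset.mul_sum, Finset.sum_div]
    rw [← Finset.sum_sub_distrib]
    refine Finset.sum_congr rfl fun i _ => ?_
    rw [← Finset.sum_sub_distrib]
    refine Finset.sum_congr rfl fun j _ => ?_
    ring
  rw [e1]
  simp only [qform, dotProduct, mulVec, Fintype.sum_option]
  simp only [mul_add, Finset.sum_add_distrib]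
  have e2 : ∑ i, x (some i) * (M (some i) none * x none) =
      x none * ∑ i, M none (some i) * x (some i) := by
    rw [Finset.mul_sum]
    refine Finset.sum_congr rfl fun i _ => ?_
    rw [hsymm (some i) none]; ring
  rw [e2]
  simp only [← Finset.mul_sum]
  field_simp
  ring

theorem PosDef.schurNone {α : Type*} [Fintype α] {M : Matrix (Option α) (Option α) ℝ}
    (hM : M.PosDef) : (schurNone M).PosDef := by
  have hp : 0 < M none none := hM.diag_pos
  refine Matrix.PosDef.of_dotProduct_mulVec_pos ?_ fun x hx => ?_
  · ext i j
    have : M (some j) (some i) = M (some i) (some j) := by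
      simpa using hM.isHermitian.apply (some i) (some j)
    simp [HilbertSiegel.schurNone, this]
    ring
  · have h := qform_option hM (fun o => o.elim (-(∑ i, M none (some i) * x i) / M none none) x)
    have hne : (fun o : Option α => o.elim (-(∑ i, M none (some i) * x i) / M none none) x) ≠ 0 :=
      fun h0 => hx (funext fun i => by simpa using congrFun h0 (some i))
    have h2 := hM.dotProduct_mulVec_pos hne
    simp only [star_trivial] at h2 ⊢
    rw [qform] at h
    rw [h] at h2
    simpa [neg_div] using h2

theorem det_option {α : Type*} [Fintype α] [DecidableEq α] {M : Matrix (Option α) (Option α) ℝ}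
    (hM : M.PosDef) : M.det = M none none * (schurNone M).det := by
  have hp : 0 < M none none := hM.diag_pos
  have hsymm : ∀ i j, M i j = M j i := fun i j => by
    have := hM.isHermitian.apply i j
    simpa using this.symm
  set e := Equiv.optionEquivSumPUnit.{0} α
  set D : Matrix PUnit PUnit ℝ := of fun _ _ => M none none with hDdef
  have h1 : M.submatrix e.symm e.symm = fromBlocks (of fun i j => M (some i) (some j))
      (of fun i _ => M (some i) none) (of fun _ j => M none (some j)) D := by
    ext i j
    rcases i with i | i <;> rcases j with j | j <;> simp [e, D]
  have hD : D.det = M none none := by simp [Matrix.det_unique, D]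
  let : Invertible D :=
    Matrix.invertibleOfIsUnitDet _ (by rw [hD]; exact isUnit_iff_ne_zero.2 hp.ne')
  rw [← Matrix.det_submatrix_equiv_self e.symm M, h1, det_fromBlocks₂₂, hD]
  congr 2
  ext i j
  have : ⅟D = of fun _ _ => (M none none)⁻¹ := by
    refine invOf_eq_right_inv ?_
    ext i j
    simp [Matrix.mul_apply, hp.ne', D]
  simp [this, Matrix.mul_apply, schurNone, hsymm (some i) none]
  field_simp

/-- Completing the square in the coordinates `some i` of the inverse form. The inverse of the Schur
complement is the restriction of `M⁻¹` to these coordinates. -/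
theorem qform_inv_option {α : Type*} [Fintype α] [DecidableEq α]
    {M : Matrix (Option α) (Option α) ℝ} (hM : M.PosDef) (u : Option α → ℝ) :
    qform M⁻¹ u = u none ^ 2 / M none none +
      qform (schurNone M)⁻¹ (fun i => u (some i) - u none * (M none (some i) / M none none)) := by
  have hp : 0 < M none none := hM.diag_pos
  have hsymm : ∀ i j, M i j = M j i := fun i j => by
    have := hM.isHermitian.apply i j
    simpa using this.symm
  have hMu : IsUnit M.det := (Matrix.isUnit_iff_isUnit_det _).1 hM.isUnit
  have hSu : IsUnit (schurNone M).det :=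
    (Matrix.isUnit_iff_isUnit_det _).1 (PosDef.schurNone hM).isUnit
  set z := M⁻¹ *ᵥ u with hz
  have hu : M *ᵥ z = u := by rw [hz, mulVec_mulVec, mul_nonsing_inv _ hMu, one_mulVec]
  have hu0 : M none none * z none + ∑ i, M none (some i) * z (some i) = u none := by
    rw [← hu]; simp [mulVec, dotProduct, Fintype.sum_option]
  have hui : ∀ i, M none (some i) * z none + ∑ j, M (some i) (some j) * z (some j) = u (some i) :=
    fun i => by
      rw [← hu, ← hsymm (some i) none]; simp [mulVec, dotProduct, Fintype.sum_option]
  have hS : schurNone M *ᵥ (fun i => z (some i)) =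
      fun i => u (some i) - u none * (M none (some i) / M none none) := by
    ext i
    simp only [mulVec, dotProduct, schurNone, sub_mul, Finset.sum_sub_distrib]
    have : ∑ j, M none (some i) * M none (some j) / M none none * z (some j) =
        M none (some i) / M none none * ∑ j, M none (some j) * z (some j) := by
      rw [Finset.mul_sum]
      refine Finset.sum_congr rfl fun j _ => ?_
      ring
    rw [this, ← hui i, ← hu0]
    field_simp
    ring
  rw [qform, qform, ← hz, ← hS, mulVec_mulVec, nonsing_inv_mul _ hSu, one_mulVec, hS]
  simp only [dotProduct, Fintype.sum_option, sub_mul, Finset.sum_sub_distrib]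
  have : ∑ i, u none * (M none (some i) / M none none) * z (some i) =
      u none / M none none * ∑ i, M none (some i) * z (some i) := by
    rw [Finset.mul_sum]
    refine Finset.sum_congr rfl fun j _ => ?_
    ring
  rw [this, ← hu0]
  field_simp
  ring

/-- Poisson summation for a Gaussian with real characteristics. The induction splits off one
coordinate by completing the square, and applies the one-dimensional formula to it. -/
theorem tsum_gaussTerm {ι : Type*} [Fintype ι] [DecidableEq ι] {M : Matrix ι ι ℝ} (hM : M.PosDef)
    (a b : ι → ℝ) :
    ∑' v, gaussTerm M a b v = ((Real.sqrt M.det)⁻¹ : ℝ) * ∑' w, dualGaussTerm M⁻¹ a b w := by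
  suffices h : ∀ (M : Matrix ι ι ℝ), M.PosDef → ∀ a b : ι → ℝ,
      ∑' v, gaussTerm M a b v =
        ((Real.sqrt M.det)⁻¹ : ℝ) * ∑' w, dualGaussTerm M⁻¹ a b w from h _ hM a b
  clear hM a b
  clear M
  rename_i inst
  revert inst
  refine Fintype.induction_empty_option
    (P := fun ι _ => ∀ [DecidableEq ι] (M : Matrix ι ι ℝ), M.PosDef → ∀ a b : ι → ℝ,
      ∑' v, gaussTerm M a b v =
        ((Real.sqrt M.det)⁻¹ : ℝ) * ∑' w, dualGaussTerm M⁻¹ a b w) ?_ ?_ ?_ ι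
  · intro α β _ e h _ M hM a b
    classical
    let := Fintype.ofEquiv β e.symm
    have h1 := h (M.submatrix e e) (hM.submatrix e.injective) (a ∘ e) (b ∘ e)
    rw [← (Equiv.arrowCongr e (Equiv.refl ℤ)).tsum_eq (gaussTerm M a b),
      ← (Equiv.arrowCongr e (Equiv.refl ℤ)).tsum_eq (dualGaussTerm M⁻¹ a b)]
    rw [det_submatrix_equiv_self] at h1
    refine (Eq.trans (tsum_congr fun v => ?_) h1).trans (congrArg _ (tsum_congr fun v => ?_))
    · simp only [gaussTerm, qform, dotProduct, mulVec, ← e.sum_comp]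
      simp [Equiv.arrowCongr]
    · rw [inv_submatrix_equiv]
      simp only [dualGaussTerm, qform, dotProduct, mulVec, ← e.sum_comp]
      simp [Equiv.arrowCongr]
  · intro _ M _ a b
    simp [gaussTerm, dualGaussTerm, qform]
  · intro α _ ih inst M hM a b
    classical
    obtain rfl : inst = Option.instDecidableEq := Subsingleton.elim _ _
    have hp : 0 < M none none := hM.diag_pos
    have hp' : (M none none : ℂ) ≠ 0 := by exact_mod_cast hp.ne'
    set p := M none none with hpdef
    set r : α → ℝ := fun i => M none (some i) with hr
    set S := schurNone M with hSdef
    have hS : S.PosDef := PosDef.schurNone hM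
    set a' : α → ℝ := fun i => a (some i) with ha'
    set b' : α → ℝ := fun i => b (some i) with hb'
    obtain ⟨e, he0, hes⟩ : ∃ e : ℤ × (α → ℤ) ≃ (Option α → ℤ),
        (∀ x, e x none = x.1) ∧ ∀ x i, e x (some i) = x.2 i :=
      ⟨(Equiv.piOptionEquivProd (α := α) (β := fun _ => ℤ)).symm, fun _ => rfl, fun _ _ => rfl⟩
    -- the shift of the coordinate `none` from completing the square
    let ρ : (α → ℤ) → ℝ := fun v => (∑ i, r i * ((v i : ℝ) + a' i)) / p
    -- after summation over the coordinate `none`, the characteristic of the remaining coordinates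
    -- depends on its dual variable `w`
    let B : ℤ → α → ℝ := fun w i => b' i + ((w : ℝ) - b none) * (r i / p)
    obtain ⟨E, hEdef⟩ : ∃ E : ℤ → ℂ, ∀ w, E w =
        cexp (-Real.pi * (((w : ℂ) - b none) ^ 2 / p) + 2 * Real.pi * I * (w * a none)) :=
      ⟨_, fun _ => rfl⟩
    have hE : ∀ w, ‖E w‖ = Real.exp (-(Real.pi / p) * ((w : ℝ) + -b none) ^ 2) := fun w => by
      have : (-Real.pi * (((w : ℂ) - b none) ^ 2 / p) + 2 * Real.pi * I * (w * a none)) =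
          ((-(Real.pi / p) * ((w : ℝ) + -b none) ^ 2 : ℝ) : ℂ) +
            ((2 * Real.pi * (w * a none) : ℝ) : ℂ) * I := by
        push_cast; field_simp; ring
      simp only [hEdef, this, Complex.norm_exp]
      simp only [add_re, ofReal_re, re_ofReal_mul, I_re, mul_zero, add_zero]
    have key1 : ∀ n v, gaussTerm M a b (e (n, v)) =
        cexp (-Real.pi * (p * ((n : ℂ) + (a none + ρ v : ℝ)) ^ 2) +
          2 * Real.pi * I * (b none * ((n : ℂ) + (a none + ρ v : ℝ)))) *
        (cexp (-2 * Real.pi * I * (b none * ρ v)) * gaussTerm S a' b' v) := by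
      intro n v
      simp only [gaussTerm, ← Complex.exp_add]
      rw [qform_option hM]
      congr 1
      simp only [he0, hes, ρ, dotProduct, Fintype.sum_option]
      push_cast
      ring
    have key2 : ∀ (w : ℤ) v, cexp (-Real.pi * (((w : ℂ) - b none) ^ 2 / p) +
          2 * Real.pi * I * (w * (a none + ρ v : ℝ))) *
        (cexp (-2 * Real.pi * I * (b none * ρ v)) * gaussTerm S a' b' v) =
        E w * gaussTerm S a' (B w) v := by
      intro w v
      simp only [gaussTerm, hEdef, ← Complex.exp_add]
      congr 1
      have : (B w ⬝ᵥ fun i => (v i : ℝ) + a' i) =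
          (b' ⬝ᵥ fun i => (v i : ℝ) + a' i) + ((w : ℝ) - b none) * ρ v := by
        simp only [B, ρ, dotProduct, add_mul, Finset.sum_add_distrib, Finset.sum_div,
          Finset.mul_sum]
        congr 1
        refine Finset.sum_congr rfl fun i _ => ?_
        ring
      rw [this]
      push_cast
      ring
    have key3 : ∀ w w', dualGaussTerm M⁻¹ a b (e (w, w')) =
        E w * dualGaussTerm S⁻¹ a' (B w) w' := by
      intro w w'
      simp only [dualGaussTerm, hEdef, ← Complex.exp_add]
      rw [qform_inv_option hM]
      congr 1
      have : (fun i => ((e (w, w') (some i) : ℤ) : ℝ) - b (some i) -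
          (((e (w, w') none : ℤ) : ℝ) - b none) * (M none (some i) / M none none)) =
          fun i => (w' i : ℝ) - B w i := by
        ext i
        simp only [he0, hes, B, b', r]
        ring
      rw [this]
      simp only [he0, hes, dotProduct, Fintype.sum_option]
      push_cast
      ring
    have hsumE : Summable fun w => ‖E w‖ := by
      simp only [hE]
      exact summable_exp_neg_sq_int (div_pos Real.pi_pos hp) _
    have hsum1 : Summable fun x : (α → ℤ) × ℤ => gaussTerm M a b (e (x.2, x.1)) :=
      (summable_gaussTerm hM a b).comp_injective ((Equiv.prodComm (α → ℤ) ℤ).trans e).injective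
    have hsum2 : Summable fun x : (α → ℤ) × ℤ => E x.2 * gaussTerm S a' (B x.2) x.1 := by
      refine Summable.of_norm ?_
      refine (((summable_gaussTerm hS a' b').norm.mul_of_nonneg hsumE (fun _ => norm_nonneg _)
        fun _ => norm_nonneg _)).congr fun x => ?_
      rw [norm_mul, norm_gaussTerm, norm_gaussTerm, mul_comm]
    have hsum3 : Summable fun x : ℤ × (α → ℤ) => dualGaussTerm M⁻¹ a b (e x) :=
      (summable_dualGaussTerm hM.inv a b).comp_injective e.injective
    have hcomm : ∀ G : (α → ℤ) → ℤ → ℂ, Summable (fun x : (α → ℤ) × ℤ => G x.1 x.2) →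
        ∑' v, ∑' w, G v w = ∑' w, ∑' v, G v w := fun G h => (Summable.tsum_comm h).symm
    calc ∑' v, gaussTerm M a b v
        = ∑' x : (α → ℤ) × ℤ, gaussTerm M a b (e (x.2, x.1)) :=
          (((Equiv.prodComm (α → ℤ) ℤ).trans e).tsum_eq (gaussTerm M a b)).symm
      _ = ∑' v, ∑' n, gaussTerm M a b (e (n, v)) := hsum1.tsum_prod
      _ = ∑' v, ((Real.sqrt p)⁻¹ : ℝ) * ∑' w, E w * gaussTerm S a' (B w) v := by
          refine tsum_congr fun v => ?_
          simp only [key1]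
          rw [tsum_mul_right, tsum_gauss_int hp, mul_assoc, ← tsum_mul_right]
          simp only [key2]
      _ = ((Real.sqrt p)⁻¹ : ℝ) * ∑' w, ∑' v, E w * gaussTerm S a' (B w) v := by
          rw [tsum_mul_left]
          congr 1
          exact hcomm (fun v w => E w * gaussTerm S a' (B w) v) hsum2
      _ = ((Real.sqrt p)⁻¹ : ℝ) * ∑' w, ((Real.sqrt S.det)⁻¹ : ℝ) *
            ∑' w', dualGaussTerm M⁻¹ a b (e (w, w')) := by
          congr 1
          refine tsum_congr fun w => ?_
          rw [tsum_mul_left, ih S hS, mul_left_comm, ← tsum_mul_left]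
          simp only [key3]
      _ = _ := by
          rw [tsum_mul_left, ← hsum3.tsum_prod, e.tsum_eq, ← mul_assoc]
          congr 1
          rw [det_option hM, Real.sqrt_mul hp.le, mul_inv]
          push_cast
          rfl

end Poisson


/-! ### Real embeddings of a totally real field -/

section Embeddings

variable {K : Type*} [Field K] [NumberField K]

variable (K) in
/-- All complex embeddings of a totally real field are real. -/
def realEmbeddingEquiv [IsTotallyReal K] : (K →+* ℝ) ≃ (K →ₐ[ℚ] ℂ) :=
  Equiv.ofBijective (fun σ => (Complex.ofRealHom.comp σ).toRatAlgHom) (by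
    constructor
    · intro σ τ h
      ext x
      have := DFunLike.congr_fun h x
      simpa using this
    · intro φ
      have hφ := IsTotallyReal.complexEmbedding_isReal (φ : K →+* ℂ)
      refine ⟨hφ.embedding, ?_⟩
      ext x
      simp)

theorem realEmbeddingEquiv_apply [IsTotallyReal K] (σ : K →+* ℝ) (x : K) :
    realEmbeddingEquiv K σ x = ((σ x : ℝ) : ℂ) := rfl

theorem sum_embeddings [IsTotallyReal K] (x : K) : ∑ σ : K →+* ℝ, σ x = (Algebra.trace ℚ K x : ℝ) := by
  have h := trace_eq_sum_embeddings ℂ (K := ℚ) (L := K) (x := x)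
  rw [← (realEmbeddingEquiv K).sum_comp] at h
  simp only [realEmbeddingEquiv_apply, eq_ratCast] at h
  exact_mod_cast h.symm

theorem prod_embeddings [IsTotallyReal K] (x : K) : ∏ σ : K →+* ℝ, σ x = (Algebra.norm ℚ x : ℝ) := by
  have h := Algebra.norm_eq_prod_embeddings ℚ ℂ x
  rw [← (realEmbeddingEquiv K).prod_comp] at h
  simp only [realEmbeddingEquiv_apply, eq_ratCast] at h
  exact_mod_cast h.symm

variable (K) in
theorem card_embeddings [IsTotallyReal K] : Fintype.card (K →+* ℝ) = Module.finrank ℚ K := by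
  rw [← AlgHom.card ℚ K ℂ]
  exact Fintype.card_congr (realEmbeddingEquiv K)

/-- The additive character `x ↦ exp(π i Tr x)`. -/
def expTrace (x : K) : ℂ := Complex.exp (Real.pi * Complex.I * ((∑ σ : K →+* ℝ, σ x : ℝ) : ℂ))

theorem expTrace_add (x y : K) : expTrace (x + y) = expTrace x * expTrace y := by
  simp only [expTrace, map_add, Finset.sum_add_distrib, ← Complex.exp_add]
  congr 1
  push_cast
  ring

theorem expTrace_zero : expTrace (0 : K) = 1 := by simp [expTrace]

theorem expTrace_two_mul [IsTotallyReal K] {x : K} {z : ℤ} (h : Algebra.trace ℚ K x = z) : expTrace (2 * x) = 1 := by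
  rw [expTrace, sum_embeddings, Complex.exp_eq_one_iff]
  refine ⟨z, ?_⟩
  rw [two_mul, map_add, h]
  push_cast
  ring

theorem norm_expTrace (x : K) : ‖expTrace x‖ = 1 := by
  rw [expTrace, mul_right_comm, ← Complex.ofReal_mul, Complex.norm_exp_ofReal_mul_I]

end Embeddings

/-! ### Positivity of the conjugates of the Gram matrix -/

section Positivity

variable {K : Type*} [Field K] [NumberField K] {m : ℕ}

theorem exists_mul_mem_of_ne_zero {J : FracIdeal K} (hJ : J ≠ 0) (y : K) :
    ∃ d : 𝓞 K, d ≠ 0 ∧ (d : K) * y ∈ J := by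
  obtain ⟨a, ha0, ha⟩ := FractionalIdeal.exists_ne_zero_mem_isInteger hJ
  obtain ⟨⟨p, q⟩, hpq⟩ := IsLocalization.surj (𝓞 K)⁰ y
  refine ⟨a * q, mul_ne_zero ha0 (nonZeroDivisors.coe_ne_zero q), ?_⟩
  have : ((a * q : 𝓞 K) : K) * y = p • algebraMap (𝓞 K) K a := by
    rw [Algebra.smul_def, ← hpq]
    simp only [map_mul]
    ring
  rw [this]
  exact Submodule.smul_mem _ _ ha

theorem exists_smul_mem_of_ne_zero {ι : Type*} [Finite ι] {J : ι → FracIdeal K}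
    (hJ : ∀ i, J i ≠ 0) (y : ι → K) :
    ∃ d : 𝓞 K, d ≠ 0 ∧ ∀ i, (d : K) * y i ∈ J i := by
  classical
  have := Fintype.ofFinite ι
  choose d hd0 hd using fun i => exists_mul_mem_of_ne_zero (hJ i) (y i)
  refine ⟨∏ i, d i, Finset.prod_ne_zero_iff.2 fun i _ => hd0 i, fun i => ?_⟩
  rw [← Finset.mul_prod_erase _ _ (Finset.mem_univ i)]
  have : ((d i * ∏ j ∈ Finset.univ.erase i, d j : 𝓞 K) : K) * y i =
      (∏ j ∈ Finset.univ.erase i, d j) • ((d i : K) * y i) := by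
    rw [Algebra.smul_def]
    simp only [map_mul]
    ring
  rw [this]
  exact Submodule.smul_mem _ _ (hd i)

/-- Total positivity extends from the lattice to the space it spans, as every vector has a nonzero
multiple in the lattice. -/
theorem QuadLattice.pos (L : QuadLattice K m) {x : Fin m → K} (hx : x ≠ 0) (σ : K →+* ℝ) :
    0 < σ (x ⬝ᵥ L.gram *ᵥ x) := by
  obtain ⟨d, hd0, hd⟩ := exists_smul_mem_of_ne_zero L.coeffIdeal_ne_zero x
  have hdK : (d : K) ≠ 0 := by simpa using hd0
  have h := L.totallyPositive ((d : K) • x) hd (smul_ne_zero hdK hx) σ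
  have e : ((d : K) • x) ⬝ᵥ L.gram *ᵥ ((d : K) • x) = (d : K) ^ 2 * (x ⬝ᵥ L.gram *ᵥ x) := by
    rw [mulVec_smul, smul_dotProduct, dotProduct_smul, smul_smul, smul_eq_mul, sq]
  rw [e, map_mul, map_pow] at h
  exact pos_of_mul_pos_right h (sq_nonneg _)

/-- The conjugates of the Gram matrix are positive on the dense set of rational vectors, and they
are not degenerate. -/
theorem QuadLattice.posDef [IsTotallyReal K] (L : QuadLattice K m) (σ : K →+* ℝ) :
    (L.gram.map σ).PosDef := by
  have hsymm : (L.gram.map σ).IsHermitian := by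
    ext i j
    simp only [conjTranspose_apply, map_apply, star_trivial]
    rw [L.gram_symm.apply]
  refine (Matrix.PosSemidef.posDef_iff_det_ne_zero ?_).2 ?_
  · refine Matrix.PosSemidef.of_dotProduct_mulVec_nonneg hsymm fun x => ?_
    simp only [star_trivial]
    have hcl : IsClosed {x : Fin m → ℝ | 0 ≤ x ⬝ᵥ (L.gram.map σ) *ᵥ x} := by
      refine isClosed_le continuous_const ?_
      simp only [dotProduct, mulVec]
      fun_prop
    have hd : DenseRange (Pi.map (fun (_ : Fin m) (q : ℚ) => (q : ℝ))) :=
      DenseRange.piMap fun _ => Rat.denseRange_cast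
    have hsub : Set.range (Pi.map (fun (_ : Fin m) (q : ℚ) => (q : ℝ))) ⊆
        {x : Fin m → ℝ | 0 ≤ x ⬝ᵥ (L.gram.map σ) *ᵥ x} := by
      rintro _ ⟨q, rfl⟩
      by_cases hq : q = 0
      · subst hq
        simp [dotProduct]
      · have h := L.pos (x := fun i => (q i : K))
          (fun h0 => hq (funext fun i => by simpa using congrFun h0 i)) σ
        have e : (Pi.map (fun (_ : Fin m) (q : ℚ) => (q : ℝ)) q) ⬝ᵥ
            (L.gram.map σ) *ᵥ (Pi.map (fun (_ : Fin m) (q : ℚ) => (q : ℝ)) q) =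
            σ ((fun i => (q i : K)) ⬝ᵥ L.gram *ᵥ (fun i => (q i : K))) := by
          simp [dotProduct, mulVec]
        rw [Set.mem_ofPred_eq, e]
        exact h.le
    exact (hcl.closure_subset_iff.2 hsub) (hd x)
  · rw [← RingHom.mapMatrix_apply, ← RingHom.map_det]
    simpa using L.det_gram_ne_zero

end Positivity

/-! ### Integral bases of lattices of matrices, and Gram matrices -/

section Bases

variable {K : Type*} [Field K] [NumberField K] {m n : ℕ}

/-- A lattice of matrices with entries in fractional ideals has a `ℤ`-basis, which is a rational
basis of the space of matrices. -/
theorem exists_basis_matrix (J : Fin m → Fin n → FracIdeal K) (hJ : ∀ i j, J i j ≠ 0) :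
    ∃ (d : ℕ) (b : Module.Basis (Fin d) ℚ (Matrix (Fin m) (Fin n) K)),
      ∀ U, (∀ i j, U i j ∈ J i j) ↔ ∀ k, ∃ z : ℤ, b.repr U k = z := by
  let u : Fin m → Fin n → (FracIdeal K)ˣ := fun i j => Units.mk0 (J i j) (hJ i j)
  let b₀ : Module.Basis _ ℚ (Fin m → Fin n → K) :=
    Pi.basis fun i => Pi.basis fun j => basisOfFractionalIdeal K (u i j)
  let b₁ : Module.Basis _ ℚ (Matrix (Fin m) (Fin n) K) := b₀.map (Matrix.ofLinearEquiv ℚ)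
  refine ⟨_, b₁.reindex (Fintype.equivFin _), fun U => ?_⟩
  have h : ∀ i j, U i j ∈ J i j ↔
      ∀ k, (basisOfFractionalIdeal K (u i j)).repr (U i j) k ∈ Set.range (algebraMap ℤ ℚ) := by
    intro i j
    rw [← Module.Basis.mem_span_iff_repr_mem, mem_span_basisOfFractionalIdeal]
    rfl
  simp only [h]
  have h2 : ∀ i j k, b₁.repr U ⟨i, j, k⟩ = (basisOfFractionalIdeal K (u i j)).repr (U i j) k := by
    intro i j k
    simp [b₁, b₀, Pi.basis_repr]
  constructor
  · intro hU k
    obtain ⟨⟨i, j, l⟩, rfl⟩ := (Fintype.equivFin _).surjective k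
    obtain ⟨z, hz⟩ := hU i j l
    refine ⟨z, ?_⟩
    rw [Module.Basis.repr_reindex_apply, Equiv.symm_apply_apply, h2, ← hz]
    simp
  · intro hU i j l
    obtain ⟨z, hz⟩ := hU (Fintype.equivFin _ ⟨i, j, l⟩)
    rw [Module.Basis.repr_reindex_apply, Equiv.symm_apply_apply, h2] at hz
    exact ⟨z, by rw [hz]; simp⟩

variable (L : QuadLattice K m) {κ : Type*}

/-- The rational bilinear form `(U, V) ↦ Tr tr(ᵗU Q V)`. -/
def QuadLattice.traceForm (n : ℕ) : LinearMap.BilinForm ℚ (Matrix (Fin m) (Fin n) K) :=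
  LinearMap.mk₂ ℚ (fun U V => Algebra.trace ℚ K (Uᵀ * L.gram * V).trace)
    (fun U V W => by simp [Matrix.add_mul])
    (fun c U V => by simp [Matrix.trace_smul])
    (fun U V W => by simp [Matrix.mul_add])
    (fun c U V => by simp [Matrix.trace_smul])

theorem QuadLattice.traceForm_apply (U V : Matrix (Fin m) (Fin n) K) :
    L.traceForm n U V = Algebra.trace ℚ K (Uᵀ * L.gram * V).trace := rfl

theorem QuadLattice.traceForm_symm (U V : Matrix (Fin m) (Fin n) K) :
    (Uᵀ * L.gram * V).trace = (Vᵀ * L.gram * U).trace := by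
  rw [← Matrix.trace_transpose, Matrix.transpose_mul, Matrix.transpose_mul, L.gram_symm.eq,
    Matrix.transpose_transpose, Matrix.mul_assoc]

theorem QuadLattice.eq_zero_of_traceForm [IsTotallyReal K] (U : Matrix (Fin m) (Fin n) K)
    (h : ∀ V, L.traceForm n U V = 0) : U = 0 := by
  have h1 : Uᵀ * L.gram = 0 := by
    ext j i
    refine (traceForm_nondegenerate ℚ K).1 _ fun y => ?_
    have := h (Matrix.single i j y)
    rw [L.traceForm_apply, Matrix.trace_mul_single] at this
    simpa [Algebra.traceForm_apply] using this
  have h2 : Uᵀ = 0 := by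
    rw [← Matrix.mul_one Uᵀ, ← Matrix.mul_nonsing_inv _ (isUnit_iff_ne_zero.2 L.det_gram_ne_zero),
      ← Matrix.mul_assoc, h1, Matrix.zero_mul]
  simpa using congrArg Matrix.transpose h2

theorem QuadLattice.traceForm_nondegenerate [IsTotallyReal K] :
    (L.traceForm (n := n)).Nondegenerate := by
  refine ⟨fun U h => L.eq_zero_of_traceForm U h, fun U h => L.eq_zero_of_traceForm U fun V => ?_⟩
  rw [← h V, L.traceForm_apply, L.traceForm_apply, L.traceForm_symm]

/-- The real Gram matrix of the form `U ↦ ∑ tr((ᵗU Q U)^(σ) Y_σ)`. -/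
def QuadLattice.realGram (b : κ → Matrix (Fin m) (Fin n) K)
    (Y : (K →+* ℝ) → Matrix (Fin n) (Fin n) ℝ) : Matrix κ κ ℝ :=
  of fun k l => ∑ σ : K →+* ℝ, (((b k)ᵀ * L.gram * b l).map σ * Y σ).trace

/-- The complex Gram matrix of the form `U ↦ tr ∑ (ᵗU Q U)^(σ) τ_σ`. -/
def QuadLattice.complexGram (b : κ → Matrix (Fin m) (Fin n) K) (τ : MatTuple K n) (k l : κ) : ℂ :=
  (∑ σ : K →+* ℝ, conj σ ((b k)ᵀ * L.gram * b l) * τ σ).trace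

/-- The conjugates of the entries of matrices `b k`, as a real matrix. -/
def conjEntries (b : κ → Matrix (Fin m) (Fin n) K) :
    Matrix ((Fin n × Fin m) × (K →+* ℝ)) κ ℝ :=
  of fun x k => vec ((b k).map x.2) x.1

end Bases


/-! ### The Gram matrix of a rational basis in terms of the conjugates -/

section GramBases

open scoped Kronecker Classical

variable {K : Type*} [Field K] [NumberField K] {m n : ℕ}

variable (L : QuadLattice K m) {κ : Type*}

/-- The block diagonal matrix of the `Y_σ ⊗ Q^(σ)`. -/
def QuadLattice.kroneckerGram (Y : (K →+* ℝ) → Matrix (Fin n) (Fin n) ℝ) :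
    Matrix ((Fin n × Fin m) × (K →+* ℝ)) ((Fin n × Fin m) × (K →+* ℝ)) ℝ :=
  blockDiagonal fun σ => Y σ ⊗ₖ L.gram.map σ

theorem QuadLattice.dotProduct_kroneckerGram (Y : (K →+* ℝ) → Matrix (Fin n) (Fin n) ℝ)
    (x y : (Fin n × Fin m) × (K →+* ℝ) → ℝ) :
    x ⬝ᵥ L.kroneckerGram Y *ᵥ y = ∑ σ, (fun p => x (p, σ)) ⬝ᵥ
      (Y σ) ⊗ₖ (L.gram.map σ) *ᵥ (fun p => y (p, σ)) := by
  rw [dotProduct, Fintype.sum_prod_type_right]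
  refine Finset.sum_congr rfl fun σ _ => Finset.sum_congr rfl fun p _ => ?_
  congr 1
  rw [mulVec, dotProduct, Fintype.sum_prod_type_right, Finset.sum_eq_single σ]
  · simp [kroneckerGram, blockDiagonal_apply, mulVec, dotProduct]
  · intro τ _ hτ
    simp [kroneckerGram, blockDiagonal_apply, Ne.symm hτ]
  · simp

/-- The real Gram matrix is obtained from a block diagonal matrix by the base change that the
conjugates of the basis define. -/
theorem QuadLattice.realGram_eq (b : κ → Matrix (Fin m) (Fin n) K)
    {Y : (K →+* ℝ) → Matrix (Fin n) (Fin n) ℝ} (hY : ∀ σ, (Y σ).IsSymm) :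
    L.realGram b Y = (conjEntries b)ᵀ * L.kroneckerGram Y * conjEntries b := by
  ext k l
  have h1 : ((conjEntries b)ᵀ * L.kroneckerGram Y * conjEntries b) k l =
      (fun x => conjEntries b x k) ⬝ᵥ L.kroneckerGram Y *ᵥ (fun x => conjEntries b x l) := by
    rw [Matrix.mul_assoc]
    rfl
  rw [h1, dotProduct_kroneckerGram, realGram, of_apply]
  refine Finset.sum_congr rfl fun σ _ => ?_
  change _ = vec ((b k).map σ) ⬝ᵥ (Y σ) ⊗ₖ (L.gram.map σ) *ᵥ vec ((b l).map σ)
  rw [kronecker_mulVec_vec, vec_dotProduct_vec, (hY σ).eq, Matrix.map_mul, Matrix.map_mul,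
    transpose_map, Matrix.mul_assoc, Matrix.mul_assoc, Matrix.mul_assoc]

theorem QuadLattice.kroneckerGram_posDef [IsTotallyReal K]
    {Y : (K →+* ℝ) → Matrix (Fin n) (Fin n) ℝ} (hY : ∀ σ, (Y σ).PosDef) :
    (L.kroneckerGram Y).PosDef := by
  have h : ∀ σ : K →+* ℝ, ((Y σ) ⊗ₖ (L.gram.map σ)).PosDef := fun σ => (hY σ).kronecker (L.posDef σ)
  refine Matrix.PosDef.of_dotProduct_mulVec_pos ?_ fun x hx => ?_
  · unfold kroneckerGram
    rw [Matrix.IsHermitian, blockDiagonal_conjTranspose]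
    congr 1
    ext σ : 1
    exact (h σ).isHermitian
  · rw [star_trivial, dotProduct_kroneckerGram]
    obtain ⟨⟨p, σ⟩, hp⟩ := Function.ne_iff.1 hx
    refine Finset.sum_pos' (fun σ _ => ?_) ⟨σ, Finset.mem_univ _, ?_⟩
    · simpa using (h σ).posSemidef.dotProduct_mulVec_nonneg (fun p => x (p, σ))
    · simpa using (h σ).dotProduct_mulVec_pos (x := fun p => x (p, σ))
        (fun h0 => hp (congrFun h0 p))

theorem QuadLattice.kroneckerGram_det (Y : (K →+* ℝ) → Matrix (Fin n) (Fin n) ℝ) :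
    (L.kroneckerGram Y).det =
      (∏ σ : K →+* ℝ, (L.gram.map σ).det ^ n) * (∏ σ, (Y σ).det) ^ m := by
  unfold kroneckerGram
  rw [det_blockDiagonal, ← Finset.prod_pow, ← Finset.prod_mul_distrib]
  refine Finset.prod_congr rfl fun σ _ => ?_
  rw [det_kronecker, mul_comm]
  simp

section Dual

variable [IsTotallyReal K] [Fintype κ] [DecidableEq κ]
  (b : Module.Basis κ ℚ (Matrix (Fin m) (Fin n) K))

/-- The basis dual to `b` under the form `Tr tr(ᵗU Q V)`. -/
def QuadLattice.dualBasis : Module.Basis κ ℚ (Matrix (Fin m) (Fin n) K) :=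
  (L.traceForm n).dualBasis L.traceForm_nondegenerate b

include b in
theorem card_index : Fintype.card κ = Fintype.card ((Fin n × Fin m) × (K →+* ℝ)) := by
  rw [← Module.finrank_eq_card_basis b, Fintype.card_prod, card_embeddings, Fintype.card_prod,
    Fintype.card_fin, Fintype.card_fin, Module.finrank_matrix]
  simp [mul_comm]

theorem QuadLattice.dual_mul_conjEntries :
    (conjEntries (L.dualBasis b)).transpose * L.kroneckerGram (n := n) 1 * conjEntries b = 1 := by
  ext k l
  have h := (L.traceForm n).apply_dualBasis_left L.traceForm_nondegenerate b k l
  rw [Matrix.mul_assoc]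
  change (fun x => conjEntries (L.dualBasis b) x k) ⬝ᵥ
    L.kroneckerGram (n := n) 1 *ᵥ (fun x => conjEntries b x l) = _
  rw [dotProduct_kroneckerGram]
  have h2 : ∀ σ : K →+* ℝ, (fun p => conjEntries (L.dualBasis b) (p, σ) k) ⬝ᵥ
      ((1 : (K →+* ℝ) → Matrix (Fin n) (Fin n) ℝ) σ) ⊗ₖ (L.gram.map σ) *ᵥ
        (fun p => conjEntries b (p, σ) l) =
      σ ((L.dualBasis b k)ᵀ * L.gram * b l).trace := by
    intro σ
    change vec ((L.dualBasis b k).map σ) ⬝ᵥ (1 : Matrix (Fin n) (Fin n) ℝ) ⊗ₖ L.gram.map σ *ᵥ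
      vec ((b l).map σ) = _
    rw [kronecker_mulVec_vec, vec_dotProduct_vec, transpose_one, Matrix.mul_one, ← transpose_map,
      ← Matrix.map_mul, ← Matrix.map_mul, ← Matrix.mul_assoc]
    simp only [Matrix.trace, map_sum, diag_apply, map_apply]
  simp only [h2]
  rw [sum_embeddings, ← L.traceForm_apply, dualBasis, h, one_apply]
  by_cases hkl : k = l
  · simp [hkl]
  · simp [hkl, Ne.symm hkl]

theorem QuadLattice.conjEntries_mul_dual :
    L.kroneckerGram (n := n) 1 * conjEntries (L.dualBasis b) * (conjEntries b).transpose = 1 := by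
  have h := L.dual_mul_conjEntries b
  rw [Matrix.mul_eq_one_comm_of_card_eq _ _ _ (card_index b)] at h
  have h2 := congrArg Matrix.transpose h
  rw [transpose_mul, transpose_mul, transpose_transpose, transpose_one] at h2
  rw [← h2]
  congr 2
  have := (L.kroneckerGram_posDef (n := n) (Y := 1) fun _ => Matrix.PosDef.one).isHermitian
  simpa [Matrix.IsHermitian, conjTranspose_eq_transpose_of_trivial] using this.symm

include L in
theorem QuadLattice.conjEntries_mulVec_injective :
    Function.Injective (conjEntries b).mulVec := by
  intro x y hxy
  have := congrArg (fun v => ((conjEntries (L.dualBasis b)).transpose * L.kroneckerGram (n := n) 1) *ᵥ v) hxy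
  simpa [Matrix.mulVec_mulVec, dual_mul_conjEntries] using this

theorem QuadLattice.realGram_posDef {Y : (K →+* ℝ) → Matrix (Fin n) (Fin n) ℝ}
    (hY : ∀ σ, (Y σ).PosDef) : (L.realGram b Y).PosDef := by
  rw [L.realGram_eq b fun σ => by simpa using (hY σ).isHermitian]
  have := (L.kroneckerGram_posDef hY).conjTranspose_mul_mul_same
    (L.conjEntries_mulVec_injective b)
  rwa [conjTranspose_eq_transpose_of_trivial] at this

/-- The inverse of the real Gram matrix is the Gram matrix of the dual basis for the inverse
matrices. -/
theorem QuadLattice.realGram_inv {Y : (K →+* ℝ) → Matrix (Fin n) (Fin n) ℝ}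
    (hY : ∀ σ, (Y σ).PosDef) :
    (L.realGram b Y)⁻¹ = L.realGram (L.dualBasis b) fun σ => (Y σ)⁻¹ := by
  refine Matrix.inv_eq_left_inv ?_
  have hs : ∀ σ, (Y σ).IsSymm := fun σ => by simpa using (hY σ).isHermitian
  have hs' : ∀ σ, ((Y σ)⁻¹).IsSymm := fun σ => by simpa using (hY σ).inv.isHermitian
  rw [L.realGram_eq b hs, L.realGram_eq _ hs']
  have hu : ∀ σ, IsUnit (Y σ).det := fun σ => (Matrix.isUnit_iff_isUnit_det _).1 (hY σ).isUnit
  classical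
  have e1 : L.kroneckerGram (fun σ => (Y σ)⁻¹) =
      blockDiagonal (fun σ => (Y σ)⁻¹ ⊗ₖ (1 : Matrix (Fin m) (Fin m) ℝ)) *
        L.kroneckerGram (n := n) 1 := by
    unfold kroneckerGram
    have : ∀ σ : K →+* ℝ, (Y σ)⁻¹ ⊗ₖ (L.gram.map σ) =
      (Y σ)⁻¹ ⊗ₖ (1 : Matrix (Fin m) (Fin m) ℝ) * (1 : Matrix (Fin n) (Fin n) ℝ) ⊗ₖ L.gram.map σ :=
      fun σ => by rw [← mul_kronecker_mul, Matrix.mul_one, Matrix.one_mul]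
    simp only [this, Pi.one_apply]
    convert blockDiagonal_mul _ _
  have e2 : blockDiagonal (fun σ => (Y σ)⁻¹ ⊗ₖ (1 : Matrix (Fin m) (Fin m) ℝ)) *
      L.kroneckerGram Y = L.kroneckerGram (n := n) 1 := by
    unfold kroneckerGram
    have : ∀ σ : K →+* ℝ, (1 : Matrix (Fin n) (Fin n) ℝ) ⊗ₖ L.gram.map σ =
      (Y σ)⁻¹ ⊗ₖ (1 : Matrix (Fin m) (Fin m) ℝ) * (Y σ) ⊗ₖ (L.gram.map σ) :=
      fun σ => by rw [← mul_kronecker_mul, nonsing_inv_mul _ (hu σ), Matrix.one_mul]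
    simp only [this, Pi.one_apply]
    convert (blockDiagonal_mul _ _).symm
  rw [e1]
  calc _ = (conjEntries (L.dualBasis b)).transpose *
      (blockDiagonal (fun σ => (Y σ)⁻¹ ⊗ₖ (1 : Matrix (Fin m) (Fin m) ℝ)) *
        (L.kroneckerGram (n := n) 1 * conjEntries (L.dualBasis b) * (conjEntries b).transpose) *
        L.kroneckerGram Y) * conjEntries b := by simp only [Matrix.mul_assoc]
    _ = 1 := by
      rw [conjEntries_mul_dual, Matrix.mul_one, e2, dual_mul_conjEntries]

/-- The determinant of the real Gram matrix depends on `Y` only through the power `(∏ det Y_σ) ^ m`,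
which is a square for even `m`; hence no choice of a square root appears in the inversion formula. -/
theorem QuadLattice.exists_realGram_det : ∃ c₀ : ℝ, 0 < c₀ ∧
    ∀ Y : (K →+* ℝ) → Matrix (Fin n) (Fin n) ℝ, (∀ σ, (Y σ).PosDef) →
      (L.realGram b Y).det = c₀ * (∏ σ, (Y σ).det) ^ m := by
  obtain ⟨e⟩ : Nonempty ((Fin n × Fin m) × (K →+* ℝ) ≃ κ) := ⟨Fintype.equivOfCardEq (card_index b).symm⟩
  classical
  have h : ∀ Y : (K →+* ℝ) → Matrix (Fin n) (Fin n) ℝ, (∀ σ, (Y σ).PosDef) →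
      (L.realGram b Y).det = (((conjEntries b).submatrix id e).det ^ 2 *
        ∏ σ : K →+* ℝ, (L.gram.map σ).det ^ n) * (∏ σ, (Y σ).det) ^ m := by
    intro Y hY
    rw [L.realGram_eq b fun σ => by simpa using (hY σ).isHermitian]
    have : ((conjEntries b).transpose * L.kroneckerGram Y * conjEntries b).submatrix e e =
        ((conjEntries b).submatrix id e).transpose * L.kroneckerGram Y *
          (conjEntries b).submatrix id e := by
      ext k l
      simp [Matrix.mul_apply]
    rw [← det_submatrix_equiv_self e, this, det_mul, det_mul, det_transpose, kroneckerGram_det]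
    ring
  refine ⟨_, ?_, h⟩
  have h1 := h 1 fun _ => Matrix.PosDef.one
  have h2 := (L.realGram_posDef b (Y := 1) fun _ => Matrix.PosDef.one).det_pos
  rw [h1] at h2
  simpa using h2

end Dual

end GramBases


/-! ### Holomorphy of Gaussian series in the matrix of the quadratic form -/

section GaussianSeries

variable {κ : Type*} [Fintype κ]

/-- The linear form `Z ↦ ∑ Z k l x k x l`. -/
def quadEval (x : κ → ℝ) : (κ → κ → ℂ) →L[ℂ] ℂ :=
  ∑ k, ∑ l, ((x k * x l : ℝ) : ℂ) •
    ((ContinuousLinearMap.proj l).comp (ContinuousLinearMap.proj (R := ℂ) (φ := fun _ => κ → ℂ) k))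

theorem quadEval_apply (x : κ → ℝ) (Z : κ → κ → ℂ) :
    quadEval x Z = ∑ k, ∑ l, Z k l * x k * x l := by
  simp only [quadEval, _root_.sum_apply, _root_.smul_apply,
    ContinuousLinearMap.comp_apply, ContinuousLinearMap.proj_apply, smul_eq_mul]
  refine Finset.sum_congr rfl fun k _ => Finset.sum_congr rfl fun l _ => ?_
  push_cast
  ring

theorem norm_quadEval_apply_le (x : κ → ℝ) (Z : κ → κ → ℂ) :
    ‖quadEval x Z‖ ≤ Fintype.card κ * (∑ k, x k ^ 2) * ‖Z‖ := by
  have h1 : ‖quadEval x Z‖ ≤ (∑ k, |x k|) ^ 2 * ‖Z‖ := by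
    rw [quadEval_apply, sq, Finset.sum_mul_sum, Finset.sum_mul]
    refine (norm_sum_le _ _).trans (Finset.sum_le_sum fun k _ => ?_)
    rw [Finset.sum_mul]
    refine (norm_sum_le _ _).trans (Finset.sum_le_sum fun l _ => ?_)
    rw [norm_mul, norm_mul, Complex.norm_real, Complex.norm_real, Real.norm_eq_abs,
      Real.norm_eq_abs, mul_assoc, mul_comm]
    gcongr
    exact (norm_le_pi_norm (Z k) l).trans (norm_le_pi_norm Z k)
  refine h1.trans ?_
  gcongr
  have := sq_sum_le_card_mul_sum_sq (s := Finset.univ) (f := fun k => |x k|)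
  simpa using this

theorem norm_quadEval_le (x : κ → ℝ) : ‖quadEval x‖ ≤ Fintype.card κ * ∑ k, x k ^ 2 :=
  ContinuousLinearMap.opNorm_le_bound _ (by positivity) (norm_quadEval_apply_le x)

/-- The terms of a Gaussian series. -/
def gaussSeriesTerm (c : (κ → ℤ) → ℂ) (a : κ → ℝ) (v : κ → ℤ) (Z : κ → κ → ℂ) : ℂ :=
  c v * Complex.exp (Real.pi * Complex.I * quadEval (fun k => (v k : ℝ) + a k) Z)

variable {c : (κ → ℤ) → ℂ} (hc : ∀ v, ‖c v‖ ≤ 1) (a : κ → ℝ)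

include hc in
theorem norm_gaussSeriesTerm_le (v : κ → ℤ) (Z : κ → κ → ℂ) :
    ‖gaussSeriesTerm c a v Z‖ ≤
      Real.exp (-(Real.pi * (quadEval (fun k => (v k : ℝ) + a k) Z).im)) := by
  rw [gaussSeriesTerm, norm_mul, Complex.norm_exp]
  have : (Real.pi * Complex.I * quadEval (fun k => (v k : ℝ) + a k) Z).re =
      -(Real.pi * (quadEval (fun k => (v k : ℝ) + a k) Z).im) := by
    simp [Complex.mul_re]
  rw [this]
  exact mul_le_of_le_one_left (Real.exp_pos _).le (hc v)

/-- Near a matrix with positive definite imaginary part the imaginary parts are uniformly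
positive definite. -/
theorem exists_im_quadEval_ge {Z₀ : κ → κ → ℂ}
    (hZ : ∃ c₀ > 0, ∀ x : κ → ℝ, c₀ * ∑ k, x k ^ 2 ≤ (quadEval x Z₀).im) :
    ∃ c₁ > 0, ∃ r > 0, ∀ Z ∈ Metric.ball Z₀ r, ∀ x : κ → ℝ,
      c₁ * ∑ k, x k ^ 2 ≤ (quadEval x Z).im := by
  obtain ⟨c₀, hc₀, h⟩ := hZ
  refine ⟨c₀ / 2, half_pos hc₀, c₀ / 2 / (Fintype.card κ + 1), by positivity, fun Z hZ x => ?_⟩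
  have h1 : |(quadEval x (Z - Z₀)).im| ≤ c₀ / 2 * ∑ k, x k ^ 2 := by
    refine (Complex.abs_im_le_norm _).trans ((norm_quadEval_apply_le x _).trans ?_)
    rw [mem_ball_iff_norm] at hZ
    have h2 : (Fintype.card κ : ℝ) * ‖Z - Z₀‖ ≤ c₀ / 2 := by
      calc (Fintype.card κ : ℝ) * ‖Z - Z₀‖ ≤ (Fintype.card κ + 1) * (c₀ / 2 / (Fintype.card κ + 1)) := by
            gcongr
            linarith
        _ = c₀ / 2 := by field_simp
    calc (Fintype.card κ : ℝ) * (∑ k, x k ^ 2) * ‖Z - Z₀‖ =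
        (Fintype.card κ * ‖Z - Z₀‖) * ∑ k, x k ^ 2 := by ring
      _ ≤ _ := by gcongr
  rw [map_sub, Complex.sub_im] at h1
  have := (abs_le.1 h1).1
  have := h x
  linarith

include hc in
theorem summable_gaussSeriesTerm {Z₀ : κ → κ → ℂ}
    (hZ : ∃ c₀ > 0, ∀ x : κ → ℝ, c₀ * ∑ k, x k ^ 2 ≤ (quadEval x Z₀).im) :
    Summable fun v => gaussSeriesTerm c a v Z₀ := by
  obtain ⟨c₀, hc₀, h⟩ := hZ
  refine Summable.of_norm_bounded (summable_exp_neg_sum_sq (mul_pos Real.pi_pos hc₀) a) fun v =>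
    (norm_gaussSeriesTerm_le hc a v Z₀).trans (Real.exp_le_exp.2 ?_)
  rw [neg_mul, neg_le_neg_iff, mul_assoc]
  exact mul_le_mul_of_nonneg_left (h _) Real.pi_pos.le

include hc in
/-- A Gaussian series is holomorphic in the matrix of the form: near a point its terms are bounded by
a summable Gaussian, and so are their derivatives. -/
theorem differentiableAt_gaussSeries {Z₀ : κ → κ → ℂ}
    (hZ : ∃ c₀ > 0, ∀ x : κ → ℝ, c₀ * ∑ k, x k ^ 2 ≤ (quadEval x Z₀).im) :
    DifferentiableAt ℂ (fun Z => ∑' v, gaussSeriesTerm c a v Z) Z₀ := by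
  obtain ⟨c₁, hc₁, r, hr, h⟩ := exists_im_quadEval_ge hZ
  have hder : ∀ v Z, HasFDerivAt (gaussSeriesTerm c a v)
      ((gaussSeriesTerm c a v Z * (Real.pi * Complex.I)) • quadEval (fun k => (v k : ℝ) + a k)) Z := by
    intro v Z
    have h1 := (((quadEval (fun k => (v k : ℝ) + a k)).hasFDerivAt (x := Z)).const_mul
      (Real.pi * Complex.I : ℂ)).cexp.const_mul (c v)
    rw [smul_smul, smul_smul] at h1
    exact h1
  set B : ℝ := Real.pi * (Fintype.card κ * (2 / (Real.pi * c₁))) with hB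
  refine (hasFDerivAt_tsum_of_isPreconnected (𝕜 := ℂ) (f := gaussSeriesTerm c a)
    (u := fun v : κ → ℤ => B * Real.exp (-(Real.pi * c₁ / 2) * ∑ k, ((v k : ℝ) + a k) ^ 2))
    (f' := fun v Z => (gaussSeriesTerm c a v Z * (Real.pi * Complex.I)) •
      quadEval (fun k => (v k : ℝ) + a k))
    ((summable_exp_neg_sum_sq (by positivity) a).mul_left _) Metric.isOpen_ball
    (convex_ball Z₀ r).isPreconnected (fun v Z _ => hder v Z) (fun v Z hZ' => ?_)
    (Metric.mem_ball_self hr) (summable_gaussSeriesTerm hc a hZ)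
    (Metric.mem_ball_self hr)).differentiableAt
  set s := ∑ k, ((v k : ℝ) + a k) ^ 2 with hs
  have hs0 : 0 ≤ s := Finset.sum_nonneg fun _ _ => sq_nonneg _
  rw [norm_smul, norm_mul, norm_mul, Complex.norm_real, Complex.norm_I, mul_one,
    Real.norm_of_nonneg Real.pi_pos.le]
  have h1 : ‖gaussSeriesTerm c a v Z‖ ≤ Real.exp (-(Real.pi * c₁ * s)) := by
    refine (norm_gaussSeriesTerm_le hc a v Z).trans (Real.exp_le_exp.2 ?_)
    rw [neg_le_neg_iff, mul_assoc]
    exact mul_le_mul_of_nonneg_left (h Z hZ' _) Real.pi_pos.le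
  have h2 := norm_quadEval_le (fun k => (v k : ℝ) + a k)
  have h3 : s * Real.exp (-(Real.pi * c₁ * s)) ≤
      2 / (Real.pi * c₁) * Real.exp (-(Real.pi * c₁ / 2) * s) := by
    have h4 := Real.add_one_le_exp (Real.pi * c₁ / 2 * s)
    have h5 : Real.exp (-(Real.pi * c₁ / 2) * s) =
        Real.exp (Real.pi * c₁ / 2 * s) * Real.exp (-(Real.pi * c₁ * s)) := by
      rw [← Real.exp_add]
      congr 1
      ring
    rw [h5, ← mul_assoc]
    refine mul_le_mul_of_nonneg_right ?_ (Real.exp_pos _).le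
    rw [div_mul_eq_mul_div, le_div_iff₀ (by positivity)]
    linarith
  calc ‖gaussSeriesTerm c a v Z‖ * Real.pi * ‖quadEval fun k => (v k : ℝ) + a k‖
      ≤ Real.exp (-(Real.pi * c₁ * s)) * Real.pi * (Fintype.card κ * s) := by gcongr
    _ = Real.pi * (Fintype.card κ * (s * Real.exp (-(Real.pi * c₁ * s)))) := by ring
    _ ≤ Real.pi * (Fintype.card κ *
        (2 / (Real.pi * c₁) * Real.exp (-(Real.pi * c₁ / 2) * s))) := by gcongr
    _ = _ := by rw [hB]; ring

end GaussianSeries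


/-! ### Theta series in the coordinates of an integral basis -/

section ThetaCoordinates

variable {K : Type*} [Field K] [NumberField K] {m n : ℕ}

theorem conj_add {a b : Type*} (σ : K →+* ℝ) (M N : Matrix a b K) :
    conj σ (M + N) = conj σ M + conj σ N := by
  ext i j
  simp [conj]

theorem conj_mul {a b c : Type*} [Fintype b] (σ : K →+* ℝ) (M : Matrix a b K) (N : Matrix b c K) :
    conj σ (M * N) = conj σ M * conj σ N := by
  ext i j
  simp [conj, Matrix.mul_apply]

theorem conj_smul_rat {a b : Type*} (σ : K →+* ℝ) (q : ℚ) (M : Matrix a b K) :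
    conj σ (q • M) = (q : ℂ) • conj σ M := by
  ext i j
  simp [conj, Algebra.smul_def]

theorem conj_transpose {a b : Type*} (σ : K →+* ℝ) (M : Matrix a b K) :
    conj σ Mᵀ = (conj σ M)ᵀ := rfl

variable (L : QuadLattice K m)

/-- The bilinear form `(U, V) ↦ tr ∑ (ᵗU Q V)^(σ) τ_σ`. -/
def QuadLattice.complexForm (τ : MatTuple K n) :
    Matrix (Fin m) (Fin n) K →ₗ[ℚ] Matrix (Fin m) (Fin n) K →ₗ[ℚ] ℂ :=
  LinearMap.mk₂ ℚ (fun U V => (∑ σ : K →+* ℝ, conj σ (Uᵀ * L.gram * V) * τ σ).trace)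
    (fun U V W => by simp [Matrix.add_mul, conj_add, Finset.sum_add_distrib])
    (fun c U V => by
      simp [conj_smul_rat, ← Finset.smul_sum, Matrix.trace_smul, Rat.smul_def])
    (fun U V W => by simp [Matrix.mul_add, Matrix.add_mul, conj_add, Finset.sum_add_distrib])
    (fun c U V => by
      simp [conj_smul_rat, ← Finset.smul_sum, Matrix.trace_smul, Rat.smul_def])

variable {κ : Type*} [Fintype κ] (b : Module.Basis κ ℚ (Matrix (Fin m) (Fin n) K))

/-- The terms of the theta series are Gaussians in the coordinates of a rational basis. -/
theorem QuadLattice.thetaTerm_eq_quadEval (τ : MatTuple K n) (U : Matrix (Fin m) (Fin n) K) :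
    L.thetaTerm τ U = Complex.exp (Real.pi * Complex.I *
      quadEval (fun k => (b.repr U k : ℝ)) (L.complexGram b τ)) := by
  have h : (∑ σ : K →+* ℝ, conj σ (Uᵀ * L.gram * U) * τ σ).trace =
      quadEval (fun k => (b.repr U k : ℝ)) (L.complexGram b τ) := by
    change L.complexForm τ U U = _
    conv_lhs => rw [← b.sum_repr U]
    simp only [map_sum, LinearMap.sum_apply, map_smul, LinearMap.smul_apply, quadEval_apply, Finset.smul_sum]
    rw [Finset.sum_comm]
    refine Finset.sum_congr rfl fun k _ => Finset.sum_congr rfl fun l _ => ?_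
    rw [Rat.smul_def, Rat.smul_def]
    change _ * (_ * L.complexGram b τ k l) = _
    push_cast
    ring
  rw [thetaTerm, expo, h]

theorem QuadLattice.im_complexGram (τ : MatTuple K n) (k l : κ) :
    (L.complexGram b τ k l).im = L.realGram b (fun σ => (τ σ).map Complex.im) k l := by
  simp only [complexGram, realGram, of_apply, Matrix.trace, diag_apply, Matrix.sum_apply,
    Complex.im_sum, Matrix.mul_apply, Matrix.map_apply, conj]
  rw [Finset.sum_comm]
  simp

/-- The tuple of the matrices `iY_σ`. -/
def imagTuple (Y : (K →+* ℝ) → Matrix (Fin n) (Fin n) ℝ) : MatTuple K n :=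
  fun σ => Complex.I • (Y σ).map Complex.ofReal

theorem QuadLattice.complexGram_imagTuple (Y : (K →+* ℝ) → Matrix (Fin n) (Fin n) ℝ) (k l : κ) :
    L.complexGram b (imagTuple Y) k l = Complex.I * L.realGram b Y k l := by
  simp only [complexGram, realGram, of_apply, Matrix.trace, diag_apply, Matrix.sum_apply,
    Matrix.mul_apply, Matrix.map_apply, conj, imagTuple, Matrix.smul_apply, smul_eq_mul]
  rw [Finset.sum_comm]
  push_cast
  simp only [Finset.mul_sum]
  refine Finset.sum_congr rfl fun _ _ => Finset.sum_congr rfl fun _ _ =>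
    Finset.sum_congr rfl fun _ _ => ?_
  ring

theorem QuadLattice.im_quadEval_complexGram (τ : MatTuple K n) (x : κ → ℝ) :
    (quadEval x (L.complexGram b τ)).im =
      qform (L.realGram b fun σ => (τ σ).map Complex.im) x := by
  rw [quadEval_apply]
  simp only [Complex.im_sum, qform, dotProduct, mulVec, Finset.mul_sum]
  refine Finset.sum_congr rfl fun k _ => Finset.sum_congr rfl fun l _ => ?_
  rw [← L.im_complexGram b, mul_assoc, ← Complex.ofReal_mul, Complex.im_mul_ofReal]
  ring

theorem QuadLattice.exists_im_complexGram_ge [IsTotallyReal K] {τ : MatTuple K n}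
    (hτ : τ ∈ upperHalfSpace K n) :
    ∃ c₀ > 0, ∀ x : κ → ℝ, c₀ * ∑ k, x k ^ 2 ≤ (quadEval x (L.complexGram b τ)).im := by
  classical
  obtain ⟨c, hc, h⟩ := PosDef.exists_pos_le (L.realGram_posDef b fun σ => (hτ σ).2)
  exact ⟨c, hc, fun x => (h x).trans_eq (L.im_quadEval_complexGram b τ x).symm⟩

/-- `Λ` is the lattice spanned over `ℤ` by the basis `b`. -/
def IsIntegralBasis (b : Module.Basis κ ℚ (Matrix (Fin m) (Fin n) K))
    (Λ : Set (Matrix (Fin m) (Fin n) K)) : Prop :=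
  ∀ U, U ∈ Λ ↔ ∀ k, ∃ z : ℤ, b.repr U k = z

variable {b} {Λ : Set (Matrix (Fin m) (Fin n) K)}

theorem IsIntegralBasis.repr_sum (v : κ → ℤ) (k : κ) :
    b.repr (∑ l, (v l : ℚ) • b l) k = v k := by
  classical
  simp [Finsupp.single_apply]

/-- The elements of the lattice `Λ` by their integral coordinates. -/
def IsIntegralBasis.equiv (hb : IsIntegralBasis b Λ) : (κ → ℤ) ≃ Λ :=
  Equiv.ofBijective (fun v => ⟨∑ l, (v l : ℚ) • b l, (hb _).2 fun k => ⟨v k, repr_sum v k⟩⟩) (by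
    constructor
    · intro v w h
      ext k
      have := repr_sum (b := b) v k
      rw [Subtype.mk.inj h, repr_sum] at this
      exact_mod_cast this.symm
    · rintro ⟨U, hU⟩
      choose v hv using (hb U).1 hU
      refine ⟨v, Subtype.ext (b.repr.injective (Finsupp.ext fun k => ?_))⟩
      rw [repr_sum, hv])

theorem IsIntegralBasis.repr_equiv (hb : IsIntegralBasis b Λ) (v : κ → ℤ) (k : κ) :
    b.repr (hb.equiv v : Matrix (Fin m) (Fin n) K) k = v k := repr_sum v k

theorem IsIntegralBasis.gaussSeriesTerm_eq (hb : IsIntegralBasis b Λ) (c : Λ → ℂ)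
    (a : Matrix (Fin m) (Fin n) K) (τ : MatTuple K n) (v : κ → ℤ) :
    c (hb.equiv v) * L.thetaTerm τ (a + hb.equiv v) =
      gaussSeriesTerm (fun v => c (hb.equiv v)) (fun k => (b.repr a k : ℝ)) v
        (L.complexGram b τ) := by
  rw [gaussSeriesTerm, L.thetaTerm_eq_quadEval b]
  congr 5
  ext k
  rw [map_add, Finsupp.add_apply, hb.repr_equiv]
  push_cast
  ring

theorem IsIntegralBasis.tsum_eq (hb : IsIntegralBasis b Λ) (c : Λ → ℂ)
    (a : Matrix (Fin m) (Fin n) K) (τ : MatTuple K n) :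
    ∑' U : Λ, c U * L.thetaTerm τ (a + U) =
      ∑' v, gaussSeriesTerm (fun v => c (hb.equiv v)) (fun k => (b.repr a k : ℝ)) v
        (L.complexGram b τ) := by
  rw [← hb.equiv.tsum_eq]
  exact tsum_congr fun v => hb.gaussSeriesTerm_eq L c a τ v

theorem IsIntegralBasis.summable [IsTotallyReal K] (hb : IsIntegralBasis b Λ) {c : Λ → ℂ}
    (hc : ∀ U, ‖c U‖ ≤ 1) (a : Matrix (Fin m) (Fin n) K) {τ : MatTuple K n}
    (hτ : τ ∈ upperHalfSpace K n) :
    Summable fun U : Λ => c U * L.thetaTerm τ (a + U) := by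
  rw [← hb.equiv.summable_iff]
  refine (summable_gaussSeriesTerm (c := fun v => c (hb.equiv v)) (fun v => hc _)
    (fun k => (b.repr a k : ℝ)) (L.exists_im_complexGram_ge b hτ)).congr fun v => ?_
  exact (hb.gaussSeriesTerm_eq L c a τ v).symm

/-- A theta series depends holomorphically on a parameter if `τ` does. -/
theorem IsIntegralBasis.differentiableAt_comp [IsTotallyReal K] (hb : IsIntegralBasis b Λ)
    {c : Λ → ℂ} (hc : ∀ U, ‖c U‖ ≤ 1) (a : Matrix (Fin m) (Fin n) K)
    {E : Type*} [NormedAddCommGroup E] [NormedSpace ℂ E] {f : E → MatTuple K n} {x : E}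
    (hf : ∀ σ i j, DifferentiableAt ℂ (fun y => f y σ i j) x) (hx : f x ∈ upperHalfSpace K n) :
    DifferentiableAt ℂ (fun y => ∑' U : Λ, c U * L.thetaTerm (f y) (a + U)) x := by
  simp only [hb.tsum_eq]
  refine DifferentiableAt.comp (g := fun Z => ∑' v, gaussSeriesTerm (fun v => c (hb.equiv v))
      (fun k => (b.repr a k : ℝ)) v Z) (f := fun y => L.complexGram b (f y)) x
    (differentiableAt_gaussSeries (fun v => hc _) _ (L.exists_im_complexGram_ge b hx)) ?_
  refine differentiableAt_pi.2 fun k => differentiableAt_pi.2 fun l => ?_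
  simp only [QuadLattice.complexGram, Matrix.trace, diag_apply, Matrix.sum_apply, Matrix.mul_apply]
  fun_prop

section

attribute [local instance] Matrix.normedAddCommGroup Matrix.normedSpace

theorem IsIntegralBasis.differentiableOn [IsTotallyReal K] (hb : IsIntegralBasis b Λ)
    {c : Λ → ℂ} (hc : ∀ U, ‖c U‖ ≤ 1) (a : Matrix (Fin m) (Fin n) K) :
    DifferentiableOn ℂ (fun τ => ∑' U : Λ, c U * L.thetaTerm τ (a + (U : Matrix (Fin m) (Fin n) K))) (upperHalfSpace K n) := by
  intro τ hτ
  refine DifferentiableAt.differentiableWithinAt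
    (hb.differentiableAt_comp L hc a (f := id) (fun σ i j => ?_) hτ)
  have h1 : DifferentiableAt ℂ (fun y : MatTuple K n => y σ) τ := by fun_prop
  have h2 := differentiableAt_pi.1 h1 i
  exact differentiableAt_pi.1 h2 j

end

end ThetaCoordinates


/-! ### The inversion on the upper half space -/

section Inversion

variable {K : Type*} [Field K] [NumberField K] {n : ℕ}

/-- The hermitian form of a symmetric complex matrix has imaginary part the form of the imaginary
part of the matrix, so that positivity of the latter makes the matrix invertible. -/
theorem im_star_dotProduct_mulVec {ι : Type*} [Fintype ι] {τ : Matrix ι ι ℂ} (hτ : τ.IsSymm)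
    (z : ι → ℂ) :
    (star z ⬝ᵥ τ *ᵥ z).im = qform (τ.map Complex.im) (fun i => (z i).re) +
      qform (τ.map Complex.im) (fun i => (z i).im) := by
  have e1 : (star z ⬝ᵥ τ *ᵥ z).im = ∑ i, ∑ j, ((τ i j).im * ((z i).re * (z j).re) +
      (τ i j).im * ((z i).im * (z j).im)) +
      ∑ i, ∑ j, (τ i j).re * ((z i).re * (z j).im - (z i).im * (z j).re) := by
    simp only [dotProduct, mulVec, Complex.im_sum, Finset.mul_sum, ← Finset.sum_add_distrib]
    refine Finset.sum_congr rfl fun i _ => Finset.sum_congr rfl fun j _ => ?_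
    simp [Complex.mul_im, Complex.mul_re]
    ring
  have e2 : ∑ i, ∑ j, (τ i j).re * ((z i).re * (z j).im - (z i).im * (z j).re) = 0 := by
    have h : ∑ i, ∑ j, (τ i j).re * ((z i).re * (z j).im - (z i).im * (z j).re) =
        ∑ i, ∑ j, -((τ i j).re * ((z i).re * (z j).im - (z i).im * (z j).re)) := by
      conv_lhs => rw [Finset.sum_comm]
      refine Finset.sum_congr rfl fun i _ => Finset.sum_congr rfl fun j _ => ?_
      rw [← hτ.apply i j]
      ring
    simp only [Finset.sum_neg_distrib] at h
    linarith
  rw [e1, e2, add_zero]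
  simp only [qform, dotProduct, mulVec, Finset.mul_sum, Matrix.map_apply,
    ← Finset.sum_add_distrib]
  refine Finset.sum_congr rfl fun i _ => Finset.sum_congr rfl fun j _ => ?_
  ring

theorem im_star_dotProduct_mulVec_pos {ι : Type*} [Fintype ι] {τ : Matrix ι ι ℂ} (hτ : τ.IsSymm)
    (hp : (τ.map Complex.im).PosDef) {z : ι → ℂ} (hz : z ≠ 0) :
    0 < (star z ⬝ᵥ τ *ᵥ z).im := by
  rw [im_star_dotProduct_mulVec hτ]
  have h0 : ∀ x : ι → ℝ, 0 ≤ qform (τ.map Complex.im) x := fun x => by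
    simpa using hp.posSemidef.dotProduct_mulVec_nonneg x
  have h1 : ∀ x : ι → ℝ, x ≠ 0 → 0 < qform (τ.map Complex.im) x := fun x hx => by
    simpa using hp.dotProduct_mulVec_pos hx
  by_cases hre : (fun i => (z i).re) = 0
  · refine add_pos_of_nonneg_of_pos (h0 _) (h1 _ fun him => hz ?_)
    funext i
    exact Complex.ext (congrFun hre i) (congrFun him i)
  · exact add_pos_of_pos_of_nonneg (h1 _ hre) (h0 _)

theorem det_ne_zero_of_im_posDef {ι : Type*} [Fintype ι] [DecidableEq ι] {τ : Matrix ι ι ℂ}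
    (hτ : τ.IsSymm) (hp : (τ.map Complex.im).PosDef) : τ.det ≠ 0 := by
  intro h
  obtain ⟨z, hz, h0⟩ := Matrix.exists_mulVec_eq_zero_iff.2 h
  have := im_star_dotProduct_mulVec_pos hτ hp hz
  rw [h0] at this
  simp at this

theorem isSymm_inv {ι R : Type*} [Fintype ι] [DecidableEq ι] [CommRing R] {M : Matrix ι ι R}
    (hM : M.IsSymm) : M⁻¹.IsSymm := by
  rw [Matrix.IsSymm, transpose_nonsing_inv, hM.eq]

/-- The tuple of the `-τ_σ⁻¹`. -/
def negInv (τ : MatTuple K n) : MatTuple K n := fun σ => -(τ σ)⁻¹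

theorem negInv_mem {τ : MatTuple K n} (hτ : τ ∈ upperHalfSpace K n) :
    negInv τ ∈ upperHalfSpace K n := by
  intro σ
  obtain ⟨hs, hp⟩ := hτ σ
  have hs' : ((negInv τ) σ).IsSymm := by
    rw [negInv, Matrix.IsSymm, transpose_neg, (isSymm_inv hs).eq]
  refine ⟨hs', Matrix.PosDef.of_dotProduct_mulVec_pos ?_ fun x hx => ?_⟩
  · ext i j
    simp only [conjTranspose_apply, map_apply, star_trivial]
    rw [hs'.apply]
  · have hu : IsUnit (τ σ).det := isUnit_iff_ne_zero.2 (det_ne_zero_of_im_posDef hs hp)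
    set x' : Fin n → ℂ := fun i => (x i : ℂ) with hx'
    set z : Fin n → ℂ := (τ σ)⁻¹ *ᵥ x' with hz
    have hxz : x' = τ σ *ᵥ z := by
      rw [hz, mulVec_mulVec, mul_nonsing_inv _ hu, one_mulVec]
    have hz0 : z ≠ 0 := by
      rintro h0
      refine hx (funext fun i => ?_)
      have := congrFun hxz i
      rw [h0, mulVec_zero] at this
      simpa [hx'] using this
    have key := im_star_dotProduct_mulVec_pos hs hp hz0
    have e1 : star x ⬝ᵥ ((negInv τ σ).map Complex.im) *ᵥ x = (x' ⬝ᵥ negInv τ σ *ᵥ x').im := by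
      simp [dotProduct, mulVec, Complex.im_sum, hx', Finset.mul_sum, Complex.mul_im]
    have e2 : (x' ⬝ᵥ negInv τ σ *ᵥ x') = -star (star z ⬝ᵥ τ σ *ᵥ z) := by
      have hxs : star x' = x' := by
        ext i
        simp [hx']
      rw [negInv, neg_mulVec, ← hz, dotProduct_neg, ← hxz, ← Matrix.star_dotProduct, hxs]
    rw [e1, e2]
    simpa using key

theorem DifferentiableAt.matrix_det {E ι : Type*} [NormedAddCommGroup E] [NormedSpace ℂ E]
    [Fintype ι] [DecidableEq ι] {f : E → Matrix ι ι ℂ} {x : E}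
    (hf : ∀ i j, DifferentiableAt ℂ (fun y => f y i j) x) :
    DifferentiableAt ℂ (fun y => (f y).det) x := by
  simp only [Matrix.det_apply']
  fun_prop

theorem DifferentiableAt.matrix_inv {E ι : Type*} [NormedAddCommGroup E] [NormedSpace ℂ E]
    [Fintype ι] [DecidableEq ι] {f : E → Matrix ι ι ℂ} {x : E}
    (hf : ∀ i j, DifferentiableAt ℂ (fun y => f y i j) x) (hx : (f x).det ≠ 0) (i j : ι) :
    DifferentiableAt ℂ (fun y => (f y)⁻¹ i j) x := by
  simp only [Matrix.inv_def, Ring.inverse_eq_inv', Matrix.smul_apply, smul_eq_mul,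
    Matrix.adjugate_apply]
  refine ((DifferentiableAt.matrix_det hf).inv hx).mul (DifferentiableAt.matrix_det fun k l => ?_)
  by_cases hk : k = j
  · subst hk
    simp
  · simpa [Matrix.updateRow_ne hk] using hf k l

end Inversion

/-! ### Poisson summation for theta series -/

section PoissonTheta

variable {K : Type*} [Field K] [NumberField K] {m n : ℕ} (L : QuadLattice K m)

/-- The dual of a lattice of matrices under the form `Tr tr(ᵗU Q V)`. -/
def QuadLattice.traceDual (Λ : Set (Matrix (Fin m) (Fin n) K)) : Set (Matrix (Fin m) (Fin n) K) :=
  {W | ∀ U ∈ Λ, ∃ z : ℤ, L.traceForm n W U = z}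

variable [IsTotallyReal K]
variable {κ : Type*} [Fintype κ] [DecidableEq κ] {b : Module.Basis κ ℚ (Matrix (Fin m) (Fin n) K)}
  {Λ : Set (Matrix (Fin m) (Fin n) K)}

theorem QuadLattice.dualBasis_repr (W : Matrix (Fin m) (Fin n) K) (k : κ) :
    (L.dualBasis b).repr W k = L.traceForm n W (b k) :=
  LinearMap.BilinForm.dualBasis_repr_apply _ _ _ _

theorem QuadLattice.traceForm_eq_sum (W U : Matrix (Fin m) (Fin n) K) :
    L.traceForm n W U = ∑ k, (L.dualBasis b).repr W k * b.repr U k := by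
  conv_lhs => rw [← b.sum_repr U, map_sum]
  simp only [map_smul, smul_eq_mul, L.dualBasis_repr, mul_comm]

/-- The dual basis spans the dual lattice over `ℤ`. -/
theorem IsIntegralBasis.dual (hb : IsIntegralBasis b Λ) :
    IsIntegralBasis (L.dualBasis b) (L.traceDual Λ) := by
  intro W
  constructor
  · intro hW k
    rw [L.dualBasis_repr]
    refine hW _ ((hb _).2 fun l => ⟨if k = l then 1 else 0, ?_⟩)
    rw [b.repr_self, Finsupp.single_apply]
    split_ifs <;> simp
  · intro hW U hU
    choose z hz using hW
    choose w hw using (hb U).1 hU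
    refine ⟨∑ k, z k * w k, ?_⟩
    rw [L.traceForm_eq_sum (b := b)]
    simp [hz, hw]

theorem expTrace_two_mul_trace (W a : Matrix (Fin m) (Fin n) K) :
    expTrace (2 * (Wᵀ * L.gram * a).trace) =
      Complex.exp (2 * Real.pi * Complex.I * ((L.traceForm n W a : ℝ) : ℂ)) := by
  rw [expTrace, sum_embeddings, L.traceForm_apply]
  congr 1
  have : Algebra.trace ℚ K (2 * (Wᵀ * L.gram * a).trace) =
      2 * Algebra.trace ℚ K (Wᵀ * L.gram * a).trace := by
    rw [two_mul, map_add, two_mul]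
  rw [this]
  push_cast
  ring

/-- Poisson summation in coordinate-free form: the shift `a` becomes a character on the dual lattice. -/
theorem IsIntegralBasis.tsum_thetaTerm_imag (hb : IsIntegralBasis b Λ)
    {Y : (K →+* ℝ) → Matrix (Fin n) (Fin n) ℝ} (hY : ∀ σ, (Y σ).PosDef)
    (a : Matrix (Fin m) (Fin n) K) :
    ∑' U : Λ, L.thetaTerm (imagTuple Y) (a + U) =
      ((Real.sqrt (L.realGram b Y).det)⁻¹ : ℝ) *
        ∑' W : L.traceDual Λ, expTrace (2 * ((W : Matrix (Fin m) (Fin n) K)ᵀ * L.gram * a).trace) *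
          L.thetaTerm (imagTuple fun σ => (Y σ)⁻¹) W := by
  have hq : ∀ {b' : Module.Basis κ ℚ (Matrix (Fin m) (Fin n) K)}
      (Y' : (K →+* ℝ) → Matrix (Fin n) (Fin n) ℝ) (x : κ → ℝ),
      Real.pi * Complex.I * quadEval x (L.complexGram b' (imagTuple Y')) =
        -Real.pi * ((qform (L.realGram b' Y') x : ℝ) : ℂ) := by
    intro b' Y' x
    have : quadEval x (L.complexGram b' (imagTuple Y')) =
        Complex.I * ((qform (L.realGram b' Y') x : ℝ) : ℂ) := by
      rw [quadEval_apply]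
      simp only [L.complexGram_imagTuple, qform, dotProduct, mulVec, Finset.mul_sum]
      push_cast
      simp only [Finset.mul_sum]
      refine Finset.sum_congr rfl fun _ _ => Finset.sum_congr rfl fun _ _ => ?_
      ring
    rw [this]
    linear_combination (Real.pi * ((qform (L.realGram b' Y') x : ℝ) : ℂ)) * Complex.I_mul_I
  have h := tsum_gaussTerm (L.realGram_posDef b hY) (fun k => (b.repr a k : ℝ)) 0
  rw [← hb.equiv.tsum_eq, ← (hb.dual L).equiv.tsum_eq]
  refine Eq.trans (tsum_congr fun v => ?_) (h.trans ?_)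
  · rw [L.thetaTerm_eq_quadEval b, hq, gaussTerm]
    congr 1
    simp only [zero_dotProduct, Complex.ofReal_zero, mul_zero, add_zero]
    congr 4
    ext k
    rw [map_add, Finsupp.add_apply, hb.repr_equiv]
    push_cast
    ring
  · congr 1
    refine tsum_congr fun w => ?_
    rw [L.thetaTerm_eq_quadEval (L.dualBasis b), hq, expTrace_two_mul_trace, dualGaussTerm,
      ← Complex.exp_add, L.realGram_inv b hY, add_comm]
    have e1 : L.traceForm n ((hb.dual L).equiv w : Matrix (Fin m) (Fin n) K) a =
        ∑ k, (w k : ℚ) * b.repr a k := by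
      rw [L.traceForm_eq_sum (b := b)]
      simp only [(hb.dual L).repr_equiv]
    rw [e1]
    congr 2
    · congr 1
      simp [dotProduct]
    · congr 4
      ext k
      rw [(hb.dual L).repr_equiv]
      simp

end PoissonTheta


/-! ### Theta inversion on the whole upper half space -/

section Continuation

open Filter Topology

/-- Positive definiteness is an open condition along a pencil `Y + sX`. -/
theorem exists_forall_posDef_add_smul {ι : Type*} [Finite ι] {n : ℕ}
    {Y X : ι → Matrix (Fin n) (Fin n) ℝ} (hY : ∀ σ, (Y σ).PosDef) (hX : ∀ σ, (X σ).IsSymm) :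
    ∃ ε > 0, ∀ s : ℝ, |s| < ε → ∀ σ, (Y σ + s • X σ).PosDef := by
  have h : ∀ σ, ∃ ε > 0, ∀ s : ℝ, |s| < ε → (Y σ + s • X σ).PosDef := by
    intro σ
    obtain ⟨c, hc, hcY⟩ := PosDef.exists_pos_le (hY σ)
    set C : ℝ := ∑ i, ∑ j, |X σ i j| with hC
    have hC0 : 0 ≤ C := Finset.sum_nonneg fun i _ => Finset.sum_nonneg fun j _ => abs_nonneg _
    have hXb : ∀ x : Fin n → ℝ, |qform (X σ) x| ≤ C * ∑ i, x i ^ 2 := by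
      intro x
      have hCx : C * ∑ i, x i ^ 2 = ∑ i, ∑ j, |X σ i j| * ∑ l, x l ^ 2 := by
        rw [hC, Finset.sum_mul]
        exact Finset.sum_congr rfl fun i _ => Finset.sum_mul _ _ _
      have hqx : qform (X σ) x = ∑ i, ∑ j, x i * (X σ i j * x j) := by
        simp only [qform, dotProduct, mulVec, Finset.mul_sum]
      rw [hCx, hqx]
      refine (Finset.abs_sum_le_sum_abs _ _).trans (Finset.sum_le_sum fun i _ => ?_)
      refine (Finset.abs_sum_le_sum_abs _ _).trans (Finset.sum_le_sum fun j _ => ?_)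
      rw [abs_mul, abs_mul]
      have h1 : |x i| * |x j| ≤ ∑ i, x i ^ 2 := by
        by_cases hij : i = j
        · subst hij
          rw [abs_mul_abs_self, ← sq]
          exact Finset.single_le_sum (f := fun i => x i ^ 2) (fun _ _ => sq_nonneg _)
            (Finset.mem_univ i)
        · have h2 : x i ^ 2 + x j ^ 2 ≤ ∑ i, x i ^ 2 := by
            rw [← Finset.sum_pair hij (f := fun i => x i ^ 2)]
            exact Finset.sum_le_sum_of_subset_of_nonneg (Finset.subset_univ _)
              fun _ _ _ => sq_nonneg _
          have := sq_nonneg (|x i| - |x j|)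
          have := sq_abs (x i)
          have := sq_abs (x j)
          nlinarith [sq_nonneg (|x i|), sq_nonneg (|x j|)]
      calc |x i| * (|X σ i j| * |x j|) = |X σ i j| * (|x i| * |x j|) := by ring
        _ ≤ _ := by gcongr
    refine ⟨c / (C + 1), by positivity, fun s hs => ?_⟩
    refine Matrix.PosDef.of_dotProduct_mulVec_pos ?_ fun x hx => ?_
    · have h1 : (Y σ).IsSymm := by simpa using (hY σ).isHermitian
      ext i j
      simp [h1.apply, (hX σ).apply]
    · have h1 : star x ⬝ᵥ (Y σ + s • X σ) *ᵥ x = qform (Y σ) x + s * qform (X σ) x := by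
        simp [qform, add_mulVec, smul_mulVec, dotProduct_add, dotProduct_smul]
      rw [h1]
      have hx0 : 0 < ∑ i, x i ^ 2 := by
        obtain ⟨i, hi⟩ := Function.ne_iff.1 hx
        exact Finset.sum_pos' (fun _ _ => sq_nonneg _) ⟨i, Finset.mem_univ _, by
          have : x i ≠ 0 := hi
          positivity⟩
      have h2 : |s * qform (X σ) x| < c * ∑ i, x i ^ 2 := by
        rw [abs_mul]
        have h3 : |s| * (C + 1) < c := by
          rwa [lt_div_iff₀ (by positivity)] at hs
        calc |s| * |qform (X σ) x| ≤ |s| * (C * ∑ i, x i ^ 2) := by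
              gcongr
              exact hXb x
          _ ≤ (|s| * (C + 1)) * ∑ i, x i ^ 2 := by
              rw [← mul_assoc]
              gcongr
              linarith
          _ < _ := by gcongr
      have h4 := (abs_lt.1 h2).1
      have h5 := hcY x
      linarith
  choose ε hε0 hε using h
  have := Fintype.ofFinite ι
  rcases isEmpty_or_nonempty ι with hι | hι
  · exact ⟨1, one_pos, fun s _ σ => isEmptyElim σ⟩
  · obtain ⟨σ₀, hσ₀⟩ := Finite.exists_min ε
    exact ⟨ε σ₀, hε0 σ₀, fun s hs σ => hε σ s (hs.trans_le (hσ₀ σ))⟩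

variable {K : Type*} [Field K] [NumberField K] [IsTotallyReal K] {k n : ℕ}
  (L : QuadLattice K (2 * k)) {κ : Type*} [Fintype κ] [DecidableEq κ]
  {b : Module.Basis κ ℚ (Matrix (Fin (2 * k)) (Fin n) K)}
  {Λ : Set (Matrix (Fin (2 * k)) (Fin n) K)}

/-- The dual theta series of the inversion formula. -/
def QuadLattice.dualTheta (Λ : Set (Matrix (Fin (2 * k)) (Fin n) K))
    (a : Matrix (Fin (2 * k)) (Fin n) K) (τ : MatTuple K n) : ℂ :=
  ∑' W : L.traceDual Λ,
    expTrace (2 * ((W : Matrix (Fin (2 * k)) (Fin n) K)ᵀ * L.gram * a).trace) * L.thetaTerm τ W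

theorem negInv_imagTuple {Y : (K →+* ℝ) → Matrix (Fin n) (Fin n) ℝ} (hY : ∀ σ, (Y σ).PosDef) :
    negInv (imagTuple Y) = imagTuple fun σ => (Y σ)⁻¹ := by
  ext1 σ
  have hu : IsUnit (Y σ).det := (Matrix.isUnit_iff_isUnit_det _).1 (hY σ).isUnit
  rw [negInv, neg_eq_iff_eq_neg]
  refine Matrix.inv_eq_left_inv ?_
  rw [imagTuple, imagTuple, ← smul_neg, Matrix.smul_mul, Matrix.neg_mul, Matrix.mul_smul, smul_neg,
    smul_smul, Complex.I_mul_I, neg_one_smul, neg_neg]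
  have := congrArg (fun M : Matrix (Fin n) (Fin n) ℝ => M.map Complex.ofReal) (nonsing_inv_mul _ hu)
  rw [show (Complex.ofReal : ℝ → ℂ) = ⇑Complex.ofRealHom from rfl, Matrix.map_mul] at this
  rw [show (Complex.ofReal : ℝ → ℂ) = ⇑Complex.ofRealHom from rfl, this]
  simp

/-- The constant of the inversion formula for purely imaginary `τ`. -/
theorem IsIntegralBasis.exists_inversion_imag (hb : IsIntegralBasis b Λ) :
    ∃ c : ℂ, c ≠ 0 ∧ ∀ Y : (K →+* ℝ) → Matrix (Fin n) (Fin n) ℝ, (∀ σ, (Y σ).PosDef) → ∀ a,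
      ∑' U : Λ, L.thetaTerm (negInv (imagTuple Y)) (a + U) =
        c * (∏ σ : K →+* ℝ, (-Complex.I • imagTuple Y σ).det) ^ k *
          L.dualTheta Λ a (imagTuple Y) := by
  obtain ⟨c₀, hc₀, hdet⟩ := L.exists_realGram_det b
  refine ⟨((Real.sqrt c₀)⁻¹ : ℝ), ?_, fun Y hY a => ?_⟩
  · simpa using (Real.sqrt_pos.2 hc₀).ne'
  · rw [negInv_imagTuple hY, hb.tsum_thetaTerm_imag L (fun σ => (hY σ).inv), hdet _ fun σ => (hY σ).inv]
    have h1 : ∀ σ, (-Complex.I • (imagTuple Y : MatTuple K n) σ).det = (((Y σ).det : ℝ) : ℂ) := by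
      intro σ
      rw [imagTuple, smul_smul]
      have : -Complex.I * Complex.I = 1 := by simp
      rw [this, one_smul]
      exact (RingHom.map_det Complex.ofRealHom _).symm
    have hp : 0 < ∏ σ : K →+* ℝ, (Y σ).det := Finset.prod_pos fun σ _ => (hY σ).det_pos
    have h2 : Real.sqrt (c₀ * (∏ σ : K →+* ℝ, ((Y σ)⁻¹).det) ^ (2 * k)) =
        Real.sqrt c₀ * ((∏ σ : K →+* ℝ, (Y σ).det) ^ k)⁻¹ := by
      have : ∏ σ : K →+* ℝ, ((Y σ)⁻¹).det = (∏ σ : K →+* ℝ, (Y σ).det)⁻¹ := by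
        rw [← Finset.prod_inv_distrib]
        refine Finset.prod_congr rfl fun σ _ => ?_
        rw [Matrix.det_nonsing_inv, Ring.inverse_eq_inv']
      rw [Real.sqrt_mul hc₀.le, this, mul_comm 2 k, pow_mul, Real.sqrt_sq (by positivity), inv_pow]
    rw [h2]
    have h3 : ∀ σ, ((Y σ)⁻¹)⁻¹ = Y σ := fun σ =>
      Matrix.nonsing_inv_nonsing_inv _ ((Matrix.isUnit_iff_isUnit_det _).1 (hY σ).isUnit)
    simp only [h1, h3, QuadLattice.dualTheta]
    push_cast
    rw [mul_inv, inv_inv]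

/-- The inversion formula for theta series with a shift, first on the imaginary axis by Poisson
summation, then everywhere by the identity theorem on the complex lines `t ↦ tX + iY`. -/
theorem IsIntegralBasis.exists_inversion (hb : IsIntegralBasis b Λ) :
    ∃ c : ℂ, c ≠ 0 ∧ ∀ τ ∈ upperHalfSpace K n, ∀ a,
      ∑' U : Λ, L.thetaTerm (negInv τ) (a + U) =
        c * (∏ σ : K →+* ℝ, (-Complex.I • τ σ).det) ^ k * L.dualTheta Λ a τ := by
  obtain ⟨c, hc, hY⟩ := hb.exists_inversion_imag L
  refine ⟨c, hc, fun τ hτ a => ?_⟩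
  set X : (K →+* ℝ) → Matrix (Fin n) (Fin n) ℝ := fun σ => (τ σ).map Complex.re with hX
  set Y : (K →+* ℝ) → Matrix (Fin n) (Fin n) ℝ := fun σ => (τ σ).map Complex.im with hYd
  have hXs : ∀ σ, (X σ).IsSymm := fun σ => by
    ext i j
    simp only [hX, transpose_apply, map_apply]
    rw [(hτ σ).1.apply]
  have hYs : ∀ σ, (Y σ).IsSymm := fun σ => by simpa using ((hτ σ).2).isHermitian
  obtain ⟨ε, hε, hpos⟩ := exists_forall_posDef_add_smul (fun σ => (hτ σ).2) hXs
  -- the complex line `tX + iY` passes through `τ` at `t = 1`, and its points with `t` in `iℝ` are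
  -- purely imaginary
  set f : ℂ → MatTuple K n := fun t σ =>
    t • (X σ).map Complex.ofReal + Complex.I • (Y σ).map Complex.ofReal with hf
  set S : Set ℂ := Complex.im ⁻¹' Metric.ball 0 ε with hS
  have hSo : IsOpen S := Metric.isOpen_ball.preimage Complex.continuous_im
  have hSc : IsPreconnected S :=
    ((convex_ball (0 : ℝ) ε).linear_preimage Complex.imLm).isPreconnected
  have hmem : ∀ t ∈ S, f t ∈ upperHalfSpace K n := by
    intro t ht σ
    have ht' : |t.im| < ε := by simpa [hS] using ht
    constructor
    · ext i j
      simp [hf, (hXs σ).apply, (hYs σ).apply]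
    · convert hpos _ ht' σ using 1
      ext i j
      simp [hf, hYd, add_comm]
  have hfd : ∀ (t : ℂ) (σ : K →+* ℝ) i j, DifferentiableAt ℂ (fun y => f y σ i j) t := by
    intro t σ i j
    simp only [hf, Matrix.add_apply, Matrix.smul_apply, smul_eq_mul]
    fun_prop
  have hb' := hb.dual L
  have hd1 : DifferentiableOn ℂ
      (fun t => ∑' U : Λ, L.thetaTerm (negInv (f t)) (a + U)) S := by
    intro t ht
    have := hb.differentiableAt_comp L (c := fun _ => 1) (by simp) a (f := fun t => negInv (f t))
      (x := t) (fun σ i j => ?_) (negInv_mem (hmem t ht))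
    · simpa only [one_mul] using this.differentiableWithinAt
    · exact (DifferentiableAt.matrix_inv (fun i j => hfd t σ i j)
        (det_ne_zero_of_im_posDef (hmem t ht σ).1 (hmem t ht σ).2) i j).neg
  have hd2 : DifferentiableOn ℂ (fun t => c * (∏ σ : K →+* ℝ, (-Complex.I • f t σ).det) ^ k *
      L.dualTheta Λ a (f t)) S := by
    intro t ht
    have h1 := hb'.differentiableAt_comp L (c := fun W => expTrace
      (2 * ((W : Matrix (Fin (2 * k)) (Fin n) K)ᵀ * L.gram * a).trace))
      (fun W => (norm_expTrace _).le) 0 (f := f) (x := t) (hfd t) (hmem t ht)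
    simp only [zero_add] at h1
    have h2 : ∀ σ, DifferentiableAt ℂ (fun t => (-Complex.I • f t σ).det) t := fun σ =>
      DifferentiableAt.matrix_det fun i j => by
        simp only [Matrix.smul_apply]
        exact (hfd t σ i j).const_mul _
    refine DifferentiableAt.differentiableWithinAt (DifferentiableAt.mul
      (DifferentiableAt.const_mul (DifferentiableAt.pow ?_ k) c) h1)
    fun_prop
  have heq : ∀ s : ℝ, |s| < ε → ∑' U : Λ, L.thetaTerm (negInv (f (Complex.I * s))) (a + U) =
      c * (∏ σ : K →+* ℝ, (-Complex.I • f (Complex.I * s) σ).det) ^ k *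
        L.dualTheta Λ a (f (Complex.I * s)) := by
    intro s hs
    have : f (Complex.I * s) = imagTuple fun σ => Y σ + s • X σ := by
      ext σ i j
      simp [hf, imagTuple]
      ring
    rw [this]
    exact hY _ (hpos s hs) a
  have h0 : (0 : ℂ) ∈ S := by simp [hS, hε]
  have h1 : (1 : ℂ) ∈ S := by simp [hS, hε]
  have hfreq : ∃ᶠ t in 𝓝[≠] (0 : ℂ), ∑' U : Λ, L.thetaTerm (negInv (f t)) (a + U) =
      c * (∏ σ : K →+* ℝ, (-Complex.I • f t σ).det) ^ k * L.dualTheta Λ a (f t) := by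
    have ht : Tendsto (fun s : ℝ => Complex.I * (s : ℂ)) (𝓝[≠] 0) (𝓝[≠] 0) := by
      refine tendsto_nhdsWithin_of_tendsto_nhds_of_eventually_within _ ?_ ?_
      · have : Tendsto (fun s : ℝ => Complex.I * (s : ℂ)) (𝓝 0) (𝓝 (Complex.I * (0 : ℝ))) :=
          (by fun_prop : Continuous fun s : ℝ => Complex.I * (s : ℂ)).tendsto 0
        simp only [Complex.ofReal_zero, mul_zero] at this
        exact this.mono_left nhdsWithin_le_nhds
      · filter_upwards [self_mem_nhdsWithin] with s hs
        simpa using hs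
    refine ht.frequently (Eventually.frequently ?_)
    have : ∀ᶠ s : ℝ in 𝓝 0, |s| < ε := by
      have := Metric.ball_mem_nhds (0 : ℝ) hε
      filter_upwards [this] with s hs
      simpa using hs
    exact (this.filter_mono nhdsWithin_le_nhds).mono heq
  have key := (hd1.analyticOnNhd hSo).eqOn_of_preconnected_of_frequently_eq (hd2.analyticOnNhd hSo)
    hSc h0 hfreq h1
  have hf1 : f 1 = τ := by
    ext σ i j
    simp only [hf, hX, hYd, Matrix.add_apply, Matrix.smul_apply, Matrix.map_apply,
      smul_eq_mul, one_mul]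
    rw [mul_comm Complex.I]
    exact Complex.re_add_im (τ σ i j)
  simpa only [hf1] using key

end Continuation


/-! ### The different, norms and the level -/

section Level

variable {K : Type*} [Field K] [NumberField K]

theorem different_ne_zero : different K ≠ 0 := by
  rw [different, Ne, FractionalIdeal.coeIdeal_eq_zero]
  exact differentIdeal_ne_bot

theorem mem_inv_different {x : K} :
    x ∈ (different K)⁻¹ ↔ ∀ y : 𝓞 K, ∃ z : ℤ, Algebra.trace ℚ K (x * y) = z := by
  rw [different, coeIdeal_differentIdeal ℤ ℚ, inv_inv, FractionalIdeal.mem_dual (one_ne_zero (α := FracIdeal K))]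
  constructor
  · intro h y
    obtain ⟨z, hz⟩ := h (y : K) ((FractionalIdeal.mem_one_iff _).2 ⟨y, rfl⟩)
    exact ⟨z, by simpa [Algebra.traceForm_apply] using hz.symm⟩
  · intro h y hy
    obtain ⟨y, rfl⟩ := (FractionalIdeal.mem_one_iff _).1 hy
    obtain ⟨z, hz⟩ := h y
    exact ⟨z, by simpa [Algebra.traceForm_apply] using hz.symm⟩

theorem expTrace_eq_one_of_mem [IsTotallyReal K] {x : K} (hx : x ∈ (different K)⁻¹) :
    expTrace (2 * x) = 1 := by
  obtain ⟨z, hz⟩ := mem_inv_different.1 hx 1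
  exact expTrace_two_mul (z := z) (by simpa using hz)

/-- The characters `y ↦ e(2xy)` detect the inverse different. -/
theorem mem_of_expTrace_eq_one [IsTotallyReal K] {x : K} (hx : ∀ y : 𝓞 K, expTrace (2 * (x * y)) = 1) :
    x ∈ (different K)⁻¹ := by
  rw [mem_inv_different]
  intro y
  have h := hx y
  rw [expTrace, sum_embeddings, Complex.exp_eq_one_iff] at h
  obtain ⟨z, hz⟩ := h
  refine ⟨z, ?_⟩
  have h2 : Algebra.trace ℚ K (2 * (x * y)) = 2 * Algebra.trace ℚ K (x * y) := by
    rw [two_mul, map_add, two_mul]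
  rw [h2] at hz
  have hpi : (2 * Real.pi * Complex.I : ℂ) ≠ 0 := Complex.two_pi_I_ne_zero
  have h3 : ((Algebra.trace ℚ K (x * y) : ℚ) : ℂ) = (z : ℂ) := by
    refine mul_left_cancel₀ hpi ?_
    rw [mul_comm _ (z : ℂ), ← hz]
    push_cast
    ring
  exact_mod_cast h3

theorem FracIdeal.le_of_mul_le_mul_right {A B C : FracIdeal K} (hC : C ≠ 0) (h : A * C ≤ B * C) :
    A ≤ B := by
  have h' : A * C * C⁻¹ ≤ B * C * C⁻¹ := by gcongr
  rwa [mul_assoc, mul_assoc, mul_inv_cancel₀ hC, mul_one, mul_one] at h'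

variable {m : ℕ} (L : QuadLattice K m)

/-- `L` as an `𝓞`-module of coordinate vectors. -/
def QuadLattice.toSubmodule : Submodule (𝓞 K) (Fin m → K) where
  carrier := L.vectors
  add_mem' hx hy i := Submodule.add_mem (L.coeffIdeal i : Submodule (𝓞 K) K) (hx i) (hy i)
  zero_mem' _ := FractionalIdeal.zero_mem _
  smul_mem' c _ hx i := Submodule.smul_mem (L.coeffIdeal i : Submodule (𝓞 K) K) c (hx i)

theorem QuadLattice.bilin_add_left (x y z : Fin m → K) :
    L.bilin (x + y) z = L.bilin x z + L.bilin y z := by simp [bilin]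

theorem QuadLattice.bilin_add_right (x y z : Fin m → K) :
    L.bilin x (y + z) = L.bilin x y + L.bilin x z := by simp [bilin, mulVec_add]

theorem QuadLattice.bilin_comm (x y : Fin m → K) : L.bilin x y = L.bilin y x := by
  rw [bilin, bilin, dotProduct_mulVec, ← mulVec_transpose, L.gram_symm.eq, dotProduct_comm]

theorem QuadLattice.bilin_smul_left (c : 𝓞 K) (x y : Fin m → K) :
    L.bilin (c • x) y = c * L.bilin x y := by
  simp [bilin, Algebra.smul_def]

theorem QuadLattice.bilin_smul_right (c : 𝓞 K) (x y : Fin m → K) :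
    L.bilin x (c • y) = c * L.bilin x y := by
  simp [bilin, mulVec_smul, Algebra.smul_def]

/-- The dual lattice as an `𝓞`-module. -/
def QuadLattice.dualSubmodule : Submodule (𝓞 K) (Fin m → K) where
  carrier := L.dualVectors
  add_mem' {x y} hx hy w hw := by
    obtain ⟨a, ha⟩ := hx w hw
    obtain ⟨b, hb⟩ := hy w hw
    exact ⟨a + b, by rw [L.bilin_add_left, ← ha, ← hb]; simp⟩
  zero_mem' w _ := ⟨0, by simp [bilin]⟩
  smul_mem' c x hx w hw := by
    obtain ⟨a, ha⟩ := hx w hw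
    exact ⟨c * a, by rw [L.bilin_smul_left, ← ha]; simp⟩

theorem QuadLattice.bilin_self_mem_norm {x : Fin m → K} (hx : x ∈ L.toSubmodule) :
    L.bilin x x ∈ L.norm :=
  Submodule.subset_span ⟨x, hx, rfl⟩

theorem QuadLattice.bilin_self_mem_dualNorm [IsTotallyReal K] {x : Fin m → K}
    (hx : x ∈ L.dualSubmodule) : L.bilin x x ∈ L.dualNorm :=
  Submodule.subset_span ⟨x, hx, rfl⟩

/-- Polarization. -/
theorem QuadLattice.two_mul_bilin_mem {S : Submodule (𝓞 K) (Fin m → K)} {N : FracIdeal K}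
    (hN : ∀ x ∈ S, L.bilin x x ∈ N) {x y : Fin m → K} (hx : x ∈ S) (hy : y ∈ S) :
    2 * L.bilin x y ∈ N := by
  have e : 2 * L.bilin x y = L.bilin (x + y) (x + y) - L.bilin x x - L.bilin y y := by
    rw [L.bilin_add_left, L.bilin_add_right, L.bilin_add_right, L.bilin_comm y x]
    ring
  rw [e]
  exact Submodule.sub_mem (N : Submodule (𝓞 K) K)
    (Submodule.sub_mem (N : Submodule (𝓞 K) K) (hN _ (S.add_mem hx hy)) (hN _ hx)) (hN _ hy)

/-- The coordinate vectors of `L^#` are the `Q⁻¹ z` with `zᵢ ∈ 𝒜ᵢ⁻¹`. -/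
theorem QuadLattice.mem_dualSubmodule_iff {x : Fin m → K} :
    x ∈ L.dualSubmodule ↔ ∀ i, (L.gram *ᵥ x) i ∈ (L.coeffIdeal i)⁻¹ := by
  have hb : ∀ w, L.bilin x w = w ⬝ᵥ L.gram *ᵥ x := fun w => L.bilin_comm x w
  constructor
  · intro h i
    rw [FractionalIdeal.mem_inv_iff (L.coeffIdeal_ne_zero i)]
    intro y hy
    obtain ⟨a, ha⟩ := h (Pi.single i y) (fun j => by
      by_cases hj : j = i
      · subst hj; simpa using hy
      · simp [hj, FractionalIdeal.zero_mem])
    rw [FractionalIdeal.mem_one_iff]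
    refine ⟨a, ha.trans ?_⟩
    rw [hb, single_dotProduct, mul_comm]
  · intro h w hw
    have : L.bilin x w ∈ (1 : FracIdeal K) := by
      rw [hb, dotProduct]
      refine Submodule.sum_mem ((1 : FracIdeal K) : Submodule (𝓞 K) K) fun i _ => ?_
      rw [mul_comm]
      exact (FractionalIdeal.mem_inv_iff (L.coeffIdeal_ne_zero i)).1 (h i) _ (hw i)
    obtain ⟨a, ha⟩ := (FractionalIdeal.mem_one_iff _).1 this
    exact ⟨a, ha⟩

theorem FractionalIdeal.ne_zero_of_mem {J : FracIdeal K} {x : K} (hx : x ∈ J) (h0 : x ≠ 0) :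
    J ≠ 0 := by
  rintro rfl
  exact h0 ((FractionalIdeal.mem_zero_iff _).1 hx)

variable [IsTotallyReal K]

variable (K) in
theorem exists_realEmbedding : Nonempty (K →+* ℝ) := by
  obtain ⟨w⟩ : Nonempty (InfinitePlace K) := inferInstance
  exact ⟨InfinitePlace.embedding_of_isReal (IsTotallyReal.isReal w)⟩

theorem QuadLattice.bilin_self_ne_zero {x : Fin m → K} (hx : x ≠ 0) : L.bilin x x ≠ 0 := by
  intro h
  obtain ⟨σ⟩ := exists_realEmbedding K
  have := L.pos hx σ
  rw [← QuadLattice.bilin, h, map_zero] at this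
  exact lt_irrefl _ this

theorem QuadLattice.norm_ne_zero (hm : 0 < m) : L.norm ≠ 0 := by
  obtain ⟨d, hd0, hd⟩ := exists_smul_mem_of_ne_zero L.coeffIdeal_ne_zero (1 : Fin m → K)
  have hx : (fun i => (d : K) * (1 : Fin m → K) i) ≠ 0 := by
    intro h
    exact hd0 (by simpa using congrFun h ⟨0, hm⟩)
  exact FractionalIdeal.ne_zero_of_mem (L.bilin_self_mem_norm hd) (L.bilin_self_ne_zero hx)

theorem QuadLattice.gram_mul_inv : L.gram * L.gram⁻¹ = 1 :=
  Matrix.mul_nonsing_inv _ (isUnit_iff_ne_zero.2 L.det_gram_ne_zero)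

theorem QuadLattice.gram_inv_mul : L.gram⁻¹ * L.gram = 1 :=
  Matrix.nonsing_inv_mul _ (isUnit_iff_ne_zero.2 L.det_gram_ne_zero)

theorem QuadLattice.dualNorm_ne_zero (hm : 0 < m) : L.dualNorm ≠ 0 := by
  obtain ⟨d, hd0, hd⟩ := exists_smul_mem_of_ne_zero
    (J := fun i => (L.coeffIdeal i)⁻¹) (fun i => inv_ne_zero (L.coeffIdeal_ne_zero i))
    (1 : Fin m → K)
  set z : Fin m → K := fun i => (d : K) * (1 : Fin m → K) i with hz
  have hQ : L.gram *ᵥ (L.gram⁻¹ *ᵥ z) = z := by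
    rw [mulVec_mulVec, L.gram_mul_inv, one_mulVec]
  have hx : L.gram⁻¹ *ᵥ z ≠ 0 := by
    intro h
    rw [h, mulVec_zero] at hQ
    exact hd0 (by simpa [hz] using (congrFun hQ ⟨0, hm⟩).symm)
  refine FractionalIdeal.ne_zero_of_mem (L.bilin_self_mem_dualNorm (x := L.gram⁻¹ *ᵥ z) ?_)
    (L.bilin_self_ne_zero hx)
  rw [L.mem_dualSubmodule_iff, hQ]
  exact hd

theorem spanSingleton_ne_zero {x : K} (hx : x ≠ 0) :
    FractionalIdeal.spanSingleton (𝓞 K)⁰ x ≠ 0 := by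
  rwa [Ne, FractionalIdeal.spanSingleton_eq_zero_iff]

theorem QuadLattice.halfNorm_ne_zero (hm : 0 < m) : L.halfNorm ≠ 0 :=
  mul_ne_zero (spanSingleton_ne_zero (by norm_num)) (L.norm_ne_zero hm)

theorem QuadLattice.level_ne_zero (hm : 0 < m) : L.level ≠ 0 :=
  mul_ne_zero (spanSingleton_ne_zero (by norm_num))
    (inv_ne_zero (mul_ne_zero (L.norm_ne_zero hm) (L.dualNorm_ne_zero hm)))

theorem QuadLattice.two_mul_halfNorm :
    FractionalIdeal.spanSingleton (𝓞 K)⁰ (2 : K) * L.halfNorm = L.norm := by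
  rw [halfNorm, ← mul_assoc, FractionalIdeal.spanSingleton_mul_spanSingleton]
  norm_num

theorem QuadLattice.dualNorm_mul_level_mul_halfNorm (hm : 0 < m) :
    L.dualNorm * (L.level * L.halfNorm) = FractionalIdeal.spanSingleton (𝓞 K)⁰ (2 : K) := by
  have h4 : FractionalIdeal.spanSingleton (𝓞 K)⁰ (4 : K) *
      FractionalIdeal.spanSingleton (𝓞 K)⁰ (1 / 2 : K) =
      FractionalIdeal.spanSingleton (𝓞 K)⁰ (2 : K) := by
    rw [FractionalIdeal.spanSingleton_mul_spanSingleton]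
    norm_num
  have h1 := L.norm_ne_zero hm
  have h2 := L.dualNorm_ne_zero hm
  rw [level, halfNorm, ← h4]
  field_simp

theorem QuadLattice.mem_halfNorm {x : K} : x ∈ L.halfNorm ↔ 2 * x ∈ L.norm := by
  rw [← L.two_mul_halfNorm, FractionalIdeal.mem_singleton_mul]
  constructor
  · intro h
    exact ⟨x, h, rfl⟩
  · rintro ⟨y, hy, h⟩
    rwa [mul_left_cancel₀ two_ne_zero h]

theorem QuadLattice.bilin_mem_halfNorm {x y : Fin m → K} (hx : x ∈ L.toSubmodule)
    (hy : y ∈ L.toSubmodule) : L.bilin x y ∈ L.halfNorm :=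
  L.mem_halfNorm.2 (L.two_mul_bilin_mem (fun _ h => L.bilin_self_mem_norm h) hx hy)

theorem mem_mul_spanSingleton_two {J : FracIdeal K} {x : K} :
    2 * x ∈ FractionalIdeal.spanSingleton (𝓞 K)⁰ (2 : K) * J ↔ x ∈ J := by
  rw [FractionalIdeal.mem_singleton_mul]
  constructor
  · rintro ⟨y, hy, h⟩
    rwa [mul_left_cancel₀ two_ne_zero h]
  · intro h
    exact ⟨x, h, rfl⟩

/-- `𝒩𝔑 L^# ⊆ L`. -/
theorem QuadLattice.smul_dual_mem (hm : 0 < m) {x : Fin m → K} (hx : x ∈ L.dualSubmodule) {t : K}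
    (ht : t ∈ L.level * L.halfNorm) : t • x ∈ L.toSubmodule := by
  intro i
  rw [← inv_inv (L.coeffIdeal i), FractionalIdeal.mem_inv_iff
    (inv_ne_zero (L.coeffIdeal_ne_zero i))]
  intro y hy
  set w : Fin m → K := L.gram⁻¹ *ᵥ Pi.single i y with hw
  have hQw : L.gram *ᵥ w = Pi.single i y := by
    rw [hw, mulVec_mulVec, L.gram_mul_inv, one_mulVec]
  have hwd : w ∈ L.dualSubmodule := by
    rw [L.mem_dualSubmodule_iff, hQw]
    intro j
    by_cases hj : j = i
    · subst hj; simpa using hy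
    · simp [hj, FractionalIdeal.zero_mem]
  have hB := L.two_mul_bilin_mem (fun _ h => L.bilin_self_mem_dualNorm h) hx hwd
  have h1 := FractionalIdeal.mul_mem_mul hB ht
  rw [L.dualNorm_mul_level_mul_halfNorm hm] at h1
  have h2 : L.bilin x w = x i * y := by
    rw [bilin, hQw, dotProduct_single]
  rw [h2] at h1
  have h3 : 2 * ((t • x) i * y) ∈ FractionalIdeal.spanSingleton (𝓞 K)⁰ (2 : K) * 1 := by
    rw [mul_one]
    convert h1 using 1
    simp only [Pi.smul_apply, smul_eq_mul]
    ring
  exact mem_mul_spanSingleton_two.1 h3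

theorem QuadLattice.smul_mem_dual (hm : 0 < m) {x : Fin m → K} (hx : x ∈ L.toSubmodule) {u : K}
    (hu : u ∈ L.halfNorm⁻¹) : u • x ∈ L.dualSubmodule := by
  intro w hw
  have h := (FractionalIdeal.mem_inv_iff (L.halfNorm_ne_zero hm)).1 hu _
    (L.bilin_mem_halfNorm hx hw)
  obtain ⟨a, ha⟩ := (FractionalIdeal.mem_one_iff _).1 h
  exact ⟨a, by rw [bilin, smul_dotProduct, smul_eq_mul]; exact ha⟩

/-- The level is integral, as `𝒩L = 𝒩𝔑(𝔑⁻¹L) ⊆ 𝒩𝔑 L^# ⊆ L`. -/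
theorem QuadLattice.level_le_one (hm : 0 < m) : L.level ≤ 1 := by
  set i : Fin m := ⟨0, hm⟩
  have h : L.level * L.halfNorm * (L.halfNorm⁻¹ * L.coeffIdeal i) ≤ 1 * L.coeffIdeal i := by
    rw [one_mul, FractionalIdeal.mul_le]
    intro t ht y hy
    have : FractionalIdeal.spanSingleton (𝓞 K)⁰ t * (L.halfNorm⁻¹ * L.coeffIdeal i) ≤
        L.coeffIdeal i := by
      rw [← mul_assoc, FractionalIdeal.mul_le]
      intro z hz a ha
      obtain ⟨u, hu, rfl⟩ := FractionalIdeal.mem_singleton_mul.1 hz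
      have h1 : Pi.single i a ∈ L.toSubmodule := by
        intro j
        by_cases hj : j = i
        · subst hj; simpa using ha
        · simp [hj, FractionalIdeal.zero_mem]
      have h2 := L.smul_dual_mem hm (L.smul_mem_dual hm h1 hu) ht i
      simpa [mul_assoc] using h2
    exact this (FractionalIdeal.mul_mem_mul (FractionalIdeal.mem_spanSingleton_self _ _) hy)
  have h0 := L.coeffIdeal_ne_zero i
  have h1 := L.halfNorm_ne_zero hm
  have h2 : L.level * L.halfNorm * (L.halfNorm⁻¹ * L.coeffIdeal i) =
      L.level * L.coeffIdeal i := by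
    field_simp
  rw [h2] at h
  exact FracIdeal.le_of_mul_le_mul_right h0 h

end Level


/-! ### Tensor lattices and the quadratic exponentials on them -/

section Tensor

variable {K : Type*} [Field K] [NumberField K] {m n : ℕ}

/-- The lattice spanned by the matrices `x ᵗw`, for `x` in `S` and `w` in `M`. -/
def tens (S : Submodule (𝓞 K) (Fin m → K)) (M : Submodule (𝓞 K) (Fin n → K)) :
    Submodule (𝓞 K) (Matrix (Fin m) (Fin n) K) :=
  Submodule.map₂ (vecMulVecBilin (𝓞 K) (𝓞 K)) S M

theorem vecMulVec_mem_tens {S : Submodule (𝓞 K) (Fin m → K)} {M : Submodule (𝓞 K) (Fin n → K)}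
    {x : Fin m → K} {w : Fin n → K} (hx : x ∈ S) (hw : w ∈ M) : vecMulVec x w ∈ tens S M :=
  Submodule.apply_mem_map₂ (vecMulVecBilin (𝓞 K) (𝓞 K)) hx hw

theorem tens_mono {S S' : Submodule (𝓞 K) (Fin m → K)} {M M' : Submodule (𝓞 K) (Fin n → K)}
    (hS : S ≤ S') (hM : M ≤ M') : tens S M ≤ tens S' M' :=
  Submodule.map₂_le_map₂ hS hM

@[elab_as_elim]
theorem tens_induction {S : Submodule (𝓞 K) (Fin m → K)} {M : Submodule (𝓞 K) (Fin n → K)}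
    {p : ∀ U : Matrix (Fin m) (Fin n) K, U ∈ tens S M → Prop} {U : Matrix (Fin m) (Fin n) K}
    (hU : U ∈ tens S M)
    (tensor : ∀ x (hx : x ∈ S) w (hw : w ∈ M), p (vecMulVec x w) (vecMulVec_mem_tens hx hw))
    (zero : p 0 (zero_mem _))
    (add : ∀ U hU V hV, p U hU → p V hV → p (U + V) (add_mem hU hV)) : p U hU := by
  have hU' := hU
  rw [tens, Submodule.map₂_eq_span_image2] at hU'
  rw [Submodule.mem_span_set'] at hU'
  obtain ⟨N, f, g, rfl⟩ := hU'
  have hterm : ∀ i, ∃ x ∈ S, ∃ w ∈ M, f i • (g i : Matrix (Fin m) (Fin n) K) = vecMulVec x w := by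
    intro i
    obtain ⟨x, hx, w, hw, h⟩ := (g i).2
    refine ⟨f i • x, S.smul_mem _ hx, w, hw, ?_⟩
    rw [← h, smul_vecMulVec]
    rfl
  have : ∀ s : Finset (Fin N), ∃ h, p (∑ i ∈ s, f i • (g i : Matrix (Fin m) (Fin n) K)) h := by
    intro s
    induction s using Finset.cons_induction with
    | empty => exact ⟨by simp, by simpa using zero⟩
    | cons i s hi ih =>
      simp only [Finset.sum_cons]
      obtain ⟨x, hx, w, hw, h⟩ := hterm i
      simp only [h]
      obtain ⟨h2, h3⟩ := ih
      exact ⟨add_mem (vecMulVec_mem_tens hx hw) h2, add _ _ _ h2 (tensor x hx w hw) h3⟩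
  obtain ⟨_, h⟩ := this Finset.univ
  exact h

theorem mul_transpose_mem_tens {S : Submodule (𝓞 K) (Fin m → K)}
    {M : Submodule (𝓞 K) (Fin n → K)} {l : ℕ} {M' : Submodule (𝓞 K) (Fin l → K)}
    {G : Matrix (Fin l) (Fin n) K} (hG : ∀ w ∈ M, G *ᵥ w ∈ M') {U : Matrix (Fin m) (Fin n) K}
    (hU : U ∈ tens S M) : U * Gᵀ ∈ tens S M' := by
  induction hU using tens_induction with
  | tensor x hx w hw =>
    rw [vecMulVec_mul, vecMul_transpose]
    exact vecMulVec_mem_tens hx (hG w hw)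
  | zero => simp
  | add U _ V _ h1 h2 =>
    rw [Matrix.add_mul]
    exact Submodule.add_mem _ h1 h2

theorem mul_mem_tens {S : Submodule (𝓞 K) (Fin m → K)} {l : ℕ}
    {S' : Submodule (𝓞 K) (Fin l → K)}
    {M : Submodule (𝓞 K) (Fin n → K)} {G : Matrix (Fin l) (Fin m) K}
    (hG : ∀ x ∈ S, G *ᵥ x ∈ S') {U : Matrix (Fin m) (Fin n) K}
    (hU : U ∈ tens S M) : G * U ∈ tens S' M := by
  induction hU using tens_induction with
  | tensor x hx w hw =>
    rw [mul_vecMulVec]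
    exact vecMulVec_mem_tens (hG x hx) hw
  | zero => simp
  | add U _ V _ h1 h2 =>
    rw [Matrix.mul_add]
    exact Submodule.add_mem _ h1 h2

/-- The lattice `I₁ ⊕ ⋯ ⊕ Iₙ`. -/
def coordSubmodule (I : Fin n → FracIdeal K) : Submodule (𝓞 K) (Fin n → K) where
  carrier := {w | ∀ j, w j ∈ I j}
  add_mem' hx hy i := Submodule.add_mem (I i : Submodule (𝓞 K) K) (hx i) (hy i)
  zero_mem' _ := FractionalIdeal.zero_mem _
  smul_mem' c _ hx i := Submodule.smul_mem (I i : Submodule (𝓞 K) K) c (hx i)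

theorem mem_coordSubmodule {I : Fin n → FracIdeal K} {w : Fin n → K} :
    w ∈ coordSubmodule I ↔ ∀ j, w j ∈ I j := Iff.rfl

theorem single_mem_coordSubmodule {I : Fin n → FracIdeal K} {i : Fin n} {x : K} (hx : x ∈ I i) :
    Pi.single i x ∈ coordSubmodule I := by
  intro j
  by_cases hj : j = i
  · subst hj; simpa using hx
  · simp [hj, FractionalIdeal.zero_mem]

theorem mem_tens_coordSubmodule {A : Fin m → FracIdeal K} {I : Fin n → FracIdeal K}
    {U : Matrix (Fin m) (Fin n) K} :
    U ∈ tens (coordSubmodule A) (coordSubmodule I) ↔ ∀ i j, U i j ∈ A i * I j := by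
  constructor
  · intro hU i j
    induction hU using tens_induction with
    | tensor x hx w hw => exact FractionalIdeal.mul_mem_mul (hx i) (hw j)
    | zero => exact FractionalIdeal.zero_mem _
    | add U _ V _ h1 h2 => exact Submodule.add_mem (A i * I j : FracIdeal K).coeToSubmodule h1 h2
  · intro hU
    rw [Matrix.matrix_eq_sum_single U]
    refine Submodule.sum_mem _ fun i _ => Submodule.sum_mem _ fun j _ => ?_
    have h := hU i j
    refine FractionalIdeal.mul_induction_on h (fun a ha b hb => ?_) (fun x y hx hy => ?_)
    · have : Matrix.single i j (a * b) = vecMulVec (Pi.single i a) (Pi.single j b) := by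
        ext k l
        rw [vecMulVec_apply, Matrix.single_apply]
        by_cases hk : i = k
        · by_cases hl : j = l
          · subst hk hl; simp
          · simp [hl, Ne.symm hl]
        · simp [hk, Ne.symm hk]
      rw [this]
      exact vecMulVec_mem_tens (single_mem_coordSubmodule ha) (single_mem_coordSubmodule hb)
    · rw [Matrix.single_add]
      exact Submodule.add_mem _ hx hy

variable (L : QuadLattice K m)

theorem QuadLattice.mem_matLattice_iff {I : Fin n → FracIdeal K} {U : Matrix (Fin m) (Fin n) K} :
    U ∈ L.matLattice I ↔ U ∈ tens L.toSubmodule (coordSubmodule I) :=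
  (mem_tens_coordSubmodule (A := L.coeffIdeal)).symm

/-- The bilinear form `(U, V) ↦ tr(ᵗU Q V s)`. -/
def QuadLattice.pairing (s : Matrix (Fin n) (Fin n) K) :
    LinearMap.BilinForm K (Matrix (Fin m) (Fin n) K) :=
  LinearMap.mk₂ K (fun U V => (Uᵀ * L.gram * V * s).trace)
    (fun U V W => by simp [Matrix.add_mul])
    (fun c U V => by simp [Matrix.trace_smul])
    (fun U V W => by simp [Matrix.mul_add, Matrix.add_mul])
    (fun c U V => by simp [Matrix.trace_smul])

variable {s : Matrix (Fin n) (Fin n) K}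

theorem QuadLattice.pairing_apply (U V : Matrix (Fin m) (Fin n) K) :
    L.pairing s U V = (Uᵀ * L.gram * V * s).trace := rfl

theorem QuadLattice.pairing_comm (hs : s.IsSymm) (U V : Matrix (Fin m) (Fin n) K) :
    L.pairing s U V = L.pairing s V U := by
  rw [L.pairing_apply, L.pairing_apply, ← Matrix.trace_transpose]
  simp only [transpose_mul, transpose_transpose, hs.eq, L.gram_symm.eq]
  rw [Matrix.trace_mul_comm]
  simp only [Matrix.mul_assoc]

theorem QuadLattice.pairing_vecMulVec (x y : Fin m → K) (w z : Fin n → K) :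
    L.pairing s (vecMulVec x w) (vecMulVec y z) = L.bilin x y * (z ⬝ᵥ s *ᵥ w) := by
  rw [L.pairing_apply, transpose_vecMulVec, vecMulVec_mul, vecMulVec_mul_vecMulVec, vecMulVec_mul,
    trace_vecMulVec, smul_vecMul, dotProduct_smul, bilin, smul_eq_mul, ← dotProduct_mulVec,
    dotProduct_comm w, ← dotProduct_mulVec]

/-- The quadratic exponential `U ↦ e(tr(ᵗU Q U s))`. -/
def QuadLattice.quadExp (s : Matrix (Fin n) (Fin n) K) (U : Matrix (Fin m) (Fin n) K) : ℂ :=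
  expTrace (L.pairing s U U)

theorem QuadLattice.quadExp_add (hs : s.IsSymm) (U V : Matrix (Fin m) (Fin n) K) :
    L.quadExp s (U + V) = L.quadExp s U * L.quadExp s V * expTrace (2 * L.pairing s U V) := by
  rw [quadExp, quadExp, quadExp, ← expTrace_add, ← expTrace_add]
  congr 1
  rw [map_add, map_add, LinearMap.add_apply, LinearMap.add_apply, L.pairing_comm hs V U]
  ring

theorem QuadLattice.mem_of_pairing {S S' : Submodule (𝓞 K) (Fin m → K)}
    {M M' : Submodule (𝓞 K) (Fin n → K)} {J : FracIdeal K} {c : K}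
    (h : ∀ x ∈ S, ∀ y ∈ S', ∀ w ∈ M, ∀ z ∈ M', c * (L.bilin x y * (z ⬝ᵥ s *ᵥ w)) ∈ J)
    {U V : Matrix (Fin m) (Fin n) K} (hU : U ∈ tens S M) (hV : V ∈ tens S' M') :
    c * L.pairing s U V ∈ J := by
  induction hU using tens_induction with
  | tensor x hx w hw =>
    induction hV using tens_induction with
    | tensor y hy z hz =>
      rw [L.pairing_vecMulVec]
      exact h x hx y hy w hw z hz
    | zero => simp [FractionalIdeal.zero_mem]
    | add U _ V _ h1 h2 =>
      rw [map_add, mul_add]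
      exact Submodule.add_mem (J : Submodule (𝓞 K) K) h1 h2
  | zero => simp [FractionalIdeal.zero_mem]
  | add U _ V _ h1 h2 =>
    rw [map_add, LinearMap.add_apply, mul_add]
    exact Submodule.add_mem (J : Submodule (𝓞 K) K) h1 h2

theorem QuadLattice.pairing_self_mem (hs : s.IsSymm) {S : Submodule (𝓞 K) (Fin m → K)}
    {M : Submodule (𝓞 K) (Fin n → K)} {N T : FracIdeal K}
    (hN : ∀ x ∈ S, L.bilin x x ∈ N) (hT : ∀ w ∈ M, ∀ z ∈ M, z ⬝ᵥ s *ᵥ w ∈ T)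
    {U : Matrix (Fin m) (Fin n) K} (hU : U ∈ tens S M) : L.pairing s U U ∈ N * T := by
  induction hU using tens_induction with
  | tensor x hx w hw =>
    rw [L.pairing_vecMulVec]
    exact FractionalIdeal.mul_mem_mul (hN x hx) (hT w hw w hw)
  | zero => simp [FractionalIdeal.zero_mem]
  | add U hU V hV h1 h2 =>
    have e : L.pairing s (U + V) (U + V) =
        L.pairing s U U + L.pairing s V V + 2 * L.pairing s U V := by
      rw [map_add, map_add, LinearMap.add_apply, LinearMap.add_apply, L.pairing_comm hs V U]
      ring
    rw [e]
    refine Submodule.add_mem (N * T : FracIdeal K).coeToSubmodule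
      (Submodule.add_mem (N * T : FracIdeal K).coeToSubmodule h1 h2)
      (L.mem_of_pairing (fun x hx y hy w hw z hz => ?_) hU hV)
    rw [← mul_assoc]
    exact FractionalIdeal.mul_mem_mul (L.two_mul_bilin_mem hN hx hy) (hT w hw z hz)

theorem expTrace_eq_one_of_mem_two_mul [IsTotallyReal K] {x : K}
    (hx : x ∈ FractionalIdeal.spanSingleton (𝓞 K)⁰ (2 : K) * (different K)⁻¹) : expTrace x = 1 := by
  obtain ⟨y, hy, rfl⟩ := FractionalIdeal.mem_singleton_mul.1 hx
  exact expTrace_eq_one_of_mem hy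

theorem QuadLattice.quadExp_eq_one [IsTotallyReal K] (hs : s.IsSymm)
    {S : Submodule (𝓞 K) (Fin m → K)} {M : Submodule (𝓞 K) (Fin n → K)} {N T : FracIdeal K}
    (hN : ∀ x ∈ S, L.bilin x x ∈ N) (hT : ∀ w ∈ M, ∀ z ∈ M, z ⬝ᵥ s *ᵥ w ∈ T)
    (hNT : N * T ≤ FractionalIdeal.spanSingleton (𝓞 K)⁰ (2 : K) * (different K)⁻¹)
    {U : Matrix (Fin m) (Fin n) K} (hU : U ∈ tens S M) : L.quadExp s U = 1 :=
  expTrace_eq_one_of_mem_two_mul (hNT (L.pairing_self_mem hs hN hT hU))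

theorem QuadLattice.expTrace_pairing_eq_one [IsTotallyReal K]
    {S : Submodule (𝓞 K) (Fin m → K)} {M M' : Submodule (𝓞 K) (Fin n → K)} {N T : FracIdeal K}
    (hN : ∀ x ∈ S, L.bilin x x ∈ N) (hT : ∀ w ∈ M, ∀ z ∈ M', z ⬝ᵥ s *ᵥ w ∈ T)
    (hNT : N * T ≤ FractionalIdeal.spanSingleton (𝓞 K)⁰ (2 : K) * (different K)⁻¹)
    {U V : Matrix (Fin m) (Fin n) K} (hU : U ∈ tens S M) (hV : V ∈ tens S M') :
    expTrace (2 * L.pairing s U V) = 1 := by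
  refine expTrace_eq_one_of_mem_two_mul (L.mem_of_pairing (fun x hx y hy w hw z hz => hNT ?_) hU hV)
  rw [← mul_assoc]
  exact FractionalIdeal.mul_mem_mul (L.two_mul_bilin_mem hN hx hy) (hT w hw z hz)

/-- The fractional ideal `(𝔑∂)⁻¹`. -/
def QuadLattice.poleIdeal : FracIdeal K := (L.halfNorm * different K)⁻¹

theorem QuadLattice.norm_mul_poleIdeal [IsTotallyReal K] (hm : 0 < m) :
    L.norm * L.poleIdeal = FractionalIdeal.spanSingleton (𝓞 K)⁰ (2 : K) * (different K)⁻¹ := by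
  have h1 := L.halfNorm_ne_zero hm
  have h2 := different_ne_zero (K := K)
  rw [poleIdeal, ← L.two_mul_halfNorm]
  field_simp

/-- The dual of `𝒜ᵢℐⱼ` under the trace form is `L^#` tensored with the inverse of `∂ℐⱼ`; the
different enters as the dual of `𝓞` under the trace. -/
theorem QuadLattice.mem_traceDual_iff [IsTotallyReal K] {I : Fin n → FracIdeal K}
    (hI : ∀ j, I j ≠ 0) {W : Matrix (Fin m) (Fin n) K} :
    W ∈ L.traceDual (L.matLattice I) ↔
      W ∈ tens L.dualSubmodule (coordSubmodule fun j => (different K * I j)⁻¹) := by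
  constructor
  · intro hW
    have h1 : ∀ i j, (L.gram * W) i j ∈ (L.coeffIdeal i)⁻¹ * (different K * I j)⁻¹ := by
      intro i j
      have hne : L.coeffIdeal i * I j ≠ 0 := mul_ne_zero (L.coeffIdeal_ne_zero i) (hI j)
      have e : (L.coeffIdeal i)⁻¹ * (different K * I j)⁻¹ =
          (different K)⁻¹ * (L.coeffIdeal i * I j)⁻¹ := by
        rw [mul_inv, mul_inv]
        ring
      rw [e]
      have h2 : ∀ x ∈ L.coeffIdeal i * I j, (L.gram * W) i j * x ∈ (different K)⁻¹ := by
        intro x hx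
        rw [mem_inv_different]
        intro y
        have hU : Matrix.single i j (y • x) ∈ L.matLattice I := by
          intro k l
          rw [Matrix.single_apply]
          split_ifs with h
          · obtain ⟨rfl, rfl⟩ := h
            exact Submodule.smul_mem (L.coeffIdeal i * I j : FracIdeal K).coeToSubmodule y hx
          · exact FractionalIdeal.zero_mem _
        obtain ⟨z, hz⟩ := hW _ hU
        refine ⟨z, ?_⟩
        rw [← hz, L.traceForm_apply, L.traceForm_symm, Matrix.mul_assoc, transpose_single,
          trace_single_mul, Algebra.smul_def]
        congr 1
        simp only [Algebra.algebraMap_self, RingHom.id_apply, Algebra.smul_def]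
        ring
      have h3 : FractionalIdeal.spanSingleton (𝓞 K)⁰ ((L.gram * W) i j) * (L.coeffIdeal i * I j) ≤
          (different K)⁻¹ := by
        rw [FractionalIdeal.spanSingleton_mul_le_iff]
        exact h2
      have h4 : FractionalIdeal.spanSingleton (𝓞 K)⁰ ((L.gram * W) i j) ≤
          (different K)⁻¹ * (L.coeffIdeal i * I j)⁻¹ := by
        refine FracIdeal.le_of_mul_le_mul_right hne ?_
        rwa [mul_assoc, inv_mul_cancel₀ hne, mul_one]
      exact FractionalIdeal.spanSingleton_le_iff_mem.1 h4
    have h5 := mem_tens_coordSubmodule.2 h1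
    have h6 : W = L.gram⁻¹ * (L.gram * W) := by
      rw [← Matrix.mul_assoc, L.gram_inv_mul, Matrix.one_mul]
    rw [h6]
    refine mul_mem_tens (fun x hx => ?_) h5
    rw [L.mem_dualSubmodule_iff, mulVec_mulVec, L.gram_mul_inv, one_mulVec]
    exact hx
  · intro hW U hU
    rw [L.mem_matLattice_iff] at hU
    have h : 1 * L.pairing 1 W U ∈ (different K)⁻¹ := by
      refine L.mem_of_pairing (fun x hx y hy w hw z hz => ?_) hW hU
      rw [one_mul, one_mulVec]
      obtain ⟨a, ha⟩ := hx y hy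
      rw [← ha, ← Algebra.smul_def]
      refine Submodule.smul_mem ((different K)⁻¹ : FracIdeal K).coeToSubmodule a ?_
      refine Submodule.sum_mem _ fun j _ => ?_
      have := FractionalIdeal.mul_mem_mul (hz j) (hw j)
      have e : I j * (different K * I j)⁻¹ = (different K)⁻¹ := by
        rw [mul_inv, mul_comm, mul_assoc, inv_mul_cancel₀ (hI j), mul_one]
      rwa [e] at this
    obtain ⟨z, hz⟩ := mem_inv_different.1 h 1
    refine ⟨z, ?_⟩
    rw [← hz, L.traceForm_apply, L.pairing_apply]
    simp

end Tensor


/-! ### Transversals of quotients of lattices -/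

section Transversal

variable {R V : Type*} [Ring R] [AddCommGroup V] [Module R V] {X Y Z : Submodule R V}

/-- `T` is a system of representatives of `X / Y`. -/
def IsTransversal (X Y : Submodule R V) (T : Finset V) : Prop :=
  (∀ t ∈ T, t ∈ X) ∧ ∀ x ∈ X, ∃! t, t ∈ T ∧ x - t ∈ Y

namespace IsTransversal

variable {T T' : Finset V}

theorem eq_of_sub_mem (h : IsTransversal X Y T) {t t' : V} (ht : t ∈ T) (ht' : t' ∈ T)
    (hs : t - t' ∈ Y) : t = t' :=
  (h.2 t (h.1 t ht)).unique ⟨ht, by simp⟩ ⟨ht', hs⟩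

/-- The sum of a function on `X / Y` over a system of representatives does not depend on the system. -/
theorem sum_eq (h : IsTransversal X Y T) (h' : IsTransversal X Y T') {A : Type*}
    [AddCommMonoid A] {f : V → A} (hf : ∀ x ∈ X, ∀ y ∈ Y, f (x + y) = f x) :
    ∑ t ∈ T, f t = ∑ t ∈ T', f t := by
  choose! r hr using fun x hx => (h'.2 x hx).exists
  refine Finset.sum_bij (fun t _ => r t) (fun t ht => (hr t (h.1 t ht)).1) (fun t ht u hu htu => ?_)
    (fun t ht => ?_) (fun t ht => ?_)
  · refine h.eq_of_sub_mem ht hu ?_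
    have := Y.sub_mem (hr t (h.1 t ht)).2 (hr u (h.1 u hu)).2
    rw [htu] at this
    simpa using this
  · obtain ⟨u, ⟨hu, hut⟩, -⟩ := h.2 t (h'.1 t ht)
    refine ⟨u, hu, h'.eq_of_sub_mem (hr u (h.1 u hu)).1 ht ?_⟩
    have := Y.add_mem (hr u (h.1 u hu)).2 hut
    rw [← Y.neg_mem_iff]
    convert this using 1
    abel
  · have h1 := hr t (h.1 t ht)
    have := hf t (h.1 t ht) (r t - t) (by rw [← Y.neg_mem_iff]; simpa using h1.2)
    simpa using this.symm

theorem card_eq (h : IsTransversal X Y T) (h' : IsTransversal X Y T') :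
    T.card = T'.card := by
  rw [Finset.card_eq_sum_ones, Finset.card_eq_sum_ones]
  exact h.sum_eq h' fun _ _ _ _ => rfl

theorem sum_add (h : IsTransversal X Y T) {A : Type*} [AddCommMonoid A] {f : V → A}
    (hf : ∀ x ∈ X, ∀ y ∈ Y, f (x + y) = f x) {v : V} (hv : v ∈ X) :
    ∑ t ∈ T, f (t + v) = ∑ t ∈ T, f t := by
  classical
  have h' : IsTransversal X Y (T.image (· + v)) := by
    constructor
    · intro t ht
      obtain ⟨u, hu, rfl⟩ := Finset.mem_image.1 ht
      exact X.add_mem (h.1 u hu) hv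
    · intro x hx
      obtain ⟨t, ⟨ht, htx⟩, huniq⟩ := h.2 (x - v) (X.sub_mem hx hv)
      refine ⟨t + v, ⟨Finset.mem_image_of_mem _ ht, by convert htx using 1; abel⟩, ?_⟩
      rintro _ ⟨hu, hux⟩
      obtain ⟨u, hu', rfl⟩ := Finset.mem_image.1 hu
      rw [huniq u ⟨hu', by convert hux using 1; abel⟩]
  rw [← h'.sum_eq h hf, Finset.sum_image fun a _ b _ hab => add_right_cancel hab]

/-- The image of a transversal under a homomorphism that induces an isomorphism of quotients. -/
theorem image {R' V' : Type*} [Ring R'] [AddCommGroup V'] [Module R' V'] {X' Y' : Submodule R' V'}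
    [DecidableEq V'] (h : IsTransversal X Y T) (φ : V →+ V') (hX : ∀ x ∈ X, φ x ∈ X')
    (hY : ∀ x ∈ X, φ x ∈ Y' ↔ x ∈ Y) (hs : ∀ x' ∈ X', ∃ x ∈ X, x' - φ x ∈ Y') :
    IsTransversal X' Y' (T.image φ) := by
  constructor
  · intro t ht
    obtain ⟨u, hu, rfl⟩ := Finset.mem_image.1 ht
    exact hX u (h.1 u hu)
  · intro x' hx'
    obtain ⟨x, hx, hxx'⟩ := hs x' hx'
    obtain ⟨t, ⟨ht, htx⟩, -⟩ := h.2 x hx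
    have h1 : φ (x - t) ∈ Y' := (hY _ (X.sub_mem hx (h.1 t ht))).2 htx
    rw [map_sub] at h1
    have h2 : x' - φ t ∈ Y' := by
      convert Y'.add_mem hxx' h1 using 1
      abel
    refine ⟨φ t, ⟨Finset.mem_image_of_mem _ ht, h2⟩, ?_⟩
    rintro _ ⟨hu, hux⟩
    obtain ⟨u, hu', rfl⟩ := Finset.mem_image.1 hu
    congr 1
    refine h.eq_of_sub_mem hu' ht ((hY _ (X.sub_mem (h.1 u hu') (h.1 t ht))).1 ?_)
    rw [map_sub]
    convert Y'.sub_mem h2 hux using 1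
    abel

theorem injOn_image {R' V' : Type*} [Ring R'] [AddCommGroup V'] [Module R' V']
    {Y' : Submodule R' V'} (h : IsTransversal X Y T) (φ : V →+ V')
    (hY : ∀ x ∈ X, φ x ∈ Y' ↔ x ∈ Y) : Set.InjOn φ T := by
  intro t ht u hu htu
  refine h.eq_of_sub_mem ht hu ((hY _ (X.sub_mem (h.1 t ht) (h.1 u hu))).1 ?_)
  rw [map_sub, htu, sub_self]
  exact Y'.zero_mem

variable {T₁ T₂ : Finset V}

/-- Representatives of `X / Z` and of `Z / Y` combine to representatives of `X / Y`. -/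
theorem prod [DecidableEq V] (hYZ : Y ≤ Z) (hZX : Z ≤ X) (h₁ : IsTransversal X Z T₁)
    (h₂ : IsTransversal Z Y T₂) :
    IsTransversal X Y ((T₁ ×ˢ T₂).image fun p => p.1 + p.2) := by
  constructor
  · intro t ht
    obtain ⟨⟨a, b⟩, hab, rfl⟩ := Finset.mem_image.1 ht
    rw [Finset.mem_product] at hab
    exact X.add_mem (h₁.1 a hab.1) (hZX (h₂.1 b hab.2))
  · intro x hx
    obtain ⟨a, ⟨ha, hax⟩, hauniq⟩ := h₁.2 x hx
    obtain ⟨b, ⟨hb, hbx⟩, hbuniq⟩ := h₂.2 _ hax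
    refine ⟨a + b, ⟨Finset.mem_image.2 ⟨(a, b), Finset.mem_product.2 ⟨ha, hb⟩, rfl⟩, ?_⟩, ?_⟩
    · convert hbx using 1
      abel
    · rintro _ ⟨hu, hux⟩
      obtain ⟨⟨c, d⟩, hcd, rfl⟩ := Finset.mem_image.1 hu
      rw [Finset.mem_product] at hcd
      simp only at hcd hux ⊢
      have hc : c = a := by
        refine hauniq c ⟨hcd.1, ?_⟩
        convert Z.add_mem (hYZ hux) (h₂.1 d hcd.2) using 1
        abel
      subst hc
      rw [hbuniq d ⟨hcd.2, by convert hux using 1; abel⟩]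

theorem sum_prod [DecidableEq V] (h₁ : IsTransversal X Z T₁)
    (h₂ : IsTransversal Z Y T₂) {A : Type*} [AddCommMonoid A] (f : V → A) :
    ∑ t ∈ (T₁ ×ˢ T₂).image (fun p => p.1 + p.2), f t = ∑ a ∈ T₁, ∑ b ∈ T₂, f (a + b) := by
  rw [Finset.sum_image, Finset.sum_product]
  rintro ⟨a, b⟩ hab ⟨c, d⟩ hcd h
  rw [Finset.mem_coe, Finset.mem_product] at hab hcd
  simp only at h hab hcd
  have hac : a = c := by
    refine h₁.eq_of_sub_mem hab.1 hcd.1 ?_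
    convert Z.sub_mem (h₂.1 d hcd.2) (h₂.1 b hab.2) using 1
    rw [sub_eq_sub_iff_add_eq_add, h, add_comm]
  subst hac
  rw [add_left_cancel h]

/-- A series over a lattice is a finite sum of series over the cosets of a sublattice. -/
theorem tsum_eq (hYX : Y ≤ X) (h : IsTransversal X Y T) {f : V → ℂ}
    (hf : Summable fun x : X => f x) :
    ∑' x : X, f x = ∑ t ∈ T, ∑' y : Y, f (t + y) := by
  let e : T × Y ≃ X := Equiv.ofBijective
    (fun p => ⟨p.1 + p.2, X.add_mem (h.1 _ p.1.2) (hYX p.2.2)⟩) (by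
      constructor
      · rintro ⟨⟨a, ha⟩, ⟨b, hb⟩⟩ ⟨⟨c, hc⟩, ⟨d, hd⟩⟩ hab
        have hab' : a + b = c + d := congrArg Subtype.val hab
        have hac : a = c := by
          refine h.eq_of_sub_mem ha hc ?_
          convert Y.sub_mem hd hb using 1
          rw [sub_eq_sub_iff_add_eq_add, hab', add_comm]
        subst hac
        have hbd := add_left_cancel hab'
        subst hbd
        rfl
      · rintro ⟨x, hx⟩
        obtain ⟨t, ⟨ht, htx⟩, -⟩ := h.2 x hx
        exact ⟨(⟨t, ht⟩, ⟨x - t, htx⟩), Subtype.ext (by simp)⟩)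
  have he : ∀ p : T × Y, ((e p : X) : V) = p.1 + p.2 := fun _ => rfl
  have hs : Summable fun p : T × Y => f (p.1 + p.2) := by
    have := e.summable_iff.2 hf
    exact this.congr fun p => by simp [he]
  rw [← e.tsum_eq, ← Finset.sum_coe_sort T (fun t => ∑' y : Y, f (t + y)), ← tsum_fintype (L := .unconditional _)]
  simp only [he]
  exact hs.tsum_prod

theorem self : IsTransversal X X {0} := by
  refine ⟨fun t ht => ?_, fun x hx => ⟨0, ⟨by simp, by simpa using hx⟩, fun y hy => ?_⟩⟩
  · rw [Finset.mem_singleton.1 ht]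
    exact X.zero_mem
  · exact Finset.mem_singleton.1 hy.1

end IsTransversal

theorem exists_isTransversal (hfin : Finite (X ⧸ Y.submoduleOf X)) :
    ∃ T, IsTransversal X Y T := by
  classical
  have := Fintype.ofFinite (X ⧸ Y.submoduleOf X)
  set r : X ⧸ Y.submoduleOf X → X := fun c => c.out with hr
  have hr' : ∀ c, Submodule.Quotient.mk (r c) = c := fun c => Quotient.out_eq' c
  have key : ∀ x : X, ∀ c, (x : V) - r c ∈ Y ↔ c = Submodule.Quotient.mk x := by
    intro x c
    conv_rhs => rw [← hr' c, eq_comm, Submodule.Quotient.eq]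
    rfl
  refine ⟨Finset.univ.image fun c => (r c : V), fun t ht => ?_, fun x hx => ?_⟩
  · obtain ⟨c, -, rfl⟩ := Finset.mem_image.1 ht
    exact (r c).2
  · refine ⟨r (Submodule.Quotient.mk ⟨x, hx⟩), ⟨Finset.mem_image_of_mem _ (Finset.mem_univ _),
      (key ⟨x, hx⟩ _).2 rfl⟩, ?_⟩
    rintro _ ⟨ht, htx⟩
    obtain ⟨c, -, rfl⟩ := Finset.mem_image.1 ht
    rw [(key ⟨x, hx⟩ c).1 htx]

end Transversal

section FiniteIndex

variable {K : Type*} [Field K] [NumberField K] {V : Type*} [AddCommGroup V] [Module (𝓞 K) V]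

theorem exists_isTransversal_of_fg {X Y : Submodule (𝓞 K) V} (hX : X.FG) {d : 𝓞 K} (hd : d ≠ 0)
    (h : ∀ x ∈ X, d • x ∈ Y) : ∃ T, IsTransversal X Y T := by
  refine exists_isTransversal ?_
  have h1 : Module.Finite (𝓞 K) X := Module.Finite.iff_fg.2 hX
  have h2 : Module.Finite (𝓞 K) (X ⧸ Y.submoduleOf X) := inferInstance
  have h3 : Module.Finite ℤ (X ⧸ Y.submoduleOf X) := Module.Finite.trans (𝓞 K) _
  refine Module.finite_of_fg_torsion _ ?_
  set N := Ideal.absNorm (Ideal.span {d}) with hN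
  have hN0 : N ≠ 0 := by
    rw [hN, Ne, Ideal.absNorm_eq_zero_iff, Ideal.span_singleton_eq_bot]
    exact hd
  obtain ⟨c, hc⟩ := Ideal.mem_span_singleton'.1 (Ideal.absNorm_mem (Ideal.span {d}))
  intro x
  refine ⟨⟨(N : ℤ), mem_nonZeroDivisors_of_ne_zero (by exact_mod_cast hN0)⟩, ?_⟩
  induction x using Submodule.Quotient.induction_on with
  | H x =>
    change ((N : ℤ)) • (Submodule.Quotient.mk x : X ⧸ Y.submoduleOf X) = 0
    rw [← Submodule.Quotient.mk_smul, Submodule.Quotient.mk_eq_zero]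
    have e : (((N : ℤ) • x : X) : V) = c • (d • (x : V)) := by
      rw [smul_smul, hc, ← hN]
      simp [Nat.cast_smul_eq_nsmul]
    change (((N : ℤ) • x : X) : V) ∈ Y
    rw [e]
    exact Y.smul_mem c (h _ x.2)

variable {m n : ℕ}

theorem coordSubmodule_fg (I : Fin n → FracIdeal K) : (coordSubmodule I).FG := by
  have e : coordSubmodule I = Submodule.pi Set.univ fun i => (I i : Submodule (𝓞 K) K) := by
    ext w
    simp [Submodule.mem_pi, mem_coordSubmodule]
  rw [e]
  exact Submodule.fg_pi fun i => FractionalIdeal.fg_of_isNoetherianRing le_rfl _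

theorem tens_fg {S : Submodule (𝓞 K) (Fin m → K)} {M : Submodule (𝓞 K) (Fin n → K)}
    (hS : S.FG) (hM : M.FG) : (tens S M).FG := Submodule.FG.map₂ _ hS hM

theorem smul_mem_tens {S : Submodule (𝓞 K) (Fin m → K)} {M M' : Submodule (𝓞 K) (Fin n → K)}
    {d : 𝓞 K} (h : ∀ w ∈ M, d • w ∈ M') {U : Matrix (Fin m) (Fin n) K} (hU : U ∈ tens S M) :
    d • U ∈ tens S M' := by
  induction hU using tens_induction with
  | tensor x hx w hw =>
    rw [← vecMulVec_smul]
    exact vecMulVec_mem_tens hx (h w hw)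
  | zero => simp
  | add U _ V _ h1 h2 =>
    rw [smul_add]
    exact Submodule.add_mem _ h1 h2

end FiniteIndex


/-! ### The matrices of the group `Γ₀` -/

section Gamma

variable {K : Type*} [Field K] [NumberField K] {m n : ℕ}

theorem mulVec_mem_coordSubmodule {l : ℕ} {G : Matrix (Fin l) (Fin n) K} {F : Fin l → Fin n → FracIdeal K}
    {J : Fin n → FracIdeal K} {H : Fin l → FracIdeal K} (hG : ∀ i j, G i j ∈ F i j)
    (hF : ∀ i j, F i j * J j ≤ H i) {w : Fin n → K} (hw : w ∈ coordSubmodule J) :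
    G *ᵥ w ∈ coordSubmodule H := by
  intro i
  simp only [mulVec, dotProduct]
  exact Submodule.sum_mem (H i : Submodule (𝓞 K) K) fun j _ =>
    hF i j (FractionalIdeal.mul_mem_mul (hG i j) (hw j))

theorem dotProduct_mem {J H : Fin n → FracIdeal K} {T : FracIdeal K} (h : ∀ j, J j * H j ≤ T)
    {z w : Fin n → K} (hz : z ∈ coordSubmodule J) (hw : w ∈ coordSubmodule H) : z ⬝ᵥ w ∈ T :=
  Submodule.sum_mem (T : Submodule (𝓞 K) K) fun j _ =>
    h j (FractionalIdeal.mul_mem_mul (hz j) (hw j))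

/-- The symplectic relations between the blocks of a matrix of `Sp_n`. -/
structure SymplecticRelations (A B C D : Matrix (Fin n) (Fin n) K) : Prop where
  ac : Aᵀ * C = Cᵀ * A
  bd : Bᵀ * D = Dᵀ * B
  ad : Aᵀ * D = 1 + Cᵀ * B
  cd : C * Dᵀ = D * Cᵀ
  ad' : A * Dᵀ = 1 + B * Cᵀ

theorem symplecticRelations {γ : Matrix (Fin n ⊕ Fin n) (Fin n ⊕ Fin n) K}
    (hγ : γ ∈ Matrix.symplecticGroup (Fin n) K) :
    SymplecticRelations γ.toBlocks₁₁ γ.toBlocks₁₂ γ.toBlocks₂₁ γ.toBlocks₂₂ := by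
  have h1 := SymplecticGroup.mem_iff.1 hγ
  have h2 := SymplecticGroup.mem_iff'.1 hγ
  rw [← fromBlocks_toBlocks γ, J, fromBlocks_transpose, fromBlocks_multiply, fromBlocks_multiply,
    fromBlocks_inj] at h1 h2
  obtain ⟨a1, a2, a3, a4⟩ := h1
  obtain ⟨b1, b2, b3, b4⟩ := h2
  simp only [Matrix.mul_zero, Matrix.mul_neg, Matrix.mul_one, zero_add, add_zero,
    Matrix.neg_mul] at a1 a2 a3 a4 b1 b2 b3 b4
  constructor
  · rw [add_neg_eq_zero] at b1
    exact b1.symm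
  · rw [add_neg_eq_zero] at b4
    exact b4.symm
  · have := congrArg Neg.neg b2
    rw [neg_neg, neg_add, neg_neg, neg_add_eq_iff_eq_add] at this
    rw [this, add_comm]
  · rw [add_neg_eq_zero] at a4
    exact a4.symm
  · have := congrArg Neg.neg a2
    rw [neg_neg, neg_add, neg_neg, neg_add_eq_iff_eq_add] at this
    rw [this, add_comm]

/-- The integrality conditions on the blocks of a matrix in `Γ₀(𝒩; ℐ₁, …, ℐₙ; 𝔑)`. -/
structure QuadLattice.BlockIntegral [IsTotallyReal K] (L : QuadLattice K m) (I : Fin n → FracIdeal K)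
    (A B C D : Matrix (Fin n) (Fin n) K) : Prop where
  a : ∀ i j, A i j ∈ (I i)⁻¹ * I j
  b : ∀ i j, B i j ∈ L.poleIdeal * ((I i)⁻¹ * (I j)⁻¹)
  c : ∀ i j, C i j ∈ L.level * L.halfNorm * different K * (I i * I j)
  d : ∀ i j, D i j ∈ I i * (I j)⁻¹

variable [IsTotallyReal K] (L : QuadLattice K m) {I : Fin n → FracIdeal K}

theorem QuadLattice.blockIntegral (hm : 0 < m) {γ : Matrix (Fin n ⊕ Fin n) (Fin n ⊕ Fin n) K}
    (hγ : γ ∈ gammaZero L.level L.halfNorm I) :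
    L.BlockIntegral I γ.toBlocks₁₁ γ.toBlocks₁₂ γ.toBlocks₂₁ γ.toBlocks₂₂ := by
  have h1 := L.halfNorm_ne_zero hm
  have h2 := different_ne_zero (K := K)
  constructor
  · intro i j
    have := (hγ.2 i j).1
    convert this using 1
    field_simp
  · intro i j
    have := (hγ.2 i j).2.1
    convert this using 1
    rw [poleIdeal]
    field_simp
  · intro i j
    have := (hγ.2 i j).2.2.1
    convert this using 1
    ring
  · exact fun i j => (hγ.2 i j).2.2.2

variable {L} {A B C D : Matrix (Fin n) (Fin n) K}

namespace QuadLattice.BlockIntegral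

variable (h : L.BlockIntegral I A B C D) (hI : ∀ j, I j ≠ 0)

include h hI

theorem mulVec_d {w : Fin n → K} (hw : w ∈ coordSubmodule I) : D *ᵥ w ∈ coordSubmodule I :=
  mulVec_mem_coordSubmodule h.d (fun i j => by
    rw [mul_assoc, inv_mul_cancel₀ (hI j), mul_one]) hw

theorem mulVec_a {w : Fin n → K} (hw : w ∈ coordSubmodule fun j => (different K * I j)⁻¹) :
    A *ᵥ w ∈ coordSubmodule fun j => (different K * I j)⁻¹ :=
  mulVec_mem_coordSubmodule h.a (fun i j => by
    have := hI j
    rw [mul_inv, mul_inv]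
    refine le_of_eq ?_
    field_simp) hw

theorem mulVec_c {w : Fin n → K} (hw : w ∈ coordSubmodule fun j => (different K * I j)⁻¹) :
    C *ᵥ w ∈ coordSubmodule fun j => L.level * L.halfNorm * I j :=
  mulVec_mem_coordSubmodule h.c (fun i j => by
    have := hI j
    have := different_ne_zero (K := K)
    refine le_of_eq ?_
    field_simp) hw

theorem dotProduct_b {z w : Fin n → K} (hz : z ∈ coordSubmodule I) (hw : w ∈ coordSubmodule I) :
    z ⬝ᵥ B *ᵥ w ∈ L.poleIdeal := by
  refine dotProduct_mem (J := I) (H := fun j => L.poleIdeal * (I j)⁻¹) (fun j => ?_) hz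
    (mulVec_mem_coordSubmodule h.b (fun i j => ?_) hw)
  · have := hI j
    refine le_of_eq ?_
    field_simp
  · have := hI j
    refine le_of_eq ?_
    field_simp

end QuadLattice.BlockIntegral

/-- The preimage of a lattice under a matrix. -/
def comapMat (D : Matrix (Fin n) (Fin n) K) (M : Submodule (𝓞 K) (Fin n → K)) :
    Submodule (𝓞 K) (Fin n → K) :=
  M.comap (D.mulVecLin.restrictScalars (𝓞 K))

theorem mem_comapMat {D : Matrix (Fin n) (Fin n) K} {M : Submodule (𝓞 K) (Fin n → K)}
    {w : Fin n → K} : w ∈ comapMat D M ↔ D *ᵥ w ∈ M := Iff.rfl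

theorem mem_tens_comapMat {D : Matrix (Fin n) (Fin n) K} (hD : IsUnit D.det)
    {S : Submodule (𝓞 K) (Fin m → K)} {M : Submodule (𝓞 K) (Fin n → K)}
    {V : Matrix (Fin m) (Fin n) K} : V ∈ tens S (comapMat D M) ↔ V * Dᵀ ∈ tens S M := by
  constructor
  · exact fun hV => mul_transpose_mem_tens (fun w hw => hw) hV
  · intro hV
    have e : V = V * Dᵀ * (D⁻¹)ᵀ := by
      rw [Matrix.mul_assoc, ← transpose_mul, nonsing_inv_mul _ hD, transpose_one, Matrix.mul_one]
    rw [e]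
    refine mul_transpose_mem_tens (fun w hw => ?_) hV
    rw [mem_comapMat, mulVec_mulVec, mul_nonsing_inv _ hD, one_mulVec]
    exact hw

end Gamma

/-! ### The Gauss sum in the transformation formula -/

section GaussTwist

variable {K : Type*} [Field K] [NumberField K] [IsTotallyReal K] {m n : ℕ} {L : QuadLattice K m}
  {I : Fin n → FracIdeal K} {A B C D : Matrix (Fin n) (Fin n) K}

theorem QuadLattice.quadExp_add_of_mem (hm : 0 < m) (h : L.BlockIntegral I A B C D)
    (hI : ∀ j, I j ≠ 0) (hr : SymplecticRelations A B C D) {V U : Matrix (Fin m) (Fin n) K}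
    (hV : V ∈ tens L.toSubmodule (comapMat D (coordSubmodule I)))
    (hU : U ∈ tens L.toSubmodule (coordSubmodule I)) :
    L.quadExp (Dᵀ * B) (V + U) = L.quadExp (Dᵀ * B) V := by
  have hs : (Dᵀ * B).IsSymm := by
    rw [Matrix.IsSymm, transpose_mul, transpose_transpose, hr.bd]
  have hs' : Dᵀ * B = (Dᵀ * B)ᵀ := hs.eq.symm
  have hN : ∀ x ∈ L.toSubmodule, L.bilin x x ∈ L.norm := fun x hx => L.bilin_self_mem_norm hx
  have key : ∀ w z, z ⬝ᵥ (Dᵀ * B) *ᵥ w = (D *ᵥ z) ⬝ᵥ B *ᵥ w := fun w z => by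
    rw [← mulVec_mulVec, dotProduct_mulVec, vecMul_transpose]
  have key' : ∀ w z, z ⬝ᵥ (Dᵀ * B) *ᵥ w = (D *ᵥ w) ⬝ᵥ B *ᵥ z := fun w z => by
    rw [← key, dotProduct_mulVec, ← mulVec_transpose, hs.eq, dotProduct_comm]
  have hNT := (L.norm_mul_poleIdeal hm).le
  rw [L.quadExp_add hs, L.quadExp_eq_one hs hN
    (fun w hw z hz => by rw [key]; exact h.dotProduct_b hI (h.mulVec_d hI hz) hw) hNT hU,
    L.expTrace_pairing_eq_one hN
    (fun w hw z hz => by rw [key']; exact h.dotProduct_b hI hw hz) hNT hV hU, mul_one, mul_one]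

theorem tens_le_comapMat (h : L.BlockIntegral I A B C D) (hI : ∀ j, I j ≠ 0) :
    tens L.toSubmodule (coordSubmodule I) ≤
      tens L.toSubmodule (comapMat D (coordSubmodule I)) :=
  tens_mono le_rfl fun _ hw => h.mulVec_d hI hw

theorem expTrace_of_mem_traceDual {Λ : Set (Matrix (Fin m) (Fin n) K)}
    {W U : Matrix (Fin m) (Fin n) K} (hW : W ∈ L.traceDual Λ) (hU : U ∈ Λ) :
    expTrace (2 * (Wᵀ * L.gram * U).trace) = 1 := by
  obtain ⟨z, hz⟩ := hW U hU
  exact expTrace_two_mul hz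

/-- The Gauss sum twisted by a dual lattice vector, by completing the square. -/
theorem QuadLattice.sum_quadExp_twist (hm : 0 < m) (h : L.BlockIntegral I A B C D)
    (hI : ∀ j, I j ≠ 0) (hr : SymplecticRelations A B C D) (hD : IsUnit D.det)
    {T : Finset (Matrix (Fin m) (Fin n) K)}
    (hT : IsTransversal (tens L.toSubmodule (comapMat D (coordSubmodule I)))
      (tens L.toSubmodule (coordSubmodule I)) T)
    {W : Matrix (Fin m) (Fin n) K} (hW : W ∈ L.traceDual (L.matLattice I)) :
    ∑ t ∈ T, L.quadExp (Dᵀ * B) t * expTrace (2 * (Wᵀ * L.gram * t).trace) =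
      L.quadExp (D⁻¹ * C) W * ∑ t ∈ T, L.quadExp (Dᵀ * B) t := by
  have hDi := nonsing_inv_mul _ hD
  have hDi' := mul_nonsing_inv _ hD
  have hs : (Dᵀ * B).IsSymm := by
    rw [Matrix.IsSymm, transpose_mul, transpose_transpose, hr.bd]
  have hW' := (L.mem_traceDual_iff hI).1 hW
  set S := D⁻¹ * C with hS
  -- the symmetry of `S`
  have hSs : Cᵀ * (D⁻¹)ᵀ = S := by
    have h1 : D * (Cᵀ * (D⁻¹)ᵀ) = C := by
      rw [← Matrix.mul_assoc, ← hr.cd, Matrix.mul_assoc, ← transpose_mul, hDi, transpose_one,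
        Matrix.mul_one]
    calc Cᵀ * (D⁻¹)ᵀ = D⁻¹ * (D * (Cᵀ * (D⁻¹)ᵀ)) := by
          rw [← Matrix.mul_assoc D⁻¹, hDi, Matrix.one_mul]
      _ = S := by rw [h1]
  have hDS : D * S = C := by rw [hS, ← Matrix.mul_assoc, hDi', Matrix.one_mul]
  have hSs' : Sᵀ = S := by rw [hS, transpose_mul, hSs]
  -- the shift
  set V₀ : Matrix (Fin m) (Fin n) K := W * S with hV₀
  have hV₀m : V₀ ∈ tens L.toSubmodule (comapMat D (coordSubmodule I)) := by
    rw [mem_tens_comapMat hD]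
    have e1 : V₀ * Dᵀ = W * Cᵀ := by
      rw [hV₀, Matrix.mul_assoc, ← hSs', ← transpose_mul, hDS]
    rw [e1]
    have hWC := mul_transpose_mem_tens (fun w hw => h.mulVec_c hI hw) hW'
    refine Submodule.map₂_le.2 (fun x hx w hw => ?_) hWC
    refine (mem_tens_coordSubmodule (A := L.coeffIdeal)).2 fun i j => ?_
    rw [vecMulVecBilin_apply_apply, vecMulVec_apply]
    have h1 := hw j
    refine FractionalIdeal.mul_induction_on (C := fun y => x i * y ∈ L.coeffIdeal i * I j) h1
      (fun a ha b hb => ?_) (fun a b ha hb => ?_)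
    · have h2 := FractionalIdeal.mul_mem_mul (L.smul_dual_mem hm hx ha i) hb
      rw [Pi.smul_apply, smul_eq_mul] at h2
      convert h2 using 1
      ring
    · rw [mul_add]
      exact Submodule.add_mem (L.coeffIdeal i * I j : FracIdeal K).coeToSubmodule ha hb
  have hper : ∀ V ∈ tens L.toSubmodule (comapMat D (coordSubmodule I)),
      ∀ U ∈ tens L.toSubmodule (coordSubmodule I),
      L.quadExp (Dᵀ * B) (V + U) * expTrace (2 * (Wᵀ * L.gram * (V + U)).trace) =
        L.quadExp (Dᵀ * B) V * expTrace (2 * (Wᵀ * L.gram * V).trace) := by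
    intro V hV U hU
    rw [L.quadExp_add_of_mem hm h hI hr hV hU, Matrix.mul_add, trace_add, mul_add, expTrace_add,
      expTrace_of_mem_traceDual hW (L.mem_matLattice_iff.2 hU), mul_one]
  rw [← hT.sum_add hper hV₀m, Finset.mul_sum]
  refine Finset.sum_congr rfl fun t ht => ?_
  have ht' := hT.1 t ht
  have hAC : L.quadExp (Aᵀ * C) W = 1 := by
    have hacs : (Aᵀ * C).IsSymm := by
      rw [Matrix.IsSymm, transpose_mul, transpose_transpose, hr.ac]
    refine L.quadExp_eq_one hacs (fun x hx => L.bilin_self_mem_dualNorm hx)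
      (T := L.level * L.halfNorm * (different K)⁻¹) (fun w hw z hz => ?_) ?_ hW'
    · have e : z ⬝ᵥ (Aᵀ * C) *ᵥ w = (A *ᵥ z) ⬝ᵥ C *ᵥ w := by
        rw [← mulVec_mulVec, dotProduct_mulVec, vecMul_transpose]
      rw [e]
      refine dotProduct_mem (fun j => ?_) (h.mulVec_a hI hz) (h.mulVec_c hI hw)
      have := hI j
      refine le_of_eq ?_
      field_simp
    · rw [← mul_assoc, L.dualNorm_mul_level_mul_halfNorm hm]
  have hAW : expTrace (2 * ((W * Aᵀ)ᵀ * L.gram * (t * Dᵀ)).trace) = 1 := by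
    refine expTrace_of_mem_traceDual (Λ := L.matLattice I) ?_ ?_
    · rw [L.mem_traceDual_iff hI]
      exact mul_transpose_mem_tens (fun w hw => h.mulVec_a hI hw) hW'
    · rw [L.mem_matLattice_iff]
      exact (mem_tens_comapMat hD).1 ht'
  -- the exponents
  have hDBS : Dᵀ * B * S = Bᵀ * C := by
    rw [← hr.bd, Matrix.mul_assoc, hDS]
  have e1 : L.pairing (Dᵀ * B) t V₀ + (Wᵀ * L.gram * t).trace =
      ((W * Aᵀ)ᵀ * L.gram * (t * Dᵀ)).trace := by
    have hDA : Dᵀ * A = 1 + Bᵀ * C := by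
      have := congrArg transpose hr.ad
      simpa [transpose_mul, transpose_add] using this
    rw [L.pairing_comm hs, L.pairing_apply, hV₀, transpose_mul, hSs']
    have e2 : (S * Wᵀ * L.gram * t * (Dᵀ * B)).trace = (Wᵀ * L.gram * t * (Bᵀ * C)).trace := by
      rw [← hDBS, Matrix.mul_assoc S, Matrix.mul_assoc S, Matrix.mul_assoc S, trace_mul_comm S]
      simp only [Matrix.mul_assoc]
    rw [e2]
    have e3 : ((W * Aᵀ)ᵀ * L.gram * (t * Dᵀ)).trace = (Wᵀ * L.gram * t * (Dᵀ * A)).trace := by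
      rw [transpose_mul, transpose_transpose, Matrix.mul_assoc A, Matrix.mul_assoc A,
        trace_mul_comm A]
      simp only [Matrix.mul_assoc]
    rw [e3, hDA, Matrix.mul_add, Matrix.mul_one, trace_add, add_comm]
  have e2 : L.pairing (Dᵀ * B) V₀ V₀ + 2 * (Wᵀ * L.gram * V₀).trace =
      L.pairing (Aᵀ * C) W W + L.pairing S W W := by
    have hAC' : Aᵀ * C = S + Cᵀ * B * S := by
      rw [← hDS, ← Matrix.mul_assoc, hr.ad, Matrix.add_mul, Matrix.one_mul, hDS]
    have hSD : S * (Dᵀ * B) = Cᵀ * B := by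
      rw [← Matrix.mul_assoc, ← hSs', ← transpose_mul, hDS]
    rw [L.pairing_apply, L.pairing_apply, L.pairing_apply, hAC', hV₀, transpose_mul, hSs']
    have e3 : (S * Wᵀ * L.gram * (W * S) * (Dᵀ * B)).trace =
        (Wᵀ * L.gram * W * (Cᵀ * B * S)).trace := by
      rw [← hSD, Matrix.mul_assoc S, Matrix.mul_assoc S, Matrix.mul_assoc S, trace_mul_comm S]
      simp only [Matrix.mul_assoc]
    rw [e3, ← Matrix.mul_assoc _ W S, Matrix.mul_add, trace_add]
    ring
  have e3 : L.pairing (Dᵀ * B) (t + V₀) (t + V₀) + 2 * (Wᵀ * L.gram * (t + V₀)).trace =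
      L.pairing (Dᵀ * B) t t + 2 * ((W * Aᵀ)ᵀ * L.gram * (t * Dᵀ)).trace +
        (L.pairing (Aᵀ * C) W W + L.pairing S W W) := by
    rw [← e1, ← e2, map_add, map_add, LinearMap.add_apply, LinearMap.add_apply,
      L.pairing_comm hs V₀ t, Matrix.mul_add, trace_add]
    ring
  unfold QuadLattice.quadExp at hAC ⊢
  rw [← expTrace_add, e3, expTrace_add, expTrace_add, expTrace_add, hAW, hAC, mul_one, one_mul,
    mul_comm]

end GaussTwist


/-! ### The transformation formula for invertible `D` -/

section Transformation

variable {K : Type*} [Field K] [NumberField K] {m n : ℕ}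

theorem conj_one (σ : K →+* ℝ) : conj σ (1 : Matrix (Fin n) (Fin n) K) = 1 := by
  ext i j
  by_cases h : i = j
  · subst h; simp [conj]
  · simp [conj, h]

theorem conj_det (σ : K →+* ℝ) (M : Matrix (Fin n) (Fin n) K) :
    (conj σ M).det = ((σ M.det : ℝ) : ℂ) :=
  (RingHom.map_det (Complex.ofRealHom.comp σ) M).symm

/-- The translate of `τ` by the conjugates of `s`. -/
def translate (s : Matrix (Fin n) (Fin n) K) (τ : MatTuple K n) : MatTuple K n :=
  fun σ => τ σ + conj σ s

theorem translate_mem {s : Matrix (Fin n) (Fin n) K} (hs : s.IsSymm) {τ : MatTuple K n}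
    (hτ : τ ∈ upperHalfSpace K n) : translate s τ ∈ upperHalfSpace K n := by
  intro σ
  constructor
  · rw [translate, Matrix.IsSymm, transpose_add, (hτ σ).1.eq, ← conj_transpose, hs.eq]
  · convert (hτ σ).2 using 1
    ext i j
    simp [translate, conj]

theorem trace_conj_mul_conj (L : QuadLattice K m) (s : Matrix (Fin n) (Fin n) K)
    (U : Matrix (Fin m) (Fin n) K) (σ : K →+* ℝ) :
    (conj σ (Uᵀ * L.gram * U) * conj σ s).trace = ((σ (L.pairing s U U) : ℝ) : ℂ) := by
  rw [← conj_mul, L.pairing_apply]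
  simp [Matrix.trace, conj]

theorem QuadLattice.thetaTerm_translate (L : QuadLattice K m) (s : Matrix (Fin n) (Fin n) K)
    (τ : MatTuple K n) (U : Matrix (Fin m) (Fin n) K) :
    L.thetaTerm (translate s τ) U = L.quadExp s U * L.thetaTerm τ U := by
  rw [thetaTerm, thetaTerm, expo, expo, quadExp, expTrace, ← Complex.exp_add]
  congr 1
  simp only [translate, Matrix.mul_add, Finset.sum_add_distrib, trace_add, trace_sum,
    trace_conj_mul_conj]
  push_cast
  ring

theorem QuadLattice.thetaTerm_mul_transpose (L : QuadLattice K m) (G : Matrix (Fin n) (Fin n) K)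
    (τ : MatTuple K n) (V : Matrix (Fin m) (Fin n) K) :
    L.thetaTerm τ (V * Gᵀ) = L.thetaTerm (fun σ => (conj σ G)ᵀ * τ σ * conj σ G) V := by
  rw [thetaTerm, thetaTerm, expo, expo, trace_sum, trace_sum]
  congr 2
  refine Finset.sum_congr rfl fun σ _ => ?_
  have e : (V * Gᵀ)ᵀ * L.gram * (V * Gᵀ) = G * (Vᵀ * L.gram * V) * Gᵀ := by
    rw [transpose_mul, transpose_transpose]
    simp only [Matrix.mul_assoc]
  rw [e, conj_mul, conj_mul, conj_transpose, Matrix.mul_assoc, Matrix.mul_assoc, trace_mul_comm]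
  simp only [Matrix.mul_assoc]

theorem congr_mem {G : Matrix (Fin n) (Fin n) K} (hG : G.det ≠ 0) {τ : MatTuple K n}
    (hτ : τ ∈ upperHalfSpace K n) :
    (fun σ => (conj σ G)ᵀ * τ σ * conj σ G) ∈ upperHalfSpace K n := by
  intro σ
  have hdet : (G.map σ).det ≠ 0 := by
    rw [← RingHom.mapMatrix_apply, ← RingHom.map_det]
    simpa using hG
  constructor
  · simp only [Matrix.IsSymm, transpose_mul, transpose_transpose, (hτ σ).1.eq, Matrix.mul_assoc]
  · have h1 : ((conj σ G)ᵀ * τ σ * conj σ G).map Complex.im =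
        (G.map σ)ᵀ * (τ σ).map Complex.im * G.map σ := by
      ext i j
      simp [conj, Matrix.mul_apply, Complex.im_sum]
    rw [h1]
    have h2 := (hτ σ).2.conjTranspose_mul_mul_same (B := G.map σ)
      (Matrix.mulVec_injective_iff_isUnit.2 ((Matrix.isUnit_iff_isUnit_det _).2
        (isUnit_iff_ne_zero.2 hdet)))
    rwa [conjTranspose_eq_transpose_of_trivial] at h2

variable [IsTotallyReal K]

theorem QuadLattice.exists_isIntegralBasis (L : QuadLattice K m) {I : Fin n → FracIdeal K}
    (hI : ∀ j, I j ≠ 0) :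
    ∃ (d : ℕ) (b : Module.Basis (Fin d) ℚ (Matrix (Fin m) (Fin n) K)),
      IsIntegralBasis b (L.matLattice I) :=
  exists_basis_matrix (fun i j => L.coeffIdeal i * I j)
    fun i j => mul_ne_zero (L.coeffIdeal_ne_zero i) (hI j)

theorem QuadLattice.summable_theta (L : QuadLattice K m) {I : Fin n → FracIdeal K}
    (hI : ∀ j, I j ≠ 0) {τ : MatTuple K n} (hτ : τ ∈ upperHalfSpace K n) :
    Summable fun U : L.matLattice I => L.thetaTerm τ (U : Matrix (Fin m) (Fin n) K) := by
  obtain ⟨d, b, hb⟩ := L.exists_isIntegralBasis hI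
  simpa using hb.summable L (c := fun _ => 1) (by simp) 0 hτ

theorem QuadLattice.differentiableOn_theta (L : QuadLattice K m) {I : Fin n → FracIdeal K}
    (hI : ∀ j, I j ≠ 0) : DifferentiableOn ℂ (L.theta I) (upperHalfSpace K n) := by
  obtain ⟨d, b, hb⟩ := L.exists_isIntegralBasis hI
  have := hb.differentiableOn L (c := fun _ => 1) (by simp) 0
  simp only [one_mul, zero_add] at this
  exact this

/-- The image of `τ` under a matrix of the group with invertible `D`, as a product of
translations, the inversion and `D`. -/
theorem denom_moebius_of_isUnit {γ : Matrix (Fin n ⊕ Fin n) (Fin n ⊕ Fin n) K}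
    (hr : SymplecticRelations γ.toBlocks₁₁ γ.toBlocks₁₂ γ.toBlocks₂₁ γ.toBlocks₂₂)
    (hD : IsUnit γ.toBlocks₂₂.det) {τ : MatTuple K n} (hτ : τ ∈ upperHalfSpace K n) :
    ∃ ρ ∈ upperHalfSpace K n, translate (γ.toBlocks₂₂⁻¹ * γ.toBlocks₂₁) ρ = negInv τ ∧
      (∀ σ, denom γ τ σ = -(conj σ γ.toBlocks₂₂ * ρ σ * τ σ)) ∧
      (fun σ => (conj σ γ.toBlocks₂₂)ᵀ * moebius γ τ σ * conj σ γ.toBlocks₂₂) =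
        translate (γ.toBlocks₂₂ᵀ * γ.toBlocks₁₂) (negInv ρ) := by
  obtain ⟨A, B, C, D, hA, hB, hC, hDd⟩ : ∃ A B C D, γ.toBlocks₁₁ = A ∧ γ.toBlocks₁₂ = B ∧
    γ.toBlocks₂₁ = C ∧ γ.toBlocks₂₂ = D := ⟨_, _, _, _, rfl, rfl, rfl, rfl⟩
  unfold moebius denom
  simp only [hA, hB, hC, hDd] at hr hD ⊢
  have hDi := nonsing_inv_mul _ hD
  have hDi' := mul_nonsing_inv _ hD
  have hSs : (D⁻¹ * C)ᵀ = D⁻¹ * C := by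
    have h1 : D * (Cᵀ * (D⁻¹)ᵀ) = C := by
      rw [← Matrix.mul_assoc, ← hr.cd, Matrix.mul_assoc, ← transpose_mul, hDi, transpose_one,
        Matrix.mul_one]
    calc (D⁻¹ * C)ᵀ = D⁻¹ * (D * (Cᵀ * (D⁻¹)ᵀ)) := by
          rw [← Matrix.mul_assoc D⁻¹, hDi, Matrix.one_mul, transpose_mul]
      _ = D⁻¹ * C := by rw [h1]
  set ρ : MatTuple K n := translate (-(D⁻¹ * C)) (negInv τ) with hρ
  have hρm : ρ ∈ upperHalfSpace K n :=
    translate_mem (by rw [Matrix.IsSymm, transpose_neg, hSs]) (negInv_mem hτ)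
  have hneg : ∀ σ, conj σ (-(D⁻¹ * C)) = -conj σ (D⁻¹ * C) := fun σ => by
    ext i j
    simp [conj]
  have hτu : ∀ σ, IsUnit (τ σ).det := fun σ =>
    isUnit_iff_ne_zero.2 (det_ne_zero_of_im_posDef (hτ σ).1 (hτ σ).2)
  have hρu : ∀ σ, IsUnit (ρ σ).det := fun σ =>
    isUnit_iff_ne_zero.2 (det_ne_zero_of_im_posDef (hρm σ).1 (hρm σ).2)
  have hden : ∀ σ, conj σ C * τ σ + conj σ D = -(conj σ D * ρ σ * τ σ) := by
    intro σ
    have h1 : conj σ D * conj σ (D⁻¹ * C) = conj σ C := by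
      rw [← conj_mul, ← Matrix.mul_assoc, hDi', Matrix.one_mul]
    have h2 : ρ σ = -(τ σ)⁻¹ - conj σ (D⁻¹ * C) := by
      rw [hρ, translate, negInv, hneg, sub_eq_add_neg]
    rw [h2, Matrix.mul_sub, h1, Matrix.sub_mul, Matrix.mul_neg, Matrix.neg_mul, Matrix.mul_assoc,
      nonsing_inv_mul _ (hτu σ), Matrix.mul_one]
    abel
  refine ⟨ρ, hρm, ?_, hden, ?_⟩
  · ext1 σ
    rw [hρ, translate, translate, hneg, neg_add_cancel_right]
  · ext1 σ
    have hDc : conj σ D * conj σ D⁻¹ = 1 := by rw [← conj_mul, hDi', conj_one]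
    have hDc' : conj σ D⁻¹ * conj σ D = 1 := by rw [← conj_mul, hDi, conj_one]
    have hinv : (conj σ C * τ σ + conj σ D)⁻¹ = -((τ σ)⁻¹ * (ρ σ)⁻¹ * conj σ D⁻¹) := by
      refine Matrix.inv_eq_left_inv ?_
      rw [hden, Matrix.neg_mul, Matrix.mul_neg, neg_neg]
      calc (τ σ)⁻¹ * (ρ σ)⁻¹ * conj σ D⁻¹ * (conj σ D * ρ σ * τ σ) =
          (τ σ)⁻¹ * ((ρ σ)⁻¹ * ((conj σ D⁻¹ * conj σ D) * (ρ σ * τ σ))) := by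
            simp only [Matrix.mul_assoc]
        _ = 1 := by
            rw [hDc', Matrix.one_mul, ← Matrix.mul_assoc _ (ρ σ), nonsing_inv_mul _ (hρu σ),
              Matrix.one_mul, nonsing_inv_mul _ (hτu σ)]
    have hnum : (conj σ D)ᵀ * (conj σ A * τ σ + conj σ B) =
        (conj σ D)ᵀ * conj σ B * conj σ D⁻¹ * (conj σ C * τ σ + conj σ D) + τ σ := by
      have h1 : (conj σ D)ᵀ * conj σ A = 1 + (conj σ B)ᵀ * conj σ C := by
        have := congrArg transpose hr.ad
        rw [transpose_mul, transpose_transpose, transpose_add, transpose_one, transpose_mul,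
          transpose_transpose] at this
        have := congrArg (conj σ) this
        rwa [conj_mul, conj_add, conj_one, conj_mul, conj_transpose, conj_transpose] at this
      have h2 : (conj σ D)ᵀ * conj σ B = (conj σ B)ᵀ * conj σ D := by
        have := congrArg (conj σ) hr.bd
        rw [conj_mul, conj_mul, conj_transpose, conj_transpose] at this
        exact this.symm
      rw [Matrix.mul_add, ← Matrix.mul_assoc, h1, h2, Matrix.mul_assoc _ (conj σ D), hDc,
        Matrix.mul_one, Matrix.mul_add, Matrix.add_mul, Matrix.one_mul, Matrix.mul_assoc]
      abel
    have hu : IsUnit (conj σ C * τ σ + conj σ D).det := by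
      rw [hden, Matrix.det_neg, det_mul, det_mul, conj_det]
      refine IsUnit.mul (IsUnit.pow _ isUnit_one.neg) (IsUnit.mul (IsUnit.mul ?_ (hρu σ)) (hτu σ))
      rw [isUnit_iff_ne_zero]
      simpa using hD.ne_zero
    calc (conj σ D)ᵀ * ((conj σ A * τ σ + conj σ B) * (conj σ C * τ σ + conj σ D)⁻¹) * conj σ D =
        ((conj σ D)ᵀ * (conj σ A * τ σ + conj σ B)) * ((conj σ C * τ σ + conj σ D)⁻¹) *
          conj σ D := by simp only [Matrix.mul_assoc]
      _ = (conj σ D)ᵀ * conj σ B * (conj σ D⁻¹ * conj σ D) +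
          τ σ * (conj σ C * τ σ + conj σ D)⁻¹ * conj σ D := by
        rw [hnum, Matrix.add_mul, Matrix.add_mul, Matrix.mul_assoc _ _ (_)⁻¹,
          mul_nonsing_inv _ hu, Matrix.mul_one, Matrix.mul_assoc _ (conj σ D⁻¹)]
      _ = _ := by
        rw [hDc', Matrix.mul_one, hinv, translate, negInv, conj_mul, conj_transpose, Matrix.mul_neg,
          Matrix.neg_mul]
        have : τ σ * ((τ σ)⁻¹ * (ρ σ)⁻¹ * conj σ D⁻¹) * conj σ D =
            (τ σ * (τ σ)⁻¹) * (ρ σ)⁻¹ * (conj σ D⁻¹ * conj σ D) := by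
          simp only [Matrix.mul_assoc]
        rw [this, hDc', Matrix.mul_one, mul_nonsing_inv _ (hτu σ), Matrix.one_mul, add_comm]

theorem negInv_negInv {τ : MatTuple K n} (hτ : τ ∈ upperHalfSpace K n) :
    negInv (negInv τ) = τ := by
  ext1 σ
  have hu : IsUnit (τ σ).det := isUnit_iff_ne_zero.2 (det_ne_zero_of_im_posDef (hτ σ).1 (hτ σ).2)
  rw [negInv, negInv]
  have : (-(τ σ)⁻¹)⁻¹ = -(τ σ) := by
    refine Matrix.inv_eq_left_inv ?_
    rw [Matrix.neg_mul, Matrix.mul_neg, neg_neg, mul_nonsing_inv _ hu]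
  rw [this, neg_neg]

/-- The transformation of the theta series under a matrix of the group with invertible `D`,
with a Gauss sum as multiplier. -/
theorem QuadLattice.slash_theta_of_isUnit {k : ℕ} (hk : 0 < 2 * k) (L : QuadLattice K (2 * k))
    {I : Fin n → FracIdeal K} (hI : ∀ j, I j ≠ 0)
    {γ : Matrix (Fin n ⊕ Fin n) (Fin n ⊕ Fin n) K} (hγ : γ ∈ gammaZero L.level L.halfNorm I)
    (hD : IsUnit γ.toBlocks₂₂.det) {T : Finset (Matrix (Fin (2 * k)) (Fin n) K)}
    (hT : IsTransversal (tens L.toSubmodule (comapMat γ.toBlocks₂₂ (coordSubmodule I)))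
      (tens L.toSubmodule (coordSubmodule I)) T)
    {τ : MatTuple K n} (hτ : τ ∈ upperHalfSpace K n) :
    slash k (L.theta I) γ τ =
      (∑ t ∈ T, L.quadExp (γ.toBlocks₂₂ᵀ * γ.toBlocks₁₂) t) *
        (((Algebra.norm ℚ γ.toBlocks₂₂.det : ℚ) : ℂ) ^ k)⁻¹ * L.theta I τ := by
  have hr := symplecticRelations hγ.1
  have h := L.blockIntegral hk hγ
  obtain ⟨ρ, hρ, hρτ, hden, hmoe⟩ := denom_moebius_of_isUnit hr hD hτ
  rw [slash]
  generalize hγτ : moebius γ τ = τ' at hmoe ⊢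
  generalize hδ : denom γ τ = δ at hden ⊢
  generalize γ.toBlocks₁₁ = A at h hr
  generalize γ.toBlocks₁₂ = B at h hr hmoe ⊢
  generalize γ.toBlocks₂₁ = C at h hr hρτ
  generalize γ.toBlocks₂₂ = D at h hr hρτ hD hmoe hden hT ⊢
  have hDi := nonsing_inv_mul _ hD
  have hDi' := mul_nonsing_inv _ hD
  have hDc : ∀ σ, conj σ D * conj σ D⁻¹ = 1 := fun σ => by rw [← conj_mul, hDi', conj_one]
  have hs : (Dᵀ * B).IsSymm := by
    rw [Matrix.IsSymm, transpose_mul, transpose_transpose, hr.bd]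
  have hτ' : τ' ∈ upperHalfSpace K n := by
    have h1 := congr_mem (G := D⁻¹) (by
      rw [← isUnit_iff_ne_zero, isUnit_nonsing_inv_det_iff]; exact hD)
      (translate_mem hs (negInv_mem hρ))
    rw [← hmoe] at h1
    convert h1 using 1
    ext1 σ
    have h2 : (conj σ D⁻¹)ᵀ * (conj σ D)ᵀ = 1 := by rw [← transpose_mul, hDc, transpose_one]
    calc τ' σ = ((conj σ D⁻¹)ᵀ * (conj σ D)ᵀ) * τ' σ * (conj σ D * conj σ D⁻¹) := by
          rw [h2, hDc, Matrix.one_mul, Matrix.mul_one]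
      _ = _ := by simp only [Matrix.mul_assoc]
  set X := tens L.toSubmodule (comapMat D (coordSubmodule I)) with hX
  set Y := tens L.toSubmodule (coordSubmodule I) with hY
  have hΛ : L.matLattice I = (Y : Set (Matrix (Fin (2 * k)) (Fin n) K)) := by
    ext U
    exact L.mem_matLattice_iff
  obtain ⟨d, b, hb⟩ := L.exists_isIntegralBasis hI
  obtain ⟨c, hc, hinv⟩ := hb.exists_inversion L
  -- the change of variables `U = V ᵗD`
  let e : X ≃ L.matLattice I :=
    { toFun := fun V => ⟨V.1 * Dᵀ, L.mem_matLattice_iff.2 ((mem_tens_comapMat hD).1 V.2)⟩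
      invFun := fun U => ⟨U.1 * (D⁻¹)ᵀ, (mem_tens_comapMat hD).2 (by
        rw [Matrix.mul_assoc, ← transpose_mul, hDi', transpose_one, Matrix.mul_one]
        exact L.mem_matLattice_iff.1 U.2)⟩
      left_inv := fun V => Subtype.ext (by
        change V.1 * Dᵀ * (D⁻¹)ᵀ = V.1
        rw [Matrix.mul_assoc, ← transpose_mul, hDi, transpose_one, Matrix.mul_one])
      right_inv := fun U => Subtype.ext (by
        change U.1 * (D⁻¹)ᵀ * Dᵀ = U.1
        rw [Matrix.mul_assoc, ← transpose_mul, hDi', transpose_one, Matrix.mul_one]) }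
  have he : ∀ V : X, L.thetaTerm τ' (e V).1 =
      L.quadExp (Dᵀ * B) V.1 * L.thetaTerm (negInv ρ) V.1 := by
    intro V
    change L.thetaTerm τ' (V.1 * Dᵀ) = _
    rw [L.thetaTerm_mul_transpose, hmoe, L.thetaTerm_translate]
  have h1 : L.theta I τ' = ∑ t ∈ T, L.quadExp (Dᵀ * B) t *
      (c * (∏ σ : K →+* ℝ, (-Complex.I • ρ σ).det) ^ k * L.dualTheta (L.matLattice I) t ρ) := by
    rw [QuadLattice.theta, ← e.tsum_eq]
    simp only [he]
    have hsum := e.summable_iff.2 (L.summable_theta hI hτ')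
    rw [hT.tsum_eq (tens_le_comapMat h hI)
      (f := fun V => L.quadExp (Dᵀ * B) V * L.thetaTerm (negInv ρ) V) (hsum.congr fun V => he V)]
    refine Finset.sum_congr rfl fun t ht => ?_
    rw [← hinv ρ hρ t, ← tsum_mul_left]
    have h2 : ∀ U : Y, L.quadExp (Dᵀ * B) (t + U) * L.thetaTerm (negInv ρ) (t + U) =
        L.quadExp (Dᵀ * B) t * L.thetaTerm (negInv ρ) (t + U) := fun U => by
      rw [L.quadExp_add_of_mem hk h hI hr (hT.1 t ht) U.2]
    simp only [h2]
    exact ((Equiv.setCongr hΛ).tsum_eq fun U : Y =>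
      L.quadExp (Dᵀ * B) t * L.thetaTerm (negInv ρ) (t + U.1)).symm
  have h2 : ∑ t ∈ T, L.quadExp (Dᵀ * B) t * L.dualTheta (L.matLattice I) t ρ =
      (∑ t ∈ T, L.quadExp (Dᵀ * B) t) * L.dualTheta (L.matLattice I) 0 (negInv τ) := by
    have hsum : ∀ t : Matrix (Fin (2 * k)) (Fin n) K,
        Summable fun W : L.traceDual (L.matLattice I) =>
          expTrace (2 * ((W : Matrix (Fin (2 * k)) (Fin n) K)ᵀ * L.gram * t).trace) *
            L.thetaTerm ρ W := fun t => by
      have := (hb.dual L).summable L (c := fun W : L.traceDual (L.matLattice I) =>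
        expTrace (2 * ((W : Matrix (Fin (2 * k)) (Fin n) K)ᵀ * L.gram * t).trace))
        (fun W => (norm_expTrace _).le) 0 hρ
      simpa using this
    simp only [QuadLattice.dualTheta]
    rw [Finset.sum_congr rfl fun t _ => (tsum_mul_left (a := L.quadExp (Dᵀ * B) t)).symm,
      ← Summable.tsum_finsetSum fun t _ => (hsum t).mul_left _, ← tsum_mul_left]
    refine tsum_congr fun W => ?_
    rw [← hρτ, L.thetaTerm_translate, Matrix.mul_zero, trace_zero, mul_zero, expTrace_zero, one_mul,
      ← mul_assoc, mul_comm (Finset.sum _ _), ← L.sum_quadExp_twist hk h hI hr hD hT W.2,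
      Finset.sum_mul]
    exact Finset.sum_congr rfl fun t _ => (mul_assoc _ _ _).symm
  have h3 : L.theta I τ = c * (∏ σ : K →+* ℝ, (-Complex.I • negInv τ σ).det) ^ k *
      L.dualTheta (L.matLattice I) 0 (negInv τ) := by
    rw [← hinv _ (negInv_mem hτ) 0, negInv_negInv hτ]
    simp only [zero_add, QuadLattice.theta]
  have hτu : ∀ σ, IsUnit (τ σ).det := fun σ =>
    isUnit_iff_ne_zero.2 (det_ne_zero_of_im_posDef (hτ σ).1 (hτ σ).2)
  have hdet : (∏ σ, (δ σ).det) * ∏ σ : K →+* ℝ, (-Complex.I • negInv τ σ).det =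
      ((Algebra.norm ℚ D.det : ℚ) : ℂ) * ∏ σ : K →+* ℝ, (-Complex.I • ρ σ).det := by
    have hN : ((Algebra.norm ℚ D.det : ℚ) : ℂ) = ∏ σ : K →+* ℝ, (conj σ D).det := by
      have := congrArg (Complex.ofReal) (prod_embeddings D.det)
      push_cast at this
      simp only [conj_det]
      exact_mod_cast this.symm
    rw [hN, ← Finset.prod_mul_distrib, ← Finset.prod_mul_distrib]
    refine Finset.prod_congr rfl fun σ _ => ?_
    rw [← det_mul, ← det_mul, hden]
    congr 1
    rw [negInv, Matrix.mul_smul, Matrix.mul_smul, Matrix.neg_mul, Matrix.mul_neg, neg_neg,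
      Matrix.mul_assoc _ (τ σ), mul_nonsing_inv _ (hτu σ), Matrix.mul_one]
  have hδ0 : ∏ σ, (δ σ).det ≠ 0 := by
    refine Finset.prod_ne_zero_iff.2 fun σ _ => ?_
    rw [hden, Matrix.det_neg, det_mul, det_mul, conj_det]
    refine mul_ne_zero (by simp) (mul_ne_zero (mul_ne_zero ?_ ?_) (hτu σ).ne_zero)
    · simpa using hD.ne_zero
    · exact det_ne_zero_of_im_posDef (hρ σ).1 (hρ σ).2
  have hN0 : ((Algebra.norm ℚ D.det : ℚ) : ℂ) ≠ 0 := by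
    simpa [Algebra.norm_eq_zero_iff] using hD.ne_zero
  have h4 : ∑ t ∈ T, L.quadExp (Dᵀ * B) t *
      (c * (∏ σ : K →+* ℝ, (-Complex.I • ρ σ).det) ^ k * L.dualTheta (L.matLattice I) t ρ) =
      c * (∏ σ : K →+* ℝ, (-Complex.I • ρ σ).det) ^ k *
        ∑ t ∈ T, L.quadExp (Dᵀ * B) t * L.dualTheta (L.matLattice I) t ρ := by
    rw [Finset.mul_sum]
    exact Finset.sum_congr rfl fun t _ => by ring
  rw [h1, h4, h2, h3]
  have hdet' := congrArg (· ^ k) hdet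
  simp only [mul_pow] at hdet'
  have hδk := pow_ne_zero k hδ0
  have hNk := pow_ne_zero k hN0
  field_simp
  linear_combination -(∑ t ∈ T, L.quadExp (Dᵀ * B) t) *
    L.dualTheta (L.matLattice I) 0 (negInv τ) * hdet'

end Transformation


/-! ### Gauss sums of quadratic forms over finite fields -/

section FiniteField

variable {F : Type*} [Field F] [Fintype F] [DecidableEq F]

omit [Fintype F] [DecidableEq F] in
theorem addChar_sum (ψ : AddChar F ℂ) {ι : Type*} (s : Finset ι) (f : ι → F) :
    ψ (∑ i ∈ s, f i) = ∏ i ∈ s, ψ (f i) := by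
  induction s using Finset.cons_induction with
  | empty => simp
  | cons i s hi ih => rw [Finset.sum_cons, Finset.prod_cons, AddChar.map_add_eq_mul, ih]

theorem sum_addChar_mul {ψ : AddChar F ℂ} (hψ : ψ ≠ 1) (b : F) :
    ∑ x, ψ (x * b) = if b = 0 then (Fintype.card F : ℂ) else 0 := by
  rw [AddChar.sum_mulShift b (AddChar.IsPrimitive.of_ne_one hψ)]
  split_ifs <;> simp

theorem sum_addChar_sq_mul {ψ : AddChar F ℂ} (hψ : ψ ≠ 1) [CharP F 2] (b : F) :
    ∑ x, ψ (x ^ 2 * b) = if b = 0 then (Fintype.card F : ℂ) else 0 := by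
  rw [← sum_addChar_mul hψ b]
  exact (frobeniusEquiv F 2).toEquiv.sum_comp fun x => ψ (x * b)

/-- The Gauss sum of a nondegenerate binary form `a x² + b x y + c y²` in characteristic two. -/
theorem sum_binary {ψ : AddChar F ℂ} (hψ : ψ ≠ 1) [CharP F 2] (a c : F) {b : F} (hb : b ≠ 0) :
    ∑ x, ∑ y, ψ (a * x ^ 2 + b * x * y + c * y ^ 2) =
      Fintype.card F * (if ∃ y, y ^ 2 + y + a * c / b ^ 2 = 0 then 1 else -1 : ℂ) := by
  have h1 : ∀ y, ∑ x, ψ (a * x ^ 2 + b * x * y + c * y ^ 2) =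
      ∑ z, ψ (y ^ 2 * (a * z ^ 2 + b * z + c)) +
        if y = 0 then ∑ x, ψ (a * x ^ 2) - (Fintype.card F : ℂ) else 0 := by
    intro y
    split_ifs with hy
    · subst hy
      simp
    · rw [add_zero]
      rw [← Equiv.sum_comp (Equiv.mulLeft₀ y hy)]
      refine Finset.sum_congr rfl fun z _ => ?_
      congr 1
      change a * (y * z) ^ 2 + b * (y * z) * y + c * y ^ 2 = _
      ring
  rw [Finset.sum_comm, Finset.sum_congr rfl fun y _ => h1 y, Finset.sum_add_distrib,
    Finset.sum_ite_eq' Finset.univ (0 : F), if_pos (Finset.mem_univ _), Finset.sum_comm,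
    Finset.sum_congr rfl fun z _ => sum_addChar_sq_mul hψ _, ← Finset.sum_filter, Finset.sum_const,
    nsmul_eq_mul]
  have h2 : ∑ x, ψ (a * x ^ 2) = if a = 0 then (Fintype.card F : ℂ) else 0 := by
    rw [← sum_addChar_sq_mul hψ]
    simp only [mul_comm]
  rw [h2]
  have h20 : (2 : F) = 0 := CharTwo.two_eq_zero
  by_cases ha : a = 0
  · subst ha
    have h3 : (Finset.univ.filter fun z : F => 0 * z ^ 2 + b * z + c = 0) = {-c / b} := by
      ext z
      rw [Finset.mem_filter, Finset.mem_singleton, eq_div_iff hb]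
      constructor
      · rintro ⟨-, h⟩
        linear_combination h
      · intro h
        exact ⟨Finset.mem_univ _, by linear_combination h⟩
    rw [h3, if_pos rfl, if_pos ⟨0, by simp⟩]
    simp
  · rw [if_neg ha]
    split_ifs with hy
    · obtain ⟨y, hy⟩ := hy
      have h3 : (Finset.univ.filter fun z : F => a * z ^ 2 + b * z + c = 0) =
          {b * y / a, b * (y + 1) / a} := by
        ext z
        rw [Finset.mem_filter, Finset.mem_insert, Finset.mem_singleton, eq_div_iff ha,
          eq_div_iff ha]
        have h4 : a * (a * z ^ 2 + b * z + c) = (z * a - b * y) * (z * a - b * (y + 1)) := by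
          field_simp at hy
          linear_combination hy + (z * a * b * (1 + y) - b ^ 2 * y ^ 2 - b ^ 2 * y) * h20
        constructor
        · rintro ⟨-, h⟩
          rw [h, mul_zero, eq_comm, mul_eq_zero, sub_eq_zero, sub_eq_zero] at h4
          exact h4
        · intro h
          refine ⟨Finset.mem_univ _, ?_⟩
          rw [← sub_eq_zero, ← sub_eq_zero (b := b * (y + 1)), ← mul_eq_zero, ← h4] at h
          exact (mul_eq_zero.1 h).resolve_left ha
      have h5 : b * y / a ≠ b * (y + 1) / a := by
        intro h
        rw [div_left_inj' ha, mul_right_inj' hb] at h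
        simp at h
      rw [h3, Finset.card_pair h5]
      push_cast
      ring
    · have h3 : (Finset.univ.filter fun z : F => a * z ^ 2 + b * z + c = 0) = ∅ := by
        refine Finset.filter_eq_empty_iff.2 fun z _ h => hy ⟨a * z / b, ?_⟩
        field_simp
        linear_combination a * h
      rw [h3]
      simp

/-- The Gauss sum of a nondegenerate quadratic form of even rank over a finite field of odd
characteristic. -/
theorem sum_quadratic_of_odd (hF : ringChar F ≠ 2) {ψ : AddChar F ℂ} (hψ : ψ ≠ 1) (k : ℕ)
    (N : Matrix (Fin (2 * k)) (Fin (2 * k)) F) (hN : (N + Nᵀ).det ≠ 0) :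
    ∑ c : Fin (2 * k) → F, ψ (c ⬝ᵥ N *ᵥ c) =
      (Fintype.card F : ℂ) ^ k * (quadraticChar F ((-1) ^ k * (N + Nᵀ).det) : ℤ) := by
  have h2 : (2 : F) ≠ 0 := Ring.two_ne_zero hF
  let : Invertible (2 : F) := invertibleOfNonzero h2
  set B : LinearMap.BilinForm F (Fin (2 * k) → F) := Matrix.toBilin' (N + Nᵀ) with hB
  have hBapp : ∀ v w, B v w = v ⬝ᵥ (N + Nᵀ) *ᵥ w := fun v w => Matrix.toBilin'_apply' _ v w
  have hBs : LinearMap.IsSymm B := ⟨fun v w => by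
    rw [RingHom.id_apply, hBapp, hBapp, dotProduct_mulVec, ← mulVec_transpose, dotProduct_comm,
      transpose_add, transpose_transpose, add_comm]⟩
  obtain ⟨v, hv⟩ := LinearMap.BilinForm.exists_orthogonal_basis hBs
  obtain ⟨e, he⟩ : ∃ e : Module.Basis (Fin (2 * k)) F (Fin (2 * k) → F), ∀ i j, i ≠ j →
      B (e i) (e j) = 0 := by
    refine ⟨v.reindex (finCongr (by simp)), fun i j hij => ?_⟩
    rw [v.reindex_apply, v.reindex_apply]
    exact hv fun h => hij (by simpa using h)
  set w : Fin (2 * k) → F := fun i => B (e i) (e i) with hw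
  have hdiag : LinearMap.BilinForm.toMatrix e B = diagonal w := by
    ext i j
    rw [LinearMap.BilinForm.toMatrix_apply]
    by_cases hij : i = j
    · subst hij; simp [hw]
    · rw [he i j hij, diagonal_apply_ne _ hij]
  obtain ⟨E, hE⟩ : ∃ E : Matrix (Fin (2 * k)) (Fin (2 * k)) F, Eᵀ * (N + Nᵀ) * E = diagonal w := by
    refine ⟨(Pi.basisFun F (Fin (2 * k))).toMatrix e, ?_⟩
    rw [← hdiag, ← LinearMap.BilinForm.toMatrix_mul_basis_toMatrix (Pi.basisFun F _) e B,
      LinearMap.BilinForm.toMatrix_basisFun, hB, LinearMap.BilinForm.toMatrix'_toBilin']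
  have hdet : E.det ^ 2 * (N + Nᵀ).det = ∏ i, w i := by
    rw [← det_diagonal, ← hE, det_mul, det_mul, det_transpose]
    ring
  have hdetE : E.det ≠ 0 := by
    intro h0
    have h3 := (LinearMap.BilinForm.toMatrix_mul_basis_toMatrix e (Pi.basisFun F _) B)
    rw [hdiag, LinearMap.BilinForm.toMatrix_basisFun, hB, LinearMap.BilinForm.toMatrix'_toBilin']
      at h3
    apply hN
    rw [← h3, det_mul, det_mul, det_diagonal, ← hdet, h0]
    ring
  have hw0 : ∀ i, w i ≠ 0 := by
    have : ∏ i, w i ≠ 0 := by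
      rw [← hdet]
      exact mul_ne_zero (pow_ne_zero 2 hdetE) hN
    exact fun i => Finset.prod_ne_zero_iff.1 this i (Finset.mem_univ i)
  -- the form in the orthogonal basis
  have hform : ∀ y : Fin (2 * k) → F, e.equivFun.symm y ⬝ᵥ N *ᵥ e.equivFun.symm y =
      ∑ i, y i ^ 2 * (w i / 2) := by
    intro y
    set c := e.equivFun.symm y with hc
    have h3 : B c c = 2 * (c ⬝ᵥ N *ᵥ c) := by
      rw [hBapp, add_mulVec, dotProduct_add, dotProduct_mulVec c Nᵀ, vecMul_transpose,
        dotProduct_comm (N *ᵥ c)]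
      ring
    have h4 : B c c = ∑ i, y i ^ 2 * w i := by
      rw [hc, e.equivFun_symm_apply]
      simp only [map_sum, LinearMap.sum_apply, map_smul, LinearMap.smul_apply, smul_eq_mul]
      refine Finset.sum_congr rfl fun i _ => ?_
      rw [Finset.sum_eq_single i (fun j _ hj => by rw [he j i hj]; simp)
        (fun h => absurd (Finset.mem_univ i) h)]
      ring
    have h5 : c ⬝ᵥ N *ᵥ c = B c c / 2 := by
      rw [h3]
      field_simp
    rw [h5, h4, Finset.sum_div]
    exact Finset.sum_congr rfl fun i _ => by ring
  set χ : MulChar F ℂ := (quadraticChar F).ringHomComp (Int.castRingHom ℂ) with hχ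
  have hχq : χ.IsQuadratic := (quadraticChar_isQuadratic F).comp _
  have hχ1 : χ ≠ 1 := by
    intro h
    apply quadraticChar_ne_one hF
    ext a
    have := congrArg (fun f : MulChar F ℂ => f a) h
    simpa [hχ, MulChar.ringHomComp_apply] using this
  have hone : ∀ a : F, a ≠ 0 → ∑ y, ψ (y ^ 2 * a) = χ a * gaussSum χ ψ := by
    intro a ha
    have h3 : ∑ y, ψ (y ^ 2 * a) = ∑ b, (χ b + 1) * ψ (b * a) := by
      rw [← Finset.sum_fiberwise Finset.univ (fun y : F => y ^ 2)]
      refine Finset.sum_congr rfl fun b _ => ?_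
      rw [Finset.sum_congr rfl fun y hy => by rw [(Finset.mem_filter.1 hy).2], Finset.sum_const,
        nsmul_eq_mul]
      congr 1
      have := quadraticChar_card_sqrts hF b
      rw [hχ, MulChar.ringHomComp_apply, eq_intCast]
      rw [Set.toFinset_ofPred] at this
      exact_mod_cast congrArg (Int.cast : ℤ → ℂ) this
    rw [h3]
    simp only [add_mul, one_mul, Finset.sum_add_distrib]
    rw [sum_addChar_mul hψ, if_neg ha, add_zero, gaussSum, Finset.mul_sum,
      ← Equiv.sum_comp (Equiv.mulRight₀ a ha) fun x => χ a * (χ x * ψ x)]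
    refine Finset.sum_congr rfl fun b _ => ?_
    change _ = χ a * (χ (b * a) * ψ (b * a))
    rw [map_mul χ, show χ a * (χ b * χ a * ψ (b * a)) = (χ a) ^ 2 * (χ b * ψ (b * a)) by ring]
    have : (χ a) ^ 2 = 1 := by
      rcases hχq a with h | h | h
      · rw [hχ, MulChar.ringHomComp_apply, eq_intCast, Int.cast_eq_zero,
          quadraticChar_eq_zero_iff] at h
        exact absurd h ha
      · rw [h]; norm_num
      · rw [h]; norm_num
    rw [this, one_mul]
  rw [← e.equivFun.symm.toEquiv.sum_comp]
  have h6 : ∀ y : Fin (2 * k) → F, ψ (e.equivFun.symm.toEquiv y ⬝ᵥ N *ᵥ e.equivFun.symm.toEquiv y) =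
      ∏ i, ψ (y i ^ 2 * (w i / 2)) := by
    intro y
    rw [← addChar_sum, ← hform]
    rfl
  rw [Finset.sum_congr rfl fun y _ => h6 y]
  have h7 := Finset.prod_univ_sum (fun _ : Fin (2 * k) => (Finset.univ : Finset F))
    fun i x => ψ (x ^ 2 * (w i / 2))
  rw [Fintype.piFinset_univ] at h7
  rw [← h7, Finset.prod_congr rfl fun i _ => hone _ (div_ne_zero (hw0 i) h2), Finset.prod_mul_distrib,
    Finset.prod_const, Finset.card_univ, Fintype.card_fin, ← map_prod, pow_mul,
    gaussSum_sq hχ1 hχq (AddChar.IsPrimitive.of_ne_one hψ), mul_pow, ← map_pow]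
  have h8 : ∏ i, w i / 2 = (E.det / 2 ^ k) ^ 2 * (N + Nᵀ).det := by
    rw [Finset.prod_div_distrib, ← hdet, Finset.prod_const, Finset.card_univ, Fintype.card_fin]
    field_simp
    ring
  have h9 : χ ((E.det / 2 ^ k) ^ 2) = 1 := by
    rw [hχ, MulChar.ringHomComp_apply, quadraticChar_sq_one' (div_ne_zero hdetE (pow_ne_zero k h2))]
    simp
  rw [h8, map_mul, h9, one_mul, ← eq_intCast (Int.castRingHom ℂ), ← MulChar.ringHomComp_apply,
    ← hχ, map_mul]
  ring

end FiniteField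


/-! ### Splitting off planes in residue characteristic two -/

section Plane

/-- Completing the square: the orthogonal complement of a unimodular block. -/
theorem sumElim_form {R : Type*} [CommRing R] {ι κ : Type*} [Fintype ι] [Fintype κ]
    {N₁₁ : Matrix ι ι R} {N₁₂ : Matrix ι κ R} {N₂₁ : Matrix κ ι R} (N₂₂ : Matrix κ κ R)
    {Q : Matrix ι κ R} (hQ : (N₁₁ + N₁₁ᵀ) * Q = N₁₂ + N₂₁ᵀ) (v : ι → R) (w : κ → R) :
    Sum.elim (v - Q *ᵥ w) w ⬝ᵥ fromBlocks N₁₁ N₁₂ N₂₁ N₂₂ *ᵥ Sum.elim (v - Q *ᵥ w) w =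
      v ⬝ᵥ N₁₁ *ᵥ v + w ⬝ᵥ (N₂₂ - Qᵀ * N₁₁ᵀ * Q) *ᵥ w := by
  set q := Q *ᵥ w with hq
  have h1 : ∀ u : ι → R, u ⬝ᵥ (N₁₁ + N₁₁ᵀ) *ᵥ q = u ⬝ᵥ (N₁₂ + N₂₁ᵀ) *ᵥ w := fun u => by
    rw [hq, mulVec_mulVec, hQ]
  have h2 : w ⬝ᵥ (Qᵀ * N₁₁ᵀ * Q) *ᵥ w = q ⬝ᵥ N₁₁ᵀ *ᵥ q := by
    rw [← mulVec_mulVec, ← mulVec_mulVec, ← hq, dotProduct_mulVec, vecMul_transpose]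
  have h3 : ∀ u : ι → R, w ⬝ᵥ N₂₁ *ᵥ u = u ⬝ᵥ N₂₁ᵀ *ᵥ w := fun u => by
    rw [mulVec_transpose, dotProduct_mulVec, dotProduct_comm]
  have h4 : ∀ u z : ι → R, u ⬝ᵥ N₁₁ᵀ *ᵥ z = z ⬝ᵥ N₁₁ *ᵥ u := fun u z => by
    rw [mulVec_transpose, dotProduct_comm, dotProduct_mulVec]
  rw [fromBlocks_mulVec, sumElim_dotProduct_sumElim, sub_mulVec, dotProduct_sub, h2]
  simp only [Sum.elim_comp_inl, Sum.elim_comp_inr, dotProduct_add, mulVec_sub, dotProduct_sub,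
    sub_dotProduct]
  have e1 := h1 v
  have e2 := h1 q
  simp only [add_mulVec, dotProduct_add, h4] at e1 e2 ⊢
  rw [h3, h3]
  linear_combination e2 - e1

/-- The Gauss sum of a nondegenerate quadratic form of even rank over the residue field, in residue
characteristic two. Its sign is multiplicative over the planes into which the form splits; the sign
of a plane is a function `sgn` of the discriminant of a lift. -/
theorem sum_quadratic_of_even {A F : Type*} [CommRing A] [Field F] [Fintype F] [DecidableEq F]
    [CharP F 2] {ψ : AddChar F ℂ} (hψ : ψ ≠ 1) (π : A →+* F) (hπ : ∀ x, π x ≠ 0 → IsUnit x)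
    (sgn : Aˣ →* ℤˣ)
    (hsgn : ∀ (u : Aˣ) (a b c : A), (u : A) = b ^ 2 - 4 * (a * c) →
      sgn u = if ∃ y : F, y ^ 2 + y + π a * π c / π b ^ 2 = 0 then 1 else -1) (k : ℕ) :
    ∀ (ι : Type) [Fintype ι] [DecidableEq ι], Fintype.card ι = 2 * k → ∀ (N : Matrix ι ι A)
      (u : Aˣ), (u : A) = (-1) ^ k * (N + Nᵀ).det →
      ∑ c : ι → F, ψ (c ⬝ᵥ N.map π *ᵥ c) = (Fintype.card F : ℂ) ^ k * ((sgn u : ℤ) : ℂ) := by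
  have h20 : (2 : F) = 0 := CharTwo.two_eq_zero
  induction k with
  | zero =>
    intro ι _ _ hι N u hu
    have : IsEmpty ι := Fintype.card_eq_zero_iff.1 hι
    have hu1 : u = 1 := by
      ext
      rw [hu]
      simp
    rw [hu1]
    simp [dotProduct]
  | succ k ih =>
    intro ι _ _ hι N u hu
    have hdet : IsUnit (N + Nᵀ).det := by
      have : IsUnit ((-1) ^ (k + 1) * (N + Nᵀ).det) := hu ▸ u.isUnit
      exact isUnit_of_mul_isUnit_right this
    -- a unimodular plane
    have : Nonempty ι := Fintype.card_pos_iff.1 (by lia)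
    obtain ⟨i⟩ := this
    obtain ⟨j, hj⟩ : ∃ j, π ((N + Nᵀ) i j) ≠ 0 := by
      by_contra! h
      have h1 : π (N + Nᵀ).det = 0 := by
        rw [RingHom.map_det]
        exact det_eq_zero_of_row_eq_zero i h
      exact (hdet.map π).ne_zero h1
    have hij : i ≠ j := by
      rintro rfl
      apply hj
      rw [Matrix.add_apply, transpose_apply, ← two_mul, map_mul, map_ofNat, h20, zero_mul]
    let f : Fin 2 → ι := ![i, j]
    have hf : Function.Injective f := by
      intro a b hab
      fin_cases a <;> fin_cases b <;> simp_all [f]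
    let κ : Type := ((Set.range f)ᶜ : Set ι)
    let e : Fin 2 ⊕ κ ≃ ι := (Equiv.sumCongr (Equiv.ofInjective f hf) (Equiv.refl _)).trans
      (Equiv.Set.sumCompl (Set.range f))
    have he : ∀ a, e (Sum.inl a) = f a := fun a => rfl
    have hκ : Fintype.card κ = 2 * k := by
      have := Fintype.card_congr e
      rw [Fintype.card_sum, Fintype.card_fin, hι] at this
      lia
    set M := N.submatrix e e with hM
    have hMdet : (M + Mᵀ).det = (N + Nᵀ).det := by
      rw [← det_submatrix_equiv_self e (N + Nᵀ)]
      rfl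
    have hsum : ∑ c : ι → F, ψ (c ⬝ᵥ N.map π *ᵥ c) =
        ∑ c : Fin 2 ⊕ κ → F, ψ (c ⬝ᵥ M.map π *ᵥ c) := by
      rw [← (Equiv.arrowCongr e (Equiv.refl F)).sum_comp]
      refine Finset.sum_congr rfl fun c _ => ?_
      congr 1
      simp only [dotProduct, mulVec]
      rw [← e.sum_comp]
      refine Finset.sum_congr rfl fun a _ => ?_
      rw [← e.sum_comp]
      simp [hM]
    obtain ⟨N₁₁, N₁₂, N₂₁, N₂₂, hblock⟩ : ∃ N₁₁ N₁₂ N₂₁ N₂₂, M = fromBlocks N₁₁ N₁₂ N₂₁ N₂₂ :=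
      ⟨_, _, _, _, (fromBlocks_toBlocks M).symm⟩
    have hP : IsUnit (N₁₁ + N₁₁ᵀ).det := by
      apply hπ
      have h1 : π (N₁₁ 0 1 + N₁₁ 1 0) ≠ 0 := by
        have h2 : N₁₁ 0 1 = N i j := by
          have := congrFun (congrFun hblock (Sum.inl 0)) (Sum.inl 1)
          rw [fromBlocks_apply₁₁] at this
          exact this.symm
        have h3 : N₁₁ 1 0 = N j i := by
          have := congrFun (congrFun hblock (Sum.inl 1)) (Sum.inl 0)
          rw [fromBlocks_apply₁₁] at this
          exact this.symm
        rw [h2, h3]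
        exact hj
      rw [det_fin_two]
      simp only [Matrix.add_apply, transpose_apply, map_sub, map_mul]
      rw [← two_mul, map_mul, map_ofNat, h20, zero_mul, zero_mul, zero_sub, add_comm (N₁₁ 1 0)]
      exact neg_ne_zero.2 (mul_ne_zero h1 h1)
    set Q := (N₁₁ + N₁₁ᵀ)⁻¹ * (N₁₂ + N₂₁ᵀ) with hQdef
    have hQ : (N₁₁ + N₁₁ᵀ) * Q = N₁₂ + N₂₁ᵀ := by
      rw [hQdef, ← Matrix.mul_assoc, mul_nonsing_inv _ hP, Matrix.one_mul]
    clear_value Q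
    set N' := N₂₂ - Qᵀ * N₁₁ᵀ * Q with hN'
    have hdet2 : (M + Mᵀ).det = (N₁₁ + N₁₁ᵀ).det * (N' + N'ᵀ).det := by
      let : Invertible (N₁₁ + N₁₁ᵀ) := invertibleOfIsUnitDet _ hP
      rw [hblock, fromBlocks_transpose, fromBlocks_add, det_fromBlocks₁₁, invOf_eq_nonsing_inv]
      congr 2
      have h1 : N₂₁ + N₁₂ᵀ = Qᵀ * (N₁₁ + N₁₁ᵀ) := by
        have := congrArg transpose hQ
        rw [transpose_mul, transpose_add, transpose_add, transpose_transpose, transpose_transpose,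
          add_comm N₁₁ᵀ, add_comm N₁₂ᵀ] at this
        exact this.symm
      rw [h1, Matrix.mul_assoc, Matrix.mul_assoc, ← hQdef, hN', transpose_sub, transpose_mul,
        transpose_mul, transpose_transpose, transpose_transpose, Matrix.add_mul, Matrix.mul_add,
        Matrix.mul_assoc]
      abel
    -- the discriminants of the plane and of its complement
    obtain ⟨p, hp⟩ := hP
    have hu' : IsUnit ((-1) ^ k * (N' + N'ᵀ).det) := by
      rw [← hMdet, hdet2] at hdet
      exact (isUnit_one.neg.pow k).mul (isUnit_of_mul_isUnit_right hdet)
    obtain ⟨u', hu'⟩ := hu'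
    have huu : u = -p * u' := by
      ext
      rw [hu, Units.val_mul, Units.val_neg, hp, hu', ← hMdet, hdet2, pow_succ]
      ring
    have hplane := hsgn (-p) (N₁₁ 0 0) (N₁₁ 0 1 + N₁₁ 1 0) (N₁₁ 1 1) (by
      rw [Units.val_neg, hp, det_fin_two]
      simp only [Matrix.add_apply, transpose_apply]
      ring)
    have hb : π (N₁₁ 0 1 + N₁₁ 1 0) ≠ 0 := by
      intro h0
      have h1 := ((-p).isUnit.map π).ne_zero
      apply h1
      rw [Units.val_neg, hp, det_fin_two]
      simp only [Matrix.add_apply, transpose_apply, map_sub, map_neg, map_mul]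
      rw [← two_mul, map_mul, map_ofNat, h20, h0]
      ring
    have hQF : (N₁₁.map π + (N₁₁.map π)ᵀ) * Q.map π = N₁₂.map π + (N₂₁.map π)ᵀ := by
      have := congrArg (fun X => Matrix.map X π) hQ
      simp only [Matrix.map_mul, Matrix.map_add π (map_add π)] at this
      exact this
    have hN'F : N'.map π = N₂₂.map π - (Q.map π)ᵀ * (N₁₁.map π)ᵀ * Q.map π := by
      rw [hN', Matrix.map_sub π (map_sub π), Matrix.map_mul, Matrix.map_mul]
      rfl
    rw [hsum, hblock, fromBlocks_map, ← (Equiv.sumArrowEquivProdArrow _ _ F).symm.sum_comp,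
      Fintype.sum_prod_type, Finset.sum_comm]
    have h5 : ∀ w : κ → F, ∑ v : Fin 2 → F, ψ ((Equiv.sumArrowEquivProdArrow _ _ F).symm (v, w) ⬝ᵥ
        fromBlocks (N₁₁.map π) (N₁₂.map π) (N₂₁.map π) (N₂₂.map π) *ᵥ
          (Equiv.sumArrowEquivProdArrow _ _ F).symm (v, w)) =
        (∑ v : Fin 2 → F, ψ (v ⬝ᵥ N₁₁.map π *ᵥ v)) * ψ (w ⬝ᵥ N'.map π *ᵥ w) := by
      intro w
      rw [← (Equiv.subRight (Q.map π *ᵥ w)).sum_comp, Finset.sum_mul]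
      refine Finset.sum_congr rfl fun v _ => ?_
      rw [← AddChar.map_add_eq_mul, hN'F]
      congr 1
      exact sumElim_form _ hQF v w
    rw [Finset.sum_congr rfl fun w _ => h5 w, ← Finset.mul_sum, ih κ hκ N' u' hu',
      ← (finTwoArrowEquiv F).symm.sum_comp, Fintype.sum_prod_type]
    have h6 : ∀ x y : F, ψ ((finTwoArrowEquiv F).symm (x, y) ⬝ᵥ N₁₁.map π *ᵥ
        (finTwoArrowEquiv F).symm (x, y)) = ψ (π (N₁₁ 0 0) * x ^ 2 +
          π (N₁₁ 0 1 + N₁₁ 1 0) * x * y + π (N₁₁ 1 1) * y ^ 2) := by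
      intro x y
      congr 1
      simp only [dotProduct, mulVec, Fin.sum_univ_two, finTwoArrowEquiv_symm_apply, map_apply,
        cons_val_zero, cons_val_one, map_add]
      ring
    simp only [h6]
    rw [sum_binary hψ _ _ hb, huu, map_mul, hplane, pow_succ]
    split_ifs <;> · push_cast; ring

end Plane


/-! ### The symbols of the local discriminants -/

section Symbol

section Dyadic

variable {A : Type*} [CommRing A] [IsDomain A] [ValuationRing A]

open IsLocalRing

/-- If `y² + y + T` has no root in the residue field, then the unit `1 - 4T`
has quadratic defect `4`. -/
theorem iInf_span_sub_sq (h2 : (2 : A) ≠ 0) {T : A}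
    (hT : ∀ y, y ^ 2 + y + residue A T ≠ 0) :
    ⨅ η : A, Ideal.span {(1 - 4 * T) - η ^ 2} = Ideal.span {4} := by
  have h4 : (4 : A) = 2 * 2 := by norm_num
  refine le_antisymm ((iInf_le _ 1).trans ?_) (le_iInf fun η => ?_)
  · rw [Ideal.span_singleton_le_span_singleton]
    exact ⟨-T, by ring⟩
  · rw [Ideal.span_singleton_le_span_singleton]
    rcases ValuationRing.dvd_total (1 - 4 * T - η ^ 2) 4 with h | ⟨μ, hμ⟩
    · exact h
    by_cases hμ0 : residue A μ = 0
    · exfalso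
      -- `η = 1 + w`, and `w / 2` is a root of `y² + y + T + μ`
      have hw : (η - 1) ^ 2 + 2 * (η - 1) + 4 * (T + μ) = 0 := by linear_combination -hμ
      have key : ¬ 2 ∣ η - 1 := by
        rintro ⟨y, hy⟩
        rw [hy] at hw
        have h5 : y ^ 2 + y + (T + μ) = 0 := by
          have : (4 : A) * (y ^ 2 + y + (T + μ)) = 0 := by linear_combination hw
          exact (mul_eq_zero.1 this).resolve_left (h4 ▸ mul_ne_zero h2 h2)
        apply hT (residue A y)
        have := congrArg (residue A) h5
        simpa [hμ0] using this
      rcases ValuationRing.dvd_total (η - 1) 2 with ⟨s, hs⟩ | h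
      · by_cases hs0 : residue A s = 0
        · have hw0 : η - 1 ≠ 0 := by
            intro h0
            rw [h0, zero_mul] at hs
            exact h2 hs
          have h5 : 1 + s + s ^ 2 * (T + μ) = 0 := by
            have : (η - 1) ^ 2 * (1 + s + s ^ 2 * (T + μ)) = 0 := by
              rw [h4, hs] at hw
              linear_combination hw
            exact (mul_eq_zero.1 this).resolve_left (pow_ne_zero 2 hw0)
          have := congrArg (residue A) h5
          simp [hs0] at this
        · obtain ⟨s', rfl⟩ := (residue_ne_zero_iff_isUnit s).1 hs0
          exact key ⟨(s'⁻¹ : Aˣ), by rw [hs, mul_assoc, Units.mul_inv, mul_one]⟩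
      · exact key h
    · obtain ⟨v, hv⟩ := (residue_ne_zero_iff_isUnit μ).1 hμ0
      rw [hμ, ← hv]
      exact ⟨(v⁻¹ : Aˣ), by rw [mul_assoc, Units.mul_inv, mul_one]⟩

variable [Finite (ResidueField A)] (h2 : (2 : A) ≠ 0) (h2' : residue A 2 = 0)
  {φ : Aˣ →* ℤˣ}
  (hφ : ∀ u : Aˣ, ⨅ η : A, Ideal.span {(u : A) - η ^ 2} = Ideal.span {4} → φ u = -1)

include h2 h2' hφ

/-- The symbol is trivial on the units congruent to `1` modulo `4𝔪`: multiplication by such a unit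
does not change the quadratic defect of a unit of defect `4`. -/
theorem symbol_one_add_four_mul {u : Aˣ} {μ : A} (hu : (u : A) = 1 + 4 * μ)
    (hμ : residue A μ = 0) : φ u = 1 := by
  have h4 : residue A 4 = 0 := by
    rw [show (4 : A) = 2 * 2 by norm_num, map_mul, h2', zero_mul]
  obtain ⟨t, ht⟩ : ∃ t : ResidueField A, ∀ y, y ^ 2 + y ≠ t := by
    by_contra! h
    have hinj : Function.Injective fun y : ResidueField A => y ^ 2 + y :=
      Finite.injective_iff_surjective.2 h
    have h1 : (-1 : ResidueField A) = 0 := hinj (by simp)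
    simp at h1
  obtain ⟨T, hT⟩ := residue_surjective (-t)
  have hT1 : IsUnit (1 - 4 * T) := (residue_ne_zero_iff_isUnit _).1 (by simp [h4])
  obtain ⟨v, hv⟩ := hT1
  have h1 : φ v = -1 := by
    refine hφ v ?_
    rw [hv]
    exact iInf_span_sub_sq h2 fun y hy => ht y (by rw [hT] at hy; linear_combination hy)
  have h3 : φ (v * u) = -1 := by
    refine hφ _ ?_
    have e : ((v * u : Aˣ) : A) = 1 - 4 * (T - μ + 4 * T * μ) := by
      rw [Units.val_mul, hv, hu]
      ring
    rw [e]
    refine iInf_span_sub_sq h2 fun y hy => ht y ?_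
    simp only [map_add, map_sub, map_mul, hμ, mul_zero, sub_zero, add_zero, hT] at hy
    linear_combination hy
  rw [map_mul, h1] at h3
  simpa using h3

open Classical in
/-- The symbol of the discriminant of a plane, in terms of the reduction of the plane. -/
theorem symbol_disc {u : Aˣ} {a b c : A} (hu : (u : A) = b ^ 2 - 4 * (a * c)) :
    φ u = if ∃ y : ResidueField A, y ^ 2 + y + residue A a * residue A c / residue A b ^ 2 = 0
      then 1 else -1 := by
  have h4 : residue A 4 = 0 := by
    rw [show (4 : A) = 2 * 2 by norm_num, map_mul, h2', zero_mul]
  have hb : residue A b ≠ 0 := by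
    intro h0
    have := (residue_ne_zero_iff_isUnit (u : A)).2 u.isUnit
    apply this
    rw [hu, map_sub, map_pow, map_mul, h0, h4]
    ring
  obtain ⟨b, rfl⟩ := (residue_ne_zero_iff_isUnit b).1 hb
  set T : A := a * c * ((b⁻¹ : Aˣ) : A) ^ 2 with hTdef
  have hbb : (b : A) * ((b⁻¹ : Aˣ) : A) = 1 := Units.mul_inv b
  have hT : residue A a * residue A c / residue A b ^ 2 = residue A T := by
    rw [div_eq_iff (pow_ne_zero 2 hb), hTdef]
    simp only [← map_mul, ← map_pow]
    congr 1
    linear_combination -(a * c * ((b : A) * ((b⁻¹ : Aˣ) : A) + 1)) * hbb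
  simp only [hT]
  obtain ⟨v, hv⟩ : IsUnit (1 - 4 * T) := (residue_ne_zero_iff_isUnit _).1 (by simp [h4])
  have huv : u = b ^ 2 * v := by
    ext
    rw [hu, Units.val_mul, Units.val_pow_eq_pow_val, hv, hTdef]
    linear_combination (4 * a * c * ((b : A) * ((b⁻¹ : Aˣ) : A) + 1)) * hbb
  have hsq : ∀ x : ℤˣ, x ^ 2 = 1 := Int.units_sq
  rw [huv, map_mul, map_pow, hsq, one_mul]
  split_ifs with hy
  · obtain ⟨y, hy⟩ := hy
    obtain ⟨y, rfl⟩ := residue_surjective y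
    obtain ⟨w, hw⟩ : IsUnit (1 + 2 * y) := (residue_ne_zero_iff_isUnit _).1 (by simp [h2'])
    have h1 : φ (w ^ 2 * v⁻¹) = 1 := by
      refine symbol_one_add_four_mul h2 h2' hφ
        (μ := (y ^ 2 + y + T) * ((v⁻¹ : Aˣ) : A)) ?_ ?_
      · have hvv : (v : A) * ((v⁻¹ : Aˣ) : A) = 1 := Units.mul_inv v
        rw [Units.val_mul, Units.val_pow_eq_pow_val, hw]
        rw [hv] at hvv
        linear_combination hvv
      · rw [map_mul, map_add, map_add, map_pow, hy, zero_mul]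
    rw [map_mul, map_pow, hsq, one_mul, map_inv, inv_eq_one] at h1
    exact h1
  · push Not at hy
    refine hφ v ?_
    rw [hv]
    exact iInf_span_sub_sq h2 hy

end Dyadic

end Symbol

section Completion

variable {K : Type*} [Field K] [NumberField K] (P : HeightOneSpectrum (𝓞 K))

open IsLocalRing

/-- The residue field of the completion. -/
abbrev LocalResidue : Type _ := ResidueField (P.adicCompletionIntegers K)

theorem residue_algebraMap_eq_zero_iff (r : 𝓞 K) :
    residue (P.adicCompletionIntegers K) (algebraMap (𝓞 K) _ r) = 0 ↔ r ∈ P.asIdeal := by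
  rw [residue_eq_zero_iff, mem_maximalIdeal, mem_nonunits_iff,
    HeightOneSpectrum.adicCompletionIntegers.isUnit_iff_valued_eq_one,
    HeightOneSpectrum.algebraMap_adicCompletionIntegers_apply,
    HeightOneSpectrum.valuedAdicCompletion_eq_valuation',
    ← P.valuation_lt_one_iff_mem (K := K)]
  exact ⟨fun h => lt_of_le_of_ne (P.valuation_le_one r) h, fun h => h.ne⟩

theorem exists_integer_sub_lt {k : K} (hk : P.valuation K k ≤ 1) :
    ∃ r : 𝓞 K, P.valuation K (k - r) < 1 := by
  obtain ⟨n, d, hnd⟩ := P.exists_primeCompl_mul_eq_of_integer k hk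
  have hmax : P.asIdeal.IsMaximal := P.isMaximal
  obtain ⟨e, he⟩ := hmax.exists_inv (x := (d : 𝓞 K)) d.2
  obtain ⟨i, hi, hie⟩ := he
  refine ⟨n * e, ?_⟩
  have h1 : k - ((n * e : 𝓞 K) : K) = k * ((i : 𝓞 K) : K) := by
    have h2 := congrArg (algebraMap (𝓞 K) K) hie
    rw [map_add, map_mul, map_one] at h2
    change k - algebraMap (𝓞 K) K (n * e) = k * algebraMap (𝓞 K) K i
    rw [map_mul]
    linear_combination (algebraMap (𝓞 K) K e) * hnd - k * h2
  rw [h1, map_mul]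
  calc _ ≤ 1 * P.valuation K (i : K) := by gcongr
    _ < 1 := by
      rw [one_mul]
      exact (P.valuation_lt_one_iff_mem i).2 hi

theorem residue_algebraMap_surjective :
    Function.Surjective fun r : 𝓞 K =>
      residue (P.adicCompletionIntegers K) (algebraMap (𝓞 K) _ r) := by
  intro y
  obtain ⟨x, rfl⟩ := residue_surjective y
  obtain ⟨k, hk⟩ : ∃ k : K, Valued.v ((x : P.adicCompletion K) - algebraMap K _ k) < 1 := by
    obtain ⟨ϖ, hϖ⟩ := P.valuation_exists_uniformizer K
    have hϖ' : Valued.v (algebraMap K (P.adicCompletion K) ϖ) = WithZero.exp (-1 : ℤ) := by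
      rw [← hϖ]
      exact P.valuedAdicCompletion_eq_valuation' ϖ
    -- elements close to `x` are handled through the neighbourhood `v y = v ϖ` of `ϖ`
    have h1 : {y | Valued.v y = Valued.v (algebraMap K (P.adicCompletion K) ϖ)} ∈
        nhds (algebraMap K (P.adicCompletion K) ϖ) :=
      Valued.locally_const (by rw [hϖ']; simp)
    have h2 : Filter.Tendsto (fun y => algebraMap K (P.adicCompletion K) ϖ +
        ((x : P.adicCompletion K) - y)) (nhds (x : P.adicCompletion K))
        (nhds (algebraMap K (P.adicCompletion K) ϖ)) := by
      have : Continuous fun y => algebraMap K (P.adicCompletion K) ϖ +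
        ((x : P.adicCompletion K) - y) := by fun_prop
      convert this.tendsto (x : P.adicCompletion K) using 2
      simp
    obtain ⟨_, h3, k, rfl⟩ := mem_closure_iff_nhds.1
      (HeightOneSpectrum.denseRange_algebraMap K P (x : P.adicCompletion K)) _ (h2 h1)
    refine ⟨k, ?_⟩
    have h4 : (x : P.adicCompletion K) - algebraMap K _ k =
      (algebraMap K (P.adicCompletion K) ϖ + ((x : P.adicCompletion K) - algebraMap K _ k)) -
        algebraMap K (P.adicCompletion K) ϖ := by ring
    rw [h4]
    refine lt_of_le_of_lt (Valuation.map_sub _ _ _) ?_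
    rw [h3, max_self, hϖ', ← WithZero.exp_zero, WithZero.exp_lt_exp]
    norm_num
  have hk1 : P.valuation K k ≤ 1 := by
    rw [← HeightOneSpectrum.valuedAdicCompletion_eq_valuation']
    have h1 : (algebraMap K (P.adicCompletion K) k) = (x : P.adicCompletion K) -
      ((x : P.adicCompletion K) - algebraMap K _ k) := by ring
    change Valued.v (algebraMap K (P.adicCompletion K) k) ≤ 1
    rw [h1]
    exact (Valuation.map_sub _ _ _).trans (max_le x.2 hk.le)
  obtain ⟨r, hr⟩ := exists_integer_sub_lt P hk1
  refine ⟨r, ?_⟩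
  rw [eq_comm, ← sub_eq_zero, ← map_sub, residue_eq_zero_iff, mem_maximalIdeal, mem_nonunits_iff,
    HeightOneSpectrum.adicCompletionIntegers.isUnit_iff_valued_eq_one]
  refine (lt_of_le_of_lt ?_ (max_lt hk hr)).ne
  have h1 : ((x - algebraMap (𝓞 K) _ r : P.adicCompletionIntegers K) : P.adicCompletion K) =
      ((x : P.adicCompletion K) - algebraMap K _ k) + algebraMap K _ (k - r) := by
    rw [map_sub]
    push_cast
    rw [HeightOneSpectrum.algebraMap_adicCompletionIntegers_apply, sub_add_sub_cancel]
    rfl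
  rw [h1]
  refine (Valuation.map_add _ _ _).trans (max_le_max le_rfl (le_of_eq ?_))
  exact P.valuedAdicCompletion_eq_valuation' _

instance : Finite (LocalResidue P) := by
  have h1 : Finite (𝓞 K ⧸ P.asIdeal) := Ideal.finiteQuotientOfFreeOfNeBot _ P.ne_bot
  refine Finite.of_surjective (Ideal.Quotient.lift P.asIdeal
    ((residue (P.adicCompletionIntegers K)).comp (algebraMap (𝓞 K) _))
    fun r hr => (residue_algebraMap_eq_zero_iff P r).2 hr) fun y => ?_
  obtain ⟨r, hr⟩ := residue_algebraMap_surjective P y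
  exact ⟨Ideal.Quotient.mk _ r, hr⟩

theorem card_localResidue : Nat.card (LocalResidue P) = Ideal.absNorm P.asIdeal := by
  rw [Ideal.absNorm_apply, Submodule.cardQuot_apply]
  refine (Nat.card_congr (Equiv.ofBijective (Ideal.Quotient.lift P.asIdeal
    ((residue (P.adicCompletionIntegers K)).comp (algebraMap (𝓞 K) _))
    fun r hr => (residue_algebraMap_eq_zero_iff P r).2 hr) ⟨?_, fun y => ?_⟩)).symm
  · rw [injective_iff_map_eq_zero]
    intro y hy
    obtain ⟨r, rfl⟩ := Ideal.Quotient.mk_surjective y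
    rw [Ideal.Quotient.lift_mk] at hy
    exact Ideal.Quotient.eq_zero_iff_mem.2 ((residue_algebraMap_eq_zero_iff P r).1 hy)
  · obtain ⟨r, hr⟩ := residue_algebraMap_surjective P y
    exact ⟨Ideal.Quotient.mk _ r, hr⟩

theorem two_ne_zero_completion : (2 : P.adicCompletionIntegers K) ≠ 0 := by
  have h : algebraMap (𝓞 K) (P.adicCompletionIntegers K) 2 ≠ 0 := by
    rw [Ne, FaithfulSMul.algebraMap_eq_zero_iff]
    exact two_ne_zero
  rwa [map_ofNat] at h

theorem residue_two_eq_zero_iff :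
    residue (P.adicCompletionIntegers K) 2 = 0 ↔ (2 : 𝓞 K) ∈ P.asIdeal := by
  rw [← residue_algebraMap_eq_zero_iff, map_ofNat (algebraMap _ _)]

/-- The Gauss sum of a unimodular quadratic form over the completed local ring, reduced to the
residue field: its sign is the symbol of the discriminant. -/
theorem sum_quadratic_local {φ : SymbolChoice K}
    (hφ : (2 : 𝓞 K) ∈ P.asIdeal → IsKroneckerSymbol P (φ P)) {k : ℕ}
    (N : Matrix (Fin (2 * k)) (Fin (2 * k)) (P.adicCompletionIntegers K))
    {u : (P.adicCompletionIntegers K)ˣ} (hu : (u : P.adicCompletionIntegers K) =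
      (-1) ^ k * (N + Nᵀ).det) [Fintype (LocalResidue P)]
    {ψ : AddChar (LocalResidue P) ℂ} (hψ : ψ ≠ 1) :
    ∑ c : Fin (2 * k) → LocalResidue P, ψ (c ⬝ᵥ N.map (residue _) *ᵥ c) =
      (Ideal.absNorm P.asIdeal : ℂ) ^ k * ((localSymbol φ P u : ℤ) : ℂ) := by
  classical
  rw [← card_localResidue, Nat.card_eq_fintype_card, localSymbol]
  split_ifs with h2
  · have h2' := (residue_two_eq_zero_iff P).2 h2
    have hchar : CharP (LocalResidue P) 2 := by
      refine CharTwo.of_one_ne_zero_of_two_eq_zero one_ne_zero ?_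
      rw [← h2', map_ofNat]
    refine sum_quadratic_of_even hψ (residue _) (fun x hx => (residue_ne_zero_iff_isUnit x).1 hx)
      (φ P) (fun u a b c h => ?_) k (Fin (2 * k)) (Fintype.card_fin _) N u hu
    convert symbol_disc (two_ne_zero_completion P) h2' (hφ h2) h
  · have h2' := mt (residue_two_eq_zero_iff P).1 h2
    rw [map_ofNat] at h2'
    have hchar : ringChar (LocalResidue P) ≠ 2 := by
      intro h
      apply h2'
      have := ringChar.Nat.cast_ringChar (R := LocalResidue P)
      rw [h] at this
      exact_mod_cast this
    have hN : N.map (residue _) + (N.map (residue _))ᵀ =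
        (N + Nᵀ).map (residue (P.adicCompletionIntegers K)) := by
      rw [Matrix.map_add _ (map_add _)]
      rfl
    have hdet : (-1) ^ k * (N.map (residue _) + (N.map (residue _))ᵀ).det =
        residue (P.adicCompletionIntegers K) u := by
      rw [hu, map_mul, map_pow, map_neg, map_one, RingHom.map_det, hN]
      rfl
    have hu0 : residue (P.adicCompletionIntegers K) u ≠ 0 :=
      (residue_ne_zero_iff_isUnit _).2 u.isUnit
    rw [sum_quadratic_of_odd hchar hψ k _ (by rw [← hdet] at hu0; exact right_ne_zero_of_mul hu0),
      hdet]
    congr 2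
    have hsq : (∃ z : P.adicCompletionIntegers K, (u : P.adicCompletionIntegers K) - z ^ 2 ∈
        maximalIdeal (P.adicCompletionIntegers K)) ↔
        IsSquare (residue (P.adicCompletionIntegers K) u) := by
      constructor
      · rintro ⟨z, hz⟩
        rw [← residue_eq_zero_iff, map_sub, sub_eq_zero] at hz
        exact ⟨residue _ z, by rw [hz, map_pow, sq]⟩
      · rintro ⟨z, hz⟩
        obtain ⟨z, rfl⟩ := residue_surjective z
        exact ⟨z, by rw [← residue_eq_zero_iff, map_sub, hz, map_pow]; ring⟩
    rw [legendreSymbol]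
    split_ifs with h
    · rw [(quadraticChar_one_iff_isSquare hu0).2 (hsq.1 h)]
      rfl
    · rw [quadraticChar_neg_one_iff_not_isSquare.2 (mt hsq.2 h)]
      rfl

end Completion


/-! ### Local generators and reduction at a prime -/

section Reduction

variable {K : Type*} [Field K] [NumberField K] (P : HeightOneSpectrum (𝓞 K))

/-- An integral fractional ideal which is not contained in `P` is comaximal to `P`. -/
theorem exists_add_eq_one {J : FracIdeal K} (h1 : J ≤ 1)
    (hP : ¬ J ≤ (P.asIdeal : FracIdeal K)) :
    ∃ c ∈ J, ∃ p ∈ P.asIdeal, c + (p : K) = 1 := by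
  set I : Ideal (𝓞 K) := Submodule.comap (Algebra.linearMap (𝓞 K) K) (J : Submodule (𝓞 K) K)
    with hI
  have hmax : P.asIdeal.IsMaximal := P.isMaximal
  have hIP : ¬ I ≤ P.asIdeal := by
    intro h
    apply hP
    intro x hx
    obtain ⟨a, rfl⟩ := (FractionalIdeal.mem_one_iff _).1 (h1 hx)
    exact (FractionalIdeal.mem_coeIdeal _).2 ⟨a, h hx, rfl⟩
  have hsup : I ⊔ P.asIdeal = ⊤ := by
    by_contra h
    exact hIP (le_sup_left.trans (hmax.eq_of_le h le_sup_right).ge)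
  obtain ⟨c, hc, p, hp, h⟩ := Submodule.mem_sup.1 (hsup ▸ Submodule.mem_top : (1 : 𝓞 K) ∈ I ⊔ P.asIdeal)
  exact ⟨algebraMap _ K c, hc, p, hp, by
    rw [← map_add, h, map_one]⟩

theorem localGenerator_mem (J : FracIdeal K) : localGenerator P J ∈ J :=
  (exists_localGenerator P J).choose_spec.1

theorem valuation_le_localGenerator {J : FracIdeal K} {y : K} (hy : y ∈ J) :
    P.valuation K y ≤ P.valuation K (localGenerator P J) :=
  (exists_localGenerator P J).choose_spec.2 y hy

theorem localGenerator_ne_zero {J : FracIdeal K} (hJ : J ≠ 0) : localGenerator P J ≠ 0 := by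
  obtain ⟨x, hx0, hx⟩ := FractionalIdeal.exists_ne_zero_mem_isInteger hJ
  intro h
  have := valuation_le_localGenerator P hx
  rw [h, map_zero, le_zero_iff, Valuation.zero_iff] at this
  exact hx0 (by simpa using this)

theorem valuation_lt_of_mem_mul {J : FracIdeal K} (hJ : J ≠ 0) {y : K}
    (hy : y ∈ (P.asIdeal : FracIdeal K) * J) :
    P.valuation K y < P.valuation K (localGenerator P J) := by
  have h0 : P.valuation K (localGenerator P J) ≠ 0 :=
    (Valuation.ne_zero_iff _).2 (localGenerator_ne_zero P hJ)
  refine FractionalIdeal.mul_induction_on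
    (C := fun y => P.valuation K y < P.valuation K (localGenerator P J)) hy
    (fun a ha b hb => ?_) fun a b ha hb => Valuation.map_add_lt _ ha hb
  obtain ⟨a, ha', rfl⟩ := (FractionalIdeal.mem_coeIdeal _).1 ha
  rw [map_mul]
  calc _ ≤ P.valuation K (algebraMap (𝓞 K) K a) * P.valuation K (localGenerator P J) := by
        gcongr
        exact valuation_le_localGenerator P hb
    _ < 1 * P.valuation K (localGenerator P J) := by
        have := (P.valuation_lt_one_iff_mem (K := K) a).2 ha'
        gcongr
        exact zero_lt_iff.2 h0
    _ = _ := one_mul _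

/-- The local generator is invertible modulo `P`. -/
theorem exists_localGenerator_inv {J : FracIdeal K} (hJ : J ≠ 0) :
    ∃ b ∈ J⁻¹, ∃ p ∈ P.asIdeal, localGenerator P J * b + (p : K) = 1 := by
  obtain ⟨c, hc, p, hp, h⟩ := exists_add_eq_one P
    (J := FractionalIdeal.spanSingleton (𝓞 K)⁰ (localGenerator P J) * J⁻¹) (by
      rw [← mul_inv_cancel₀ hJ]
      gcongr
      exact FractionalIdeal.spanSingleton_le_iff_mem.2 (localGenerator_mem P J)) (by
      intro h
      have h1 : localGenerator P J ∈ (P.asIdeal : FracIdeal K) * J := by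
        rw [← FractionalIdeal.spanSingleton_le_iff_mem]
        calc _ = FractionalIdeal.spanSingleton (𝓞 K)⁰ (localGenerator P J) * J⁻¹ * J := by
              rw [mul_assoc, inv_mul_cancel₀ hJ, mul_one]
          _ ≤ _ := by gcongr
      exact (valuation_lt_of_mem_mul P hJ h1).false)
  obtain ⟨b, hb, rfl⟩ := FractionalIdeal.mem_singleton_mul.1 hc
  exact ⟨b, hb, p, hp, h⟩

theorem valuation_div_localGenerator_le {J : FracIdeal K} {y : K} (hy : y ∈ J) :
    P.valuation K (y / localGenerator P J) ≤ 1 := by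
  rw [map_div₀]
  exact div_le_one_of_le₀ (valuation_le_localGenerator P hy) zero_le

/-- Membership in `PJ` is read off from the quotient by a local generator of `J`. -/
theorem mem_mul_iff_valuation_lt {J : FracIdeal K} (hJ : J ≠ 0) {y : K} (hy : y ∈ J) :
    y ∈ (P.asIdeal : FracIdeal K) * J ↔ P.valuation K (y / localGenerator P J) < 1 := by
  have h0 : P.valuation K (localGenerator P J) ≠ 0 :=
    (Valuation.ne_zero_iff _).2 (localGenerator_ne_zero P hJ)
  rw [map_div₀, div_lt_one₀ (zero_lt_iff.2 h0)]
  refine ⟨valuation_lt_of_mem_mul P hJ, fun h => ?_⟩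
  obtain ⟨b, hb, p, hp, hbp⟩ := exists_localGenerator_inv P hJ
  have e : y = y * b * localGenerator P J + p * y := by linear_combination -y * hbp
  rw [e]
  refine Submodule.add_mem ((P.asIdeal : FracIdeal K) * J).coeToSubmodule ?_
    (FractionalIdeal.mul_mem_mul ((FractionalIdeal.mem_coeIdeal _).2 ⟨p, hp, rfl⟩) hy)
  refine FractionalIdeal.mul_mem_mul ?_ (localGenerator_mem P J)
  obtain ⟨r, hr⟩ := (FractionalIdeal.mem_one_iff _).1
    (mul_inv_cancel₀ hJ ▸ FractionalIdeal.mul_mem_mul hy hb)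
  refine (FractionalIdeal.mem_coeIdeal _).2 ⟨r, ?_, hr⟩
  rw [← P.valuation_lt_one_iff_mem (K := K)]
  change P.valuation K (algebraMap (𝓞 K) K r) < 1
  rw [hr, map_mul]
  have h1 : P.valuation K (localGenerator P J * b) ≤ 1 := by
    obtain ⟨s, hs⟩ := (FractionalIdeal.mem_one_iff _).1
      (mul_inv_cancel₀ hJ ▸ FractionalIdeal.mul_mem_mul (localGenerator_mem P J) hb)
    rw [← hs]
    exact P.valuation_le_one s
  by_cases hb0 : b = 0
  · simp [hb0]
  calc _ < P.valuation K (localGenerator P J) * P.valuation K b := by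
        gcongr
        exact zero_lt_iff.2 ((Valuation.ne_zero_iff _).2 hb0)
    _ ≤ 1 := by rwa [← map_mul]

/-- The map from the local ring at `P` to its completion. -/
def toCompletion : (P.valuation K).valuationSubring →+* P.adicCompletionIntegers K :=
  ((algebraMap K (P.adicCompletion K)).comp (P.valuation K).valuationSubring.subtype).codRestrict
    (P.adicCompletionIntegers K).toSubring fun x => by
      refine (HeightOneSpectrum.mem_adicCompletionIntegers (𝓞 K) K P).2 ?_
      have := P.valuedAdicCompletion_eq_valuation' (x : K)
      exact this.le.trans x.2

theorem coe_toCompletion (x : (P.valuation K).valuationSubring) :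
    (toCompletion P x : P.adicCompletion K) = algebraMap K _ (x : K) := rfl

/-- The reduction map of the local ring at `P`. -/
def reduction : (P.valuation K).valuationSubring →+* LocalResidue P :=
  (IsLocalRing.residue _).comp (toCompletion P)

theorem reduction_eq_zero_iff (x : (P.valuation K).valuationSubring) :
    reduction P x = 0 ↔ P.valuation K (x : K) < 1 := by
  rw [reduction, RingHom.comp_apply, IsLocalRing.residue_eq_zero_iff, IsLocalRing.mem_maximalIdeal,
    mem_nonunits_iff, HeightOneSpectrum.adicCompletionIntegers.isUnit_iff_valued_eq_one,
    coe_toCompletion]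
  have := P.valuedAdicCompletion_eq_valuation' (x : K)
  erw [this]
  exact ⟨fun h => lt_of_le_of_ne x.2 h, fun h => h.ne⟩

/-- An integer as an element of the local ring at `P`. -/
def ofInteger (r : 𝓞 K) : (P.valuation K).valuationSubring := ⟨r, P.valuation_le_one r⟩

theorem exists_integer_reduction (c : LocalResidue P) :
    ∃ r : 𝓞 K, reduction P (ofInteger P r) = c :=
  residue_algebraMap_surjective P c

end Reduction


/-! ### The Gauss sum of `L / PL` -/

section LocalGauss

variable {K : Type*} [Field K] [NumberField K] {P : HeightOneSpectrum (𝓞 K)}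

theorem coe_mem_coeIdeal {I : Ideal (𝓞 K)} {p : 𝓞 K} (hp : p ∈ I) : (p : K) ∈ (I : FracIdeal K) :=
  (FractionalIdeal.mem_coeIdeal _).2 ⟨p, hp, rfl⟩

theorem coeIdeal_prime_ne_zero (P : HeightOneSpectrum (𝓞 K)) : (P.asIdeal : FracIdeal K) ≠ 0 :=
  FractionalIdeal.coeIdeal_ne_zero.2 P.ne_bot

variable {m : ℕ} (L : QuadLattice K m)

theorem QuadLattice.mem_smul_iff {x : Fin m → K} :
    x ∈ P.asIdeal • L.toSubmodule ↔
      ∀ i, x i ∈ (P.asIdeal : FracIdeal K) * L.coeffIdeal i := by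
  constructor
  · intro hx i
    refine Submodule.smul_induction_on hx (fun p hp y hy => ?_) fun y z hy hz => ?_
    · rw [Pi.smul_apply, Algebra.smul_def]
      exact FractionalIdeal.mul_mem_mul (coe_mem_coeIdeal hp) (hy i)
    · exact Submodule.add_mem
        ((P.asIdeal : FracIdeal K) * L.coeffIdeal i : FracIdeal K).coeToSubmodule hy hz
  · intro hx
    rw [← Finset.univ_sum_single x]
    refine Submodule.sum_mem _ fun i _ => ?_
    refine FractionalIdeal.mul_induction_on
      (C := fun a => Pi.single i a ∈ P.asIdeal • L.toSubmodule) (hx i) (fun a ha b hb => ?_)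
      fun a b ha hb => ?_
    · obtain ⟨p, hp, rfl⟩ := (FractionalIdeal.mem_coeIdeal _).1 ha
      rw [← Algebra.smul_def, Pi.single_smul]
      exact Submodule.smul_mem_smul hp (single_mem_coordSubmodule hb)
    · rw [Pi.single_add]
      exact Submodule.add_mem _ ha hb

theorem QuadLattice.bilin_smul_left' (c : K) (x y : Fin m → K) :
    L.bilin (c • x) y = c * L.bilin x y := by
  simp [bilin]

variable [IsTotallyReal K]

theorem QuadLattice.exists_add_eq_one_of_not_dvd {t : K} (ht : t ∈ (P.asIdeal : FracIdeal K)⁻¹ * L.poleIdeal)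
    (ht' : t ∉ L.poleIdeal) (hm : 0 < m) : ∃ c ∈ FractionalIdeal.spanSingleton (𝓞 K)⁰ t *
      (L.halfNorm * different K) * P.asIdeal, ∃ p ∈ P.asIdeal, c + (p : K) = 1 := by
  have h1 := L.halfNorm_ne_zero hm
  have h2 := different_ne_zero (K := K)
  have hP := coeIdeal_prime_ne_zero P
  refine exists_add_eq_one P ?_ fun h => ht' ?_
  · calc _ ≤ ((P.asIdeal : FracIdeal K)⁻¹ * L.poleIdeal) * (L.halfNorm * different K) * P.asIdeal := by
          gcongr
          exact FractionalIdeal.spanSingleton_le_iff_mem.2 ht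
      _ = 1 := by
          rw [QuadLattice.poleIdeal]
          field_simp
  · rw [← FractionalIdeal.spanSingleton_le_iff_mem]
    have h3 : FractionalIdeal.spanSingleton (𝓞 K)⁰ t * (L.halfNorm * different K) ≤ 1 := by
      refine FracIdeal.le_of_mul_le_mul_right hP ?_
      rw [one_mul]
      exact h
    refine FracIdeal.le_of_mul_le_mul_right (mul_ne_zero h1 h2) (h3.trans (le_of_eq ?_))
    rw [QuadLattice.poleIdeal]
    field_simp

/-- Nondegeneracy of the bilinear form modulo a prime that does not divide the level. -/
theorem QuadLattice.mem_smul_of_expTrace (hm : 0 < m) (hP : ¬ L.DvdLevel P) {t : K}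
    (ht : t ∈ (P.asIdeal : FracIdeal K)⁻¹ * L.poleIdeal) (ht' : t ∉ L.poleIdeal)
    {x : Fin m → K} (hx : x ∈ L.toSubmodule)
    (h : ∀ y ∈ L.toSubmodule, expTrace (2 * (t * L.bilin x y)) = 1) :
    x ∈ P.asIdeal • L.toSubmodule := by
  have h1 := L.halfNorm_ne_zero hm
  have h2 := different_ne_zero (K := K)
  have hP0 := coeIdeal_prime_ne_zero P
  have hB : ∀ y ∈ L.toSubmodule, L.bilin x y ∈ (P.asIdeal : FracIdeal K) * L.halfNorm := by
    intro y hy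
    have h3 : t * L.bilin x y ∈ (different K)⁻¹ := by
      refine mem_of_expTrace_eq_one fun r => ?_
      rw [← h (r • y) (L.toSubmodule.smul_mem r hy), L.bilin_smul_right]
      congr 1
      ring
    obtain ⟨c, hc, p, hp, hcp⟩ := L.exists_add_eq_one_of_not_dvd ht ht' hm
    have e : L.bilin x y = c * L.bilin x y + p * L.bilin x y := by
      linear_combination (-L.bilin x y) * hcp
    rw [e]
    refine Submodule.add_mem ((P.asIdeal : FracIdeal K) * L.halfNorm).coeToSubmodule ?_
      (FractionalIdeal.mul_mem_mul (coe_mem_coeIdeal hp) (L.bilin_mem_halfNorm hx hy))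
    rw [mul_assoc] at hc
    obtain ⟨b, hb, rfl⟩ := FractionalIdeal.mem_singleton_mul.1 hc
    have h4 := FractionalIdeal.mul_mem_mul h3 hb
    have h5 : (different K)⁻¹ * (L.halfNorm * different K * P.asIdeal) =
        (P.asIdeal : FracIdeal K) * L.halfNorm := by
      field_simp
    rw [h5] at h4
    have e2 : t * b * L.bilin x y = t * L.bilin x y * b := by ring
    rw [e2]
    exact h4
  rw [L.mem_smul_iff]
  intro i
  obtain ⟨c, hc, p, hp, hcp⟩ := exists_add_eq_one P (L.level_le_one hm) hP
  have e : x i = c * x i + p * x i := by linear_combination (-x i) * hcp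
  rw [e]
  refine Submodule.add_mem ((P.asIdeal : FracIdeal K) * L.coeffIdeal i).coeToSubmodule ?_
    (FractionalIdeal.mul_mem_mul (coe_mem_coeIdeal hp) (hx i))
  have hc' : c ∈ (P.asIdeal : FracIdeal K) *
      ((L.level * L.halfNorm) * ((P.asIdeal : FracIdeal K) * L.halfNorm)⁻¹) := by
    convert hc using 1
    field_simp
  refine FractionalIdeal.mul_induction_on
    (C := fun c => c * x i ∈ (P.asIdeal : FracIdeal K) * L.coeffIdeal i) hc'
    (fun q hq d hd => ?_) fun a b ha hb => ?_
  · rw [mul_assoc]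
    refine FractionalIdeal.mul_mem_mul hq ?_
    refine FractionalIdeal.mul_induction_on
      (C := fun d => d * x i ∈ L.coeffIdeal i) hd (fun s hs u hu => ?_) fun a b ha hb => ?_
    · have hux : u • x ∈ L.dualSubmodule := by
        intro y hy
        rw [L.bilin_smul_left']
        have := FractionalIdeal.mul_mem_mul hu (hB y hy)
        rw [inv_mul_cancel₀ (mul_ne_zero hP0 h1)] at this
        exact (FractionalIdeal.mem_one_iff _).1 this
      have := L.smul_dual_mem hm hux hs i
      rw [Pi.smul_apply, Pi.smul_apply, smul_eq_mul, smul_eq_mul, ← mul_assoc] at this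
      exact this
    · rw [add_mul]
      exact Submodule.add_mem (L.coeffIdeal i).coeToSubmodule ha hb
  · rw [add_mul]
    exact Submodule.add_mem ((P.asIdeal : FracIdeal K) * L.coeffIdeal i).coeToSubmodule ha hb

/-- The additive character `r ↦ e(2 s r)` of the residue field. -/
theorem exists_addChar {s : K} (hs : s ∈ (P.asIdeal : FracIdeal K)⁻¹ * (different K)⁻¹) :
    ∃ ψ : AddChar (LocalResidue P) ℂ, ∀ r : 𝓞 K,
      ψ (reduction P (ofInteger P r)) = expTrace (2 * (s * r)) := by
  have hP0 := coeIdeal_prime_ne_zero P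
  have hadd : ∀ a b : 𝓞 K, reduction P (ofInteger P (a + b)) =
      reduction P (ofInteger P a) + reduction P (ofInteger P b) := fun a b => by
    rw [← map_add]
    congr 1
  have hker : ∀ r r' : 𝓞 K, reduction P (ofInteger P r) = reduction P (ofInteger P r') →
      expTrace (2 * (s * r)) = expTrace (2 * (s * r')) := by
    intro r r' h
    have h0 : reduction P (ofInteger P (r - r')) = 0 := by
      have := hadd (r - r') r'
      rw [sub_add_cancel, h] at this
      simpa using this
    rw [reduction_eq_zero_iff] at h0
    have h1 : r - r' ∈ P.asIdeal := (P.valuation_lt_one_iff_mem (K := K) _).1 h0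
    have h2 := FractionalIdeal.mul_mem_mul hs (coe_mem_coeIdeal h1)
    rw [mul_right_comm, inv_mul_cancel₀ hP0, one_mul] at h2
    have h3 := expTrace_eq_one_of_mem h2
    have e : (2 * (s * r) : K) = 2 * (s * (r - r' : 𝓞 K)) + 2 * (s * r') := by
      push_cast
      ring
    rw [e, expTrace_add, h3, one_mul]
  choose g hg using exists_integer_reduction P
  refine ⟨⟨fun c => expTrace (2 * (s * g c)), ?_, fun a b => ?_⟩, fun r => ?_⟩
  · rw [hker (g 0) 0]
    · simp [expTrace_zero]
    · rw [hg, eq_comm, reduction_eq_zero_iff]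
      simp [ofInteger]
  · rw [← expTrace_add, hker (g (a + b)) (g a + g b)]
    · congr 1
      push_cast
      ring
    · rw [hg, hadd, hg, hg]
  · exact hker _ _ (hg _)

variable (P) in
/-- The coordinates of a vector of `L` with respect to local generators of the `𝒜ᵢ`, as elements of
the local ring at `P`. -/
def QuadLattice.localCoord {m : ℕ} (L : QuadLattice K m) (x : L.toSubmodule) (i : Fin m) :
    (P.valuation K).valuationSubring :=
  ⟨x.1 i / localGenerator P (L.coeffIdeal i),
    valuation_div_localGenerator_le P (x.2 i)⟩

theorem QuadLattice.reduction_localCoord_eq_iff {m : ℕ} (L : QuadLattice K m) (x y : L.toSubmodule) :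
    (∀ i, reduction P (L.localCoord P x i) = reduction P (L.localCoord P y i)) ↔
      x.1 - y.1 ∈ P.asIdeal • L.toSubmodule := by
  rw [L.mem_smul_iff]
  refine forall_congr' fun i => ?_
  rw [mem_mul_iff_valuation_lt P (L.coeffIdeal_ne_zero i) ((L.toSubmodule.sub_mem x.2 y.2) i),
    ← sub_eq_zero, ← map_sub, reduction_eq_zero_iff]
  congr! 2
  exact (sub_div _ _ _).symm

theorem QuadLattice.exists_localCoord {m : ℕ} (L : QuadLattice K m) (c : Fin m → LocalResidue P) :
    ∃ x : L.toSubmodule, ∀ i, reduction P (L.localCoord P x i) = c i := by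
  choose r hr using fun i => exists_integer_reduction P (c i)
  refine ⟨⟨fun i => r i • localGenerator P (L.coeffIdeal i), fun i =>
    Submodule.smul_mem (L.coeffIdeal i : Submodule (𝓞 K) K) _ (localGenerator_mem P _)⟩,
    fun i => ?_⟩
  rw [← hr i]
  congr 1
  refine Subtype.ext ?_
  change (r i • localGenerator P (L.coeffIdeal i)) / localGenerator P (L.coeffIdeal i) = (r i : K)
  rw [Algebra.smul_def, mul_div_cancel_right₀ _ (localGenerator_ne_zero P (L.coeffIdeal_ne_zero i))]

/-- The Gauss sum of `L` at a prime that does not divide the level. -/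
theorem QuadLattice.sum_expTrace_bilin {k : ℕ} (L : QuadLattice K (2 * k)) (hk : 0 < 2 * k)
    {φ : SymbolChoice K}
    (hφ : (2 : 𝓞 K) ∈ P.asIdeal → IsKroneckerSymbol P (φ P)) (hP : ¬ L.DvdLevel P) {t : K}
    (ht : t ∈ (P.asIdeal : FracIdeal K)⁻¹ * L.poleIdeal) (ht' : t ∉ L.poleIdeal)
    {T : Finset (Fin (2 * k) → K)}
    (hT : IsTransversal L.toSubmodule (P.asIdeal • L.toSubmodule) T) :
    ∑ x ∈ T, expTrace (t * L.bilin x x) =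
      (Ideal.absNorm P.asIdeal : ℂ) ^ k * ((L.chiStarPrime φ P : ℤ) : ℂ) := by
  classical
  have := Fintype.ofFinite (LocalResidue P)
  have h1 := L.halfNorm_ne_zero hk
  have h2 := different_ne_zero (K := K)
  have hP0 := coeIdeal_prime_ne_zero P
  -- `e` generates `𝔑⁻¹` locally, and `η` is its inverse modulo `P`
  obtain ⟨η, hη, p, hp, hηp⟩ := exists_localGenerator_inv P (inv_ne_zero h1)
  have he := localGenerator_mem P L.halfNorm⁻¹
  have he0 := localGenerator_ne_zero P (inv_ne_zero h1)
  set e := localGenerator P L.halfNorm⁻¹ with hedef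
  rw [inv_inv] at hη
  have hint : ∀ a ∈ L.halfNorm, ∃ r : 𝓞 K, (r : K) = e * a := fun a ha => by
    have := FractionalIdeal.mul_mem_mul he ha
    rw [inv_mul_cancel₀ h1] at this
    exact (FractionalIdeal.mem_one_iff _).1 this
  have htη : t * η ∈ (P.asIdeal : FracIdeal K)⁻¹ * (different K)⁻¹ := by
    convert FractionalIdeal.mul_mem_mul ht hη using 1
    rw [QuadLattice.poleIdeal]
    field_simp
  have hred : ∀ a ∈ L.halfNorm, ∀ r : 𝓞 K, (r : K) = e * a →
      t * a - t * η * r ∈ (different K)⁻¹ := by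
    intro a ha r hr
    have h3 := FractionalIdeal.mul_mem_mul ht
      (FractionalIdeal.mul_mem_mul (coe_mem_coeIdeal hp) ha)
    have h4 : (P.asIdeal : FracIdeal K)⁻¹ * L.poleIdeal * (P.asIdeal * L.halfNorm) =
        (different K)⁻¹ := by
      rw [QuadLattice.poleIdeal]
      field_simp
    rw [h4] at h3
    have h5 : t * a - t * η * r = t * (p * a) := by
      rw [hr]
      linear_combination (-t * a) * hηp
    rwa [h5]
  obtain ⟨ψ, hψ⟩ := exists_addChar htη
  have hψred : ∀ a ∈ L.halfNorm, ∀ z : (P.valuation K).valuationSubring, (z : K) = e * a →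
      expTrace (2 * (t * a)) = ψ (reduction P z) := by
    intro a ha z hz
    obtain ⟨r, hr⟩ := hint a ha
    have h3 : z = ofInteger P r := Subtype.ext (hz.trans hr.symm)
    have h4 : 2 * (t * a) = 2 * (t * a - t * η * r) + 2 * (t * η * r) := by ring
    rw [h3, hψ, h4, expTrace_add, expTrace_eq_one_of_mem (hred a ha r hr), one_mul]
  have hψ1 : ψ ≠ 1 := by
    intro h
    apply ht'
    have h3 : t * η ∈ (different K)⁻¹ := by
      refine mem_of_expTrace_eq_one fun r => ?_
      rw [← hψ, h]
      rfl
    rw [QuadLattice.poleIdeal, FractionalIdeal.mem_inv_iff (mul_ne_zero h1 h2)]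
    intro y hy
    refine FractionalIdeal.mul_induction_on (C := fun y => t * y ∈ (1 : FracIdeal K)) hy
      (fun a ha d hd => ?_) fun a b ha hb => ?_
    · obtain ⟨r, hr⟩ := hint a ha
      have h4 : t * a ∈ (different K)⁻¹ := by
        have h5 := Submodule.smul_mem ((different K)⁻¹ : FracIdeal K).coeToSubmodule r h3
        have h6 := Submodule.add_mem ((different K)⁻¹ : FracIdeal K).coeToSubmodule
          (hred a ha r hr) h5
        have h7 : t * a = t * a - t * η * algebraMap (𝓞 K) K r + r • (t * η) := by
          rw [Algebra.smul_def]
          ring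
        rw [h7]
        exact h6
      have h5 := FractionalIdeal.mul_mem_mul h4 hd
      rw [inv_mul_cancel₀ h2] at h5
      rwa [← mul_assoc]
    · rw [mul_add]
      exact Submodule.add_mem (1 : FracIdeal K).coeToSubmodule ha hb
  -- the Gram matrix in local coordinates
  set α : Fin (2 * k) → K := fun i => localGenerator P (L.coeffIdeal i) with hα
  have hα0 : ∀ i, α i ≠ 0 := fun i => localGenerator_ne_zero P (L.coeffIdeal_ne_zero i)
  have hαL : ∀ i, Pi.single i (α i) ∈ L.toSubmodule := fun i =>
    single_mem_coordSubmodule (localGenerator_mem P _)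
  have hbil : ∀ i j, L.bilin (Pi.single i (α i)) (Pi.single j (α j)) = α i * L.gram i j * α j := by
    intro i j
    rw [bilin, single_dotProduct, mulVec_single]
    simp [mul_assoc]
  have hval : ∀ a ∈ L.halfNorm, P.valuation K (e * a) ≤ 1 := fun a ha => by
    obtain ⟨r, hr⟩ := hint a ha
    rw [← hr]
    exact P.valuation_le_one r
  set M₀ : Matrix (Fin (2 * k)) (Fin (2 * k)) K := fun i j =>
    if i = j then e * (α i * L.gram i i * α i / 2) else
      if i < j then e * (α i * L.gram i j * α j) else 0 with hM₀
  have hM₀v : ∀ i j, P.valuation K (M₀ i j) ≤ 1 := by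
    intro i j
    simp only [hM₀]
    split_ifs with hij hij
    · refine hval _ (L.mem_halfNorm.2 ?_)
      rw [← hbil, mul_div_cancel₀ _ two_ne_zero]
      exact L.bilin_self_mem_norm (hαL i)
    · refine hval _ ?_
      rw [← hbil]
      exact L.bilin_mem_halfNorm (hαL i) (hαL j)
    · simp
  have hM₀g : ∀ i j, M₀ i j + M₀ j i = e * (α i * L.gram i j * α j) := by
    intro i j
    have hs : L.gram j i = L.gram i j := L.gram_symm.apply i j
    simp only [hM₀]
    rcases lt_trichotomy i j with h | h | h
    · rw [if_neg h.ne, if_pos h, if_neg h.ne', if_neg h.not_gt, add_zero]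
    · subst h
      rw [if_pos rfl]
      ring
    · rw [if_neg h.ne', if_neg h.not_gt, if_neg h.ne, if_pos h, hs]
      ring
  set M : Matrix (Fin (2 * k)) (Fin (2 * k)) (P.valuation K).valuationSubring :=
    fun i j => ⟨M₀ i j, hM₀v i j⟩ with hM
  have hMM : ∀ i j, ((M + Mᵀ) i j : K) = e * (α i * L.gram i j * α j) := hM₀g
  have hcoord : ∀ (x : L.toSubmodule) i, (L.localCoord P x i : K) * α i = x.1 i := fun x i =>
    div_mul_cancel₀ _ (hα0 i)
  -- the bilinear form in local coordinates
  have hbil' : ∀ x y : L.toSubmodule, ((L.localCoord P x ⬝ᵥ (M + Mᵀ) *ᵥ L.localCoord P y :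
      (P.valuation K).valuationSubring) : K) = e * L.bilin x.1 y.1 := by
    intro x y
    rw [bilin]
    simp only [dotProduct, mulVec, Finset.mul_sum, AddSubmonoidClass.coe_finsetSum,
      MulMemClass.coe_mul, hMM]
    refine Finset.sum_congr rfl fun i _ => Finset.sum_congr rfl fun j _ => ?_
    rw [← hcoord x i, ← hcoord y j]
    ring
  have hquad : ∀ x : L.toSubmodule, ((L.localCoord P x ⬝ᵥ M *ᵥ L.localCoord P x :
      (P.valuation K).valuationSubring) : K) = e * (L.bilin x.1 x.1 / 2) := by
    intro x
    have h3 : (L.localCoord P x ⬝ᵥ (M + Mᵀ) *ᵥ L.localCoord P x) =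
        (L.localCoord P x ⬝ᵥ M *ᵥ L.localCoord P x) +
          (L.localCoord P x ⬝ᵥ M *ᵥ L.localCoord P x) := by
      rw [add_mulVec, dotProduct_add, mulVec_transpose, dotProduct_comm _ (_ ᵥ* M),
        ← dotProduct_mulVec]
    have h4 := hbil' x x
    rw [h3] at h4
    push_cast at h4
    linear_combination h4 / 2
  have hterm : ∀ x : L.toSubmodule, expTrace (t * L.bilin x.1 x.1) =
      ψ ((fun i => reduction P (L.localCoord P x i)) ⬝ᵥ (M.map (toCompletion P)).map
        (IsLocalRing.residue _) *ᵥ fun i => reduction P (L.localCoord P x i)) := by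
    intro x
    have h3 := hψred (L.bilin x.1 x.1 / 2) (L.mem_halfNorm.2 (by
      rw [mul_div_cancel₀ _ two_ne_zero]
      exact L.bilin_self_mem_norm x.2)) _ (hquad x)
    rw [show 2 * (t * (L.bilin x.1 x.1 / 2)) = t * L.bilin x.1 x.1 by ring] at h3
    rw [h3, RingHom.map_dotProduct]
    congr 2
    funext i
    rw [Function.comp_apply, RingHom.map_mulVec]
    rfl
  -- the Gram matrix is invertible modulo `P`
  have hdet : reduction P (M + Mᵀ).det ≠ 0 := by
    intro h0
    rw [RingHom.map_det] at h0
    obtain ⟨c, hc0, hc⟩ := Matrix.exists_mulVec_eq_zero_iff.2 h0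
    obtain ⟨x, hx⟩ := L.exists_localCoord c
    apply hc0
    have hxP : x.1 ∈ P.asIdeal • L.toSubmodule := by
      refine L.mem_smul_of_expTrace hk hP ht ht' x.2 fun y hy => ?_
      rw [L.bilin_comm]
      rw [hψred _ (L.bilin_mem_halfNorm hy x.2) _ (hbil' ⟨y, hy⟩ x), RingHom.map_dotProduct]
      have h3 : (reduction P ∘ ((M + Mᵀ) *ᵥ L.localCoord P x)) = 0 := by
        rw [← hc]
        funext i
        rw [Function.comp_apply, RingHom.map_mulVec]
        congr 1
        funext j
        exact hx j
      rw [h3, dotProduct_zero, AddChar.map_zero_eq_one]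
    have h3 := (L.reduction_localCoord_eq_iff x 0).2 (by simpa using hxP)
    funext i
    rw [Pi.zero_apply, ← hx i, h3 i, reduction_eq_zero_iff]
    simp [QuadLattice.localCoord]
  have hdetK : (((M + Mᵀ).det : (P.valuation K).valuationSubring) : K) =
      e ^ (2 * k) * (∏ i, α i) ^ 2 * L.gram.det := by
    have h3 : (M + Mᵀ).map (P.valuation K).valuationSubring.subtype =
        e • (diagonal α * L.gram * diagonal α) := by
      ext i j
      rw [Matrix.smul_apply, mul_diagonal, diagonal_mul, smul_eq_mul]
      exact hMM i j
    have h4 := RingHom.map_det (P.valuation K).valuationSubring.subtype (M + Mᵀ)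
    rw [RingHom.mapMatrix_apply, h3, det_smul, det_mul, det_mul, det_diagonal, Fintype.card_fin]
      at h4
    refine h4.trans ?_
    ring
  obtain ⟨d, hd⟩ : IsUnit (toCompletion P ((-1) ^ k * (M + Mᵀ).det)) := by
    rw [← IsLocalRing.residue_ne_zero_iff_isUnit]
    change reduction P ((-1) ^ k * (M + Mᵀ).det) ≠ 0
    rw [map_mul, map_pow, map_neg, map_one]
    exact mul_ne_zero (by simp) hdet
  have hdisc : ((d : P.adicCompletionIntegers K) : P.adicCompletion K) =
      algebraMap K (P.adicCompletion K) (L.localDisc P) := by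
    rw [hd, coe_toCompletion, localDisc]
    congr 1
    push_cast
    rw [hdetK]
    ring
  have hchi : L.chiStarPrime φ P = localSymbol φ P d := by
    have hex : ∃ u : (P.adicCompletionIntegers K)ˣ,
      ((u : P.adicCompletionIntegers K) : P.adicCompletion K) =
        algebraMap K (P.adicCompletion K) (L.localDisc P) := ⟨d, hdisc⟩
    rw [chiStarPrime, dif_pos hex]
    congr 1
    exact Units.ext (Subtype.ext (hex.choose_spec.trans hdisc.symm))
  rw [hchi, ← sum_quadratic_local P hφ (M.map (toCompletion P)) (u := d) (by
    rw [hd, map_mul, map_pow, map_neg, map_one, RingHom.map_det]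
    congr 2
    ext i j
    simp) hψ1]
  refine Finset.sum_bij (fun x hx i => reduction P (L.localCoord P ⟨x, hT.1 x hx⟩ i))
    (fun _ _ => Finset.mem_univ _) (fun x hx y hy h => ?_) (fun c _ => ?_) fun x hx => ?_
  · exact hT.eq_of_sub_mem hx hy ((L.reduction_localCoord_eq_iff ⟨x, hT.1 x hx⟩
      ⟨y, hT.1 y hy⟩).1 fun i => congrFun h i)
  · obtain ⟨x, hx⟩ := L.exists_localCoord c
    obtain ⟨y, ⟨hy, hyx⟩, -⟩ := hT.2 x.1 x.2
    refine ⟨y, hy, ?_⟩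
    funext i
    rw [← hx i]
    exact ((L.reduction_localCoord_eq_iff x ⟨y, hT.1 y hy⟩).2 hyx i).symm
  · exact hterm ⟨x, hT.1 x hx⟩

end LocalGauss


/-! ### The determinant ideal of a lattice -/

section DetSpan

variable {K : Type*} [Field K] [NumberField K] {n : ℕ} {P : HeightOneSpectrum (𝓞 K)}

/-- The `𝓞`-module generated by the determinants of the `n`-tuples of vectors of a lattice in `Kⁿ`.
Its behaviour under inclusions measures the index as an ideal. -/
def detSpan (Λ : Submodule (𝓞 K) (Fin n → K)) : Submodule (𝓞 K) K :=
  Submodule.span (𝓞 K) {a | ∃ M : Matrix (Fin n) (Fin n) K, (∀ i, M i ∈ Λ) ∧ a = M.det}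

theorem det_mem_detSpan {Λ : Submodule (𝓞 K) (Fin n → K)} {M : Matrix (Fin n) (Fin n) K}
    (hM : ∀ i, M i ∈ Λ) : M.det ∈ detSpan Λ := Submodule.subset_span ⟨M, hM, rfl⟩

theorem detSpan_mono {Λ Λ' : Submodule (𝓞 K) (Fin n → K)} (h : Λ ≤ Λ') :
    detSpan Λ ≤ detSpan Λ' := by
  refine Submodule.span_mono ?_
  rintro _ ⟨M, hM, rfl⟩
  exact ⟨M, fun i => h (hM i), rfl⟩

/-- `Λ' = Λ + 𝓞v` with `Λ' / Λ` isomorphic to `𝓞 / P`. -/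
structure IsPrimeExtension (P : HeightOneSpectrum (𝓞 K)) (Λ Λ' : Submodule (𝓞 K) (Fin n → K))
    (v : Fin n → K) : Prop where
  le : Λ ≤ Λ'
  mem : v ∈ Λ'
  notMem : v ∉ Λ
  exists_sub_mem : ∀ z ∈ Λ', ∃ c : 𝓞 K, z - c • v ∈ Λ
  smul_mem : ∀ p ∈ P.asIdeal, p • v ∈ Λ

variable {Λ Λ' : Submodule (𝓞 K) (Fin n → K)} {v : Fin n → K}

theorem coe_smul_apply (c : 𝓞 K) (w : Fin n → K) (i : Fin n) : (c • w) i = (c : K) * w i := by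
  rw [Pi.smul_apply, Algebra.smul_def]

theorem smul_detSpan_le (h : IsPrimeExtension P Λ Λ' v) :
    P.asIdeal • detSpan Λ' ≤ detSpan Λ := by
  rw [detSpan, Submodule.smul_le]
  intro p hp d hd
  induction hd using Submodule.span_induction with
  | zero => simp
  | add x y _ _ hx hy => rw [smul_add]; exact Submodule.add_mem _ hx hy
  | smul r x _ hx =>
    rw [smul_comm]
    exact Submodule.smul_mem _ r hx
  | mem x hx =>
    obtain ⟨M, hM, rfl⟩ := hx
    choose c hc using fun i => h.exists_sub_mem (M i) (hM i)
    set N : Matrix (Fin n) (Fin n) K := fun i => M i - c i • v with hN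
    have hpv := h.smul_mem p hp
    -- the rows of `N` are replaced by those of `M` one at a time
    have key : ∀ s : Finset (Fin n),
        p • (Matrix.det fun i => if i ∈ s then M i else N i) ∈ detSpan Λ := by
      intro s
      induction s using Finset.induction_on with
      | empty => exact Submodule.smul_mem _ p (det_mem_detSpan fun i => by simpa using hc i)
      | insert a s ha ih =>
        set X : Matrix (Fin n) (Fin n) K := fun i => if i ∈ s then M i else N i with hX
        have e1 : (fun i => if i ∈ insert a s then M i else N i) =
            X.updateRow a (N a + (c a : K) • v) := by
          funext i
          by_cases hi : i = a
          · subst hi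
            rw [updateRow_self, if_pos (Finset.mem_insert_self _ _), hN]
            change M i = M i - c i • v + (c i : K) • v
            rw [← algebraMap_smul K (c i) v, sub_add_cancel]
          · rw [updateRow_ne hi]
            simp [hX, hi]
        have e2 : X.updateRow a (N a) = X := by
          have : X a = N a := by simp [hX, ha]
          rw [← this, updateRow_eq_self]
        have e3 : (X.updateRow a v).det = (updateRow N a v).det := by
          refine det_eq_of_forall_row_eq_smul_add_const
            (fun i => if i = a then 0 else if i ∈ s then (c i : K) else 0) a (by simp) fun i j => ?_
          by_cases hi : i = a
          · subst hi; simp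
          · rw [updateRow_ne hi, updateRow_ne hi, updateRow_self, if_neg hi]
            by_cases his : i ∈ s
            · simp only [hX, his, if_true, hN]
              change M i j = (M i - c i • v) j + (c i : K) * v j
              rw [Pi.sub_apply, coe_smul_apply]
              ring
            · simp [hX, his]
        have e4 : p • (updateRow N a v).det ∈ detSpan Λ := by
          have : p • (updateRow N a v).det = (updateRow N a (p • v)).det := by
            rw [← algebraMap_smul K p v, det_updateRow_smul, Algebra.smul_def]
          rw [this]
          refine det_mem_detSpan fun i => ?_
          by_cases hi : i = a
          · subst hi; rwa [updateRow_self]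
          · rw [updateRow_ne hi]; exact hc i
        rw [e1, det_updateRow_add, e2, det_updateRow_smul, e3, smul_add]
        refine Submodule.add_mem _ ih ?_
        have : p • ((c a : K) * (updateRow N a v).det) = c a • (p • (updateRow N a v).det) := by
          simp only [Algebra.smul_def]
          ring
        rw [this]
        exact Submodule.smul_mem _ _ e4
    simpa using key Finset.univ

theorem detSpan_le_smul (h : IsPrimeExtension P Λ Λ' v) :
    detSpan Λ ≤ P.asIdeal • detSpan Λ' := by
  have hmax : P.asIdeal.IsMaximal := P.isMaximal
  refine Submodule.span_le.2 ?_
  rintro _ ⟨M, hM, rfl⟩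
  by_cases hdet : M.det = 0
  · rw [hdet]
    exact Submodule.zero_mem _
  -- the coordinates of `v` in the basis formed by the rows of `M`
  set r : Fin n → K := v ᵥ* M⁻¹ with hr
  have hv : r ᵥ* M = v := by
    rw [hr, vecMul_vecMul, nonsing_inv_mul _ (isUnit_iff_ne_zero.2 hdet), vecMul_one]
  have hcase : ∃ i, ∃ a ∈ P.asIdeal, ∃ d ∉ P.asIdeal, r i * (a : K) = (d : 𝓞 K) := by
    by_contra! hno
    have hint : ∀ i, ∃ d ∉ P.asIdeal, ∃ a : 𝓞 K, r i * (d : K) = a := by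
      intro i
      obtain ⟨a, d, had⟩ := P.exists_primeCompl_mul_eq_or_mul_eq (r i)
      rcases had with had | had
      · exact ⟨d, d.2, a, had⟩
      · by_cases ha : a ∈ P.asIdeal
        · exact absurd had (hno i a ha d d.2)
        · exact ⟨a, ha, d, had⟩
    choose d hd a ha using hint
    -- a common denominator prime to `P`
    set D : 𝓞 K := ∏ i, d i with hD
    have hDP : D ∉ P.asIdeal := fun hmem => by
      obtain ⟨i, -, hi⟩ := (P.isPrime.prod_mem_iff).1 hmem
      exact hd i hi
    have hDv : D • v ∈ Λ := by
      rw [← hv, vecMul_eq_sum, Finset.smul_sum]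
      refine Submodule.sum_mem _ fun i _ => ?_
      have : D • (r i • M i) = ((∏ j ∈ Finset.univ.erase i, d j) * a i) • M i := by
        rw [hD, ← Finset.mul_prod_erase _ _ (Finset.mem_univ i)]
        funext j
        rw [coe_smul_apply, coe_smul_apply, Pi.smul_apply, smul_eq_mul]
        push_cast
        linear_combination (∏ i ∈ Finset.univ.erase i, (d i : K)) * M i j * ha i
      rw [this]
      exact Λ.smul_mem _ (hM i)
    obtain ⟨e, p, hp, hep⟩ := hmax.exists_inv hDP
    apply h.notMem
    have : v = e • (D • v) + p • v := by
      rw [smul_smul, ← add_smul, hep, one_smul]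
    rw [this]
    exact Λ.add_mem (Λ.smul_mem e hDv) (h.smul_mem p hp)
  obtain ⟨i, a, ha, d, hd, had⟩ := hcase
  have h1 : (M.updateRow i v).det = r i * M.det := by
    conv_lhs => rw [← hv]
    rw [vecMul_eq_sum]
    have := det_updateRow_sum M i r
    simpa using this
  have h2 : (M.updateRow i v).det ∈ detSpan Λ' := det_mem_detSpan fun j => by
    by_cases hj : j = i
    · subst hj; rw [updateRow_self]; exact h.mem
    · rw [updateRow_ne hj]; exact h.le (hM j)
  have h3 : d • M.det ∈ P.asIdeal • detSpan Λ' := by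
    have : d • M.det = a • (M.updateRow i v).det := by
      rw [h1, Algebra.smul_def, Algebra.smul_def]
      change (d : K) * M.det = (a : K) * _
      rw [← had]
      ring
    rw [this]
    exact Submodule.smul_mem_smul ha h2
  obtain ⟨e, p, hp, hep⟩ := hmax.exists_inv hd
  have h4 : M.det = e • (d • M.det) + p • M.det := by
    rw [smul_smul, ← add_smul, hep, one_smul]
  rw [SetLike.mem_coe, h4]
  exact Submodule.add_mem _ (Submodule.smul_mem _ e h3)
    (Submodule.smul_mem_smul hp (detSpan_mono h.le (det_mem_detSpan hM)))

/-- A step with quotient `𝓞 / P` multiplies the determinant ideal by `P`. -/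
theorem detSpan_eq_smul (h : IsPrimeExtension P Λ Λ' v) :
    detSpan Λ = P.asIdeal • detSpan Λ' :=
  le_antisymm (detSpan_le_smul h) (smul_detSpan_le h)

end DetSpan


/-! ### Multiplicativity of `χ*` -/

section ChiStar

variable {K : Type*} [Field K] [NumberField K] {k : ℕ} (L : QuadLattice K (2 * k))
  (φ : SymbolChoice K)

theorem QuadLattice.chiStar_one : L.chiStar φ 1 = 1 := by
  simp [chiStar, FractionalIdeal.count_one]

theorem QuadLattice.chiStar_mul {J J' : FracIdeal K} (hJ : J ≠ 0) (hJ' : J' ≠ 0) :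
    L.chiStar φ (J * J') = L.chiStar φ J * L.chiStar φ J' := by
  have hfin : ∀ J : FracIdeal K, (Function.mulSupport fun P : HeightOneSpectrum (𝓞 K) =>
      L.chiStarPrime φ P ^ FractionalIdeal.count K P J).Finite := by
    intro J
    refine (Filter.eventually_cofinite.1 (FractionalIdeal.finite_factors J)).subset fun P hP h => ?_
    apply hP
    simp only [h, zpow_zero]
  rw [chiStar, chiStar, chiStar, ← finprod_mul_distrib (hfin J) (hfin J')]
  refine finprod_congr fun P => ?_
  rw [FractionalIdeal.count_mul K P hJ hJ', _root_.zpow_add]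

theorem QuadLattice.chiStar_prime (P : HeightOneSpectrum (𝓞 K)) :
    L.chiStar φ (P.asIdeal : FracIdeal K) = L.chiStarPrime φ P := by
  rw [chiStar, finprod_eq_single _ P fun Q hQ => by
    rw [FractionalIdeal.count_maximal_coprime K Q hQ.symm, zpow_zero]]
  rw [FractionalIdeal.count_self, zpow_one]

end ChiStar

/-! ### Gauss sums of lattices -/

section PrimeExtension

variable {K : Type*} [Field K] [NumberField K] [IsTotallyReal K] {m n : ℕ}
  (L : QuadLattice K m) {P : HeightOneSpectrum (𝓞 K)}
  {Λ Λ' : Submodule (𝓞 K) (Fin n → K)} {v w : Fin n → K} {s : Matrix (Fin n) (Fin n) K}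

open Classical in
/-- If the form pairs `v` with `w` nontrivially modulo `(𝔑∂)⁻¹`, the matrices `x ᵗv`, with `x` in
`L / PL`, represent `L ⊗ (Λ + 𝓞v)` modulo `L ⊗ Λ`. The vector `w` serves to separate the classes. -/
theorem IsPrimeExtension.isTransversal (hm : 0 < m) (hP : ¬ L.DvdLevel P)
    (h : IsPrimeExtension P Λ Λ' v) (hw : w ⬝ᵥ s *ᵥ v ∈ (P.asIdeal : FracIdeal K)⁻¹ * L.poleIdeal)
    (hw' : w ⬝ᵥ s *ᵥ v ∉ L.poleIdeal) (hwΛ : ∀ z ∈ Λ, w ⬝ᵥ s *ᵥ z ∈ L.poleIdeal)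
    {T : Finset (Fin m → K)}
    (hT : IsTransversal L.toSubmodule (P.asIdeal • L.toSubmodule) T) :
    IsTransversal (tens L.toSubmodule Λ') (tens L.toSubmodule Λ)
      (T.image fun x => vecMulVec x v) ∧ Set.InjOn (fun x : Fin m → K => vecMulVec x v) T := by
  let f : (Fin m → K) →+ Matrix (Fin m) (Fin n) K :=
    { toFun := fun x => vecMulVec x v
      map_zero' := by simp
      map_add' := fun x y => add_vecMulVec x y v }
  have hf : ∀ x ∈ L.toSubmodule, f x ∈ tens L.toSubmodule Λ ↔ x ∈ P.asIdeal • L.toSubmodule := by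
    intro x hx
    constructor
    · intro hxv
      refine L.mem_smul_of_expTrace hm hP hw hw' hx fun y hy => ?_
      have h1 := L.expTrace_pairing_eq_one (s := s) (fun x hx => L.bilin_self_mem_norm hx)
        (M := Λ) (M' := Submodule.span (𝓞 K) {w}) (T := L.poleIdeal) (fun z hz w' hw' => by
          obtain ⟨c, rfl⟩ := Submodule.mem_span_singleton.1 hw'
          rw [smul_dotProduct]
          exact Submodule.smul_mem (L.poleIdeal : Submodule (𝓞 K) K) c (hwΛ z hz))
        (L.norm_mul_poleIdeal hm).le hxv
        (vecMulVec_mem_tens hy (Submodule.mem_span_singleton_self w))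
      rw [← h1]
      change _ = expTrace (2 * L.pairing s (vecMulVec x v) (vecMulVec y w))
      rw [L.pairing_vecMulVec, mul_comm (L.bilin x y)]
    · intro hx
      refine Submodule.smul_induction_on hx (fun p hp y hy => ?_) fun y z hy hz => ?_
      · change vecMulVec (p • y) v ∈ _
        rw [smul_vecMulVec, ← vecMulVec_smul]
        exact vecMulVec_mem_tens hy (h.smul_mem p hp)
      · rw [map_add]
        exact Submodule.add_mem _ hy hz
  refine ⟨hT.image f (fun x hx => vecMulVec_mem_tens hx h.mem) hf fun U hU => ?_,
    hT.injOn_image f hf⟩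
  induction hU using tens_induction with
  | tensor y hy z hz =>
    obtain ⟨c, hc⟩ := h.exists_sub_mem z hz
    refine ⟨c • y, L.toSubmodule.smul_mem c hy, ?_⟩
    change vecMulVec y z - vecMulVec (c • y) v ∈ _
    have : vecMulVec y z - vecMulVec (c • y) v = vecMulVec y (z - c • v) := by
      rw [vecMulVec_sub, vecMulVec_smul, smul_vecMulVec]
    rw [this]
    exact vecMulVec_mem_tens hy hc
  | zero => exact ⟨0, Submodule.zero_mem _, by simp⟩
  | add U hU V hV h1 h2 =>
    obtain ⟨x, hx, hxU⟩ := h1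
    obtain ⟨y, hy, hyV⟩ := h2
    refine ⟨x + y, Submodule.add_mem _ hx hy, ?_⟩
    rw [map_add, add_sub_add_comm]
    exact Submodule.add_mem _ hxU hyV

theorem QuadLattice.card_transversal {T : Finset (Fin m → K)}
    (hT : IsTransversal L.toSubmodule (P.asIdeal • L.toSubmodule) T) :
    T.card = Ideal.absNorm P.asIdeal ^ m := by
  classical
  have := Fintype.ofFinite (LocalResidue P)
  have hc : Fintype.card (Fin m → LocalResidue P) = Ideal.absNorm P.asIdeal ^ m := by
    rw [← card_localResidue, Nat.card_eq_fintype_card, Fintype.card_fun, Fintype.card_fin]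
  rw [← hc, ← Finset.card_univ]
  refine Finset.card_bij (fun x hx i => reduction P (L.localCoord P ⟨x, hT.1 x hx⟩ i))
    (fun _ _ => Finset.mem_univ _) (fun x hx y hy h => ?_) fun c _ => ?_
  · exact hT.eq_of_sub_mem hx hy ((L.reduction_localCoord_eq_iff ⟨x, hT.1 x hx⟩
      ⟨y, hT.1 y hy⟩).1 fun i => congrFun h i)
  · obtain ⟨x, hx⟩ := L.exists_localCoord c
    obtain ⟨y, ⟨hy, hyx⟩, -⟩ := hT.2 x.1 x.2
    refine ⟨y, hy, ?_⟩
    funext i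
    rw [← hx i]
    exact ((L.reduction_localCoord_eq_iff x ⟨y, hT.1 y hy⟩).2 hyx i).symm

/-- The bilinear form scaled by an element of `P⁻¹(𝔑∂)⁻¹` defines characters on `L / PL`. -/
theorem QuadLattice.expTrace_smul_eq_one (hm : 0 < m) {t : K}
    (ht : t ∈ (P.asIdeal : FracIdeal K)⁻¹ * L.poleIdeal) {x y : Fin m → K}
    (hx : x ∈ L.toSubmodule) (hy : y ∈ P.asIdeal • L.toSubmodule) :
    expTrace (2 * (t * L.bilin x y)) = 1 := by
  refine Submodule.smul_induction_on hy (fun p hp y hy => ?_) fun y z hy hz => ?_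
  · refine expTrace_eq_one_of_mem ?_
    rw [L.bilin_smul_right]
    have h1 := FractionalIdeal.mul_mem_mul ht (FractionalIdeal.mul_mem_mul (coe_mem_coeIdeal hp)
      (L.bilin_mem_halfNorm hx hy))
    have h2 := L.halfNorm_ne_zero hm
    have h3 := coeIdeal_prime_ne_zero P
    have h4 := different_ne_zero (K := K)
    have h5 : (P.asIdeal : FracIdeal K)⁻¹ * L.poleIdeal * (P.asIdeal * L.halfNorm) =
        (different K)⁻¹ := by
      rw [QuadLattice.poleIdeal]
      field_simp
    rwa [h5] at h1
  · rw [L.bilin_add_right, mul_add, mul_add, expTrace_add, hy, hz, one_mul]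

open Classical in
/-- Orthogonality of the characters of `L / PL`. -/
theorem QuadLattice.sum_expTrace_linear (hm : 0 < m) (hP : ¬ L.DvdLevel P) {t : K}
    (ht : t ∈ (P.asIdeal : FracIdeal K)⁻¹ * L.poleIdeal) (ht' : t ∉ L.poleIdeal)
    {T : Finset (Fin m → K)}
    (hT : IsTransversal L.toSubmodule (P.asIdeal • L.toSubmodule) T) {x : Fin m → K}
    (hx : x ∈ L.toSubmodule) :
    ∑ y ∈ T, expTrace (2 * (t * L.bilin x y)) =
      if x ∈ P.asIdeal • L.toSubmodule then (Ideal.absNorm P.asIdeal : ℂ) ^ m else 0 := by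
  split_ifs with hxP
  · rw [Finset.sum_congr rfl fun y hy => by
      rw [L.bilin_comm, L.expTrace_smul_eq_one hm ht (hT.1 y hy) hxP]]
    rw [Finset.sum_const, L.card_transversal hT]
    simp
  · obtain ⟨z, hz, hz1⟩ : ∃ z ∈ L.toSubmodule, expTrace (2 * (t * L.bilin x z)) ≠ 1 := by
      by_contra! h
      exact hxP (L.mem_smul_of_expTrace hm hP ht ht' hx h)
    have hper : ∀ y ∈ L.toSubmodule, ∀ u ∈ P.asIdeal • L.toSubmodule,
        expTrace (2 * (t * L.bilin x (y + u))) = expTrace (2 * (t * L.bilin x y)) := by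
      intro y _ u hu
      rw [L.bilin_add_right, mul_add, mul_add, expTrace_add, L.expTrace_smul_eq_one hm ht hx hu,
        mul_one]
    have h1 := hT.sum_add
      (f := fun y => expTrace (2 * (t * L.bilin x y))) hper hz
    simp only [L.bilin_add_right, mul_add, expTrace_add] at h1
    rw [← Finset.sum_mul] at h1
    have h2 : (∑ y ∈ T, expTrace (2 * (t * L.bilin x y))) *
        (expTrace (2 * (t * L.bilin x z)) - 1) = 0 := by
      linear_combination h1
    exact (mul_eq_zero.1 h2).resolve_right (sub_ne_zero.2 hz1)

end PrimeExtension


section Radical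

variable {K : Type*} [Field K] [NumberField K] [IsTotallyReal K] {n : ℕ} {P : HeightOneSpectrum (𝓞 K)}
  {R : FracIdeal K} {s : Matrix (Fin n) (Fin n) K} {Λ M W : Submodule (𝓞 K) (Fin n → K)}
  {v w z : Fin n → K}

theorem dotProduct_mulVec_comm (hs : s.IsSymm) (v w : Fin n → K) :
    v ⬝ᵥ s *ᵥ w = w ⬝ᵥ s *ᵥ v := by
  rw [dotProduct_comm, ← vecMul_transpose, hs.eq, dotProduct_mulVec]

theorem dotProduct_mulVec_smul (c : 𝓞 K) (v w : Fin n → K) :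
    v ⬝ᵥ s *ᵥ (c • w) = c • (v ⬝ᵥ s *ᵥ w) := by
  rw [mulVec_smul, dotProduct_smul]

theorem dotProduct_mulVec_sub_smul (c : 𝓞 K) (v w z : Fin n → K) :
    v ⬝ᵥ s *ᵥ (z - c • w) = v ⬝ᵥ s *ᵥ z - c * (v ⬝ᵥ s *ᵥ w) := by
  rw [mulVec_sub, dotProduct_sub, dotProduct_mulVec_smul, Algebra.smul_def]

/-- `P⁻¹R / R` is one-dimensional over `𝓞 / P`. -/
theorem exists_sub_mul_mem (hR : R ≠ 0) {t₀ t : K} (h₀ : t₀ ∈ (P.asIdeal : FracIdeal K)⁻¹ * R)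
    (h₀' : t₀ ∉ R) (ht : t ∈ (P.asIdeal : FracIdeal K)⁻¹ * R) : ∃ c : 𝓞 K, t - c * t₀ ∈ R := by
  have hP0 := coeIdeal_prime_ne_zero P
  have ht0 : FractionalIdeal.spanSingleton (𝓞 K)⁰ t₀ ≠ 0 := spanSingleton_ne_zero fun h => h₀' (by
    rw [h]; exact FractionalIdeal.zero_mem _)
  have hle : FractionalIdeal.spanSingleton (𝓞 K)⁰ t₀ ≤ (P.asIdeal : FracIdeal K)⁻¹ * R :=
    FractionalIdeal.spanSingleton_le_iff_mem.2 h₀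
  obtain ⟨c, hc, p, hp, hcp⟩ := exists_add_eq_one P
    (J := (P.asIdeal : FracIdeal K) * FractionalIdeal.spanSingleton (𝓞 K)⁰ t₀ * R⁻¹) (by
      refine FracIdeal.le_of_mul_le_mul_right hR ?_
      have : (P.asIdeal : FracIdeal K) * ((P.asIdeal : FracIdeal K)⁻¹ * R) = R := by field_simp
      rw [mul_assoc, inv_mul_cancel₀ hR, mul_one, one_mul]
      calc _ ≤ (P.asIdeal : FracIdeal K) * ((P.asIdeal : FracIdeal K)⁻¹ * R) := by gcongr
        _ = R := this) (fun h => by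
      apply h₀'
      rw [← FractionalIdeal.spanSingleton_le_iff_mem]
      have h1 : (P.asIdeal : FracIdeal K) * FractionalIdeal.spanSingleton (𝓞 K)⁰ t₀ * R⁻¹ *
          ((P.asIdeal : FracIdeal K)⁻¹ * R) ≤ P.asIdeal * ((P.asIdeal : FracIdeal K)⁻¹ * R) := by
        gcongr
      have e1 : (P.asIdeal : FracIdeal K) * FractionalIdeal.spanSingleton (𝓞 K)⁰ t₀ * R⁻¹ *
          ((P.asIdeal : FracIdeal K)⁻¹ * R) = FractionalIdeal.spanSingleton (𝓞 K)⁰ t₀ := by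
        field_simp
      have e2 : (P.asIdeal : FracIdeal K) * ((P.asIdeal : FracIdeal K)⁻¹ * R) = R := by field_simp
      rwa [e1, e2] at h1)
  have h1 : c * t ∈ FractionalIdeal.spanSingleton (𝓞 K)⁰ t₀ := by
    have := FractionalIdeal.mul_mem_mul hc ht
    have e1 : (P.asIdeal : FracIdeal K) * FractionalIdeal.spanSingleton (𝓞 K)⁰ t₀ * R⁻¹ *
          ((P.asIdeal : FracIdeal K)⁻¹ * R) = FractionalIdeal.spanSingleton (𝓞 K)⁰ t₀ := by
        field_simp
    rwa [e1] at this
  have h2 : (p : K) * t ∈ R := by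
    have := FractionalIdeal.mul_mem_mul (coe_mem_coeIdeal hp) ht
    have e2 : (P.asIdeal : FracIdeal K) * ((P.asIdeal : FracIdeal K)⁻¹ * R) = R := by field_simp
    rwa [e2] at this
  obtain ⟨b, hb⟩ := (FractionalIdeal.mem_spanSingleton _).1 h1
  refine ⟨b, ?_⟩
  have e : t - b * t₀ = p * t := by
    rw [Algebra.smul_def] at hb
    change (b : K) * t₀ = c * t at hb
    rw [hb]
    linear_combination (-t) * hcp
  rwa [e]

theorem mem_inv_mul_of_smul_mem {t : K} (h : ∀ p ∈ P.asIdeal, p • t ∈ R) :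
    t ∈ (P.asIdeal : FracIdeal K)⁻¹ * R := by
  have hP0 := coeIdeal_prime_ne_zero P
  have h1 : (P.asIdeal : FracIdeal K) * FractionalIdeal.spanSingleton (𝓞 K)⁰ t ≤ R := by
    rw [FractionalIdeal.mul_le]
    intro i hi j hj
    obtain ⟨p, hp, rfl⟩ := (FractionalIdeal.mem_coeIdeal _).1 hi
    obtain ⟨c, rfl⟩ := (FractionalIdeal.mem_spanSingleton _).1 hj
    have := Submodule.smul_mem (R : Submodule (𝓞 K) K) c (h p hp)
    rw [← Algebra.smul_def, smul_comm]
    exact this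
  rw [← FractionalIdeal.spanSingleton_le_iff_mem]
  calc FractionalIdeal.spanSingleton (𝓞 K)⁰ t = (P.asIdeal : FracIdeal K)⁻¹ *
        (P.asIdeal * FractionalIdeal.spanSingleton (𝓞 K)⁰ t) := by field_simp
    _ ≤ _ := by gcongr

/-- `Λ` is the radical of the form `(z, w) ↦ ᵗz s w` on `M`, taken modulo the ideal `R`. -/
structure IsRadical (R : FracIdeal K) (s : Matrix (Fin n) (Fin n) K)
    (Λ M : Submodule (𝓞 K) (Fin n → K)) : Prop where
  le : Λ ≤ M
  mem_iff : ∀ w ∈ M, w ∈ Λ ↔ ∀ z ∈ M, z ⬝ᵥ s *ᵥ w ∈ R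

/-- The vectors of `M` orthogonal to `v` modulo `R`. -/
def orthogonal (R : FracIdeal K) (s : Matrix (Fin n) (Fin n) K) (M : Submodule (𝓞 K) (Fin n → K))
    (v : Fin n → K) : Submodule (𝓞 K) (Fin n → K) where
  carrier := {w | w ∈ M ∧ v ⬝ᵥ s *ᵥ w ∈ R}
  add_mem' := fun ha hb => ⟨M.add_mem ha.1 hb.1, by
    rw [mulVec_add, dotProduct_add]
    exact Submodule.add_mem (R : Submodule (𝓞 K) K) ha.2 hb.2⟩
  zero_mem' := ⟨M.zero_mem, by simp [FractionalIdeal.zero_mem]⟩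
  smul_mem' := fun c _ hw => ⟨M.smul_mem c hw.1, by
    rw [dotProduct_mulVec_smul]
    exact Submodule.smul_mem (R : Submodule (𝓞 K) K) c hw.2⟩

theorem orthogonal_le : orthogonal R s M v ≤ M := fun _ h => h.1

theorem IsRadical.dotProduct_mem (h : IsRadical R s Λ M) (hz : z ∈ M) (hw : w ∈ Λ) :
    z ⬝ᵥ s *ᵥ w ∈ R := (h.mem_iff w (h.le hw)).1 hw z hz

theorem IsRadical.dotProduct_mem' (hs : s.IsSymm) (h : IsRadical R s Λ M) (hz : z ∈ Λ) (hw : w ∈ M) :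
    z ⬝ᵥ s *ᵥ w ∈ R := by
  rw [dotProduct_mulVec_comm hs]
  exact h.dotProduct_mem hw hz

theorem IsRadical.le_orthogonal (h : IsRadical R s Λ M) (hv : v ∈ M) :
    Λ ≤ orthogonal R s M v := fun _ hw => ⟨h.le hw, h.dotProduct_mem hv hw⟩

/-- If `Pv ⊆ Λ`, then the values of the form at `v` lie in `P⁻¹R`. -/
theorem IsRadical.dotProduct_mem_inv (hs : s.IsSymm) (h : IsRadical R s Λ M)
    (hPv : ∀ p ∈ P.asIdeal, p • v ∈ Λ) (hw : w ∈ M) :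
    v ⬝ᵥ s *ᵥ w ∈ (P.asIdeal : FracIdeal K)⁻¹ * R := by
  refine mem_inv_mul_of_smul_mem fun p hp => ?_
  rw [dotProduct_mulVec_comm hs, ← dotProduct_mulVec_smul]
  exact h.dotProduct_mem hw (hPv p hp)

/-- The orthogonal complement of `v` has colength one in `M`. -/
theorem IsRadical.isPrimeExtension_orthogonal (hs : s.IsSymm) (hR : R ≠ 0) (h : IsRadical R s Λ M)
    (hPv : ∀ p ∈ P.asIdeal, p • v ∈ Λ) (hw : w ∈ M) (hvw : v ⬝ᵥ s *ᵥ w ∉ R) :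
    IsPrimeExtension P (orthogonal R s M v) M w where
  le := orthogonal_le
  mem := hw
  notMem := fun h => hvw h.2
  exists_sub_mem := fun z hz => by
    obtain ⟨c, hc⟩ := exists_sub_mul_mem hR (h.dotProduct_mem_inv hs hPv hw) hvw
      (h.dotProduct_mem_inv hs hPv hz)
    exact ⟨c, M.sub_mem hz (M.smul_mem c hw), by rwa [dotProduct_mulVec_sub_smul]⟩
  smul_mem := fun p hp => ⟨M.smul_mem p hw, by
    rw [dotProduct_mulVec_smul, dotProduct_mulVec_comm hs, ← dotProduct_mulVec_smul]
    exact h.dotProduct_mem hw (hPv p hp)⟩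

/-- If the form does not vanish at `v`, then `M` is, up to `Λ`, the sum of the line of `v` and its
orthogonal complement, on which the radical is still `Λ`. -/
theorem IsRadical.orthogonal_of_notMem (hs : s.IsSymm) (h : IsRadical R s Λ M)
    (hv : v ∈ M) (hext : IsPrimeExtension P (orthogonal R s M v) M v) :
    IsRadical R s Λ (orthogonal R s M v) where
  le := h.le_orthogonal hv
  mem_iff := fun w hw => by
    rw [h.mem_iff w hw.1]
    refine ⟨fun h1 z hz => h1 z hz.1, fun h1 z hz => ?_⟩
    obtain ⟨c, hc⟩ := hext.exists_sub_mem z hz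
    have h2 := h1 _ hc
    rw [dotProduct_mulVec_comm hs, dotProduct_mulVec_sub_smul, dotProduct_mulVec_comm hs w v] at h2
    have h3 := Submodule.add_mem (R : Submodule (𝓞 K) K) h2
      (Submodule.smul_mem (R : Submodule (𝓞 K) K) c hw.2)
    rw [Algebra.smul_def] at h3
    rw [dotProduct_mulVec_comm hs]
    have e : w ⬝ᵥ s *ᵥ z - c * (v ⬝ᵥ s *ᵥ w) + (algebraMap (𝓞 K) K) c * (v ⬝ᵥ s *ᵥ w) =
      w ⬝ᵥ s *ᵥ z := sub_add_cancel _ _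
    rwa [e] at h3

theorem isPrimeExtension_sup (hvΛ : v ∉ Λ) (hPv : ∀ p ∈ P.asIdeal, p • v ∈ Λ) :
    IsPrimeExtension P Λ (Λ ⊔ Submodule.span (𝓞 K) {v}) v where
  le := le_sup_left
  mem := Submodule.mem_sup_right (Submodule.mem_span_singleton_self v)
  notMem := hvΛ
  exists_sub_mem := fun z hz => by
    obtain ⟨x, hx, y, hy, rfl⟩ := Submodule.mem_sup.1 hz
    obtain ⟨c, rfl⟩ := Submodule.mem_span_singleton.1 hy
    exact ⟨c, by simpa using hx⟩
  smul_mem := hPv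

/-- If `v` is isotropic but not in the radical, then the radical of the orthogonal complement of `v`
is `Λ + 𝓞v`: passing from `M` to the complement removes a hyperbolic plane. -/
theorem IsRadical.sup_orthogonal (hs : s.IsSymm) (h : IsRadical R s Λ M)
    (hv : v ∈ M) (hvv : v ⬝ᵥ s *ᵥ v ∈ R) (hR : R ≠ 0)
    (hPv : ∀ p ∈ P.asIdeal, p • v ∈ Λ) (hw : w ∈ M) (hvw : v ⬝ᵥ s *ᵥ w ∉ R) :
    IsRadical R s (Λ ⊔ Submodule.span (𝓞 K) {v}) (orthogonal R s M v) where
  le := sup_le (h.le_orthogonal hv) ((Submodule.span_singleton_le_iff_mem _ _).2 ⟨hv, hvv⟩)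
  mem_iff := fun x hx => by
    have hext := h.isPrimeExtension_orthogonal hs hR hPv hw hvw
    constructor
    · intro hx z hz
      obtain ⟨a, ha, y, hy, rfl⟩ := Submodule.mem_sup.1 hx
      obtain ⟨c, rfl⟩ := Submodule.mem_span_singleton.1 hy
      rw [mulVec_add, dotProduct_add, dotProduct_mulVec_smul, dotProduct_mulVec_comm hs z v]
      exact Submodule.add_mem (R : Submodule (𝓞 K) K) (h.dotProduct_mem hz.1 ha)
        (Submodule.smul_mem (R : Submodule (𝓞 K) K) c hz.2)
    · intro hx'
      have h1 : w ⬝ᵥ s *ᵥ x ∈ (P.asIdeal : FracIdeal K)⁻¹ * R := by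
        refine mem_inv_mul_of_smul_mem fun p hp => ?_
        rw [dotProduct_mulVec_comm hs, ← dotProduct_mulVec_smul, dotProduct_mulVec_comm hs]
        exact hx' _ (hext.smul_mem p hp)
      have hwv : w ⬝ᵥ s *ᵥ v ∉ R := by rwa [dotProduct_mulVec_comm hs]
      have h2 : w ⬝ᵥ s *ᵥ v ∈ (P.asIdeal : FracIdeal K)⁻¹ * R := by
        rw [dotProduct_mulVec_comm hs]
        exact h.dotProduct_mem_inv hs hPv hw
      obtain ⟨c, hc⟩ := exists_sub_mul_mem hR h2 hwv h1
      rw [← dotProduct_mulVec_sub_smul] at hc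
      have h3 : x - c • v ∈ Λ := by
        rw [h.mem_iff _ (M.sub_mem hx.1 (M.smul_mem c hv))]
        intro z hz
        obtain ⟨b, hb⟩ := hext.exists_sub_mem z hz
        have h4 : (z - b • w) ⬝ᵥ s *ᵥ (x - c • v) ∈ R := by
          rw [mulVec_sub, dotProduct_sub, dotProduct_mulVec_smul, dotProduct_mulVec_comm hs _ v]
          exact Submodule.sub_mem (R : Submodule (𝓞 K) K) (hx' _ hb)
            (Submodule.smul_mem (R : Submodule (𝓞 K) K) c hb.2)
        have h5 := Submodule.add_mem (R : Submodule (𝓞 K) K) h4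
          (Submodule.smul_mem (R : Submodule (𝓞 K) K) b hc)
        rwa [sub_dotProduct, smul_dotProduct, sub_add_cancel] at h5
      rw [← sub_add_cancel x (c • v)]
      exact Submodule.add_mem_sup h3 (Submodule.smul_mem _ c (Submodule.mem_span_singleton_self v))

end Radical


section GaussSum

variable {K : Type*} [Field K] [NumberField K] [IsTotallyReal K] {k m n : ℕ}
  {P : HeightOneSpectrum (𝓞 K)} {s : Matrix (Fin n) (Fin n) K}
  {Λ M W : Submodule (𝓞 K) (Fin n → K)} {v w z : Fin n → K}

theorem QuadLattice.poleIdeal_ne_zero (L : QuadLattice K m) (hm : 0 < m) : L.poleIdeal ≠ 0 :=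
  inv_ne_zero (mul_ne_zero (L.halfNorm_ne_zero hm) different_ne_zero)

theorem QuadLattice.toSubmodule_fg (L : QuadLattice K m) : L.toSubmodule.FG :=
  coordSubmodule_fg L.coeffIdeal

theorem QuadLattice.expTrace_pairing_vecMulVec_eq_one (L : QuadLattice K m) (hm : 0 < m)
    (hs : s.IsSymm) (hv : ∀ z ∈ M, v ⬝ᵥ s *ᵥ z ∈ L.poleIdeal) {x : Fin m → K}
    (hx : x ∈ L.toSubmodule) {U : Matrix (Fin m) (Fin n) K} (hU : U ∈ tens L.toSubmodule M) :
    expTrace (2 * L.pairing s (vecMulVec x v) U) = 1 := by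
  rw [L.pairing_comm hs]
  refine L.expTrace_pairing_eq_one (s := s) (fun x hx => L.bilin_self_mem_norm hx)
    (M := M) (M' := Submodule.span (𝓞 K) {v}) (T := L.poleIdeal) (fun z hz w' hw' => ?_)
    (L.norm_mul_poleIdeal hm).le hU (vecMulVec_mem_tens hx (Submodule.mem_span_singleton_self v))
  obtain ⟨c, rfl⟩ := Submodule.mem_span_singleton.1 hw'
  rw [smul_dotProduct]
  exact Submodule.smul_mem (L.poleIdeal : Submodule (𝓞 K) K) c (hv z hz)

theorem IsRadical.quadExp_eq_one {L : QuadLattice K m} (h : IsRadical L.poleIdeal s Λ M)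
    (hm : 0 < m) (hs : s.IsSymm) {V : Matrix (Fin m) (Fin n) K} (hV : V ∈ tens L.toSubmodule Λ) :
    L.quadExp s V = 1 :=
  L.quadExp_eq_one hs (fun _ hx => L.bilin_self_mem_norm hx)
    (fun _ hw _ hz => h.dotProduct_mem (h.le hz) hw) (L.norm_mul_poleIdeal hm).le hV

theorem IsRadical.quadExp_add {L : QuadLattice K m} (h : IsRadical L.poleIdeal s Λ M)
    (hm : 0 < m) (hs : s.IsSymm) {U V : Matrix (Fin m) (Fin n) K} (hU : U ∈ tens L.toSubmodule M)
    (hV : V ∈ tens L.toSubmodule Λ) : L.quadExp s (U + V) = L.quadExp s U := by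
  have h1 := L.expTrace_pairing_eq_one (s := s) (M := M) (M' := Λ) (T := L.poleIdeal)
    (fun x hx => L.bilin_self_mem_norm hx) (fun _ hw _ hz => h.dotProduct_mem' hs hz hw)
    (L.norm_mul_poleIdeal hm).le hU hV
  rw [L.quadExp_add hs, h.quadExp_eq_one hm hs hV, h1, mul_one, mul_one]

/-- Splitting off the line spanned by a vector on which the form does not vanish modulo `(𝔑∂)⁻¹`. -/
theorem exists_gaussSum_of_notMem (L : QuadLattice K (2 * k)) (hk : 0 < 2 * k) (hs : s.IsSymm)
    {φ : SymbolChoice K} (hφ : (2 : 𝓞 K) ∈ P.asIdeal → IsKroneckerSymbol P (φ P))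
    (hP : ¬ L.DvdLevel P) (h : IsRadical L.poleIdeal s Λ M) (hv : v ∈ M)
    (hPv : ∀ p ∈ P.asIdeal, p • v ∈ Λ) (hvv : v ⬝ᵥ s *ᵥ v ∉ L.poleIdeal)
    {X : Finset (Fin (2 * k) → K)} (hX : IsTransversal L.toSubmodule (P.asIdeal • L.toSubmodule) X)
    {T : Finset (Matrix (Fin (2 * k)) (Fin n) K)}
    (hT : IsTransversal (tens L.toSubmodule (orthogonal L.poleIdeal s M v))
      (tens L.toSubmodule Λ) T) :
    ∃ T', IsTransversal (tens L.toSubmodule M) (tens L.toSubmodule Λ) T' ∧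
      T'.card = X.card * T.card ∧
      ∑ U ∈ T', L.quadExp s U = (Ideal.absNorm P.asIdeal : ℂ) ^ k *
        ((L.chiStarPrime φ P : ℤ) : ℂ) * ∑ U ∈ T, L.quadExp s U := by
  classical
  have hR := L.poleIdeal_ne_zero hk
  have hext := h.isPrimeExtension_orthogonal hs hR hPv hv hvv
  have hvv' := h.dotProduct_mem_inv hs hPv hv
  obtain ⟨h1, h2⟩ := hext.isTransversal L hk hP hvv' hvv (fun z hz => hz.2) hX
  have hΛ := tens_mono (le_refl L.toSubmodule) (h.le_orthogonal hv)
  have hM := tens_mono (le_refl L.toSubmodule) (orthogonal_le (R := L.poleIdeal) (s := s) (v := v) (M := M))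
  refine ⟨_, IsTransversal.prod hΛ hM h1 hT, ?_, ?_⟩
  · rw [Finset.card_eq_sum_ones, IsTransversal.sum_prod h1 hT, Finset.sum_const,
      Finset.sum_const, Finset.card_image_of_injOn h2]
    simp
  · rw [IsTransversal.sum_prod h1 hT, Finset.sum_image h2,
      ← L.sum_expTrace_bilin hk hφ hP hvv' hvv hX, Finset.sum_mul]
    refine Finset.sum_congr rfl fun x hx => ?_
    rw [Finset.mul_sum]
    refine Finset.sum_congr rfl fun U hU => ?_
    rw [L.quadExp_add hs, L.expTrace_pairing_vecMulVec_eq_one (M := orthogonal L.poleIdeal s M v) hk hs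
      (fun z hz => hz.2)
      (hX.1 x hx) (hT.1 U hU), mul_one, QuadLattice.quadExp, L.pairing_vecMulVec, mul_comm (L.bilin x x)]

/-- Splitting off the hyperbolic plane spanned by `v`, on which the form vanishes modulo
`(𝔑∂)⁻¹`, and by a vector `w` not orthogonal to `v`. -/
theorem exists_gaussSum_of_mem (L : QuadLattice K m) (hm : 0 < m) (hs : s.IsSymm)
    (hP : ¬ L.DvdLevel P) (h : IsRadical L.poleIdeal s Λ M) (hv : v ∈ M) (hvΛ : v ∉ Λ)
    (hPv : ∀ p ∈ P.asIdeal, p • v ∈ Λ) (hvv : v ⬝ᵥ s *ᵥ v ∈ L.poleIdeal)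
    (hw : w ∈ M) (hvw : v ⬝ᵥ s *ᵥ w ∉ L.poleIdeal)
    {X : Finset (Fin m → K)} (hX : IsTransversal L.toSubmodule (P.asIdeal • L.toSubmodule) X)
    {T : Finset (Matrix (Fin m) (Fin n) K)}
    (hT : IsTransversal (tens L.toSubmodule (orthogonal L.poleIdeal s M v))
      (tens L.toSubmodule (Λ ⊔ Submodule.span (𝓞 K) {v})) T) :
    ∃ T', IsTransversal (tens L.toSubmodule M) (tens L.toSubmodule Λ) T' ∧
      T'.card = X.card * (T.card * X.card) ∧
      ∑ U ∈ T', L.quadExp s U = (Ideal.absNorm P.asIdeal : ℂ) ^ m *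
        ∑ U ∈ T, L.quadExp s U := by
  classical
  have hR := L.poleIdeal_ne_zero hm
  have hext := h.isPrimeExtension_orthogonal hs hR hPv hw hvw
  have hvw' := h.dotProduct_mem_inv hs hPv hw
  have hrad := h.sup_orthogonal hs hv hvv hR hPv hw hvw
  obtain ⟨h1, h2⟩ := hext.isTransversal L hm hP hvw' hvw (fun z hz => hz.2) hX
  have hext' := isPrimeExtension_sup hvΛ hPv
  obtain ⟨h3, h4⟩ := hext'.isTransversal L hm hP (dotProduct_mulVec_comm hs v w ▸ hvw')
    (dotProduct_mulVec_comm hs v w ▸ hvw) (fun z hz => h.dotProduct_mem hw hz) hX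
  have hΛ := tens_mono (le_refl L.toSubmodule) hext'.le
  have hΛW := tens_mono (le_refl L.toSubmodule) hrad.le
  have hM := tens_mono (le_refl L.toSubmodule) hext.le
  have h5 := IsTransversal.prod hΛ hΛW hT h3
  refine ⟨_, IsTransversal.prod (hΛ.trans hΛW) hM h1 h5, ?_, ?_⟩
  · rw [Finset.card_eq_sum_ones, IsTransversal.sum_prod h1 h5]
    simp only [IsTransversal.sum_prod hT h3, Finset.sum_const,
      Finset.card_image_of_injOn h2, Finset.card_image_of_injOn h4]
    simp
  · rw [IsTransversal.sum_prod h1 h5, Finset.sum_image h2]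
    simp only [IsTransversal.sum_prod hT h3, Finset.sum_image h4]
    -- the sum over the line spanned by `v` is a character sum
    have key : ∀ x ∈ X, ∑ U ∈ T, ∑ y ∈ X, L.quadExp s (vecMulVec x w + (U + vecMulVec y v)) =
        if x ∈ P.asIdeal • L.toSubmodule then
          (Ideal.absNorm P.asIdeal : ℂ) ^ m * ∑ U ∈ T, L.quadExp s U else 0 := by
      intro x hx
      have e1 : ∀ U ∈ T, ∀ y ∈ X, L.quadExp s (vecMulVec x w + (U + vecMulVec y v)) =
          L.quadExp s (U + vecMulVec x w) *
            expTrace (2 * ((v ⬝ᵥ s *ᵥ w) * L.bilin x y)) := by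
        intro U hU y hy
        have e2 : L.quadExp s (vecMulVec y v) = 1 :=
          hrad.quadExp_eq_one hm hs (vecMulVec_mem_tens (hX.1 y hy) hext'.mem)
        have e3 := L.expTrace_pairing_vecMulVec_eq_one (M := orthogonal L.poleIdeal s M v) hm hs
          (fun z hz => hz.2) (hX.1 y hy) (hT.1 U hU)
        rw [← add_assoc, L.quadExp_add hs, e2, mul_one, map_add, LinearMap.add_apply, mul_add,
          expTrace_add, L.pairing_comm hs U, e3, mul_one, L.pairing_vecMulVec,
          mul_comm (L.bilin x y), add_comm U]
      rw [Finset.sum_congr rfl fun U hU => by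
        rw [Finset.sum_congr rfl (e1 U hU), ← Finset.mul_sum,
          L.sum_expTrace_linear hm hP hvw' hvw hX (hX.1 x hx)], ← Finset.sum_mul]
      split_ifs with hxP
      · have hmem : vecMulVec x w ∈ tens L.toSubmodule (orthogonal L.poleIdeal s M v) := by
          refine Submodule.smul_induction_on hxP (fun p hp y hy => ?_) fun y z hy hz => ?_
          · rw [smul_vecMulVec, ← vecMulVec_smul]
            exact vecMulVec_mem_tens hy (hext.smul_mem p hp)
          · rw [add_vecMulVec]
            exact Submodule.add_mem _ hy hz
        rw [hT.sum_add (f := L.quadExp s) (fun U hU V hV => hrad.quadExp_add hm hs hU hV) hmem,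
          mul_comm]
      · rw [mul_zero]
    rw [Finset.sum_congr rfl key]
    obtain ⟨x₀, ⟨hx₀, hx₀P⟩, huniq⟩ := hX.2 0 (Submodule.zero_mem _)
    have hiff : ∀ x : Fin m → K, 0 - x ∈ P.asIdeal • L.toSubmodule ↔
        x ∈ P.asIdeal • L.toSubmodule := fun x => by rw [zero_sub, Submodule.neg_mem_iff]
    rw [Finset.sum_eq_single_of_mem x₀ hx₀ fun x hx hne => if_neg fun hxP =>
      hne (huniq x ⟨hx, (hiff x).2 hxP⟩), if_pos ((hiff _).1 hx₀P)]

end GaussSum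


section GaussSum

variable {K : Type*} [Field K] [NumberField K] {k n : ℕ}
  {s : Matrix (Fin n) (Fin n) K} {Λ M : Submodule (𝓞 K) (Fin n → K)}

/-- The module `M / Λ`, if it is not zero, contains a simple submodule `𝓞 / P`. -/
theorem exists_smul_mem_of_lt (h : Λ ≤ M) (hne : Λ ≠ M) {d : 𝓞 K} (hd : d ≠ 0)
    (hdM : ∀ w ∈ M, d • w ∈ Λ) :
    ∃ P : HeightOneSpectrum (𝓞 K), d ∈ P.asIdeal ∧
      ∃ v ∈ M, v ∉ Λ ∧ ∀ p ∈ P.asIdeal, p • v ∈ Λ := by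
  obtain ⟨v₀, hv₀, hv₀Λ⟩ := SetLike.exists_of_lt (lt_of_le_of_ne h hne)
  set I : Ideal (𝓞 K) := Λ.comap (LinearMap.toSpanSingleton (𝓞 K) _ v₀) with hI
  have hmem : ∀ a, a ∈ I ↔ a • v₀ ∈ Λ := fun a => by simp [hI]
  have hdI : d ∈ I := (hmem d).2 (hdM v₀ hv₀)
  have hI0 : I ≠ ⊥ := fun h => hd (by rwa [h] at hdI)
  have hItop : I ≠ ⊤ := fun h => hv₀Λ (by
    have := (hmem 1).1 (h ▸ Submodule.mem_top)
    rwa [one_smul] at this)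
  obtain ⟨p, hp, hIp⟩ := Ideal.exists_le_maximal I hItop
  have hp0 : p ≠ ⊥ := fun h => hI0 (le_bot_iff.1 (h ▸ hIp))
  obtain ⟨q, hq⟩ := Ideal.dvd_iff_le.2 hIp
  have hnot : ¬ q ≤ I := by
    intro hle
    have hq0 : q ≠ ⊥ := fun h => hI0 (by rw [hq, h, Ideal.mul_bot])
    have h1 : p * q = 1 * q := by
      rw [one_mul, ← hq]
      exact le_antisymm (hq ▸ Ideal.mul_le_right) hle
    have h2 := mul_right_cancel₀ hq0 h1
    exact hp.ne_top (by rw [h2, Ideal.one_eq_top])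
  obtain ⟨b, hb, hbI⟩ := SetLike.not_le_iff_exists.1 hnot
  refine ⟨⟨p, hp.isPrime, hp0⟩, hIp hdI, b • v₀, M.smul_mem b hv₀, fun h => hbI ((hmem b).2 h),
    fun a ha => ?_⟩
  rw [smul_smul, ← hmem, hq]
  exact Ideal.mul_mem_mul ha hb

variable [IsTotallyReal K]

theorem QuadLattice.exists_transversal {m : ℕ} (L : QuadLattice K m) (P : HeightOneSpectrum (𝓞 K)) :
    ∃ X, IsTransversal L.toSubmodule (P.asIdeal • L.toSubmodule) X := by
  obtain ⟨p, hp, hp0⟩ := Submodule.exists_mem_ne_zero_of_ne_bot P.ne_bot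
  exact exists_isTransversal_of_fg L.toSubmodule_fg hp0 fun x hx => Submodule.smul_mem_smul hp hx

/-- The Gauss sum of a pair of lattices whose index is prime to the level. -/
theorem IsRadical.exists_gaussSum {L : QuadLattice K (2 * k)} (hk : 0 < 2 * k) (hs : s.IsSymm)
    {φ : SymbolChoice K}
    (hφ : ∀ P : HeightOneSpectrum (𝓞 K), (2 : 𝓞 K) ∈ P.asIdeal → IsKroneckerSymbol P (φ P))
    (h : IsRadical L.poleIdeal s Λ M) (hM : M.FG) {d : 𝓞 K} (hd : d ≠ 0)
    (hdL : ∀ P : HeightOneSpectrum (𝓞 K), L.DvdLevel P → d ∉ P.asIdeal)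
    (hdM : ∀ w ∈ M, d • w ∈ Λ) :
    ∃ J : Ideal (𝓞 K), J ≠ ⊥ ∧ detSpan Λ = J • detSpan M ∧
      ∀ T, IsTransversal (tens L.toSubmodule M) (tens L.toSubmodule Λ) T →
        ∑ U ∈ T, L.quadExp s U =
          (Ideal.absNorm J : ℂ) ^ k * ((L.chiStar φ (J : FracIdeal K) : ℤ) : ℂ) := by
  classical
  suffices ∀ (N : ℕ) (Λ M : Submodule (𝓞 K) (Fin n → K)), IsRadical L.poleIdeal s Λ M → M.FG →
      (∀ w ∈ M, d • w ∈ Λ) → ∀ T, IsTransversal (tens L.toSubmodule M) (tens L.toSubmodule Λ) T →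
      T.card = N → ∃ J : Ideal (𝓞 K), J ≠ ⊥ ∧ detSpan Λ = J • detSpan M ∧
        ∑ U ∈ T, L.quadExp s U =
          (Ideal.absNorm J : ℂ) ^ k * ((L.chiStar φ (J : FracIdeal K) : ℤ) : ℂ) by
    obtain ⟨T, hT⟩ := exists_isTransversal_of_fg (tens_fg L.toSubmodule_fg hM) hd
      (fun U hU => smul_mem_tens hdM hU)
    obtain ⟨J, hJ0, hJ, hsum⟩ := this _ Λ M h hM hdM T hT rfl
    refine ⟨J, hJ0, hJ, fun T' hT' => ?_⟩
    rw [← hsum]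
    exact hT'.sum_eq hT fun U hU V hV => h.quadExp_add hk hs hU hV
  intro N
  induction N using Nat.strong_induction_on with
  | _ N ih =>
  intro Λ M h hM hdM T hT hcard
  have hper : ∀ U ∈ tens L.toSubmodule M, ∀ V ∈ tens L.toSubmodule Λ,
      L.quadExp s (U + V) = L.quadExp s U := fun U hU V hV => h.quadExp_add hk hs hU hV
  have hle := tens_mono (le_refl L.toSubmodule) h.le
  by_cases hΛ : Λ = M
  · subst hΛ
    refine ⟨⊤, top_ne_bot, by simp, ?_⟩
    rw [hT.sum_eq IsTransversal.self hper, Finset.sum_singleton,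
      h.quadExp_eq_one hk hs (Submodule.zero_mem _)]
    simp [QuadLattice.chiStar_one]
  obtain ⟨P, hdP, v, hv, hvΛ, hPv⟩ := exists_smul_mem_of_lt h.le hΛ hd hdM
  have hP : ¬ L.DvdLevel P := fun hP => hdL P hP hdP
  obtain ⟨X, hX⟩ := L.exists_transversal P
  have hX1 : 1 < X.card := by
    rw [L.card_transversal hX]
    have h1 : Ideal.absNorm P.asIdeal ≠ 1 := fun h1 =>
      P.isPrime.ne_top (Ideal.absNorm_eq_one_iff.1 h1)
    have h0 : Ideal.absNorm P.asIdeal ≠ 0 := fun h0 => P.ne_bot (Ideal.absNorm_eq_zero_iff.1 h0)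
    exact Nat.one_lt_pow hk.ne' (by omega)
  have hpos : ∀ {A B : Submodule (𝓞 K) (Matrix (Fin (2 * k)) (Fin n) K)} {T}, 
      IsTransversal A B T → 0 < T.card := fun hT => Finset.card_pos.2 (by
    obtain ⟨t, ⟨ht, -⟩, -⟩ := hT.2 0 (Submodule.zero_mem _)
    exact ⟨t, ht⟩)
  have hWfg : (orthogonal L.poleIdeal s M v).FG := Submodule.FG.of_le hM orthogonal_le
  have hPJ : ∀ J : Ideal (𝓞 K), J ≠ ⊥ → J * P.asIdeal ≠ ⊥ := fun J hJ =>
    mul_ne_zero hJ P.ne_bot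
  by_cases hvv : v ⬝ᵥ s *ᵥ v ∈ L.poleIdeal
  · obtain ⟨w, hw, hvw⟩ : ∃ w ∈ M, v ⬝ᵥ s *ᵥ w ∉ L.poleIdeal := by
      by_contra! hcon
      refine hvΛ ((h.mem_iff v hv).2 fun z hz => ?_)
      rw [dotProduct_mulVec_comm hs]
      exact hcon z hz
    have hR := L.poleIdeal_ne_zero hk
    have hext := h.isPrimeExtension_orthogonal hs hR hPv hw hvw
    have hrad := h.sup_orthogonal hs hv hvv hR hPv hw hvw
    have hext' := isPrimeExtension_sup hvΛ hPv
    have hdW : ∀ w ∈ orthogonal L.poleIdeal s M v, d • w ∈ Λ ⊔ Submodule.span (𝓞 K) {v} :=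
      fun w hw => hext'.le (hdM w hw.1)
    obtain ⟨T₁, hT₁⟩ := exists_isTransversal_of_fg (tens_fg L.toSubmodule_fg hWfg) hd
      (fun U hU => smul_mem_tens hdW hU)
    obtain ⟨T', hT', hcard', hsum⟩ :=
      exists_gaussSum_of_mem L hk hs hP h hv hvΛ hPv hvv hw hvw hX hT₁
    have hlt : T₁.card < N := by
      rw [← hcard, hT.card_eq hT', hcard']
      exact (lt_mul_of_one_lt_right (hpos hT₁) hX1).trans_le (Nat.le_mul_of_pos_left _ (by omega))
    obtain ⟨J, hJ0, hJ, hJsum⟩ := ih _ hlt _ _ hrad hWfg hdW T₁ hT₁ rfl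
    refine ⟨J * P.asIdeal * P.asIdeal, hPJ _ (hPJ J hJ0), ?_, ?_⟩
    · rw [detSpan_eq_smul hext', hJ, detSpan_eq_smul hext]
      simp only [← Submodule.mul_smul]
      congr 1
      ring
    · have hJ0' : (J : FracIdeal K) ≠ 0 := FractionalIdeal.coeIdeal_ne_zero.2 hJ0
      have hP0 := coeIdeal_prime_ne_zero P
      rw [hT.sum_eq hT' hper, hsum, hJsum, map_mul, map_mul, FractionalIdeal.coeIdeal_mul,
        FractionalIdeal.coeIdeal_mul, mul_assoc (J : FracIdeal K), L.chiStar_mul φ hJ0' (mul_ne_zero hP0 hP0),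
        L.chiStar_mul φ hP0 hP0, Int.units_mul_self, mul_one]
      push_cast
      ring
  · have hext := h.isPrimeExtension_orthogonal hs (L.poleIdeal_ne_zero hk) hPv hv hvv
    have hrad := h.orthogonal_of_notMem hs hv hext
    have hdW : ∀ w ∈ orthogonal L.poleIdeal s M v, d • w ∈ Λ := fun w hw => hdM w hw.1
    obtain ⟨T₁, hT₁⟩ := exists_isTransversal_of_fg (tens_fg L.toSubmodule_fg hWfg) hd
      (fun U hU => smul_mem_tens hdW hU)
    obtain ⟨T', hT', hcard', hsum⟩ :=
      exists_gaussSum_of_notMem L hk hs (hφ P) hP h hv hPv hvv hX hT₁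
    have hlt : T₁.card < N := by
      rw [← hcard, hT.card_eq hT', hcard']
      exact lt_mul_of_one_lt_left (hpos hT₁) hX1
    obtain ⟨J, hJ0, hJ, hJsum⟩ := ih _ hlt _ _ hrad hWfg hdW T₁ hT₁ rfl
    refine ⟨J * P.asIdeal, hPJ J hJ0, ?_, ?_⟩
    · rw [hJ, detSpan_eq_smul hext, Submodule.mul_smul]
    · rw [hT.sum_eq hT' hper, hsum, hJsum, map_mul, FractionalIdeal.coeIdeal_mul,
        L.chiStar_mul φ (FractionalIdeal.coeIdeal_ne_zero.2 hJ0) (coeIdeal_prime_ne_zero P),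
        L.chiStar_prime]
      push_cast
      ring

end GaussSum


/-! ### Determinants of matrices with entries in ideals -/

section DetIdeal

variable {K : Type*} [Field K] [NumberField K] [IsTotallyReal K] {n : ℕ}

theorem prod_mem_prod {ι : Type*} {S : Finset ι} {G : ι → FracIdeal K} {a : ι → K}
    (h : ∀ i ∈ S, a i ∈ G i) : ∏ i ∈ S, a i ∈ ∏ i ∈ S, G i := by
  classical
  induction S using Finset.induction_on with
  | empty => simpa using FractionalIdeal.one_mem_one (𝓞 K)⁰
  | insert i S hi ih =>
    rw [Finset.prod_insert hi, Finset.prod_insert hi]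
    exact FractionalIdeal.mul_mem_mul (h i (Finset.mem_insert_self i S))
      (ih fun j hj => h j (Finset.mem_insert_of_mem hj))

theorem prod_sub_prod_mem {ι : Type*} {S : Finset ι} {G : ι → FracIdeal K} {𝔞 : FracIdeal K}
    {a b : ι → K} (ha : ∀ i ∈ S, a i ∈ G i) (hb : ∀ i ∈ S, b i ∈ G i)
    (hab : ∀ i ∈ S, a i - b i ∈ 𝔞 * G i) : ∏ i ∈ S, a i - ∏ i ∈ S, b i ∈ 𝔞 * ∏ i ∈ S, G i := by
  classical
  induction S using Finset.induction_on with
  | empty => simpa using FractionalIdeal.zero_mem _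
  | insert i S hi ih =>
    have hS : ∀ j ∈ S, j ∈ insert i S := fun j hj => Finset.mem_insert_of_mem hj
    have h0 := Finset.mem_insert_self i S
    rw [Finset.prod_insert hi, Finset.prod_insert hi, Finset.prod_insert hi]
    have h1 := FractionalIdeal.mul_mem_mul (hab i h0) (prod_mem_prod fun j hj => ha j (hS j hj))
    have h2 := FractionalIdeal.mul_mem_mul (hb i h0) (ih (fun j hj => ha j (hS j hj))
      (fun j hj => hb j (hS j hj)) fun j hj => hab j (hS j hj))
    rw [mul_left_comm] at h2
    rw [mul_assoc] at h1
    have h3 := Submodule.add_mem (𝔞 * (G i * ∏ i ∈ S, G i) : FracIdeal K).coeToSubmodule h1 h2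
    have e : (a i - b i) * ∏ j ∈ S, a j + b i * (∏ j ∈ S, a j - ∏ j ∈ S, b j) =
      a i * ∏ j ∈ S, a j - b i * ∏ j ∈ S, b j := by ring
    rwa [e] at h3

/-- Congruent matrices with entries in products of ideals have congruent determinants. -/
theorem det_sub_det_mem {F G : Fin n → FracIdeal K} {𝔞 : FracIdeal K}
    {M N : Matrix (Fin n) (Fin n) K} (hM : ∀ i j, M i j ∈ F i * G j)
    (hN : ∀ i j, N i j ∈ F i * G j) (h : ∀ i j, M i j - N i j ∈ 𝔞 * (F i * G j)) :
    M.det - N.det ∈ 𝔞 * ((∏ i, F i) * ∏ i, G i) := by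
  rw [det_apply, det_apply, ← Finset.sum_sub_distrib]
  refine Submodule.sum_mem (𝔞 * ((∏ i, F i) * ∏ i, G i) : FracIdeal K).coeToSubmodule fun σ _ => ?_
  rw [← smul_sub]
  have h1 := prod_sub_prod_mem (S := Finset.univ) (fun i _ => hM (σ i) i) (fun i _ => hN (σ i) i)
    fun i _ => h (σ i) i
  rw [Finset.prod_mul_distrib, Equiv.prod_comp σ F] at h1
  rcases Int.units_eq_one_or (Equiv.Perm.sign σ) with hσ | hσ
  · rw [hσ, one_smul]; exact h1
  · rw [hσ, Units.neg_smul, one_smul]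
    exact Submodule.neg_mem (𝔞 * ((∏ i, F i) * ∏ i, G i) : FracIdeal K).coeToSubmodule h1

theorem det_mem_prod {F G : Fin n → FracIdeal K} {M : Matrix (Fin n) (Fin n) K}
    (hM : ∀ i j, M i j ∈ F i * G j) : M.det ∈ (∏ i, F i) * ∏ i, G i := by
  rw [det_apply]
  refine Submodule.sum_mem ((∏ i, F i) * ∏ i, G i : FracIdeal K).coeToSubmodule fun σ _ => ?_
  have h1 := prod_mem_prod (S := Finset.univ) (fun i _ => hM (σ i) i)
  rw [Finset.prod_mul_distrib, Equiv.prod_comp σ F] at h1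
  rcases Int.units_eq_one_or (Equiv.Perm.sign σ) with hσ | hσ
  · rw [hσ, one_smul]; exact h1
  · rw [hσ, Units.neg_smul, one_smul]
    exact Submodule.neg_mem ((∏ i, F i) * ∏ i, G i : FracIdeal K).coeToSubmodule h1

theorem exists_integer_det {I : Fin n → FracIdeal K} (hI : ∀ i, I i ≠ 0)
    {D : Matrix (Fin n) (Fin n) K} (hD : ∀ i j, D i j ∈ I i * (I j)⁻¹) :
    ∃ d : 𝓞 K, (d : K) = D.det := by
  have h := det_mem_prod hD
  rw [← Finset.prod_mul_distrib, Finset.prod_eq_one fun i _ => mul_inv_cancel₀ (hI i)] at h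
  exact (FractionalIdeal.mem_one_iff _).1 h

/-- The entries of the adjugate satisfy the same integrality conditions as those of the matrix. -/
theorem adjugate_mem {I : Fin n → FracIdeal K} (hI : ∀ i, I i ≠ 0)
    {D : Matrix (Fin n) (Fin n) K} (hD : ∀ i j, D i j ∈ I i * (I j)⁻¹) (i j : Fin n) :
    D.adjugate i j ∈ I i * (I j)⁻¹ := by
  classical
  rw [adjugate_apply]
  have h := det_mem_prod (M := D.updateRow j (Pi.single i 1)) (F := Function.update I j (I i))
    (G := fun j => (I j)⁻¹) (fun r c => by
      by_cases hr : r = j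
      · subst hr
        rw [updateRow_self, Function.update_self]
        by_cases hc : c = i
        · subst hc
          rw [Pi.single_eq_same, mul_inv_cancel₀ (hI c)]
          exact FractionalIdeal.one_mem_one _
        · rw [Pi.single_eq_of_ne hc]
          exact FractionalIdeal.zero_mem _
      · rw [updateRow_ne hr, Function.update_of_ne hr]
        exact hD r c)
  have e : (∏ r, Function.update I j (I i) r) * ∏ r, (I r)⁻¹ = I i * (I j)⁻¹ := by
    rw [Finset.prod_update_of_mem (Finset.mem_univ j), ← Finset.erase_eq,
      ← Finset.mul_prod_erase Finset.univ (fun r => (I r)⁻¹) (Finset.mem_univ j), mul_mul_mul_comm,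
      ← Finset.prod_mul_distrib, Finset.prod_eq_one fun r _ => mul_inv_cancel₀ (hI r), mul_one]
  rwa [e] at h

theorem det_smul_mem_coordSubmodule {I : Fin n → FracIdeal K} (hI : ∀ i, I i ≠ 0)
    {D : Matrix (Fin n) (Fin n) K} (hD : ∀ i j, D i j ∈ I i * (I j)⁻¹) {d : 𝓞 K}
    (hd : (d : K) = D.det) {w : Fin n → K} (hw : w ∈ comapMat D (coordSubmodule I)) :
    d • w ∈ coordSubmodule I := by
  have e : d • w = D.adjugate *ᵥ (D *ᵥ w) := by
    rw [mulVec_mulVec, adjugate_mul, smul_mulVec, one_mulVec, ← hd]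
    exact (algebraMap_smul K d w).symm
  rw [e]
  exact mulVec_mem_coordSubmodule (adjugate_mem hI hD) (fun i j => by
    rw [mul_assoc, inv_mul_cancel₀ (hI j), mul_one]) hw

theorem comapMat_fg {D : Matrix (Fin n) (Fin n) K} (hD : IsUnit D.det)
    {M : Submodule (𝓞 K) (Fin n → K)} (hM : M.FG) : (comapMat D M).FG := by
  have e : comapMat D M = M.map (D⁻¹.mulVecLin.restrictScalars (𝓞 K)) := by
    ext w
    rw [mem_comapMat, Submodule.mem_map]
    constructor
    · intro hw
      refine ⟨_, hw, ?_⟩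
      simp [nonsing_inv_mul _ hD]
    · rintro ⟨y, hy, rfl⟩
      simpa [mul_nonsing_inv _ hD] using hy
  rw [e]
  exact hM.map _

/-- The determinant ideal of the inverse image of `M` under `D` is that of `M` divided by `det D`. -/
theorem smul_detSpan_comapMat {D : Matrix (Fin n) (Fin n) K} (hD : IsUnit D.det)
    (M : Submodule (𝓞 K) (Fin n → K)) {a : K} :
    a ∈ detSpan (comapMat D M) ↔ D.det * a ∈ detSpan M := by
  have hmul : ∀ {D : Matrix (Fin n) (Fin n) K} {M M' : Submodule (𝓞 K) (Fin n → K)},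
      (∀ w ∈ M, D *ᵥ w ∈ M') → ∀ {a}, a ∈ detSpan M → D.det * a ∈ detSpan M' := by
    intro D M M' h a ha
    induction ha using Submodule.span_induction with
    | zero => simp
    | add x y _ _ hx hy => rw [mul_add]; exact Submodule.add_mem _ hx hy
    | smul r x _ hx => rw [mul_smul_comm]; exact Submodule.smul_mem _ r hx
    | mem x hx =>
      obtain ⟨X, hX, rfl⟩ := hx
      have : D.det * X.det = (X * Dᵀ).det := by rw [det_mul, det_transpose, mul_comm]
      rw [this]
      refine det_mem_detSpan fun i => ?_
      have e : (X * Dᵀ) i = D *ᵥ X i := by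
        funext j
        simp only [mul_apply, mulVec, dotProduct, transpose_apply]
        exact Finset.sum_congr rfl fun _ _ => mul_comm _ _
      rw [e]
      exact h _ (hX i)
  constructor
  · exact hmul fun w hw => hw
  · intro ha
    have h := hmul (D := D⁻¹) (M' := comapMat D M) (fun w hw => by
      rw [mem_comapMat, mulVec_mulVec, mul_nonsing_inv _ hD, one_mulVec]; exact hw) ha
    rwa [← mul_assoc, ← det_mul, nonsing_inv_mul _ hD, det_one, one_mul] at h

theorem smul_coe_eq_mul (J : Ideal (𝓞 K)) (X : FracIdeal K) :
    J • (X : Submodule (𝓞 K) K) = ((J * X : FracIdeal K) : Submodule (𝓞 K) K) := by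
  refine le_antisymm ?_ ?_
  · rw [Submodule.smul_le]
    intro p hp x hx
    rw [Algebra.smul_def]
    exact FractionalIdeal.mul_mem_mul (coe_mem_coeIdeal hp) hx
  · intro y hy
    refine FractionalIdeal.mul_induction_on (C := fun y => y ∈ J • (X : Submodule (𝓞 K) K)) hy
      (fun i hi x hx => ?_) fun x y hx hy => Submodule.add_mem _ hx hy
    obtain ⟨p, hp, rfl⟩ := (FractionalIdeal.mem_coeIdeal _).1 hi
    rw [← Algebra.smul_def]
    exact Submodule.smul_mem_smul hp hx

/-- The index of `M` in its inverse image under `D` is the ideal generated by `det D`. -/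
theorem coe_eq_spanSingleton_det {I : Fin n → FracIdeal K} (hI : ∀ i, I i ≠ 0)
    {D : Matrix (Fin n) (Fin n) K} (hD : IsUnit D.det) {J : Ideal (𝓞 K)}
    (hJ : detSpan (coordSubmodule I) = J • detSpan (comapMat D (coordSubmodule I))) :
    (J : FracIdeal K) = FractionalIdeal.spanSingleton (𝓞 K)⁰ D.det := by
  have hle : detSpan (coordSubmodule I) ≤ ((∏ i, I i : FracIdeal K) : Submodule (𝓞 K) K) := by
    refine Submodule.span_le.2 ?_
    rintro _ ⟨M, hM, rfl⟩
    have h := det_mem_prod (M := M) (F := 1) (G := I) fun i j => by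
      rw [Pi.one_apply, one_mul]; exact hM i j
    simpa using h
  set X : FracIdeal K := ⟨detSpan (coordSubmodule I), FractionalIdeal.isFractional_of_le hle⟩ with hX
  have hX0 : X ≠ 0 := by
    choose a ha0 ha using fun i => FractionalIdeal.exists_ne_zero_mem_isInteger (hI i)
    have hmem : (diagonal fun i => (a i : K)).det ∈ X := det_mem_detSpan fun i j => by
      by_cases hij : i = j
      · subst hij
        rw [diagonal_apply_eq]
        exact ha i
      · rw [diagonal_apply_ne _ hij]
        exact FractionalIdeal.zero_mem _
    refine FractionalIdeal.ne_zero_of_mem hmem ?_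
    rw [det_diagonal]
    exact Finset.prod_ne_zero_iff.2 fun i _ => RingOfIntegers.coe_ne_zero_iff.2 (ha0 i)
  have hd := hD.ne_zero
  have hd' := spanSingleton_ne_zero hd
  have hX' : detSpan (comapMat D (coordSubmodule I)) =
      ((FractionalIdeal.spanSingleton (𝓞 K)⁰ D.det⁻¹ * X : FracIdeal K) : Submodule (𝓞 K) K) := by
    ext a
    rw [smul_detSpan_comapMat hD]
    change D.det * a ∈ X ↔ a ∈ FractionalIdeal.spanSingleton (𝓞 K)⁰ D.det⁻¹ * X
    rw [FractionalIdeal.mem_singleton_mul]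
    constructor
    · intro h
      exact ⟨_, h, by field_simp⟩
    · rintro ⟨y, hy, rfl⟩
      rwa [mul_inv_cancel_left₀ hd]
  rw [hX', smul_coe_eq_mul] at hJ
  have h1 : X = J * (FractionalIdeal.spanSingleton (𝓞 K)⁰ D.det⁻¹ * X) :=
    FractionalIdeal.coeToSubmodule_injective hJ
  rw [← FractionalIdeal.spanSingleton_inv] at h1
  have h2 : X * FractionalIdeal.spanSingleton (𝓞 K)⁰ D.det = X * J := by
    conv_lhs => rw [h1]
    field_simp
  exact (mul_left_cancel₀ hX0 h2).symm

end DetIdeal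


/-! ### The transformation formula when `det D ≠ 0` -/

section Transformation

variable {K : Type*} [Field K] [NumberField K] [IsTotallyReal K] {k m n : ℕ}
  {I : Fin n → FracIdeal K} {A B C D : Matrix (Fin n) (Fin n) K}

theorem valuation_eq_one_of_notMem {P : HeightOneSpectrum (𝓞 K)} {d : 𝓞 K} (hd : d ∉ P.asIdeal) :
    P.valuation K (d : K) = 1 :=
  le_antisymm (P.valuation_le_one d) (not_lt.1 fun h => hd ((P.valuation_lt_one_iff_mem d).1 h))

theorem notMem_of_valuation_eq_one {P : HeightOneSpectrum (𝓞 K)} {d : 𝓞 K}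
    (hd : P.valuation K (d : K) = 1) : d ∉ P.asIdeal :=
  fun h => ((P.valuation_lt_one_iff_mem d).2 h).ne hd

/-- The determinant of `D` is prime to the level, since `det A det D` is `1` modulo `𝒩`. -/
theorem QuadLattice.BlockIntegral.det_notMem {L : QuadLattice K m} (hm : 0 < m)
    (h : L.BlockIntegral I A B C D) (hI : ∀ j, I j ≠ 0) (hr : SymplecticRelations A B C D)
    {d : 𝓞 K} (hd : (d : K) = D.det) {P : HeightOneSpectrum (𝓞 K)} (hP : L.DvdLevel P) :
    d ∉ P.asIdeal := by
  have h1 := L.halfNorm_ne_zero hm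
  have h2 := different_ne_zero (K := K)
  obtain ⟨a, ha⟩ := exists_integer_det (D := Aᵀ) hI (fun i j => by
    rw [mul_comm]; exact h.a j i)
  have hX : ∀ i j, (Cᵀ * B) i j ∈ L.level * (I i * (I j)⁻¹) := by
    intro i j
    rw [mul_apply]
    refine Submodule.sum_mem (L.level * (I i * (I j)⁻¹) : FracIdeal K).coeToSubmodule fun l _ => ?_
    have h3 := FractionalIdeal.mul_mem_mul (h.c l i) (h.b l j)
    have e : L.level * L.halfNorm * different K * (I l * I i) *
        (L.poleIdeal * ((I l)⁻¹ * (I j)⁻¹)) = L.level * (I i * (I j)⁻¹) := by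
      have := hI l
      rw [QuadLattice.poleIdeal]
      field_simp
    rwa [e] at h3
  have hone : ∀ i j, (1 : Matrix (Fin n) (Fin n) K) i j ∈ I i * (I j)⁻¹ := by
    intro i j
    by_cases hij : i = j
    · subst hij
      rw [one_apply_eq, mul_inv_cancel₀ (hI i)]
      exact FractionalIdeal.one_mem_one _
    · rw [one_apply_ne hij]
      exact FractionalIdeal.zero_mem _
  have hlevel : ∀ J : FracIdeal K, L.level * J ≤ J := fun J => by
    calc L.level * J ≤ 1 * J := by gcongr; exact L.level_le_one hm
      _ = J := one_mul J
  have hdet := det_sub_det_mem (M := Aᵀ * D) (N := 1) (F := I) (G := fun j => (I j)⁻¹) (𝔞 := L.level)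
    (fun i j => by
      rw [hr.ad]
      exact Submodule.add_mem (I i * (I j)⁻¹ : FracIdeal K).coeToSubmodule (hone i j)
        (hlevel _ (hX i j))) hone (fun i j => by
      rw [hr.ad, Matrix.add_apply, add_sub_cancel_left]
      exact hX i j)
  rw [← Finset.prod_mul_distrib, Finset.prod_eq_one fun i _ => mul_inv_cancel₀ (hI i), mul_one,
    det_mul, det_one, ← ha, ← hd] at hdet
  intro hdP
  have h4 : (a * d - 1 : K) ∈ (P.asIdeal : FracIdeal K) := hP hdet
  have h5 : (a * d : K) ∈ (P.asIdeal : FracIdeal K) := by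
    have := coe_mem_coeIdeal (Ideal.mul_mem_left P.asIdeal a hdP)
    simpa using this
  have h6 := Submodule.sub_mem (P.asIdeal : FracIdeal K).coeToSubmodule h5 h4
  rw [sub_sub_cancel] at h6
  obtain ⟨x, hx, hx1⟩ := (FractionalIdeal.mem_coeIdeal _).1 h6
  have : x = 1 := RingOfIntegers.coe_injective (by simpa using hx1)
  exact P.isPrime.ne_top ((Ideal.eq_top_iff_one _).2 (this ▸ hx))

/-- By the symplectic relations, the lattice `ℐ₁ ⊕ ⋯ ⊕ ℐₙ` is the radical of the form `ᵗDB` on its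
inverse image under `D`. -/
theorem QuadLattice.BlockIntegral.isRadical {L : QuadLattice K m} (hm : 0 < m)
    (h : L.BlockIntegral I A B C D) (hI : ∀ j, I j ≠ 0) (hr : SymplecticRelations A B C D)
    (hD : IsUnit D.det) :
    IsRadical L.poleIdeal (Dᵀ * B) (coordSubmodule I) (comapMat D (coordSubmodule I)) := by
  have h1 := L.halfNorm_ne_zero hm
  have h2 := different_ne_zero (K := K)
  have key : ∀ w z : Fin n → K, z ⬝ᵥ (Dᵀ * B) *ᵥ w = (D *ᵥ z) ⬝ᵥ B *ᵥ w := fun w z => by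
    rw [← mulVec_mulVec, dotProduct_mulVec, vecMul_transpose]
  refine ⟨fun w hw => h.mulVec_d hI hw, fun w hw => ⟨fun hw' z hz => ?_, fun hw' => ?_⟩⟩
  · rw [key]
    exact h.dotProduct_b hI hz hw'
  · -- `w = ᵗA (D w) - ᵗC (B w)`
    have hBw : ∀ j, (B *ᵥ w) j ∈ L.poleIdeal * (I j)⁻¹ := by
      intro j
      have h3 : FractionalIdeal.spanSingleton (𝓞 K)⁰ ((B *ᵥ w) j) * I j ≤ L.poleIdeal := by
        rw [FractionalIdeal.mul_le]
        intro x hx a ha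
        obtain ⟨c, rfl⟩ := (FractionalIdeal.mem_spanSingleton _).1 hx
        have h4 := hw' (D⁻¹ *ᵥ Pi.single j a) (by
          rw [mem_comapMat, mulVec_mulVec, mul_nonsing_inv _ hD, one_mulVec]
          exact single_mem_coordSubmodule ha)
        rw [key, mulVec_mulVec, mul_nonsing_inv _ hD, one_mulVec, single_dotProduct] at h4
        have h5 := Submodule.smul_mem (L.poleIdeal : Submodule (𝓞 K) K) c h4
        rwa [smul_mul_assoc, mul_comm]
      rw [← FractionalIdeal.spanSingleton_le_iff_mem]
      have h6 := hI j
      calc _ = FractionalIdeal.spanSingleton (𝓞 K)⁰ ((B *ᵥ w) j) * I j * (I j)⁻¹ := by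
            field_simp
        _ ≤ _ := by gcongr
    have e : w = Aᵀ *ᵥ (D *ᵥ w) - Cᵀ *ᵥ (B *ᵥ w) := by
      rw [mulVec_mulVec, mulVec_mulVec, hr.ad, add_mulVec, one_mulVec, add_sub_cancel_right]
    rw [e]
    refine Submodule.sub_mem _ (mulVec_mem_coordSubmodule (J := I)
      (F := fun i j => (I j)⁻¹ * I i) (fun i j => h.a j i) (fun i j => ?_) hw)
      (mulVec_mem_coordSubmodule (J := fun j => L.poleIdeal * (I j)⁻¹)
      (F := fun i j => L.level * L.halfNorm * different K * (I j * I i)) (fun i j => h.c j i)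
      (fun i j => ?_) hBw)
    · have := hI j
      refine le_of_eq ?_
      field_simp
    · have e : L.level * L.halfNorm * different K * (I j * I i) * (L.poleIdeal * (I j)⁻¹) =
          L.level * I i := by
        have := hI j
        rw [QuadLattice.poleIdeal]
        field_simp
      rw [e]
      calc L.level * I i ≤ 1 * I i := by gcongr; exact L.level_le_one hm
        _ = I i := one_mul _

theorem normSign_mul_abs_norm (y : K) : (normSign y : ℝ) * |((Algebra.norm ℚ y : ℚ) : ℝ)| =
    ((Algebra.norm ℚ y : ℚ) : ℝ) := by
  rw [← prod_embeddings, Finset.abs_prod, normSign]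
  push_cast
  rw [← Finset.prod_mul_distrib]
  exact Finset.prod_congr rfl fun σ _ => by
    rcases lt_trichotomy (σ y) 0 with h | h | h
    · simp [h, abs_of_neg h]
    · simp [h]
    · simp [h, abs_of_pos h]

theorem normSign_mul_self {y : K} (hy : y ≠ 0) : normSign y * normSign y = 1 := by
  rw [normSign, ← Finset.prod_mul_distrib]
  refine Finset.prod_eq_one fun σ _ => ?_
  have h0 : σ y ≠ 0 := (map_ne_zero σ).2 hy
  rcases lt_or_gt_of_ne h0 with h | h <;> simp [h]

/-- The quotient of the factor `|N(y)|` of the Gauss sum by the factor of automorphy `N(y)` is the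
product of the signs of the conjugates. -/
theorem abs_norm_div_norm {y : K} (hy : y ≠ 0) :
    ((|Algebra.norm ℚ y| : ℚ) : ℂ) * ((Algebra.norm ℚ y : ℚ) : ℂ)⁻¹ = (normSign y : ℂ) := by
  have h0 : ((Algebra.norm ℚ y : ℚ) : ℂ) ≠ 0 := by
    exact_mod_cast (Algebra.norm_ne_zero_iff (R := ℚ)).2 hy
  have h1 : (normSign y : ℂ) * ((|Algebra.norm ℚ y| : ℚ) : ℂ) = ((Algebra.norm ℚ y : ℚ) : ℂ) := by
    have := normSign_mul_abs_norm y
    exact_mod_cast congrArg (fun x : ℝ => (x : ℂ)) this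
  have h2 : (normSign y : ℂ) * normSign y = 1 := by exact_mod_cast normSign_mul_self hy
  rw [mul_inv_eq_iff_eq_mul₀ h0, ← h1, ← mul_assoc, h2, one_mul]

theorem QuadLattice.chi_eq (L : QuadLattice K (2 * k)) (φ : SymbolChoice K) {d : 𝓞 K} (hd : d ≠ 0)
    (hdL : ∀ P : HeightOneSpectrum (𝓞 K), L.DvdLevel P → d ∉ P.asIdeal) :
    L.chi φ (d : K) = normSign (d : K) ^ k *
      (L.chiStar φ (FractionalIdeal.spanSingleton (𝓞 K)⁰ (d : K)) : ℤ) := by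
  rw [chi, if_pos fun P hP => valuation_eq_one_of_notMem (hdL P hP),
    if_neg (RingOfIntegers.coe_ne_zero_iff.2 hd)]

/-- The transformation formula for `det D ≠ 0`: the Gauss sum contributes `|N(det D)|ᵏ χ*(det D)`, and
the absolute value of the norm against the factor `N(det D)⁻ᵏ` gives the signs in `χ_L`. -/
theorem QuadLattice.slash_theta (hk : 0 < 2 * k) (L : QuadLattice K (2 * k)) {φ : SymbolChoice K}
    (hφ : ∀ P : HeightOneSpectrum (𝓞 K), (2 : 𝓞 K) ∈ P.asIdeal → IsKroneckerSymbol P (φ P))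
    (hI : ∀ j, I j ≠ 0) {γ : Matrix (Fin n ⊕ Fin n) (Fin n ⊕ Fin n) K}
    (hγ : γ ∈ gammaZero L.level L.halfNorm I) (hD : γ.toBlocks₂₂.det ≠ 0) {τ : MatTuple K n}
    (hτ : τ ∈ upperHalfSpace K n) :
    slash k (L.theta I) γ τ = L.chi φ γ.toBlocks₂₂.det * L.theta I τ := by
  have h := L.blockIntegral hk hγ
  have hr := symplecticRelations hγ.1
  have hD' := isUnit_iff_ne_zero.2 hD
  obtain ⟨d, hd⟩ := exists_integer_det hI h.d
  have hd0 : d ≠ 0 := fun h0 => hD (by rw [← hd, h0]; rfl)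
  have hdL : ∀ P : HeightOneSpectrum (𝓞 K), L.DvdLevel P → d ∉ P.asIdeal := fun P hP =>
    h.det_notMem hk hI hr hd hP
  have hs : (γ.toBlocks₂₂ᵀ * γ.toBlocks₁₂).IsSymm := by
    rw [Matrix.IsSymm, transpose_mul, transpose_transpose, hr.bd]
  have hfg := comapMat_fg hD' (coordSubmodule_fg I)
  have hdM : ∀ w ∈ comapMat γ.toBlocks₂₂ (coordSubmodule I), d • w ∈ coordSubmodule I :=
    fun w hw => det_smul_mem_coordSubmodule hI h.d hd hw
  obtain ⟨J, hJ0, hJ, hsum⟩ := (h.isRadical hk hI hr hD').exists_gaussSum hk hs hφ hfg hd0 hdL hdM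
  obtain ⟨T, hT⟩ := exists_isTransversal_of_fg (tens_fg L.toSubmodule_fg hfg) hd0
    (fun U hU => smul_mem_tens hdM hU)
  rw [L.slash_theta_of_isUnit hk hI hγ hD' hT hτ, hsum T hT]
  have hJd := coe_eq_spanSingleton_det hI hD' hJ
  have hJd' : J = Ideal.span {d} := by
    rw [← hd] at hJd
    exact FractionalIdeal.coeIdeal_injective (hJd.trans (FractionalIdeal.coeIdeal_span_singleton d).symm)
  have hnorm : (Ideal.absNorm J : ℂ) = ((|Algebra.norm ℚ γ.toBlocks₂₂.det| : ℚ) : ℂ) := by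
    rw [hJd', Ideal.absNorm_span_singleton, ← hd, ← Algebra.coe_norm_int]
    rw [Nat.cast_natAbs, ← Int.cast_abs, Rat.cast_intCast]
  rw [hJd, hnorm, ← hd, L.chi_eq φ hd0 hdL,
    mul_right_comm _ _ (((Algebra.norm ℚ (d : K) : ℚ) : ℂ) ^ k)⁻¹, ← inv_pow, ← mul_pow,
    abs_norm_div_norm (RingOfIntegers.coe_ne_zero_iff.2 hd0)]
  push_cast
  ring

end Transformation


/-! ### Translations -/

section Translate

variable {K : Type*} [Field K] [NumberField K] [IsTotallyReal K] {k m n : ℕ}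
  {I : Fin n → FracIdeal K} {s : Matrix (Fin n) (Fin n) K}

theorem QuadLattice.mem_gammaZero (L : QuadLattice K m) (hm : 0 < m)
    {A B C D : Matrix (Fin n) (Fin n) K} (hγ : fromBlocks A B C D ∈ symplecticGroup (Fin n) K)
    (h : L.BlockIntegral I A B C D) : fromBlocks A B C D ∈ gammaZero L.level L.halfNorm I := by
  have h1 := L.halfNorm_ne_zero hm
  have h2 := different_ne_zero (K := K)
  refine ⟨hγ, fun i j => ⟨?_, ?_, ?_, ?_⟩⟩
  · have e : (L.halfNorm * different K * I i)⁻¹ * (L.halfNorm * different K * I j) =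
        (I i)⁻¹ * I j := by field_simp
    rw [e]
    exact h.a i j
  · have e : (L.halfNorm * different K * I i)⁻¹ * (I j)⁻¹ =
        L.poleIdeal * ((I i)⁻¹ * (I j)⁻¹) := by
      rw [QuadLattice.poleIdeal, mul_inv (L.halfNorm * different K), mul_assoc]
    rw [e]
    exact h.b i j
  · have e : I i * L.level * (L.halfNorm * different K * I j) =
        L.level * L.halfNorm * different K * (I i * I j) := by ring
    rw [e]
    exact h.c i j
  · exact h.d i j

theorem fromBlocks_one_mem (hs : s.IsSymm) : fromBlocks 1 s 0 1 ∈ symplecticGroup (Fin n) K := by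
  rw [SymplecticGroup.mem_iff, J, fromBlocks_transpose, fromBlocks_multiply, fromBlocks_multiply]
  simp [hs.eq]

theorem mul_fromBlocks_one (γ : Matrix (Fin n ⊕ Fin n) (Fin n ⊕ Fin n) K) :
    γ * fromBlocks 1 s 0 1 = fromBlocks γ.toBlocks₁₁ (γ.toBlocks₁₁ * s + γ.toBlocks₁₂)
      γ.toBlocks₂₁ (γ.toBlocks₂₁ * s + γ.toBlocks₂₂) := by
  conv_lhs => rw [← fromBlocks_toBlocks γ, fromBlocks_multiply]
  simp

/-- The group contains the translations by symmetric matrices with entries in `(𝔑∂ℐᵢℐⱼ)⁻¹`. -/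
theorem QuadLattice.mul_translation_mem (L : QuadLattice K m) (hm : 0 < m) (hI : ∀ j, I j ≠ 0)
    {γ : Matrix (Fin n ⊕ Fin n) (Fin n ⊕ Fin n) K}
    (hγ : γ ∈ gammaZero L.level L.halfNorm I) (hs : s.IsSymm)
    (hsI : ∀ i j, s i j ∈ L.poleIdeal * ((I i)⁻¹ * (I j)⁻¹)) :
    γ * fromBlocks 1 s 0 1 ∈ gammaZero L.level L.halfNorm I := by
  have h := L.blockIntegral hm hγ
  have h1 := L.halfNorm_ne_zero hm
  have h2 := different_ne_zero (K := K)
  have h3 := Submonoid.mul_mem _ hγ.1 (fromBlocks_one_mem hs)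
  rw [mul_fromBlocks_one] at h3 ⊢
  refine L.mem_gammaZero hm h3 ⟨h.a, fun i j => ?_, h.c, fun i j => ?_⟩
  · rw [Matrix.add_apply, mul_apply]
    refine Submodule.add_mem (L.poleIdeal * ((I i)⁻¹ * (I j)⁻¹) : FracIdeal K).coeToSubmodule
      (Submodule.sum_mem (L.poleIdeal * ((I i)⁻¹ * (I j)⁻¹) : FracIdeal K).coeToSubmodule
        fun l _ => ?_) (h.b i j)
    have h4 := FractionalIdeal.mul_mem_mul (h.a i l) (hsI l j)
    have e : (I i)⁻¹ * I l * (L.poleIdeal * ((I l)⁻¹ * (I j)⁻¹)) =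
        L.poleIdeal * ((I i)⁻¹ * (I j)⁻¹) := by
      have := hI l
      field_simp
    rwa [e] at h4
  · rw [Matrix.add_apply, mul_apply]
    refine Submodule.add_mem (I i * (I j)⁻¹ : FracIdeal K).coeToSubmodule
      (Submodule.sum_mem (I i * (I j)⁻¹ : FracIdeal K).coeToSubmodule fun l _ => ?_) (h.d i j)
    have h4 := FractionalIdeal.mul_mem_mul (h.c i l) (hsI l j)
    have e : L.level * L.halfNorm * different K * (I i * I l) *
        (L.poleIdeal * ((I l)⁻¹ * (I j)⁻¹)) = L.level * (I i * (I j)⁻¹) := by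
      have := hI l
      rw [QuadLattice.poleIdeal]
      field_simp
    rw [e] at h4
    have h5 : L.level * (I i * (I j)⁻¹) ≤ 1 * (I i * (I j)⁻¹) := by
      gcongr
      exact L.level_le_one hm
    rw [one_mul] at h5
    exact h5 h4

theorem slash_mul_translation (f : MatTuple K n → ℂ)
    (γ : Matrix (Fin n ⊕ Fin n) (Fin n ⊕ Fin n) K) (τ : MatTuple K n) :
    slash k f (γ * fromBlocks 1 s 0 1) τ = slash k f γ (translate s τ) := by
  have key : ∀ (σ : K →+* ℝ) (M N : Matrix (Fin n) (Fin n) K),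
      conj σ M * τ σ + conj σ (M * s + N) = conj σ M * translate s τ σ + conj σ N := by
    intro σ M N
    rw [translate, conj_add, conj_mul, Matrix.mul_add]
    abel
  have hden : denom (γ * fromBlocks 1 s 0 1) τ = denom γ (translate s τ) := by
    funext σ
    rw [mul_fromBlocks_one, denom, denom, toBlocks_fromBlocks₂₁, toBlocks_fromBlocks₂₂, key]
  have hmoeb : moebius (γ * fromBlocks 1 s 0 1) τ = moebius γ (translate s τ) := by
    funext σ
    rw [moebius, moebius, hden, mul_fromBlocks_one, toBlocks_fromBlocks₁₁, toBlocks_fromBlocks₁₂,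
      key]
  rw [slash, slash, hden, hmoeb]

theorem QuadLattice.theta_translate (L : QuadLattice K m) (hm : 0 < m) (hI : ∀ j, I j ≠ 0)
    (hs : s.IsSymm) (hsI : ∀ i j, s i j ∈ L.poleIdeal * ((I i)⁻¹ * (I j)⁻¹)) (τ : MatTuple K n) :
    L.theta I (translate s τ) = L.theta I τ := by
  rw [theta, theta]
  refine tsum_congr fun U => ?_
  rw [L.thetaTerm_translate, L.quadExp_eq_one hs (M := coordSubmodule I)
    (fun x hx => L.bilin_self_mem_norm hx) (fun w hw z hz => ?_) (L.norm_mul_poleIdeal hm).le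
    (L.mem_matLattice_iff.1 U.2), one_mul]
  refine dotProduct_mem (J := I) (H := fun j => L.poleIdeal * (I j)⁻¹) (fun j => ?_) hz
    (mulVec_mem_coordSubmodule hsI (fun i j => ?_) hw)
  · have := hI j
    refine le_of_eq ?_
    field_simp
  · have := hI j
    refine le_of_eq ?_
    field_simp

/-- On the imaginary point `i`, all the terms of the theta series are positive real numbers. -/
theorem QuadLattice.exists_theta_ne_zero (L : QuadLattice K m) (hI : ∀ j, I j ≠ 0) :
    ∃ τ ∈ upperHalfSpace K n, L.theta I τ ≠ 0 := by
  set τ : MatTuple K n := fun _ => Complex.I • (1 : Matrix (Fin n) (Fin n) ℂ) with hτdef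
  have hτ : τ ∈ upperHalfSpace K n := by
    intro σ
    refine ⟨by simp [hτdef, Matrix.IsSymm], ?_⟩
    have : (τ σ).map Complex.im = 1 := by
      ext i j
      by_cases hij : i = j
      · subst hij; simp [hτdef]
      · simp [hτdef, hij]
    rw [this]
    exact PosDef.one
  refine ⟨τ, hτ, ?_⟩
  have hterm : ∀ U : Matrix (Fin m) (Fin n) K, L.thetaTerm τ U =
      (Real.exp (-(Real.pi * ∑ σ : K →+* ℝ, σ (Uᵀ * L.gram * U).trace)) : ℝ) := by
    intro U
    have htr : ∀ (σ : K →+* ℝ) (M : Matrix (Fin n) (Fin n) K),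
        (conj σ M).trace = ((σ M.trace : ℝ) : ℂ) := fun σ M => by
      simp [conj, Matrix.trace, map_sum]
    rw [thetaTerm, expo]
    push_cast
    congr 1
    rw [Matrix.trace_sum]
    simp only [hτdef, Matrix.mul_smul, Matrix.mul_one, Matrix.trace_smul, htr]
    rw [← Finset.smul_sum, smul_eq_mul]
    linear_combination (Real.pi * ∑ σ : K →+* ℝ, ((σ (Uᵀ * L.gram * U).trace : ℝ) : ℂ)) * Complex.I_sq
  have hsum := L.summable_theta hI hτ
  simp only [hterm] at hsum
  rw [theta]
  simp only [hterm]
  rw [← Complex.ofReal_tsum, Complex.ofReal_ne_zero]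
  refine (Summable.tsum_pos (Complex.summable_ofReal.1 hsum) (fun U => (Real.exp_pos _).le)
    ⟨0, fun i j => FractionalIdeal.zero_mem _⟩ (Real.exp_pos _)).ne'

end Translate


/-! ### The quadratic character -/

section Congruence

variable {K : Type*} [Field K] [NumberField K] [IsTotallyReal K]

/-- There is a nonzero `c` in `J` such that the integral ideal `cJ⁻¹` is prime to `𝔟`. -/
theorem exists_spanSingleton_mul_inv_add {J : FracIdeal K} (hJ : J ≠ 0) {𝔟 : Ideal (𝓞 K)}
    (h𝔟 : 𝔟 ≠ ⊥) : ∃ c ∈ J, c ≠ 0 ∧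
      FractionalIdeal.spanSingleton (𝓞 K)⁰ c * J⁻¹ + (𝔟 : FracIdeal K) = 1 := by
  have key : ∃ c ∈ J, FractionalIdeal.spanSingleton (𝓞 K)⁰ c * J⁻¹ + (𝔟 : FracIdeal K) = 1 := by
    obtain ⟨t, J₀, ht, hJJ⟩ := FractionalIdeal.exists_eq_spanSingleton_mul J
    have ht0 : (algebraMap (𝓞 K) K t)⁻¹ ≠ 0 :=
      inv_ne_zero (by rwa [Ne, FaithfulSMul.algebraMap_eq_zero_iff])
    have hJ0 : (J₀ : FracIdeal K) ≠ 0 := fun h => hJ (by rw [hJJ, h, mul_zero])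
    have hJ0' : J₀ ≠ ⊥ := FractionalIdeal.coeIdeal_ne_zero.1 hJ0
    obtain ⟨a, ha⟩ := IsDedekindDomain.exists_sup_span_eq (I := J₀ * 𝔟) (J := J₀)
      Ideal.mul_le_left (mul_ne_zero hJ0' h𝔟)
    have ha' : (J₀ : FracIdeal K) * 𝔟 + FractionalIdeal.spanSingleton (𝓞 K)⁰ (a : K) = J₀ := by
      conv_rhs => rw [← ha]
      rw [FractionalIdeal.coeIdeal_sup, FractionalIdeal.coeIdeal_mul,
        FractionalIdeal.coeIdeal_span_singleton]
    refine ⟨(algebraMap (𝓞 K) K t)⁻¹ * a, ?_, ?_⟩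
    · rw [hJJ]
      refine FractionalIdeal.mul_mem_mul (FractionalIdeal.mem_spanSingleton_self _ _)
        (coe_mem_coeIdeal ?_)
      rw [← ha]
      exact Submodule.mem_sup_right (Submodule.mem_span_singleton_self a)
    · have h1 := spanSingleton_ne_zero ht0
      have e : FractionalIdeal.spanSingleton (𝓞 K)⁰ ((algebraMap (𝓞 K) K t)⁻¹ * a) * J⁻¹ =
          FractionalIdeal.spanSingleton (𝓞 K)⁰ (a : K) * (J₀ : FracIdeal K)⁻¹ := by
        rw [hJJ, ← FractionalIdeal.spanSingleton_mul_spanSingleton]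
        generalize FractionalIdeal.spanSingleton (𝓞 K)⁰ ((algebraMap (𝓞 K) K) t)⁻¹ = X at h1
        field_simp
      have e' : (𝔟 : FracIdeal K) = J₀ * 𝔟 * (J₀ : FracIdeal K)⁻¹ := by field_simp
      rw [e, e', ← add_mul, add_comm, ha', mul_inv_cancel₀ hJ0]
  obtain ⟨c, hc, h⟩ := key
  by_cases hc0 : c = 0
  · rw [hc0, FractionalIdeal.spanSingleton_zero, zero_mul, zero_add] at h
    obtain ⟨x, hx0, hx⟩ := FractionalIdeal.exists_ne_zero_mem_isInteger hJ
    refine ⟨_, hx, by rwa [Ne, FaithfulSMul.algebraMap_eq_zero_iff], ?_⟩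
    rw [h]
    refine le_antisymm ?_ ?_
    · rw [← FractionalIdeal.sup_eq_add]
      refine sup_le ?_ le_rfl
      rw [← mul_inv_cancel₀ hJ]
      gcongr
      exact FractionalIdeal.spanSingleton_le_iff_mem.2 hx
    · rw [← FractionalIdeal.sup_eq_add]
      exact le_sup_right
  · exact ⟨c, hc, hc0, h⟩

variable {k m n : ℕ}

theorem QuadLattice.coe_levelIdeal (L : QuadLattice K m) (hm : 0 < m) :
    (L.levelIdeal : FracIdeal K) = L.level := by
  ext x
  rw [FractionalIdeal.mem_coeIdeal]
  constructor
  · rintro ⟨y, hy, rfl⟩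
    exact hy
  · intro hx
    obtain ⟨y, rfl⟩ := (FractionalIdeal.mem_one_iff _).1 (L.level_le_one hm hx)
    exact ⟨y, hx, rfl⟩

theorem QuadLattice.dvdLevel_iff (L : QuadLattice K m) (hm : 0 < m) {P : HeightOneSpectrum (𝓞 K)} :
    L.DvdLevel P ↔ L.levelIdeal ≤ P.asIdeal := by
  rw [DvdLevel, ← L.coe_levelIdeal hm, FractionalIdeal.coeIdeal_le_coeIdeal]

theorem QuadLattice.levelIdeal_ne_bot (L : QuadLattice K m) (hm : 0 < m) : L.levelIdeal ≠ ⊥ :=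
  FractionalIdeal.coeIdeal_ne_zero.1 (L.coe_levelIdeal hm ▸ L.level_ne_zero hm)

theorem QuadLattice.levelIdeal_sup_span (L : QuadLattice K m) (hm : 0 < m) {d : 𝓞 K}
    (hd : ∀ P : HeightOneSpectrum (𝓞 K), L.DvdLevel P → d ∉ P.asIdeal) :
    L.levelIdeal ⊔ Ideal.span {d} = ⊤ := by
  by_contra h
  obtain ⟨p, hp, hle⟩ := Ideal.exists_le_maximal _ h
  have hp0 : p ≠ ⊥ := fun h0 => L.levelIdeal_ne_bot hm (le_bot_iff.1 (h0 ▸ le_sup_left.trans hle))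
  exact hd ⟨p, hp.isPrime, hp0⟩ ((L.dvdLevel_iff hm).2 (le_sup_left.trans hle))
    (hle (Submodule.mem_sup_right (Submodule.mem_span_singleton_self d)))

/-- The translate of `τ` by `s` fixes the theta series and replaces `D` by `Cs + D`. As the theta
series is not identically zero, the transformation formula forces the characters to agree. -/
theorem QuadLattice.chi_det_translate (hk : 0 < 2 * k) (L : QuadLattice K (2 * k))
    {φ : SymbolChoice K}
    (hφ : ∀ P : HeightOneSpectrum (𝓞 K), (2 : 𝓞 K) ∈ P.asIdeal → IsKroneckerSymbol P (φ P))
    {I : Fin n → FracIdeal K} (hI : ∀ j, I j ≠ 0)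
    {γ : Matrix (Fin n ⊕ Fin n) (Fin n ⊕ Fin n) K} (hγ : γ ∈ gammaZero L.level L.halfNorm I)
    {s : Matrix (Fin n) (Fin n) K} (hs : s.IsSymm)
    (hsI : ∀ i j, s i j ∈ L.poleIdeal * ((I i)⁻¹ * (I j)⁻¹)) (hD : γ.toBlocks₂₂.det ≠ 0)
    (hD' : (γ.toBlocks₂₁ * s + γ.toBlocks₂₂).det ≠ 0) :
    L.chi φ (γ.toBlocks₂₁ * s + γ.toBlocks₂₂).det = L.chi φ γ.toBlocks₂₂.det := by
  obtain ⟨τ, hτ, hθ⟩ := L.exists_theta_ne_zero (I := I) hI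
  have h1 := L.slash_theta hk hφ hI (L.mul_translation_mem hk hI hγ hs hsI)
    (by rwa [mul_fromBlocks_one, toBlocks_fromBlocks₂₂]) hτ
  rw [slash_mul_translation, L.slash_theta hk hφ hI hγ hD (translate_mem hs hτ),
    L.theta_translate hk hI hs hsI, mul_fromBlocks_one, toBlocks_fromBlocks₂₂] at h1
  exact_mod_cast (mul_right_cancel₀ hθ h1).symm

/-- A variant of `chi_det_translate` for `n = 1` and `ℐ₁ = 𝓞`, starting from the lower row of a
matrix of `Γ₀`. -/
theorem QuadLattice.chi_add_mul (hk : 0 < 2 * k) (L : QuadLattice K (2 * k))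
    {φ : SymbolChoice K}
    (hφ : ∀ P : HeightOneSpectrum (𝓞 K), (2 : 𝓞 K) ∈ P.asIdeal → IsKroneckerSymbol P (φ P))
    {c d β : K} {a : 𝓞 K} {d₀ : 𝓞 K} {b : K} (hb : b ∈ L.poleIdeal)
    (hc : c ∈ L.level * L.poleIdeal⁻¹) (hd : (d₀ : K) = d) (habcd : a * d - b * c = 1)
    (hβ : β ∈ L.poleIdeal) (hd0 : d ≠ 0) (hcd : c * β + d ≠ 0) :
    L.chi φ (c * β + d) = L.chi φ d := by
  have h1 : ∀ x : 𝓞 K, (x : K) ∈ (1 : FracIdeal K) * (1 : FracIdeal K)⁻¹ := fun x => by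
    rw [inv_one, mul_one]
    exact (FractionalIdeal.mem_one_iff _).2 ⟨x, rfl⟩
  have h1' : ∀ x : 𝓞 K, (x : K) ∈ (1 : FracIdeal K)⁻¹ * (1 : FracIdeal K) := fun x => by
    rw [mul_comm]; exact h1 x
  have hpole : ∀ x ∈ L.poleIdeal,
      x ∈ L.poleIdeal * ((1 : FracIdeal K)⁻¹ * (1 : FracIdeal K)⁻¹) := fun x hx => by
    rwa [inv_one, mul_one, mul_one]
  have hγ : fromBlocks (of fun _ _ : Fin 1 => (a : K)) (of fun _ _ => b) (of fun _ _ => c)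
      (of fun _ _ => d) ∈ gammaZero L.level L.halfNorm fun _ : Fin 1 => (1 : FracIdeal K) := by
    refine L.mem_gammaZero hk ?_ ⟨fun _ _ => h1' a, fun _ _ => hpole b hb, fun _ _ => ?_,
      fun _ _ => hd ▸ h1 d₀⟩
    · rw [SymplecticGroup.mem_iff, J, fromBlocks_transpose, fromBlocks_multiply,
        fromBlocks_multiply, fromBlocks_inj]
      refine ⟨?_, ?_, ?_, ?_⟩ <;> ext i j <;> fin_cases i <;> fin_cases j <;>
        simp [mul_apply] <;>
        first | ring1 | linear_combination habcd | linear_combination -habcd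
    · rw [mul_one, mul_one, mul_assoc]
      rwa [QuadLattice.poleIdeal, inv_inv] at hc
  have h := L.chi_det_translate hk hφ (fun _ => one_ne_zero) hγ
    (s := of fun _ _ => β) (by ext i j; rfl) (fun _ _ => hpole β hβ)
    (by rw [toBlocks_fromBlocks₂₂]; simpa using hd0)
    (by rw [toBlocks_fromBlocks₂₂, toBlocks_fromBlocks₂₁]; simpa [mul_apply] using hcd)
  rw [toBlocks_fromBlocks₂₂, toBlocks_fromBlocks₂₁] at h
  simpa [mul_apply] using h

end Congruence


section Character

variable {K : Type*} [Field K] [NumberField K] [IsTotallyReal K] {k m n : ℕ}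

/-- Completing `d` to the lower row `(c, d)` of a matrix of `Γ₀` with `n = 1`, with prescribed
coprimality of `c`. -/
theorem QuadLattice.exists_row (L : QuadLattice K m) (hm : 0 < m) {d : 𝓞 K} (hd : d ≠ 0)
    (hdL : ∀ P : HeightOneSpectrum (𝓞 K), L.DvdLevel P → d ∉ P.asIdeal) {𝔠 : Ideal (𝓞 K)}
    (h𝔠 : 𝔠 ≠ ⊥) :
    ∃ c ∈ L.level * L.poleIdeal⁻¹, c ≠ 0 ∧ (∃ (a : 𝓞 K), ∃ b ∈ L.poleIdeal, a * d - b * c = 1) ∧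
      FractionalIdeal.spanSingleton (𝓞 K)⁰ c * (L.level * L.poleIdeal⁻¹)⁻¹ + (𝔠 : FracIdeal K) = 1 := by
  have hR := L.poleIdeal_ne_zero hm
  have hN := L.level_ne_zero hm
  have hJ : L.level * L.poleIdeal⁻¹ ≠ 0 := mul_ne_zero hN (inv_ne_zero hR)
  have hspan : Ideal.span {d} ≠ ⊥ := by rwa [Ne, Ideal.span_singleton_eq_bot]
  obtain ⟨c, hc, hc0, h⟩ := exists_spanSingleton_mul_inv_add hJ (mul_ne_zero hspan h𝔠)
  set X := FractionalIdeal.spanSingleton (𝓞 K)⁰ c * (L.level * L.poleIdeal⁻¹)⁻¹ with hX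
  have hX1 : X ≤ 1 := by
    rw [hX, ← mul_inv_cancel₀ hJ]
    gcongr
    exact FractionalIdeal.spanSingleton_le_iff_mem.2 hc
  have hint : ∀ 𝔞 : Ideal (𝓞 K), (𝔞 : FracIdeal K) ≤ 1 := fun 𝔞 => FractionalIdeal.coeIdeal_le_one
  have hle : ∀ 𝔞 : Ideal (𝓞 K), Ideal.span {d} * 𝔠 ≤ 𝔞 → X + (𝔞 : FracIdeal K) = 1 := by
    intro 𝔞 h𝔞
    refine le_antisymm ?_ ?_
    · rw [← FractionalIdeal.sup_eq_add]
      exact sup_le hX1 (hint 𝔞)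
    · rw [← h, ← FractionalIdeal.sup_eq_add, ← FractionalIdeal.sup_eq_add]
      exact sup_le_sup_left ((FractionalIdeal.coeIdeal_le_coeIdeal K).2 h𝔞) X
  refine ⟨c, hc, hc0, ?_, hle 𝔠 Ideal.mul_le_right⟩
  have hXd := hle (Ideal.span {d}) Ideal.mul_le_left
  have hNd : L.level + ((Ideal.span {d} : Ideal (𝓞 K)) : FracIdeal K) = 1 := by
    rw [← L.coe_levelIdeal hm, ← FractionalIdeal.coeIdeal_sup, L.levelIdeal_sup_span hm hdL,
      FractionalIdeal.coeIdeal_top]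
  have hXN : (1 : FracIdeal K) ≤ FractionalIdeal.spanSingleton (𝓞 K)⁰ c * L.poleIdeal +
      ((Ideal.span {d} : Ideal (𝓞 K)) : FracIdeal K) := by
    have e : FractionalIdeal.spanSingleton (𝓞 K)⁰ c * L.poleIdeal = X * L.level := by
      rw [hX]
      field_simp
    rw [e]
    set D := ((Ideal.span {d} : Ideal (𝓞 K)) : FracIdeal K)
    calc (1 : FracIdeal K) = (X + D) * (L.level + D) := by rw [hXd, hNd, one_mul]
      _ = X * L.level + (X * D + D * (L.level + D)) := by ring
      _ = X * L.level + (X * D + D) := by rw [hNd, mul_one]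
      _ ≤ X * L.level + D := by
        rw [← FractionalIdeal.sup_eq_add, ← FractionalIdeal.sup_eq_add, ← FractionalIdeal.sup_eq_add]
        refine sup_le_sup_left (sup_le ?_ le_rfl) _
        calc X * D ≤ 1 * D := by gcongr
          _ = D := one_mul D
  have h1 := hXN (FractionalIdeal.one_mem_one _)
  rw [← FractionalIdeal.sup_eq_add] at h1
  obtain ⟨x, hx, y, hy, hxy⟩ := Submodule.mem_sup.1 h1
  obtain ⟨b, hb, rfl⟩ := FractionalIdeal.mem_singleton_mul.1 hx
  obtain ⟨y, hy', rfl⟩ := (FractionalIdeal.mem_coeIdeal _).1 hy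
  obtain ⟨a, rfl⟩ := Ideal.mem_span_singleton'.1 hy'
  refine ⟨a, -b, Submodule.neg_mem (L.poleIdeal : Submodule (𝓞 K) K) hb, ?_⟩
  rw [map_mul] at hxy
  change c * b + (a : K) * (d : K) = 1 at hxy
  linear_combination hxy

/-- The character is periodic modulo the level: congruent elements `d` and `d'` are completed to lower
rows `(c, d)` and `(c', d')` of matrices of the group such that a common value of `cβ + d` and
`c'β' + d'` exists. -/
theorem QuadLattice.chi_congr (hk : 0 < 2 * k) (L : QuadLattice K (2 * k)) {φ : SymbolChoice K}
    (hφ : ∀ P : HeightOneSpectrum (𝓞 K), (2 : 𝓞 K) ∈ P.asIdeal → IsKroneckerSymbol P (φ P))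
    {d d' : 𝓞 K} (hd0 : d ≠ 0) (hd0' : d' ≠ 0)
    (hd : ∀ P : HeightOneSpectrum (𝓞 K), L.DvdLevel P → d ∉ P.asIdeal)
    (hd' : ∀ P : HeightOneSpectrum (𝓞 K), L.DvdLevel P → d' ∉ P.asIdeal)
    (hdd : d - d' ∈ L.levelIdeal) : L.chi φ (d : K) = L.chi φ (d' : K) := by
  have hR := L.poleIdeal_ne_zero hk
  have hN := L.level_ne_zero hk
  have hJ : L.level * L.poleIdeal⁻¹ ≠ 0 := mul_ne_zero hN (inv_ne_zero hR)
  obtain ⟨c, hc, hc0, ⟨a, b, hb, hab⟩, -⟩ := L.exists_row hk hd0 hd (𝔠 := ⊤) top_ne_bot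
  -- the second row is chosen with `c'` prime to `c`
  set X := FractionalIdeal.spanSingleton (𝓞 K)⁰ c * (L.level * L.poleIdeal⁻¹)⁻¹ with hX
  have hX1 : X ≤ 1 := by
    rw [hX, ← mul_inv_cancel₀ hJ]
    gcongr
    exact FractionalIdeal.spanSingleton_le_iff_mem.2 hc
  have hX0 : X ≠ 0 := mul_ne_zero (spanSingleton_ne_zero hc0) (inv_ne_zero hJ)
  obtain ⟨𝔠, h𝔠⟩ := FractionalIdeal.le_one_iff_exists_coeIdeal.1 hX1
  have h𝔠0 : 𝔠 ≠ ⊥ := FractionalIdeal.coeIdeal_ne_zero.1 (h𝔠 ▸ hX0)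
  obtain ⟨c', hc', hc0', ⟨a', b', hb', hab'⟩, hcc⟩ := L.exists_row hk hd0' hd' h𝔠0
  have hsum : L.level = FractionalIdeal.spanSingleton (𝓞 K)⁰ c' * L.poleIdeal +
      FractionalIdeal.spanSingleton (𝓞 K)⁰ c * L.poleIdeal := by
    rw [← mul_one L.level, ← hcc, h𝔠, hX, mul_add]
    congr 1 <;> field_simp
  have hmem : (d - d' : K) ∈ L.level := by
    rw [← L.coe_levelIdeal hk]
    have := coe_mem_coeIdeal hdd
    simpa using this
  rw [hsum, ← FractionalIdeal.sup_eq_add] at hmem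
  obtain ⟨x, hx, y, hy, hxy⟩ := Submodule.mem_sup.1 hmem
  obtain ⟨β', hβ', rfl⟩ := FractionalIdeal.mem_singleton_mul.1 hx
  obtain ⟨β, hβ, rfl⟩ := FractionalIdeal.mem_singleton_mul.1 hy
  -- a common element `c γ + d = c' γ' + d'`, different from zero
  obtain ⟨γ, hγ, γ', hγ', hne, heq⟩ : ∃ γ ∈ L.poleIdeal, ∃ γ' ∈ L.poleIdeal,
      c * γ + d ≠ 0 ∧ c * γ + (d : K) = c' * γ' + d' := by
    have hβn := Submodule.neg_mem (L.poleIdeal : Submodule (𝓞 K) K) hβ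
    by_cases h0 : c * -β + (d : K) = 0
    · obtain ⟨u, w, hw, huw⟩ := IsFractionRing.div_surjective (A := 𝓞 K) (c / c')
      have hw0 : (w : K) ≠ 0 := RingOfIntegers.coe_ne_zero_iff.2 (nonZeroDivisors.ne_zero hw)
      change (u : K) / (w : K) = c / c' at huw
      obtain ⟨r, hr0, hr⟩ := FractionalIdeal.exists_ne_zero_mem_isInteger hR
      have hr0' : algebraMap (𝓞 K) K r ≠ 0 := by rwa [Ne, FaithfulSMul.algebraMap_eq_zero_iff]
      have huw' : c * w = c' * u := by
        field_simp at huw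
        linear_combination -huw
      refine ⟨-β + w • algebraMap (𝓞 K) K r, Submodule.add_mem (L.poleIdeal : Submodule (𝓞 K) K) hβn
        (Submodule.smul_mem (L.poleIdeal : Submodule (𝓞 K) K) w hr),
        β' + u • algebraMap (𝓞 K) K r, Submodule.add_mem (L.poleIdeal : Submodule (𝓞 K) K) hβ'
        (Submodule.smul_mem (L.poleIdeal : Submodule (𝓞 K) K) u hr), ?_, ?_⟩
      · have e : c * (-β + w • algebraMap (𝓞 K) K r) + (d : K) = c * (w * algebraMap (𝓞 K) K r) := by
          rw [Algebra.smul_def]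
          change c * (-β + (w : K) * algebraMap (𝓞 K) K r) + (d : K) = _
          linear_combination h0
        rw [e]
        exact mul_ne_zero hc0 (mul_ne_zero hw0 hr0')
      · rw [Algebra.smul_def, Algebra.smul_def]
        change c * (-β + (w : K) * algebraMap (𝓞 K) K r) + (d : K) =
          c' * (β' + (u : K) * algebraMap (𝓞 K) K r) + d'
        linear_combination -hxy + algebraMap (𝓞 K) K r * huw'
    · exact ⟨-β, hβn, β', hβ', h0, by linear_combination -hxy⟩
  have h1 := L.chi_add_mul hk hφ hb hc rfl hab hγ (RingOfIntegers.coe_ne_zero_iff.2 hd0) hne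
  have h2 := L.chi_add_mul hk hφ hb' hc' rfl hab' hγ' (RingOfIntegers.coe_ne_zero_iff.2 hd0')
    (heq ▸ hne)
  rw [← h1, heq, h2]

theorem QuadLattice.chi_one (L : QuadLattice K (2 * k)) (φ : SymbolChoice K) :
    L.chi φ 1 = 1 := by
  rw [chi, if_pos fun P _ => map_one _, if_neg one_ne_zero, FractionalIdeal.spanSingleton_one,
    L.chiStar_one]
  simp [normSign]

theorem QuadLattice.chi_eq_zero (L : QuadLattice K (2 * k)) (φ : SymbolChoice K) {d : 𝓞 K}
    {P : HeightOneSpectrum (𝓞 K)} (hP : L.DvdLevel P) (hd : d ∈ P.asIdeal) :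
    L.chi φ (d : K) = 0 := by
  rw [chi, if_neg]
  exact fun h => notMem_of_valuation_eq_one (h P hP) hd

/-- If the level is `𝓞`, the character is trivial. -/
theorem QuadLattice.chi_eq_one (hk : 0 < 2 * k) (L : QuadLattice K (2 * k)) {φ : SymbolChoice K}
    (hφ : ∀ P : HeightOneSpectrum (𝓞 K), (2 : 𝓞 K) ∈ P.asIdeal → IsKroneckerSymbol P (φ P))
    (hL : ∀ P : HeightOneSpectrum (𝓞 K), ¬ L.DvdLevel P) (d : 𝓞 K) : L.chi φ (d : K) = 1 := by
  by_cases hd : d = 0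
  · rw [chi, if_pos fun P hP => absurd hP (hL P), if_pos (RingOfIntegers.coe_eq_zero_iff.2 hd)]
  · have htop := L.levelIdeal_sup_span hk (d := 0) fun P hP => absurd hP (hL P)
    rw [Ideal.span_singleton_eq_bot.2 rfl, sup_bot_eq] at htop
    have h := L.chi_congr hk hφ hd one_ne_zero (fun P hP => absurd hP (hL P))
      (fun P hP => absurd hP (hL P)) (htop ▸ Submodule.mem_top)
    rw [h]
    exact L.chi_one φ

theorem QuadLattice.chi_eq_of_sub_mem (hk : 0 < 2 * k) (L : QuadLattice K (2 * k))
    {φ : SymbolChoice K}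
    (hφ : ∀ P : HeightOneSpectrum (𝓞 K), (2 : 𝓞 K) ∈ P.asIdeal → IsKroneckerSymbol P (φ P))
    {d d' : 𝓞 K} (hdd : d - d' ∈ L.levelIdeal) : L.chi φ (d : K) = L.chi φ (d' : K) := by
  by_cases hL : ∀ P : HeightOneSpectrum (𝓞 K), ¬ L.DvdLevel P
  · rw [L.chi_eq_one hk hφ hL, L.chi_eq_one hk hφ hL]
  push Not at hL
  obtain ⟨P₀, hP₀⟩ := hL
  have hiff : ∀ P : HeightOneSpectrum (𝓞 K), L.DvdLevel P → (d ∈ P.asIdeal ↔ d' ∈ P.asIdeal) := by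
    intro P hP
    have h := (L.dvdLevel_iff hk).1 hP hdd
    exact ⟨fun hd => by simpa using P.asIdeal.sub_mem hd h,
      fun hd => by simpa using P.asIdeal.add_mem h hd⟩
  by_cases hd : ∃ P : HeightOneSpectrum (𝓞 K), L.DvdLevel P ∧ d ∈ P.asIdeal
  · obtain ⟨P, hP, hdP⟩ := hd
    rw [L.chi_eq_zero φ hP hdP, L.chi_eq_zero φ hP ((hiff P hP).1 hdP)]
  · push Not at hd
    have hd' : ∀ P : HeightOneSpectrum (𝓞 K), L.DvdLevel P → d' ∉ P.asIdeal := fun P hP h =>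
      hd P hP ((hiff P hP).2 h)
    exact L.chi_congr hk hφ (fun h => hd P₀ hP₀ (h ▸ zero_mem _))
      (fun h => hd' P₀ hP₀ (h ▸ zero_mem _)) hd hd' hdd

theorem normSign_mul (x y : K) : normSign (x * y) = normSign x * normSign y := by
  simp [normSign, sign_mul, Finset.prod_mul_distrib]

theorem QuadLattice.chi_mul (hk : 0 < 2 * k) (L : QuadLattice K (2 * k))
    {φ : SymbolChoice K}
    (hφ : ∀ P : HeightOneSpectrum (𝓞 K), (2 : 𝓞 K) ∈ P.asIdeal → IsKroneckerSymbol P (φ P))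
    (d d' : 𝓞 K) : L.chi φ ((d * d' : 𝓞 K) : K) = L.chi φ (d : K) * L.chi φ (d' : K) := by
  by_cases hL : ∀ P : HeightOneSpectrum (𝓞 K), ¬ L.DvdLevel P
  · rw [L.chi_eq_one hk hφ hL, L.chi_eq_one hk hφ hL, L.chi_eq_one hk hφ hL, mul_one]
  push Not at hL
  obtain ⟨P₀, hP₀⟩ := hL
  by_cases hd : ∃ P : HeightOneSpectrum (𝓞 K), L.DvdLevel P ∧ d ∈ P.asIdeal
  · obtain ⟨P, hP, hdP⟩ := hd
    rw [L.chi_eq_zero φ hP (Ideal.mul_mem_right d' _ hdP), L.chi_eq_zero φ hP hdP, zero_mul]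
  by_cases hd' : ∃ P : HeightOneSpectrum (𝓞 K), L.DvdLevel P ∧ d' ∈ P.asIdeal
  · obtain ⟨P, hP, hdP⟩ := hd'
    rw [L.chi_eq_zero φ hP (Ideal.mul_mem_left _ d hdP), L.chi_eq_zero φ hP hdP, mul_zero]
  push Not at hd hd'
  have hd0 : d ≠ 0 := fun h => hd P₀ hP₀ (h ▸ zero_mem _)
  have hd0' : d' ≠ 0 := fun h => hd' P₀ hP₀ (h ▸ zero_mem _)
  have e : ((d * d' : 𝓞 K) : K) = (d : K) * d' := map_mul (algebraMap (𝓞 K) K) d d'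
  rw [L.chi_eq φ hd0 hd, L.chi_eq φ hd0' hd', L.chi_eq φ (mul_ne_zero hd0 hd0') fun P hP h =>
    (P.isPrime.mem_or_mem h).elim (hd P hP) (hd' P hP), e, normSign_mul,
    ← FractionalIdeal.spanSingleton_mul_spanSingleton,
    L.chiStar_mul φ (spanSingleton_ne_zero (RingOfIntegers.coe_ne_zero_iff.2 hd0))
      (spanSingleton_ne_zero (RingOfIntegers.coe_ne_zero_iff.2 hd0'))]
  push_cast
  ring

theorem QuadLattice.chi_eq_zero_or (L : QuadLattice K (2 * k)) (φ : SymbolChoice K) (y : K) :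
    L.chi φ y = 0 ∨ L.chi φ y = 1 ∨ L.chi φ y = -1 := by
  rw [chi]
  split_ifs with h1 h2
  · exact Or.inr (Or.inl rfl)
  · right
    have h3 : IsUnit (normSign y) := IsUnit.of_mul_eq_one _ (normSign_mul_self h2)
    exact Int.isUnit_iff.1 ((h3.pow k).mul (Units.isUnit _))
  · exact Or.inl rfl

/-- `χ_L` is a quadratic character modulo the level. -/
theorem QuadLattice.isQuadraticCharacter (hk : 0 < 2 * k) (L : QuadLattice K (2 * k))
    {φ : SymbolChoice K}
    (hφ : ∀ P : HeightOneSpectrum (𝓞 K), (2 : 𝓞 K) ∈ P.asIdeal → IsKroneckerSymbol P (φ P)) :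
    L.IsQuadraticCharacter φ := by
  have hout : ∀ y : 𝓞 K, L.chi φ ((Ideal.Quotient.mk L.levelIdeal y).out : 𝓞 K) = L.chi φ (y : K) :=
    fun y => L.chi_eq_of_sub_mem hk hφ
      (Ideal.Quotient.eq.1 (by rw [Ideal.Quotient.mk_out]))
  refine ⟨⟨⟨⟨fun q => L.chi φ ((q.out : 𝓞 K) : K), ?_⟩, ?_⟩, ?_⟩, ?_, ?_⟩
  · rw [← map_one (Ideal.Quotient.mk L.levelIdeal), hout]
    exact L.chi_one φ
  · intro x y
    obtain ⟨x, rfl⟩ := Ideal.Quotient.mk_surjective x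
    obtain ⟨y, rfl⟩ := Ideal.Quotient.mk_surjective y
    simp only
    rw [← map_mul, hout, hout, hout, L.chi_mul hk hφ]
  · intro q hq
    obtain ⟨d, rfl⟩ := Ideal.Quotient.mk_surjective q
    change L.chi φ _ = 0
    rw [hout]
    by_contra hne
    have hd : ∀ P : HeightOneSpectrum (𝓞 K), L.DvdLevel P → d ∉ P.asIdeal := fun P hP hd =>
      hne (L.chi_eq_zero φ hP hd)
    have htop := (Ideal.eq_top_iff_one _).1 (L.levelIdeal_sup_span hk hd)
    obtain ⟨x, hx, y, hy, hxy⟩ := Submodule.mem_sup.1 htop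
    obtain ⟨a, rfl⟩ := Ideal.mem_span_singleton'.1 hy
    refine hq (IsUnit.of_mul_eq_one (Ideal.Quotient.mk _ a) ?_)
    rw [← map_mul, ← map_one (Ideal.Quotient.mk L.levelIdeal), eq_comm, Ideal.Quotient.eq, ← hxy]
    simpa [mul_comm] using hx
  · intro q
    exact L.chi_eq_zero_or φ _
  · intro y
    exact (hout y).symm

end Character


/-! ### Matrices with `det D = 0` -/

section Degenerate

variable {K : Type*} [Field K] [NumberField K] [IsTotallyReal K] {k m n : ℕ}
  {I : Fin n → FracIdeal K} {A B C D : Matrix (Fin n) (Fin n) K}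

open scoped ComplexOrder in
/-- The matrix `Cτ + D` is invertible at the imaginary point `τ = i`. -/
theorem det_conj_ne_zero (hr : SymplecticRelations A B C D) (σ : K →+* ℝ) :
    (Complex.I • conj σ C + conj σ D).det ≠ 0 := by
  intro h
  obtain ⟨v, hv0, hv⟩ := exists_vecMul_eq_zero_iff.2 h
  apply hv0
  have hconj : ∀ M : Matrix (Fin n) (Fin n) K, (conj σ M)ᴴ = conj σ Mᵀ := fun M => by
    ext i j; simp [conj]
  set p := v ᵥ* conj σ C with hp
  set q := v ᵥ* conj σ D with hq
  have hpq : q = -(Complex.I • p) := by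
    rw [vecMul_add, vecMul_smul, ← hp, ← hq] at hv
    exact eq_neg_of_add_eq_zero_right hv
  -- `C ᵗD` is symmetric
  have h1 : p ⬝ᵥ star q = q ⬝ᵥ star p := by
    rw [hq, hp, star_vecMul, star_vecMul, hconj, hconj, ← dotProduct_mulVec, ← dotProduct_mulVec,
      mulVec_mulVec, mulVec_mulVec, ← conj_mul, ← conj_mul, hr.cd]
  have hp0 : p = 0 := by
    rw [hpq, star_neg, star_smul, dotProduct_neg, neg_dotProduct, smul_dotProduct, dotProduct_smul,
      Complex.star_def, Complex.conj_I, smul_eq_mul, smul_eq_mul] at h1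
    rw [← dotProduct_star_self_eq_zero]
    have h2 : Complex.I * (p ⬝ᵥ star p) = 0 := by linear_combination h1 / 2
    simpa [dotProduct_comm] using (mul_eq_zero.1 h2).resolve_left Complex.I_ne_zero
  have hq0 : q = 0 := by rw [hpq, hp0, smul_zero, neg_zero]
  have h3 : D * Aᵀ = 1 + C * Bᵀ := by
    have := congrArg transpose hr.ad'
    simpa using this
  have h4 := congrArg (fun M => v ᵥ* conj σ M) h3
  simp only [conj_add, conj_mul, conj_one, vecMul_add, vecMul_one, ← vecMul_vecMul] at h4
  rw [← hp, ← hq, hp0, hq0, zero_vecMul, zero_vecMul, add_zero] at h4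
  exact h4.symm

/-- Only finitely many translations by scalar matrices make the lower right block singular. -/
theorem exists_det_smul_add_ne_zero (hr : SymplecticRelations A B C D) {t : K} (ht : t ≠ 0) :
    ∃ N : ℕ, (((N : K) * t) • C + D).det ≠ 0 := by
  obtain ⟨σ⟩ := exists_realEmbedding (K := K)
  set p : Polynomial K := ((Polynomial.X : Polynomial K) • C.map Polynomial.C +
    D.map Polynomial.C).det with hp
  have hp0 : p ≠ 0 := by
    intro h
    apply det_conj_ne_zero hr σ
    have := congrArg (Polynomial.eval₂ (Complex.ofRealHom.comp σ) Complex.I) h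
    rw [Polynomial.eval₂_zero, hp, ← Polynomial.coe_eval₂RingHom, RingHom.map_det] at this
    rw [← this]
    congr 1
    ext i j
    simp [conj]
    exact mul_comm _ _
  by_contra! hcon
  apply hp0
  refine Polynomial.eq_zero_of_infinite_isRoot p ?_
  refine Set.Infinite.mono ?_ (Set.infinite_range_of_injective (f := fun N : ℕ => (N : K) * t) ?_)
  · rintro _ ⟨N, rfl⟩
    rw [Set.mem_ofPred_eq, Polynomial.IsRoot, ← hcon N, hp, ← Polynomial.coe_evalRingHom,
      RingHom.map_det]
    congr 1
    ext i j
    simp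
    exact mul_comm _ _
  · intro a b hab
    exact_mod_cast mul_right_cancel₀ ht hab

/-- Some translation of the group makes the lower right block invertible. -/
theorem QuadLattice.exists_translation (L : QuadLattice K m) (hm : 0 < m) (hI : ∀ j, I j ≠ 0)
    (hr : SymplecticRelations A B C D) : ∃ s : Matrix (Fin n) (Fin n) K, s.IsSymm ∧
      (∀ i j, s i j ∈ L.poleIdeal * ((I i)⁻¹ * (I j)⁻¹)) ∧ (C * s + D).det ≠ 0 := by
  choose a ha0 ha using fun i => FractionalIdeal.exists_ne_zero_mem_isInteger
    (I := L.poleIdeal * ((I i)⁻¹ * (I i)⁻¹)) (mul_ne_zero (L.poleIdeal_ne_zero hm)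
      (mul_ne_zero (inv_ne_zero (hI i)) (inv_ne_zero (hI i))))
  set t : 𝓞 K := ∏ i, a i with ht
  have ht0 : (t : K) ≠ 0 :=
    RingOfIntegers.coe_ne_zero_iff.2 (Finset.prod_ne_zero_iff.2 fun i _ => ha0 i)
  obtain ⟨N, hN⟩ := exists_det_smul_add_ne_zero hr ht0
  refine ⟨((N : K) * t) • 1, by simp [Matrix.IsSymm], fun i j => ?_, ?_⟩
  · by_cases hij : i = j
    · subst hij
      have e : (((N : K) * t) • (1 : Matrix (Fin n) (Fin n) K)) i i =
          ((N : 𝓞 K) * ∏ l ∈ Finset.univ.erase i, a l) • algebraMap (𝓞 K) K (a i) := by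
        rw [Matrix.smul_apply, one_apply_eq, smul_eq_mul, mul_one, ht,
          ← Finset.prod_erase_mul _ _ (Finset.mem_univ i), Algebra.smul_def, map_mul, map_natCast,
          mul_assoc]
        congr 1
      rw [e]
      exact Submodule.smul_mem (L.poleIdeal * ((I i)⁻¹ * (I i)⁻¹) : FracIdeal K).coeToSubmodule _
        (ha i)
    · rw [Matrix.smul_apply, one_apply_ne hij, smul_zero]
      exact FractionalIdeal.zero_mem _
  · rwa [Matrix.mul_smul, Matrix.mul_one]

/-- The transformation formula: the case `det D = 0`, which occurs for the level `𝓞` only, is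
reduced to the other case by a translation. -/
theorem QuadLattice.slash_theta_eq (hk : 0 < 2 * k) (L : QuadLattice K (2 * k))
    {φ : SymbolChoice K}
    (hφ : ∀ P : HeightOneSpectrum (𝓞 K), (2 : 𝓞 K) ∈ P.asIdeal → IsKroneckerSymbol P (φ P))
    (hI : ∀ j, I j ≠ 0) {γ : Matrix (Fin n ⊕ Fin n) (Fin n ⊕ Fin n) K}
    (hγ : γ ∈ gammaZero L.level L.halfNorm I) {τ : MatTuple K n} (hτ : τ ∈ upperHalfSpace K n) :
    slash k (L.theta I) γ τ = L.chi φ γ.toBlocks₂₂.det * L.theta I τ := by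
  by_cases hD : γ.toBlocks₂₂.det ≠ 0
  · exact L.slash_theta hk hφ hI hγ hD hτ
  rw [not_not] at hD
  have h := L.blockIntegral hk hγ
  have hr := symplecticRelations hγ.1
  have hL : ∀ P : HeightOneSpectrum (𝓞 K), ¬ L.DvdLevel P := fun P hP =>
    h.det_notMem hk hI hr (d := 0) (by rw [hD]; rfl) hP (zero_mem _)
  obtain ⟨s, hs, hsI, hdet⟩ := L.exists_translation hk hI hr
  have hmem := L.mul_translation_mem hk hI hγ hs hsI
  have hs' : (-s).IsSymm := by rw [Matrix.IsSymm, transpose_neg, hs.eq]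
  have hsI' : ∀ i j, (-s) i j ∈ L.poleIdeal * ((I i)⁻¹ * (I j)⁻¹) := fun i j =>
    Submodule.neg_mem (L.poleIdeal * ((I i)⁻¹ * (I j)⁻¹) : FracIdeal K).coeToSubmodule (hsI i j)
  have hback : translate s (translate (-s) τ) = τ := by
    funext σ
    have : conj σ (-s) = -conj σ s := by ext i j; simp [conj]
    rw [translate, translate, this, neg_add_cancel_right]
  have h1 := L.slash_theta hk hφ hI hmem
    (by rwa [mul_fromBlocks_one, toBlocks_fromBlocks₂₂]) (translate_mem hs' hτ)
  rw [slash_mul_translation, hback, L.theta_translate hk hI hs' hsI', mul_fromBlocks_one,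
    toBlocks_fromBlocks₂₂] at h1
  obtain ⟨e, he⟩ := exists_integer_det hI (fun i j => (L.blockIntegral hk hmem).d i j)
  rw [mul_fromBlocks_one, toBlocks_fromBlocks₂₂] at he
  have h0 := L.chi_eq_one hk hφ hL 0
  rw [← he, L.chi_eq_one hk hφ hL] at h1
  rw [h1, hD, ← h0]
  rfl

end Degenerate

end HilbertSiegel

end

/-- For a totally real number field `K`, a lattice `L` of rank `m = 2k` with a totally positive
quadratic form, and nonzero fractional ideals `ℐ₁, …, ℐₙ`: the theta series `θ(ℒ'; τ)` of
`ℒ' = ℒ⟨ℐ₁, …, ℐₙ⟩` converges absolutely on the upper half space, `χ_L` is a quadratic character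
modulo the level, and `θ(ℒ')` is a Hilbert-Siegel modular form of weight `k` and character `χ_L`
for `Γ₀(𝒩; ℐ₁, …, ℐₙ; 𝔑)`. Here `φ` is an arbitrary choice of the Kronecker-type symbols at the
dyadic primes. -/
theorem theorem2p7 {K : Type*} [Field K] [NumberField K] [IsTotallyReal K]
    (k n : ℕ) (hk : 1 ≤ k) (hn : 1 ≤ n)
    (L : HilbertSiegel.QuadLattice K (2 * k))
    (φ : HilbertSiegel.SymbolChoice K)
    (hφ : ∀ P : HeightOneSpectrum (𝓞 K), (2 : 𝓞 K) ∈ P.asIdeal →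
      HilbertSiegel.IsKroneckerSymbol P (φ P))
    (I : Fin n → HilbertSiegel.FracIdeal K) (hI : ∀ j, I j ≠ 0) :
    (∀ τ ∈ HilbertSiegel.upperHalfSpace K n,
      Summable fun U : L.matLattice I => L.thetaTerm τ (U : Matrix (Fin (2 * k)) (Fin n) K)) ∧
    L.IsQuadraticCharacter φ ∧
    HilbertSiegel.IsModularForm k (HilbertSiegel.gammaZero L.level L.halfNorm I) (L.chi φ)
      (L.theta I) := by
  have hk' : 0 < 2 * k := by omega
  exact ⟨fun τ hτ => L.summable_theta hI hτ, L.isQuadraticCharacter hk' hφ,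
    ⟨L.differentiableOn_theta hI, fun γ hγ τ hτ => L.slash_theta_eq hk' hφ hI hγ hτ⟩⟩
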